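/- **Notation.** Let $(x;q)=\prod_{k\ge 0}(1-xq^k)$, $\theta(x;p)=(x;p)(p/x;p)$, $\Gamma(x;p,q)=\prod_{i,j\ge 0}\frac{1-p^{i+1}q^{j+1}/x}{1-p^iq^jx}$. These are written multiplicatively in $x$: $(x_1,\dots,x_k;q)=\prod_i (x_i;q)$, and $\pm$ in an exponent means the product over all choices of sign. $1_P$ is $1$ if $P$ holds and $0$ otherwise. Complex numbers $q,t$ with $0<|q|,|t|<1$ and an integer $n\ge 1$ are fixed; $p$ is complex, $0<|p|<1$, and $p^s$ is the principal power. **Power series in $p$.** $M(x)$ denotes the functions $F(x;p)$ with an expansion $F=\sum_{s}a_s(x)p^s$, where the real exponents $s$ form a discrete set bounded below, the $a_s$ are rational functions of $x$ regular outside the zero set of one nonzero polynomial $h$, and on each compact subset of $\{x: x_i\neq 0,\ h(x)\ne0\}$ the series converges to $F$ absolutely and uniformly for all sufficiently small $p\ne0$. For $F\ne 0$, $val(F)$ is the smallest $s$ with $a_s\neq0$ and $lc(F)=a_{val(F)}$. **Functions.** $A^{(n)}(u_0;p,q)$ (with polar length $m$) consists of the meromorphic functions $f(z_1,\dots,z_n)$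 on $(\mathbb C^*)^n$ that are invariant under permutations of the $z_i$, under $z_i\to1/z_i$ and under $z_i\to pz_i$, and for which $D_m f$ is holomorphic on $(\mathbb C^*)^n$, where $D_m(z;u_0)=\prod_{i=1}^n\prod_{k=0}^{m-1}\theta(pq^{k+1}z_i^{\pm1}/u_0;p)$. $\tilde A^{(n)}$ (with polar length $m$) consists of the functions $f(z;u_0;p)$ such that $f(\cdot;u_0;p)\in A^{(n)}(u_0;p,q)$ for all $u_0\neq0$ and $0<|p|<1$; $D_mf$ is holomorphic in $(z,u_0)\in(\mathbb C^*)^{n+1}$ for $0<|p|<\frac12$; $f(p^{\zeta_1}z_1,\dots,p^{\zeta_n}z_n;p^{\gamma}u_0;p)\in M(z,u_0)$ for all real $\zeta_i,\gamma$; and for all real $M>0$ and $\zeta$ there are $B>0,\beta\in\mathbb R$ with $|D_mf|\le B|p|^{-\beta}$ whenever $0<|p|<\frac12$ and $\frac1{M|p|^\zeta}<|z_i|,|u_0|<M|p|^\zeta$. **Contours.** A contour $C$ is a finite system of closed $C^1$ curves in $\mathbb C^*$ such that each point off $C$ has winding number $1$ (it is *contained* in $C$) or $0$ (it is *excluded*).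 $\int_{C^n}$ is the corresponding $n$-fold integral. **Bilinear form.** Let $f\in\tilde A^{(n)}$ with polar length $m_f$ and $g\in\tilde A^{(n)}$ with polar length $m_g$. For parameters $t_0,\dots,t_5$ put $\tilde t_r=t_r$ for $r\le 3$, $\tilde t_4=t_4q^{-m_f}$, $\tilde t_5=t_5q^{-m_g}$. If $t^{2(n-1)}\prod_r t_r=pq$, then with $f=f(z;t_4;p)$, $g=g(z;t_5;p)$ and $\Gamma(x)=\Gamma(x;p,q)$, $$\langle f,g\rangle_{t_r}=\frac{(q;q)^n(p;p)^n\Gamma(t)^n}{2^nn!\prod_{j=1}^n\big(\Gamma(t^j)\prod_{0\le r<s\le5}\Gamma(t^{n-j}t_rt_s)\big)}\int_{C^n}f\,g\prod_{1\le j<k\le n}\frac{\Gamma(tz_j^{\pm1}z_k^{\pm1})}{\Gamma(z_j^{\pm1}z_k^{\pm1})}\prod_{j=1}^n\frac{\prod_{r=0}^5\Gamma(t_rz_j^{\pm1})}{\Gamma(z_j^{\pm2})}\frac{dz_j}{2\pi iz_j},$$ where $C$ is any admissible contour: $C=C^{-1}$ (inversion preserves $C$ and exchanges contained and excluded points, apart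 from $0$), and $C$ contains the points $p^iq^j\tilde t_r$, excludes their reciprocals, and contains $p^iq^jtC$ ($i,j\ge0$). (Such contours exist for generic parameters.) **Statement.** Let $t_0,\dots,t_5\in\mathbb C^*$ with $t^{2(n-1)}\prod_rt_r=q$, let $a\ne b$ in $\{0,\dots,5\}$, $-\frac12\le\zeta<0$, and $\alpha\in\mathbb R^6$ with $\sum_r\alpha_r=1$, $\alpha_a=\alpha_b=\zeta$ and $-\zeta\le\alpha_r\le1+\zeta$ for $r\ne a,b$. Let $v\in\mathbb C^*$ be arbitrary, except that $\theta(t^{n-j}t_av,t^{n-j}t_bv;q)\neq0$ for $1\le j\le n$; assume also $(qt^{j-n}t_r^{-1}t_s^{-1};q)\ne0$ for $1\le j\le n$ and $r<s$ with $\alpha_r+\alpha_s=1$. Let $f,g$ be as above, and let $val(f),lc(f)$ be those of $f(p^\zeta z;p^{\alpha_4}u_0;p)\in M(z,u_0)$, and $val(g),lc(g)$ those of $g(p^\zeta z;p^{\alpha_5}u_0;p)$ (both functions being nonzero). Then, as $p\to0$ through values for which an admissible contour for the parameters $t_rp^{\alpha_r}$ exists, $$\begin{aligned}\lim_{p\to0}p^{-val(f)-val(g)}\langle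 f,g\rangle_{t_rp^{\alpha_r}}=&\ \frac{(q;q)^n}{n!\,(t;q)^n}\prod_{j=1}^n\frac{(t^j;q)\,(t^{n-j}t_at_b;q)^{1_{\zeta=-1/2}}\prod_{r:\alpha_r=-\zeta}(t^{n-j}t_rt_a,t^{n-j}t_rt_b;q)}{\prod_{r<s:\,\alpha_r+\alpha_s=1}(qt^{j-n}t_r^{-1}t_s^{-1};q)\;\theta(t^{n-j}t_av,t^{n-j}t_bv;q)}\\&\times\int_{C^n}lc(f)(z;t_4)\,lc(g)(z;t_5)\prod_{1\le j<k\le n}\frac{(z_j/z_k,z_k/z_j;q)}{(tz_j/z_k,tz_k/z_j;q)}\left(\frac{(z_jz_k,qz_jz_k/t;q)}{(tz_jz_k,qz_jz_k;q)}\right)^{1_{\zeta=-1/2}}\\&\times\prod_{j=1}^n\frac{\prod_{r:\alpha_r=1+\zeta}(qz_j/t_r;q)}{(t_a/z_j,t_b/z_j;q)\prod_{r:\alpha_r=-\zeta}(t_rz_j;q)}\left(\frac{(z_j^2;q)}{(t_az_j,t_bz_j,qz_j^2;q)}\right)^{1_{\zeta=-1/2}}\theta\Big(vz_j,\frac{qz_j}{t^{n-1}vt_at_b};q\Big)\frac{dz_j}{2\pi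 iz_j}.\end{aligned}$$ The limit is uniform in the admissible contour on the left. On the right, $C$ is any contour that contains the points $q^j\tilde t_a,q^j\tilde t_b$ and excludes $q^{-j}/\tilde t_r$ for each $r$ with $\alpha_r=-\zeta$ ($j\ge0$); if $\zeta=-\frac12$, it also excludes $q^{-j}/\tilde t_a$ and $q^{-j}/\tilde t_b$; it contains $tq^jC$ and excludes $t^{-1}q^{-j}C$; and, if $\zeta=-\frac12$ and $n\ge2$, it excludes $t^{-1}q^{-j}C^{-1}$. -/

import Mathlib

open scoped Topology Classical
open Filter MeasureTheory

namespace SelbergLimit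

noncomputable section

/-! ### The univariate symbols -/

/-- The infinite shifted factorial `(x; q) = ∏_{k ≥ 0} (1 - x q^k)`. -/
def qPoch (x q : ℂ) : ℂ := ∏' k : ℕ, (1 - x * q ^ k)

/-- The theta function `θ(x; p) = (x; p) (p / x; p)`. -/
def theta (x p : ℂ) : ℂ := qPoch x p * qPoch (p / x) p

/-- The elliptic gamma function
`Γ(x; p, q) = ∏_{i, j ≥ 0} (1 - p^(i+1) q^(j+1) / x) / (1 - p^i q^j x)`. -/
def ellGamma (p q x : ℂ) : ℂ :=
  (∏' ij : ℕ × ℕ, (1 - p ^ (ij.1 + 1) * q ^ (ij.2 + 1) / x)) /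
    ∏' ij : ℕ × ℕ, (1 - p ^ ij.1 * q ^ ij.2 * x)

/-- The space `(ℂ^*)^ι`. -/
def cstar (ι : Type) : Set (ι → ℂ) := {x | ∀ i, x i ≠ 0}

/-! ### Power series in `p` -/

/-- The value at `x` of a rational function, computed from its reduced fraction. -/
def ratEval {ι : Type} (r : FractionRing (MvPolynomial ι ℂ)) (x : ι → ℂ) : ℂ :=
  MvPolynomial.eval x (IsFractionRing.num (MvPolynomial ι ℂ) r) /
    MvPolynomial.eval x (IsFractionRing.den (MvPolynomial ι ℂ) r : MvPolynomial ι ℂ)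

/-- `F(x; p) = ∑_s a_s(x) p^s` is an expansion in real powers of `p` (principal branch): the
exponents `s` form a discrete set that is bounded below, the coefficients `a_s` are rational
functions of `x`, regular outside the zero set of one nonzero polynomial `h`, and on each compact
subset of `{x ∈ (ℂ^*)^ι : h(x) ≠ 0}` the series converges to `F`, absolutely and uniformly, for
all sufficiently small `p ≠ 0`. -/
structure HasPExpansion {ι : Type} (F : (ι → ℂ) → ℂ → ℂ)
    (a : ℝ → FractionRing (MvPolynomial ι ℂ)) : Prop where
  finite_below : ∀ b : ℝ, {s : ℝ | s ≤ b ∧ a s ≠ 0}.Finite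
  converges : ∃ h : MvPolynomial ι ℂ, h ≠ 0 ∧
    (∀ s, ∃ (k : ℕ) (P : MvPolynomial ι ℂ),
      a s * algebraMap _ (FractionRing (MvPolynomial ι ℂ)) h ^ k = algebraMap _ _ P) ∧
    ∀ K : Set (ι → ℂ), IsCompact K → (∀ x ∈ K, x ∈ cstar ι ∧ MvPolynomial.eval x h ≠ 0) →
      ∃ δ : ℝ, 0 < δ ∧ δ < 1 ∧
        (∃ B : ℝ → ℝ, Summable B ∧ ∀ s, ∀ x ∈ K, ‖ratEval (a s) x‖ * δ ^ s ≤ B s) ∧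
        ∀ p : ℂ, 0 < ‖p‖ → ‖p‖ < δ → ∀ x ∈ K,
          HasSum (fun s : ℝ => ratEval (a s) x * p ^ (s : ℂ)) (F x p)

/-- `F` belongs to the field `M(x)` of power series in `p`. -/
def MemM {ι : Type} (F : (ι → ℂ) → ℂ → ℂ) : Prop := ∃ a, HasPExpansion F a

/-- `F ∈ M(x)` is nonzero, `val(F) = v` and `lc(F) = c`. -/
def HasLeadingTerm {ι : Type} (F : (ι → ℂ) → ℂ → ℂ) (v : ℝ)
    (c : FractionRing (MvPolynomial ι ℂ)) : Prop :=
  ∃ a, HasPExpansion F a ∧ a v = c ∧ c ≠ 0 ∧ ∀ s < v, a s = 0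

/-! ### The spaces of functions -/

/-- `∏_i θ(p q z_i^{±1} / u₀; q; p)_m`. -/
def polarDen (n : ℕ) (q : ℂ) (m : ℕ) (p u₀ : ℂ) (z : Fin n → ℂ) : ℂ :=
  ∏ i, ∏ k ∈ Finset.range m,
    theta (p * q ^ (k + 1) * z i / u₀) p * theta (p * q ^ (k + 1) / (z i * u₀)) p

/-- `f ∈ A^{(n)}(u₀; p, q)`, with polar factor of length `m`: a `BC_n`-symmetric `p`-abelian
meromorphic function whose product with `polarDen` is holomorphic on `(ℂ^*)^n`. The values of `f`
at zeros of `polarDen`, where `f` may have poles, play no role. -/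
structure MemA (n : ℕ) (q : ℂ) (m : ℕ) (p u₀ : ℂ) (f : (Fin n → ℂ) → ℂ) : Prop where
  perm : ∀ (σ : Equiv.Perm (Fin n)), ∀ z ∈ cstar (Fin n), polarDen n q m p u₀ z ≠ 0 →
    f (fun i => z (σ i)) = f z
  inversion : ∀ i, ∀ z ∈ cstar (Fin n), polarDen n q m p u₀ z ≠ 0 →
    f (Function.update z i (z i)⁻¹) = f z
  shift : ∀ i, ∀ z ∈ cstar (Fin n), polarDen n q m p u₀ z ≠ 0 →
    f (Function.update z i (p * z i)) = f z
  holomorphic : ∃ F : (Fin n → ℂ) → ℂ, DifferentiableOn ℂ F (cstar (Fin n)) ∧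
    ∀ z ∈ cstar (Fin n), polarDen n q m p u₀ z ≠ 0 → F z = polarDen n q m p u₀ z * f z

/-- The function `(z, u₀; p) ↦ f(p^ζ z; p^γ u₀; p)` of the variables `z_i = x (some i)` and
`u₀ = x none`. -/
def rescale {n : ℕ} (f : (Fin n → ℂ) → ℂ → ℂ → ℂ) (ζ : Fin n → ℝ) (γ : ℝ) :
    (Option (Fin n) → ℂ) → ℂ → ℂ :=
  fun x p => f (fun i => p ^ (ζ i : ℂ) * x (some i)) (p ^ (γ : ℂ) * x none) p

/-- The space `Ã^{(n)}(u₀)`, with polar factor of length `m`. The arguments of `f` are `z`, `u₀`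
and `p`; the number `q` and all other parameters are held fixed. The field `joint` says that
`polarDen * f` is holomorphic in `(z, u₀)`: a function that is meromorphic in these variables and
satisfies the growth bound has this property. -/
structure MemATilde (n : ℕ) (q : ℂ) (m : ℕ) (f : (Fin n → ℂ) → ℂ → ℂ → ℂ) : Prop where
  memA : ∀ p : ℂ, 0 < ‖p‖ → ‖p‖ < 1 → ∀ u₀ : ℂ, u₀ ≠ 0 → MemA n q m p u₀ (fun z => f z u₀ p)
  joint : ∀ p : ℂ, 0 < ‖p‖ → ‖p‖ < 1 / 2 → ∃ F : (Option (Fin n) → ℂ) → ℂ,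
    DifferentiableOn ℂ F (cstar (Option (Fin n))) ∧
    ∀ x ∈ cstar (Option (Fin n)), polarDen n q m p (x none) (fun i => x (some i)) ≠ 0 →
      F x = polarDen n q m p (x none) (fun i => x (some i)) *
        f (fun i => x (some i)) (x none) p
  memM : ∀ (ζ : Fin n → ℝ) (γ : ℝ), MemM (rescale f ζ γ)
  bound : ∀ (M ζ : ℝ), 0 < M → ∃ (B β : ℝ), 0 < B ∧
    ∀ p : ℂ, 0 < ‖p‖ → ‖p‖ < 1 / 2 → ∀ (z : Fin n → ℂ) (u₀ : ℂ),
      (∀ i, 1 / (M * ‖p‖ ^ ζ) < ‖z i‖ ∧ ‖z i‖ < M * ‖p‖ ^ ζ) →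
      1 / (M * ‖p‖ ^ ζ) < ‖u₀‖ → ‖u₀‖ < M * ‖p‖ ^ ζ →
      ‖polarDen n q m p u₀ z * f z u₀ p‖ ≤ B * ‖p‖ ^ (-β)

/-! ### Contours -/

/-- A finite system of closed `C¹` curves in `ℂ^*`, parametrized by `[0, 1]`. -/
structure ClosedChain where
  num : ℕ
  path : Fin num → ℝ → ℂ
  contDiff : ∀ j, ContDiff ℝ 1 (path j)
  closed : ∀ j, path j 0 = path j 1
  ne_zero : ∀ j, ∀ s ∈ Set.Icc (0 : ℝ) 1, path j s ≠ 0

namespace ClosedChain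

/-- The union of the curves. -/
def support (C : ClosedChain) : Set ℂ := ⋃ j, C.path j '' Set.Icc (0 : ℝ) 1

/-- The winding number of `C` about `w`. -/
def winding (C : ClosedChain) (w : ℂ) : ℂ :=
  ∑ j, (2 * Real.pi * Complex.I)⁻¹ *
    ∫ s in (0 : ℝ)..1, deriv (C.path j) s / (C.path j s - w)

/-- The points contained in `C`. -/
def inside (C : ClosedChain) : Set ℂ := {w | w ∉ C.support ∧ C.winding w = 1}

/-- The points excluded from `C`. -/
def outside (C : ClosedChain) : Set ℂ := {w | w ∉ C.support ∧ C.winding w = 0}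

/-- `C` bounds a region: each point off `C` is either contained in `C` or excluded from `C`. For
instance a positively oriented closed Jordan curve, or the oriented boundary of finitely many
smoothly bounded domains with disjoint closures. -/
def IsContour (C : ClosedChain) : Prop := ∀ w, w ∉ C.support → w ∈ C.inside ∨ w ∈ C.outside

/-- `∫_{C^n} F(z) ∏_j dz_j / (2 π i z_j)`. -/
def torusIntegral (C : ClosedChain) (n : ℕ) (F : (Fin n → ℂ) → ℂ) : ℂ :=
  ∑ e : Fin n → Fin C.num,
    ∫ s in (Set.Icc 0 1 : Set (Fin n → ℝ)),
      F (fun j => C.path (e j) (s j)) *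
        ∏ j, deriv (C.path (e j)) (s j) / (2 * Real.pi * Complex.I * C.path (e j) (s j))

end ClosedChain

/-- The contours of the elliptic bilinear form, for parameters `τ'_r = \tilde t_r`: `C = C^{-1}`,
and `C` contains the points `p^i q^j τ'_r`, excludes their reciprocals, and contains
`p^i q^j t C`. -/
structure IsFormContour (p q t : ℂ) (τ' : Fin 6 → ℂ) (C : ClosedChain) : Prop where
  isContour : C.IsContour
  support_inv : ∀ z ∈ C.support, z⁻¹ ∈ C.support
  inside_inv : ∀ z ∈ C.inside, z ≠ 0 → z⁻¹ ∈ C.outside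
  outside_inv : ∀ z ∈ C.outside, z ≠ 0 → z⁻¹ ∈ C.inside
  contains : ∀ (r : Fin 6) (i j : ℕ), p ^ i * q ^ j * τ' r ∈ C.inside
  excludes : ∀ (r : Fin 6) (i j : ℕ), (p ^ i * q ^ j * τ' r)⁻¹ ∈ C.outside
  contains_image : ∀ (i j : ℕ), ∀ c ∈ C.support, p ^ i * q ^ j * t * c ∈ C.inside

/-- The contours of the limiting form, for parameters `τ'_r = \tilde t_r`. -/
structure IsLimitContour (n : ℕ) (q t : ℂ) (τ' : Fin 6 → ℂ) (a b : Fin 6) (α : Fin 6 → ℝ)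
    (ζ : ℝ) (C : ClosedChain) : Prop where
  isContour : C.IsContour
  contains_a : ∀ j : ℕ, q ^ j * τ' a ∈ C.inside
  contains_b : ∀ j : ℕ, q ^ j * τ' b ∈ C.inside
  excludes : ∀ r, α r = -ζ → ∀ j : ℕ, (q ^ j * τ' r)⁻¹ ∈ C.outside
  excludes_a : ζ = -1 / 2 → ∀ j : ℕ, (q ^ j * τ' a)⁻¹ ∈ C.outside
  excludes_b : ζ = -1 / 2 → ∀ j : ℕ, (q ^ j * τ' b)⁻¹ ∈ C.outside
  /-- `C` contains the contours `t q^j C`; the second half follows from the first one if `C` is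
  a Jordan curve. -/
  contains_image : ∀ j : ℕ, ∀ c ∈ C.support, t * q ^ j * c ∈ C.inside ∧
    (t * q ^ j)⁻¹ * c ∈ C.outside
  /-- `C` excludes the poles `z_j z_k = 1 / (t q^l)` of the cross terms, which are present if
  `ζ = -1/2` and there are at least two variables. -/
  excludes_image_inv : ζ = -1 / 2 → 2 ≤ n → ∀ j : ℕ, ∀ c ∈ C.support,
    (t * q ^ j * c)⁻¹ ∈ C.outside

/-! ### The bilinear form and its limit -/

/-- `\tilde t_r`: the parameters `t_4`, `t_5` are multiplied by `q^{-m_f}`, `q^{-m_g}`. -/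
def tildeParam (q : ℂ) (mf mg : ℕ) (τ : Fin 6 → ℂ) (r : Fin 6) : ℂ :=
  τ r / q ^ ((![0, 0, 0, 0, mf, mg] : Fin 6 → ℕ) r)

/-- The density of the elliptic Selberg integral. -/
def ellDensity (n : ℕ) (p q t : ℂ) (τ : Fin 6 → ℂ) (z : Fin n → ℂ) : ℂ :=
  (∏ j, ∏ k ∈ Finset.univ.filter (fun k => j < k),
    (ellGamma p q (t * z j * z k) * ellGamma p q (t * z j / z k) *
        ellGamma p q (t * z k / z j) * ellGamma p q (t / (z j * z k))) /
      (ellGamma p q (z j * z k) * ellGamma p q (z j / z k) *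
        ellGamma p q (z k / z j) * ellGamma p q (1 / (z j * z k)))) *
  ∏ j, (∏ r, ellGamma p q (τ r * z j) * ellGamma p q (τ r / z j)) /
    (ellGamma p q (z j ^ 2) * ellGamma p q (1 / z j ^ 2))

/-- The normalized bilinear form `⟨F, G⟩_{t_0, …, t_5; q, t; p}`, computed with the contour `C`. -/
def bilinForm (n : ℕ) (p q t : ℂ) (τ : Fin 6 → ℂ) (C : ClosedChain)
    (F G : (Fin n → ℂ) → ℂ) : ℂ :=
  qPoch q q ^ n * qPoch p p ^ n * ellGamma p q t ^ n /
    (2 ^ n * (n.factorial : ℂ) *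
      ∏ j ∈ Finset.range n, (ellGamma p q (t ^ (j + 1)) *
        ∏ r : Fin 6, ∏ s ∈ Finset.univ.filter (fun s => r < s),
          ellGamma p q (t ^ j * τ r * τ s))) *
  C.torusIntegral n (fun z => F z * G z * ellDensity n p q t τ z)

/-- The prefactor of the limiting form (with `t^{n-j}`, `1 ≤ j ≤ n`, written as `t^i`,
`0 ≤ i < n`). -/
def limitPrefactor (n : ℕ) (q t : ℂ) (τ : Fin 6 → ℂ) (a b : Fin 6) (α : Fin 6 → ℝ) (ζ : ℝ)
    (v : ℂ) : ℂ :=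
  qPoch q q ^ n / ((n.factorial : ℂ) * qPoch t q ^ n) *
  ∏ i ∈ Finset.range n,
    (qPoch (t ^ (i + 1)) q *
      (if ζ = -1 / 2 then qPoch (t ^ i * τ a * τ b) q else 1) *
      ∏ r ∈ Finset.univ.filter (fun r => α r = -ζ),
        (qPoch (t ^ i * τ r * τ a) q * qPoch (t ^ i * τ r * τ b) q)) /
    ((∏ r : Fin 6, ∏ s ∈ Finset.univ.filter (fun s => r < s ∧ α r + α s = 1),
        qPoch (q / (t ^ i * τ r * τ s)) q) *
      theta (t ^ i * τ a * v) q * theta (t ^ i * τ b * v) q)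

/-- The density of the limiting form. -/
def limitDensity (n : ℕ) (q t : ℂ) (τ : Fin 6 → ℂ) (a b : Fin 6) (α : Fin 6 → ℝ) (ζ : ℝ)
    (v : ℂ) (z : Fin n → ℂ) : ℂ :=
  (∏ j, ∏ k ∈ Finset.univ.filter (fun k => j < k),
    (qPoch (z j / z k) q * qPoch (z k / z j) q) /
      (qPoch (t * z j / z k) q * qPoch (t * z k / z j) q) *
    (if ζ = -1 / 2 then
      (qPoch (z j * z k) q * qPoch (q * z j * z k / t) q) /
        (qPoch (t * z j * z k) q * qPoch (q * z j * z k) q)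
      else 1)) *
  ∏ j, (∏ r ∈ Finset.univ.filter (fun r => α r = 1 + ζ), qPoch (q * z j / τ r) q) /
      (qPoch (τ a / z j) q * qPoch (τ b / z j) q *
        ∏ r ∈ Finset.univ.filter (fun r => α r = -ζ), qPoch (τ r * z j) q) *
    (if ζ = -1 / 2 then
      qPoch (z j ^ 2) q /
        (qPoch (τ a * z j) q * qPoch (τ b * z j) q * qPoch (q * z j ^ 2) q)
      else 1) *
    (theta (v * z j) q * theta (q * z j / (t ^ (n - 1) * v * τ a * τ b)) q)

end

end SelbergLimit

open SelbergLimit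

/-!
The integrand of the elliptic form is invariant under `z_j ↦ 1 / z_j`, and after the substitution
`z = p^ζ x` this symmetry is lost in the limit `p → 0`. The proof breaks it before taking the
limit, so that the integrand converges on a fixed contour and no tail has to be estimated.

*Breaking the symmetry.* The theta identity `sum_thetaTerm` of type `BC_n` writes a constant as a
sum over the `2^n` choices of signs `z_j^{±1}`. Here its four parameters are `t_a p^ζ`, `t_b p^ζ`,
`p^(-ζ) v` and `p^(-ζ) w` with `w = q / (t^(n-1) v t_a t_b)`. Multiplied by the symmetric integrand,
it expresses the elliptic integral by `2^n` integrals, which differ by inversions of variables, of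
one and the same function, the product with a single summand
(`ellDensity_mul_thetaTerm`, `prod_theta_mul_torusIntegral`). In the variable `x`, the density of
this product is `brokenDensity`, in which no factor degenerates as `p → 0`. The factors
`θ(v z_j, w z_j; q)` of the limiting form come from the summand, and `θ(t^{n-j} t_a v, t^{n-j} t_b v; q)`
in the prefactor from the value of the sum.

*Moving the contour.* The poles of the broken integrand cluster at `0` and `∞`, and the contours of
the elliptic form depend on `p` in an arbitrary way. They all have the same integral as a given
contour of the limiting form (`IsLimitContour.eventually_torusIntegral_eq`). Contours are
replaced by pairs `L ⊆ U` of a compact and an open set, with all poles in `L` or outside `U`; the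
integral over a cycle that separates `L` from the complement of `U` does not depend on the cycle
(`Cycle.multiInt_eq_of_separates`, by the Cauchy-Pompeiu formula). It is the same for two pairs
whose members are near enough, since a cutoff function defines a cycle that separates both. The
condition that the contours contain their images under multiplication by `t p^i q^j` makes the
cross terms holomorphic along a chain of such pairs, which connects the two kinds of contours in
finitely many steps (`HasMultiInt.of_triple`). As the chain consists of sets and not of
curves, nothing has to be known about the shape of the contours.

*The functions `f` and `g`.* Multiplied by its polar factor and divided by its leading power of `p`,
`f(p^ζ x; p^γ u; p)` is holomorphic on `(ℂ^*)^{n+1}` and converges outside an algebraic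
hypersurface. The maximum principle on small circles makes it converge locally uniformly everywhere
(`exists_tendsto_of_generic`, `exists_normalized`). The polar factors are absorbed by the shift of
`t_4`, `t_5` to `t_4 q^{-m_f}`, `t_5 q^{-m_g}`.

*The limit.* The integrand converges locally uniformly on the fixed contour
(`tendsto_brokenDensity`), so the integral converges (`ClosedChain.tendsto_torusIntegral`), and the
prefactor converges by `tendsto_brokenPrefactor`. Identities between integrands are
needed only outside the zero sets of countably many nonzero polynomials, which every torus integral
ignores (`ClosedChain.torusIntegral_congr_of_polynomials`); this disposes of the conventional values
of `f`, `g` and of the quotients at their poles.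
-/

namespace SelbergLimit

/-! ### Infinite products, theta functions and the elliptic gamma function -/

/-- The entire function `x ↦ ∏ᵢ (1 - aᵢ x)` attached to an absolutely summable family `a`. -/
noncomputable def genProd {ι : Type*} (a : ι → ℂ) (x : ℂ) : ℂ := ∏' i, (1 - a i * x)

section genProd

variable {ι : Type*} {a : ι → ℂ}

lemma summable_norm_neg_mul (ha : Summable fun i => ‖a i‖) (x : ℂ) :
    Summable fun i => ‖-(a i * x)‖ := by
  simpa using ha.mul_right ‖x‖

lemma multipliable_one_sub_mul (ha : Summable fun i => ‖a i‖) (x : ℂ) :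
    Multipliable fun i => 1 - a i * x := by
  simpa [sub_eq_add_neg] using multipliable_one_add_of_summable (summable_norm_neg_mul ha x)

lemma genProd_eq_zero_iff (ha : Summable fun i => ‖a i‖) (x : ℂ) :
    genProd a x = 0 ↔ ∃ i, a i * x = 1 := by
  constructor
  · intro h
    by_contra! hne
    refine tprod_one_add_ne_zero_of_summable (f := fun i => -(a i * x)) (fun i hi => hne i ?_)
      (summable_norm_neg_mul ha x) (by simpa [genProd, sub_eq_add_neg] using h)
    linear_combination -hi
  · rintro ⟨i, hi⟩
    have h0 : HasProd (fun i => 1 - a i * x) 0 := by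
      refine tendsto_const_nhds.congr' ?_
      filter_upwards [eventually_ge_atTop {i}] with s hs
      exact (Finset.prod_eq_zero (hs (by simp) : i ∈ s) (by simp [hi])).symm
    exact h0.tprod_eq

lemma differentiable_genProd (ha : Summable fun i => ‖a i‖) : Differentiable ℂ (genProd a) := by
  intro x
  have hu : Summable fun i => ‖a i‖ * (‖x‖ + 1) := ha.mul_right _
  have hp := hu.hasProdLocallyUniformlyOn_one_add (f := fun i y => -(a i * y))
    (Metric.isOpen_ball (x := x) (ε := 1)) (.of_forall fun i y hy => by
      have : ‖y‖ ≤ ‖x‖ + 1 := by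
        have := norm_sub_norm_le y x
        have h2 := mem_ball_iff_norm.1 hy
        linarith
      rw [norm_neg, norm_mul]
      gcongr) (fun i => by fun_prop)
  have hd := hp.differentiableOn (.of_forall fun s => by
    simpa [Finset.prod_fn] using DifferentiableOn.finsetProd (fun _ _ ↦ by fun_prop))
    Metric.isOpen_ball
  have : DifferentiableAt ℂ (fun y => ∏' i, (1 + -(a i * y))) x :=
    hd.differentiableAt (Metric.ball_mem_nhds x one_pos)
  have e : genProd a = fun y => ∏' i, (1 + -(a i * y)) := by
    funext y; simp [genProd, sub_eq_add_neg]
  rw [e]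
  exact this

lemma norm_genProd_sub_one_le (ha : Summable fun i => ‖a i‖) (x : ℂ) :
    ‖genProd a x - 1‖ ≤ Real.exp ((∑' i, ‖a i‖) * ‖x‖) - 1 := by
  have h := (multipliable_one_sub_mul ha x).hasProd
  refine le_of_tendsto (h.sub_const 1).norm (.of_forall fun s => ?_)
  have := Finset.norm_prod_one_add_sub_one_le s (fun i => -(a i * x))
  simp only [← sub_eq_add_neg, norm_neg, norm_mul] at this
  refine this.trans ?_
  gcongr
  rw [← Finset.sum_mul]
  gcongr
  exact ha.sum_le_tsum _ (fun _ _ => norm_nonneg _)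

end genProd

section qPoch

variable {q : ℂ}

lemma summable_norm_pow (hq : ‖q‖ < 1) : Summable fun k : ℕ => ‖q ^ k‖ := by
  simpa using summable_geometric_of_lt_one (norm_nonneg q) hq

lemma qPoch_eq_genProd (x q : ℂ) : qPoch x q = genProd (fun k : ℕ => q ^ k) x := by
  simp [qPoch, genProd, mul_comm]

lemma qPoch_eq_zero_iff (hq : ‖q‖ < 1) (x : ℂ) : qPoch x q = 0 ↔ ∃ k : ℕ, q ^ k * x = 1 := by
  rw [qPoch_eq_genProd, genProd_eq_zero_iff (summable_norm_pow hq)]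

lemma differentiable_qPoch (hq : ‖q‖ < 1) : Differentiable ℂ (fun x => qPoch x q) := by
  simpa only [qPoch_eq_genProd] using differentiable_genProd (summable_norm_pow hq)

lemma qPoch_rec (hq : ‖q‖ < 1) (x : ℂ) : qPoch x q = (1 - x) * qPoch (q * x) q := by
  have e : ∀ k : ℕ, 1 - x * q ^ (k + 1) = 1 - q ^ k * (q * x) := fun k => by ring
  have h : Multipliable fun k : ℕ => 1 - x * q ^ (k + 1) := by
    simpa only [e] using multipliable_one_sub_mul (summable_norm_pow hq) (q * x)
  have h2 : qPoch x q = (1 - x * q ^ 0) * ∏' k : ℕ, (1 - x * q ^ (k + 1)) := tprod_eq_zero_mul' h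
  rw [h2, qPoch_eq_genProd (q * x), genProd, tprod_congr e, pow_zero, mul_one]

lemma qPoch_zero (q : ℂ) : qPoch 0 q = 1 := by simp [qPoch]

lemma qPoch_self_ne_zero (hq : ‖q‖ < 1) : qPoch q q ≠ 0 := by
  rw [Ne, qPoch_eq_zero_iff hq]
  rintro ⟨k, hk⟩
  have : ‖q ^ (k + 1)‖ = 1 := by rw [pow_succ, hk, norm_one]
  rw [norm_pow] at this
  exact absurd this (pow_lt_one₀ (norm_nonneg q) hq (by simp)).ne

lemma theta_mul (hq0 : q ≠ 0) (hq : ‖q‖ < 1) {x : ℂ} (hx : x ≠ 0) :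
    theta (q * x) q = -x⁻¹ * theta x q := by
  rw [theta, theta, qPoch_rec hq x, show q / (q * x) = x⁻¹ by field_simp, qPoch_rec hq x⁻¹,
    show q * x⁻¹ = q / x from rfl]
  field_simp
  ring

lemma theta_inv (hq : ‖q‖ < 1) {x : ℂ} (hx : x ≠ 0) :
    theta x⁻¹ q = -x⁻¹ * theta x q := by
  rw [theta, theta, qPoch_rec hq x, div_inv_eq_mul, qPoch_rec hq x⁻¹,
    show q * x⁻¹ = q / x from rfl]
  field_simp
  ring

lemma theta_div_self (hq0 : q ≠ 0) (x : ℂ) :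
    theta (q / x) q = theta x q := by
  rw [theta, theta, div_div_cancel₀ hq0, mul_comm]

lemma theta_eq_zero_iff (hq0 : q ≠ 0) (hq : ‖q‖ < 1) {x : ℂ} (hx : x ≠ 0) :
    theta x q = 0 ↔ ∃ m : ℤ, x = q ^ m := by
  rw [theta, mul_eq_zero, qPoch_eq_zero_iff hq, qPoch_eq_zero_iff hq]
  constructor
  · rintro (⟨k, hk⟩ | ⟨k, hk⟩)
    · refine ⟨-k, ?_⟩
      rw [zpow_neg, zpow_natCast]
      exact eq_inv_of_mul_eq_one_right hk
    · refine ⟨k + 1, ?_⟩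
      rw [mul_div_assoc', div_eq_one_iff_eq hx] at hk
      rw [← hk]; exact_mod_cast (pow_succ q k).symm
  · rintro ⟨m, rfl⟩
    rcases le_or_gt m 0 with h | h
    · left
      refine ⟨m.natAbs, ?_⟩
      rw [← zpow_natCast, ← zpow_add₀ hq0, show ((m.natAbs : ℤ) + m) = 0 by omega, zpow_zero]
    · right
      refine ⟨(m - 1).natAbs, ?_⟩
      rw [← zpow_natCast, show q / q ^ m = q ^ (1 - m) by rw [zpow_sub₀ hq0, zpow_one],
        ← zpow_add₀ hq0, show (((m - 1).natAbs : ℤ) + (1 - m)) = 0 by omega, zpow_zero]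

lemma theta_ne_zero_iff_inv (hq : ‖q‖ < 1) {x : ℂ} (hx : x ≠ 0) :
    theta x⁻¹ q = 0 ↔ theta x q = 0 := by
  rw [theta_inv hq hx]; simp [hx]

lemma differentiableAt_theta (hq : ‖q‖ < 1) {x : ℂ} (hx : x ≠ 0) :
    DifferentiableAt ℂ (fun x => theta x q) x := by
  have h1 : DifferentiableAt ℂ (fun x => qPoch (q / x) q) x :=
    DifferentiableAt.comp x (g := fun x => qPoch x q) (differentiable_qPoch hq _)
      ((differentiableAt_const q).div differentiableAt_id hx)
  exact (differentiable_qPoch hq x).mul h1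

/-- The zeros of the theta function are simple: at `1` because of the factor `1 - x`, at the other
powers of `q` by quasi-periodicity. -/
lemma deriv_theta_ne_zero (hq0 : q ≠ 0) (hq : ‖q‖ < 1) {x : ℂ} (hx : x ≠ 0)
    (h0 : theta x q = 0) : deriv (fun x => theta x q) x ≠ 0 := by
  obtain ⟨m, rfl⟩ := (theta_eq_zero_iff hq0 hq hx).1 h0
  have h1 : deriv (fun x => theta x q) 1 ≠ 0 := by
    have hd : DifferentiableAt ℂ (fun x => qPoch (q * x) q * qPoch (q / x) q) 1 := by
      refine DifferentiableAt.mul ?_ ?_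
      · exact DifferentiableAt.comp 1 (g := fun x => qPoch x q) (differentiable_qPoch hq _)
          (by fun_prop)
      · exact DifferentiableAt.comp 1 (g := fun x => qPoch x q) (differentiable_qPoch hq _)
          ((differentiableAt_const q).div differentiableAt_id one_ne_zero)
    have e : (fun x => theta x q) = fun x => (1 - x) * (qPoch (q * x) q * qPoch (q / x) q) := by
      funext x; rw [theta, qPoch_rec hq x]; ring
    have hl : HasDerivAt (fun x : ℂ => 1 - x) (-1) 1 := by
      simpa using (hasDerivAt_id (1 : ℂ)).const_sub 1
    have hh := (hl.fun_mul hd.hasDerivAt).deriv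
    rw [e, hh]
    simpa using qPoch_self_ne_zero hq
  have step : ∀ y : ℂ, y ≠ 0 → theta y q = 0 →
      deriv (fun x => theta x q) (q * y) = -(q * y)⁻¹ * deriv (fun x => theta x q) y := by
    intro y hy hy0
    have hA : HasDerivAt (fun x => theta (q * x) q) (deriv (fun x => theta x q) (q * y) * q) y := by
      have hg := (differentiableAt_theta hq (mul_ne_zero hq0 hy)).hasDerivAt
      have hf : HasDerivAt (fun x : ℂ => q * x) q y := by
        simpa using (hasDerivAt_id y).const_mul q
      exact HasDerivAt.comp y (h₂ := fun x => theta x q) hg hf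
    have hB : HasDerivAt (fun x => -x⁻¹ * theta x q)
        (-(-(y ^ 2)⁻¹) * theta y q + -y⁻¹ * deriv (fun x => theta x q) y) y :=
      ((hasDerivAt_inv hy).neg).mul (differentiableAt_theta hq hy).hasDerivAt
    have hev : (fun x => theta (q * x) q) =ᶠ[𝓝 y] fun x => -x⁻¹ * theta x q := by
      filter_upwards [isOpen_ne.mem_nhds hy] with x hx using theta_mul hq0 hq hx
    have := hA.unique (hB.congr_of_eventuallyEq hev)
    rw [hy0, mul_zero, zero_add] at this
    field_simp at this ⊢
    exact this
  have hz : ∀ m : ℤ, theta (q ^ m) q = 0 := fun m =>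
    (theta_eq_zero_iff hq0 hq (zpow_ne_zero _ hq0)).2 ⟨m, rfl⟩
  clear h0 hx
  induction m with
  | zero => simpa using h1
  | succ i ih =>
    rw [show q ^ ((i : ℤ) + 1) = q * q ^ (i : ℤ) by rw [zpow_add₀ hq0, zpow_one, mul_comm],
      step _ (zpow_ne_zero _ hq0) (hz _)]
    exact mul_ne_zero (neg_ne_zero.2 (inv_ne_zero (mul_ne_zero hq0 (zpow_ne_zero _ hq0)))) ih
  | pred i ih =>
    intro h
    apply ih
    rw [show q ^ (-(i : ℤ)) = q * q ^ (-(i : ℤ) - 1) by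
      rw [← zpow_one_add₀ hq0]; congr 1; ring,
      step _ (zpow_ne_zero _ hq0) (hz _), h, mul_zero]

end qPoch

section dPoch

/-- The double product `∏_{i, j ≥ 0} (1 - p^i q^j x)`. -/
noncomputable def dPoch (p q x : ℂ) : ℂ := genProd (fun ij : ℕ × ℕ => p ^ ij.1 * q ^ ij.2) x

variable {p q : ℂ}

lemma hasSum_norm_pow_mul_pow (hp : ‖p‖ < 1) (hq : ‖q‖ < 1) :
    HasSum (fun ij : ℕ × ℕ => ‖p ^ ij.1 * q ^ ij.2‖) ((1 - ‖p‖)⁻¹ * (1 - ‖q‖)⁻¹) := by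
  have h1 := hasSum_geometric_of_lt_one (norm_nonneg p) hp
  have h2 := hasSum_geometric_of_lt_one (norm_nonneg q) hq
  simpa using h1.mul h2 (h1.summable.mul_of_nonneg h2.summable
    (fun _ => by positivity) (fun _ => by positivity))

lemma summable_norm_pow_mul_pow (hp : ‖p‖ < 1) (hq : ‖q‖ < 1) :
    Summable (fun ij : ℕ × ℕ => ‖p ^ ij.1 * q ^ ij.2‖) := (hasSum_norm_pow_mul_pow hp hq).summable

lemma dPoch_eq_zero_iff (hp : ‖p‖ < 1) (hq : ‖q‖ < 1) (x : ℂ) :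
    dPoch p q x = 0 ↔ ∃ i j : ℕ, p ^ i * q ^ j * x = 1 := by
  rw [dPoch, genProd_eq_zero_iff (summable_norm_pow_mul_pow hp hq)]
  simp

lemma differentiable_dPoch (hp : ‖p‖ < 1) (hq : ‖q‖ < 1) : Differentiable ℂ (dPoch p q) :=
  differentiable_genProd (summable_norm_pow_mul_pow hp hq)

lemma norm_dPoch_sub_one_le (hp : ‖p‖ < 1) (hq : ‖q‖ < 1) (x : ℂ) :
    ‖dPoch p q x - 1‖ ≤ Real.exp ((1 - ‖p‖)⁻¹ * (1 - ‖q‖)⁻¹ * ‖x‖) - 1 := by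
  have := norm_genProd_sub_one_le (summable_norm_pow_mul_pow hp hq) x
  rwa [(hasSum_norm_pow_mul_pow hp hq).tsum_eq] at this

lemma dPoch_rec_left (hp : ‖p‖ < 1) (hq : ‖q‖ < 1) (x : ℂ) :
    dPoch p q x = qPoch x q * dPoch p q (p * x) := by
  let e : ℕ ⊕ (ℕ × ℕ) ≃ ℕ × ℕ :=
    { toFun := Sum.elim (fun j => (0, j)) (fun ij => (ij.1 + 1, ij.2))
      invFun := fun ij => match ij with
        | (0, j) => Sum.inl j
        | (i + 1, j) => Sum.inr (i, j)
      left_inv := by rintro (j | ⟨i, j⟩) <;> rfl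
      right_inv := by rintro ⟨_ | i, j⟩ <;> rfl }
  have h1 : HasProd (fun k : ℕ => 1 - q ^ k * x) (qPoch x q) := by
    rw [qPoch_eq_genProd]
    exact (multipliable_one_sub_mul (summable_norm_pow hq) x).hasProd
  have h2 : HasProd (fun ij : ℕ × ℕ => 1 - p ^ ij.1 * q ^ ij.2 * (p * x)) (dPoch p q (p * x)) :=
    (multipliable_one_sub_mul (summable_norm_pow_mul_pow hp hq) (p * x)).hasProd
  have h3 : HasProd ((fun ij : ℕ × ℕ => 1 - p ^ ij.1 * q ^ ij.2 * x) ∘ e)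
      (qPoch x q * dPoch p q (p * x)) := by
    refine HasProd.sum ?_ ?_
    · refine h1.congr_fun fun j => ?_
      simp [e]
    · refine h2.congr_fun fun ij => ?_
      simp [e]; ring
  exact ((e.hasProd_iff).1 h3).tprod_eq

lemma dPoch_comm (p q x : ℂ) : dPoch p q x = dPoch q p x := by
  rw [dPoch, dPoch, genProd, genProd, ← (Equiv.prodComm ℕ ℕ).tprod_eq]
  refine tprod_congr fun ij => ?_
  simp [mul_comm]

lemma dPoch_rec_right (hp : ‖p‖ < 1) (hq : ‖q‖ < 1) (x : ℂ) :
    dPoch p q x = qPoch x p * dPoch p q (q * x) := by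
  rw [dPoch_comm, dPoch_rec_left hq hp, dPoch_comm]

lemma ellGamma_eq (p q x : ℂ) : ellGamma p q x = dPoch p q (p * q / x) / dPoch p q x := by
  rw [ellGamma, dPoch, dPoch, genProd, genProd]
  congr 1
  refine tprod_congr fun ij => ?_
  congr 1
  ring

end dPoch

/-! ### The Cauchy-Pompeiu formula -/

/-- The Wirtinger derivative `∂g/∂z̄`. -/
noncomputable def dbar (g : ℂ → ℂ) (z : ℂ) : ℂ :=
  (fderiv ℝ g z 1 + Complex.I * fderiv ℝ g z Complex.I) / 2

lemma continuous_dbar {g : ℂ → ℂ} (hg : ContDiff ℝ 1 g) : Continuous (dbar g) := by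
  have h := hg.continuous_fderiv (by norm_num)
  unfold dbar
  fun_prop

lemma dbar_eq_zero_of_differentiableAt {g : ℂ → ℂ} {z : ℂ} (h : DifferentiableAt ℂ g z) :
    dbar g z = 0 := by
  have e : fderiv ℝ g z = (fderiv ℂ g z).restrictScalars ℝ := h.fderiv_restrictScalars ℝ
  have e2 : fderiv ℂ g z Complex.I = Complex.I * fderiv ℂ g z 1 := by
    rw [← smul_eq_mul, ← map_smul, smul_eq_mul, mul_one]
  rw [dbar, e]
  simp only [ContinuousLinearMap.coe_restrictScalars', e2]
  rw [← mul_assoc, Complex.I_mul_I]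
  ring

lemma dbar_congr {g₁ g₂ : ℂ → ℂ} {z : ℂ} (h : g₁ =ᶠ[𝓝 z] g₂) : dbar g₁ z = dbar g₂ z := by
  rw [dbar, dbar, h.fderiv_eq]

lemma dbar_eq_zero_of_notMem_tsupport {g : ℂ → ℂ} {z : ℂ} (h : z ∉ tsupport g) :
    dbar g z = 0 := by
  rw [dbar_congr (notMem_tsupport_iff_eventuallyEq.1 h)]
  exact dbar_eq_zero_of_differentiableAt (by
    exact differentiableAt_const (0 : ℂ))

/-- The Cauchy-Pompeiu formula for compactly supported functions: in polar coordinates about `w`,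
the integrand is `(∂_r + i r⁻¹ ∂_θ) g / 2`, whose angular part integrates to zero. -/
theorem integral_dbar_div_sub {g : ℂ → ℂ} (hg : ContDiff ℝ 1 g) (hs : HasCompactSupport g)
    (w : ℂ) : ∫ z, dbar g z / (z - w) = -Real.pi * g w := by
  have hd : Differentiable ℝ g := hg.differentiable (by norm_num)
  have hcf : Continuous (fderiv ℝ g) := hg.continuous_fderiv (by norm_num)
  let e : ℝ → ℂ := fun θ => Real.cos θ + Real.sin θ * Complex.I
  have he : ∀ θ, e θ = Complex.exp (θ * Complex.I) := fun θ => by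
    simp [e, Complex.exp_mul_I]
  have hec : Continuous e := by fun_prop
  let A : ℝ × ℝ → ℂ := fun x => fderiv ℝ g (w + x.1 * e x.2) (e x.2)
  let B : ℝ × ℝ → ℂ := fun x => fderiv ℝ g (w + x.1 * e x.2) (Complex.I * e x.2)
  have hA : Continuous A := by fun_prop
  have hB : Continuous B := by fun_prop
  obtain ⟨R, hR⟩ : ∃ R : ℝ, ∀ z, R ≤ ‖z‖ → fderiv ℝ g (w + z) = 0 := by
    obtain ⟨R, hR⟩ := (hs.isCompact.isBounded).exists_norm_le
    refine ⟨R + ‖w‖ + 1, fun z hz => ?_⟩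
    have : w + z ∉ tsupport g := fun h => by
      have h1 := hR _ h
      have h2 := norm_sub_norm_le z (-w)
      rw [sub_neg_eq_add, norm_neg, add_comm z w] at h2
      linarith
    rw [(notMem_tsupport_iff_eventuallyEq.1 this).fderiv_eq]
    simp
  let R' := max R 1
  have hR'0 : 0 < R' := lt_of_lt_of_le one_pos (le_max_right _ _)
  have hzero : ∀ r θ, R' ≤ r → fderiv ℝ g (w + (r : ℂ) * e θ) = 0 := fun r θ h => by
    apply hR
    rw [norm_mul, he, Complex.norm_exp_ofReal_mul_I, mul_one, Complex.norm_real, Real.norm_eq_abs,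
      abs_of_pos (hR'0.trans_le h)]
    exact (le_max_left _ _).trans h
  have h1 : ∫ z, dbar g z / (z - w) = ∫ z, dbar g (w + z) / z := by
    rw [← integral_add_left_eq_self _ w]
    simp
  -- `∂̄g = (∂_r + i r⁻¹ ∂_θ) g · e^{iθ} / 2` at `w + r e^{iθ}`, and `A = ∂_r g`, `B = r⁻¹ ∂_θ g`
  have hpt : ∀ x ∈ polarCoord.target, x.1 • (fun z => dbar g (w + z) / z)
      (Complex.polarCoord.symm x) = (A x + Complex.I * B x) / 2 := by
    rintro ⟨r, θ⟩ ⟨hr, -⟩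
    have hr0 : (r : ℂ) ≠ 0 := by exact_mod_cast (ne_of_gt hr)
    have he0 : e θ ≠ 0 := by rw [he]; exact Complex.exp_ne_zero _
    simp only [Complex.polarCoord_symm_apply]
    change r • (dbar g (w + r * e θ) / (r * e θ)) = _
    set L := fderiv ℝ g (w + r * e θ) with hL
    have hLlin : ∀ ξ : ℂ, L ξ = ξ.re * L 1 + ξ.im * L Complex.I := fun ξ => by
      have : ξ = ξ.re • (1 : ℂ) + ξ.im • Complex.I := by
        simp
      conv_lhs => rw [this]
      rw [map_add, map_smul, map_smul]
      simp
    have hA' : A (r, θ) = L (e θ) := rfl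
    have hB' : B (r, θ) = L (Complex.I * e θ) := rfl
    have hcs : (Real.cos θ : ℂ) ^ 2 + (Real.sin θ : ℂ) ^ 2 = 1 := by
      exact_mod_cast Real.cos_sq_add_sin_sq θ
    rw [hA', hB', hLlin (e θ), hLlin (Complex.I * e θ), dbar, ← hL, Complex.real_smul]
    have r1 : (e θ).re = Real.cos θ := by simp [e, Complex.cos_ofReal_re, Complex.sin_ofReal_im]
    have r2 : (e θ).im = Real.sin θ := by simp [e, Complex.cos_ofReal_im, Complex.sin_ofReal_re]
    have r3 : (Complex.I * e θ).re = -Real.sin θ := by simp [r2]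
    have r4 : (Complex.I * e θ).im = Real.cos θ := by simp [r1]
    rw [r1, r2, r3, r4]
    have h3 : ∀ X : ℂ, (r : ℂ) * (X / (r * e θ)) = X / e θ := fun X => by field_simp
    rw [h3, div_eq_iff he0]
    simp only [e]
    generalize Real.cos θ = c at hcs ⊢
    generalize Real.sin θ = s at hcs ⊢
    push_cast
    linear_combination (-(L 1 + Complex.I * L Complex.I) / 2) * hcs +
      ((s : ℂ) ^ 2 * L 1 / 2 - s * c * L Complex.I / 2) * Complex.I_sq
  have h2 : ∫ z, dbar g (w + z) / z =
      ∫ x in Set.Ioi (0 : ℝ) ×ˢ Set.Ioo (-Real.pi) Real.pi, (A x + Complex.I * B x) / 2 := by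
    rw [← Complex.integral_comp_polarCoord_symm, ← polarCoord_target]
    exact setIntegral_congr_fun (by rw [polarCoord_target]; measurability) hpt
  have h3 : ∫ x in Set.Ioi (0 : ℝ) ×ˢ Set.Ioo (-Real.pi) Real.pi, (A x + Complex.I * B x) / 2 =
      ∫ x in Set.Ioc (0 : ℝ) R' ×ˢ Set.Ioc (-Real.pi) Real.pi, (A x + Complex.I * B x) / 2 := by
    have : ∫ x in Set.Ioi (0 : ℝ) ×ˢ Set.Ioo (-Real.pi) Real.pi, (A x + Complex.I * B x) / 2 =
      ∫ x in Set.Ioc (0 : ℝ) R' ×ˢ Set.Ioo (-Real.pi) Real.pi, (A x + Complex.I * B x) / 2 := by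
      apply setIntegral_eq_of_subset_of_forall_sdiff_eq_zero
      · measurability
      · exact Set.prod_mono Set.Ioc_subset_Ioi_self subset_rfl
      · rintro ⟨r, θ⟩ ⟨⟨hr, hθ⟩, hn⟩
        have : R' ≤ r := by
          by_contra! h
          exact hn (Set.mk_mem_prod ⟨hr, h.le⟩ hθ)
        simp [A, B, hzero r θ this]
    rw [this]
    apply setIntegral_congr_set
    rw [Measure.volume_eq_prod]
    exact Measure.set_prod_ae_eq (ae_eq_refl _) Ioo_ae_eq_Ioc
  have hint : ∀ {F : ℝ × ℝ → ℂ}, Continuous F →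
      IntegrableOn F (Set.Ioc (0 : ℝ) R' ×ˢ Set.Ioc (-Real.pi) Real.pi) := fun {F} hF =>
    (hF.continuousOn.integrableOn_compact (isCompact_Icc.prod isCompact_Icc)).mono_set
      (Set.prod_mono Set.Ioc_subset_Icc_self Set.Ioc_subset_Icc_self)
  have hpi : -Real.pi ≤ Real.pi := by linarith [Real.pi_pos]
  -- the radial integral of `∂_r g` is `-g w` on every ray
  have hAint : ∫ x in Set.Ioc (0 : ℝ) R' ×ˢ Set.Ioc (-Real.pi) Real.pi, A x =
      -(2 * Real.pi) * g w := by
    rw [Measure.volume_eq_prod, ← setIntegral_prod_swap,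
      setIntegral_prod _ (by
        have := hint (F := A) hA
        rw [Measure.volume_eq_prod] at this
        exact this.swap)]
    have : ∀ θ : ℝ, ∫ r in Set.Ioc (0 : ℝ) R', A (Prod.swap (θ, r)) = -g w := by
      intro θ
      simp only [Prod.swap_prod_mk]
      rw [← intervalIntegral.integral_of_le hR'0.le]
      have hder : ∀ r : ℝ, HasDerivAt (fun r : ℝ => g (w + r * e θ)) (A (r, θ)) r := by
        intro r
        have h1 : HasDerivAt (fun r : ℝ => w + (r : ℂ) * e θ) (e θ) r := by
          simpa using ((Complex.ofRealCLM.hasDerivAt (x := r)).mul_const (e θ)).const_add w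
        exact (hd (w + r * e θ)).hasFDerivAt.comp_hasDerivAt r h1
      rw [intervalIntegral.integral_eq_sub_of_hasDerivAt (fun r _ => hder r)
        (Continuous.intervalIntegrable (by fun_prop) _ _)]
      have : g (w + (R' : ℂ) * e θ) = 0 := by
        have hconst : ∀ r, R' ≤ r → g (w + (r : ℂ) * e θ) = g (w + (R' : ℂ) * e θ) := by
          intro r hr
          have := intervalIntegral.integral_eq_sub_of_hasDerivAt (a := R') (b := r)
            (fun r _ => hder r) (Continuous.intervalIntegrable (by fun_prop) _ _)
          rw [intervalIntegral.integral_congr (g := fun _ => (0 : ℂ))] at this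
          · simp at this; linear_combination -this
          · intro s hs
            rw [Set.uIcc_of_le hr] at hs
            simp [A, hzero s θ hs.1]
        obtain ⟨M, hM⟩ := (hs.isCompact.isBounded).exists_norm_le
        have hbig : w + ((max R' (M + ‖w‖ + 1) : ℝ) : ℂ) * e θ ∉ tsupport g := fun h => by
          have h1 := hM _ h
          have h2 := norm_sub_norm_le (((max R' (M + ‖w‖ + 1) : ℝ) : ℂ) * e θ) (-w)
          rw [sub_neg_eq_add, norm_neg, add_comm _ w, norm_mul, he,
            Complex.norm_exp_ofReal_mul_I, mul_one, Complex.norm_real, Real.norm_eq_abs,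
            abs_of_pos (hR'0.trans_le (le_max_left _ _)), ← he] at h2
          have := le_max_right R' (M + ‖w‖ + 1)
          linarith
        rw [← hconst _ (le_max_left R' (M + ‖w‖ + 1))]
        exact image_eq_zero_of_notMem_tsupport hbig
      rw [this]; simp
    simp_rw [this]
    rw [setIntegral_const, measureReal_def, Real.volume_Ioc,
      ENNReal.toReal_ofReal (by linarith), Complex.real_smul]
    push_cast; ring
  -- the angular integral of `∂_θ g` vanishes by periodicity
  have hBint : ∫ x in Set.Ioc (0 : ℝ) R' ×ˢ Set.Ioc (-Real.pi) Real.pi, B x = 0 := by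
    rw [Measure.volume_eq_prod, setIntegral_prod _ (by
        have := hint (F := B) hB
        rwa [Measure.volume_eq_prod] at this)]
    have : ∀ r ∈ Set.Ioc (0 : ℝ) R', ∫ θ in Set.Ioc (-Real.pi) Real.pi, B (r, θ) = 0 := by
      intro r hr
      have hr0 : (r : ℂ) ≠ 0 := by exact_mod_cast (ne_of_gt hr.1)
      rw [← intervalIntegral.integral_of_le hpi]
      have hder : ∀ θ : ℝ, HasDerivAt (fun θ : ℝ => (r : ℂ)⁻¹ * g (w + r * e θ)) (B (r, θ)) θ := by
        intro θ
        have h0 : HasDerivAt e (Complex.I * e θ) θ := by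
          have : HasDerivAt (fun θ : ℝ => Complex.exp (θ * Complex.I))
              (Complex.exp (θ * Complex.I) * (1 * Complex.I)) θ :=
            ((Complex.ofRealCLM.hasDerivAt (x := θ)).mul_const Complex.I).cexp
          have e' : e = fun θ : ℝ => Complex.exp (θ * Complex.I) := funext he
          rw [e']
          convert! this using 1
          ring
        have h1 : HasDerivAt (fun θ : ℝ => w + (r : ℂ) * e θ) (r * (Complex.I * e θ)) θ :=
          (h0.const_mul (r : ℂ)).const_add w
        have h2 := ((hd (w + r * e θ)).hasFDerivAt.comp_hasDerivAt θ h1).const_mul (r : ℂ)⁻¹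
        convert! h2 using 1
        rw [show (r : ℂ) * (Complex.I * e θ) = r • (Complex.I * e θ) by simp, map_smul,
          Complex.real_smul, inv_mul_cancel_left₀ hr0]
      rw [intervalIntegral.integral_eq_sub_of_hasDerivAt (fun θ _ => hder θ)
        (Continuous.intervalIntegrable (by fun_prop) _ _)]
      simp [e]
    rw [setIntegral_congr_fun measurableSet_Ioc this]
    simp
  rw [h1, h2, h3]
  have hsplit : ∫ x in Set.Ioc (0 : ℝ) R' ×ˢ Set.Ioc (-Real.pi) Real.pi,
      (A x + Complex.I * B x) / 2 =
      ((∫ x in Set.Ioc (0 : ℝ) R' ×ˢ Set.Ioc (-Real.pi) Real.pi, A x) +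
      Complex.I * ∫ x in Set.Ioc (0 : ℝ) R' ×ˢ Set.Ioc (-Real.pi) Real.pi, B x) / 2 := by
    rw [integral_div, integral_add (hint hA) (hint (by fun_prop)), integral_const_mul]
  rw [hsplit, hAint, hBint]
  ring

/-- Smooth cutoff functions. -/
lemma exists_cutoff {K U : Set ℂ} (hK : IsCompact K) (hU : IsOpen U) (hKU : K ⊆ U) :
    ∃ ψ : ℂ → ℂ, ContDiff ℝ 1 ψ ∧ (∀ᶠ z in 𝓝ˢ K, ψ z = 1) ∧ HasCompactSupport ψ ∧
      tsupport ψ ⊆ U := by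
  obtain ⟨L, hL, hKL, hLU⟩ := exists_compact_between hK hU hKU
  obtain ⟨f, hf1, hf0, -⟩ := exists_contMDiffMap_one_nhds_of_subset_interior (n := 1)
    (modelWithCornersSelf ℝ ℂ) hK.isClosed hKL
  have hsm : ContDiff ℝ 1 (fun z => (f z : ℂ)) := by
    have h1 : ContDiff ℝ 1 f := f.contMDiff.contDiff
    exact Complex.ofRealCLM.contDiff.comp h1
  have hsub : tsupport (fun z => (f z : ℂ)) ⊆ L := by
    refine closure_minimal (fun z hz => ?_) hL.isClosed
    by_contra h
    exact hz (by simp [hf0 z h])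
  refine ⟨fun z => (f z : ℂ), hsm, ?_, hL.of_isClosed_subset (isClosed_tsupport _) hsub,
    hsub.trans hLU⟩
  filter_upwards [hf1] with z hz
  simp [hz]

/-! ### Cycles and their Cauchy transforms -/

/-- A compactly parametrized complex measure on the plane: `∫ φ(pt ω) wt(ω) dμ(ω)` plays the role
of the integral of `φ(z) dz / (2πi z)`. Contours are of this form, and so are the smooth area
integrals that arise from cutoff functions by Stokes' theorem. -/
structure Cycle where
  Ω : Type
  [top : TopologicalSpace Ω]
  [compact : CompactSpace Ω]
  [t2 : T2Space Ω]
  [sc : SecondCountableTopology Ω]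
  [meas : MeasurableSpace Ω]
  [borel : BorelSpace Ω]
  μ : Measure Ω
  [fin : IsFiniteMeasure μ]
  pt : Ω → ℂ
  wt : Ω → ℂ
  cont_pt : Continuous pt
  cont_wt : Continuous wt

attribute [instance] Cycle.top Cycle.compact Cycle.t2 Cycle.sc Cycle.meas Cycle.borel Cycle.fin

namespace Cycle

/-- The Cauchy transform of a cycle; for a contour this is the winding number. -/
noncomputable def cauchy (c : Cycle) (z : ℂ) : ℂ :=
  ∫ ω, c.wt ω * c.pt ω / (c.pt ω - z) ∂c.μ

/-- The homology form of Cauchy's theorem: two cycles in an open set `N` whose Cauchy transforms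
agree off a compact subset of `N` give the same integrals of functions holomorphic on `N`. After
multiplication by a cutoff function, the Cauchy-Pompeiu formula expresses the integral by the values
of the Cauchy transform where the cutoff function varies. -/
theorem integral_eq_of_cauchy_eq {N Q : Set ℂ} (hN : IsOpen N) (h0 : (0 : ℂ) ∉ N)
    (hQ : IsCompact Q) (hQN : Q ⊆ N) {c c' : Cycle} (hc : ∀ ω, c.pt ω ∈ Q)
    (hc' : ∀ ω, c'.pt ω ∈ Q) (he : ∀ z, z ∉ Q → c.cauchy z = c'.cauchy z)
    {φ : ℂ → ℂ} (hφ : DifferentiableOn ℂ φ N) :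
    ∫ ω, φ (c.pt ω) * c.wt ω ∂c.μ = ∫ ω, φ (c'.pt ω) * c'.wt ω ∂c'.μ := by
  obtain ⟨ψ, hψ, hψ1, hψs, hψN⟩ := exists_cutoff hQ hN hQN
  let g : ℂ → ℂ := fun z => ψ z * (φ z / z)
  have hquot : DifferentiableOn ℂ (fun z => φ z / z) N :=
    hφ.div differentiableOn_id (fun z hz h => h0 (h ▸ hz))
  have hsupp : tsupport g ⊆ tsupport ψ := tsupport_mul_subset_left
  have hg : ContDiff ℝ 1 g := by
    rw [contDiff_iff_contDiffAt]
    intro z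
    by_cases hz : z ∈ tsupport ψ
    · have h1 : ContDiffAt ℂ 1 (fun z => φ z / z) z :=
        (hquot.contDiffOn hN).contDiffAt (hN.mem_nhds (hψN hz))
      exact hψ.contDiffAt.mul (h1.restrict_scalars ℝ)
    · have : g =ᶠ[𝓝 z] fun _ => 0 := notMem_tsupport_iff_eventuallyEq.1 fun h => hz (hsupp h)
      exact contDiffAt_const.congr_of_eventuallyEq this
  have hgs : HasCompactSupport g := hψs.of_isClosed_subset (isClosed_tsupport _) hsupp
  have hdQ : ∀ z ∈ Q, ∀ᶠ y in 𝓝 z, dbar g y = 0 := by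
    intro z hz
    have h1 : ∀ᶠ y in 𝓝 z, ψ y = 1 := (eventually_nhdsSet_iff_forall.1 hψ1) z hz
    filter_upwards [h1.eventually_nhds, hN.mem_nhds (hQN hz)] with y hy hyN
    have : g =ᶠ[𝓝 y] fun z => φ z / z := by
      filter_upwards [hy] with x hx
      simp [g, hx]
    rw [dbar_congr this]
    exact dbar_eq_zero_of_differentiableAt (hquot.differentiableAt (hN.mem_nhds hyN))
  -- the Cauchy-Pompeiu formula for `g = ψ φ / z`, integrated over the cycle
  have key : ∀ c : Cycle, (∀ ω, c.pt ω ∈ Q) →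
      ∫ ω, φ (c.pt ω) * c.wt ω ∂c.μ = (Real.pi : ℂ)⁻¹ * ∫ z, dbar g z * c.cauchy z := by
    intro c hc
    have hpi : (Real.pi : ℂ) ≠ 0 := by exact_mod_cast Real.pi_ne_zero
    have e1 : ∀ ω, φ (c.pt ω) * c.wt ω =
        (Real.pi : ℂ)⁻¹ * ∫ z, dbar g z * (c.wt ω * c.pt ω / (c.pt ω - z)) := by
      intro ω
      have hne : c.pt ω ≠ 0 := fun h => h0 (h ▸ hQN (hc ω))
      have h2 := integral_dbar_div_sub hg hgs (c.pt ω)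
      have h3 : ∀ z, dbar g z * (c.wt ω * c.pt ω / (c.pt ω - z)) =
          -(c.wt ω * c.pt ω) * (dbar g z / (z - c.pt ω)) := fun z => by
        rw [← neg_sub z (c.pt ω), div_neg]; ring
      simp_rw [h3]
      rw [integral_const_mul, h2]
      have : ψ (c.pt ω) = 1 := hψ1.self_of_nhdsSet _ (hc ω)
      simp only [g, this]
      field_simp
    simp_rw [e1]
    rw [integral_const_mul]
    congr 1
    have hcont : Continuous (Function.uncurry fun (ω : c.Ω) (z : ℂ) =>
        dbar g z * (c.wt ω * c.pt ω / (c.pt ω - z))) := by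
      rw [continuous_iff_continuousAt]
      rintro ⟨ω, z⟩
      by_cases hz : z ∈ Q
      · have : (Function.uncurry fun (ω : c.Ω) (z : ℂ) =>
            dbar g z * (c.wt ω * c.pt ω / (c.pt ω - z))) =ᶠ[𝓝 (ω, z)] fun _ => 0 := by
          have := (continuous_snd.tendsto (ω, z)).eventually (hdQ z hz)
          filter_upwards [this] with x hx
          simp [Function.uncurry, hx]
        exact continuousAt_const.congr this.symm
      · have hne : c.pt ω - z ≠ 0 := fun h => hz (by rw [← sub_eq_zero.1 h]; exact hc ω)
        have h1 := (continuous_dbar hg).comp (continuous_snd (X := c.Ω))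
        have h2 := c.cont_wt.comp (continuous_fst (Y := ℂ))
        have h3 := c.cont_pt.comp (continuous_fst (Y := ℂ))
        exact h1.continuousAt.mul ((h2.mul h3).continuousAt.div
          (h3.sub continuous_snd).continuousAt hne)
    have hcs : HasCompactSupport (Function.uncurry fun (ω : c.Ω) (z : ℂ) =>
        dbar g z * (c.wt ω * c.pt ω / (c.pt ω - z))) := by
      refine HasCompactSupport.intro (isCompact_univ.prod hgs) ?_
      rintro ⟨ω, z⟩ h
      have : z ∉ tsupport g := fun hz => h ⟨trivial, hz⟩
      simp [Function.uncurry, dbar_eq_zero_of_notMem_tsupport this]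
    rw [integral_integral_swap_of_hasCompactSupport hcont hcs]
    simp_rw [integral_const_mul]
    rfl
  rw [key c hc, key c' hc']
  congr 1
  refine integral_congr_ae (.of_forall fun z => ?_)
  by_cases hz : z ∈ Q
  · simp [(hdQ z hz).self_of_nhds]
  · simp only [he z hz]

/-- The cycle `c` separates the compact set `L` from the complement of the open set `U`: it runs in
`U \ L`, winds once around `L` and does not wind around the complement of `U`. -/
def Separates (c : Cycle) (L U : Set ℂ) : Prop :=
  ∃ L' K' : Set ℂ, IsOpen L' ∧ L ⊆ L' ∧ IsCompact K' ∧ K' ⊆ U ∧ (∀ ω, c.pt ω ∈ K' \ L') ∧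
    (∀ z ∈ L', c.cauchy z = 1) ∧ ∀ z, z ∉ K' → c.cauchy z = 0

theorem Separates.integral_eq {L U : Set ℂ} (hL : IsClosed L) (hU : IsOpen U)
    (h0 : (0 : ℂ) ∈ L) {c c' : Cycle} (hc : c.Separates L U) (hc' : c'.Separates L U)
    {φ : ℂ → ℂ} (hφ : DifferentiableOn ℂ φ (U \ L)) :
    ∫ ω, φ (c.pt ω) * c.wt ω ∂c.μ = ∫ ω, φ (c'.pt ω) * c'.wt ω ∂c'.μ := by
  obtain ⟨L₁, K₁, hL₁, hLL₁, hK₁, hKU₁, hpt₁, h1₁, h0₁⟩ := hc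
  obtain ⟨L₂, K₂, hL₂, hLL₂, hK₂, hKU₂, hpt₂, h1₂, h0₂⟩ := hc'
  refine integral_eq_of_cauchy_eq (N := U \ L) (Q := (K₁ ∪ K₂) \ (L₁ ∩ L₂))
    (hU.sdiff hL) (fun h => h.2 h0) ((hK₁.union hK₂).diff (hL₁.inter hL₂))
    ?_ ?_ ?_ ?_ hφ
  · rintro z ⟨hz | hz, hz'⟩
    · exact ⟨hKU₁ hz, fun h => hz' ⟨hLL₁ h, hLL₂ h⟩⟩
    · exact ⟨hKU₂ hz, fun h => hz' ⟨hLL₁ h, hLL₂ h⟩⟩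
  · exact fun ω => ⟨Or.inl (hpt₁ ω).1, fun h => (hpt₁ ω).2 h.1⟩
  · exact fun ω => ⟨Or.inr (hpt₂ ω).1, fun h => (hpt₂ ω).2 h.2⟩
  · intro z hz
    by_cases hK : z ∈ K₁ ∪ K₂
    · have : z ∈ L₁ ∩ L₂ := by
        by_contra h
        exact hz ⟨hK, h⟩
      rw [h1₁ z this.1, h1₂ z this.2]
    · rw [h0₁ z fun h => hK (Or.inl h), h0₂ z fun h => hK (Or.inr h)]

lemma Separates.mono {L L' U U' : Set ℂ} {c : Cycle} (h : c.Separates L U) (hL : L' ⊆ L)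
    (hU : U ⊆ U') : c.Separates L' U' := by
  obtain ⟨L₁, K₁, hL₁, hLL₁, hK₁, hKU₁, hr⟩ := h
  exact ⟨L₁, K₁, hL₁, hL.trans hLL₁, hK₁, hKU₁.trans hU, hr⟩

lemma Separates.pt_mem {L U : Set ℂ} {c : Cycle} (h : c.Separates L U) (ω : c.Ω) :
    c.pt ω ∈ U \ L := by
  obtain ⟨L₁, K₁, hL₁, hLL₁, hK₁, hKU₁, hpt, -⟩ := h
  exact ⟨hKU₁ (hpt ω).1, fun h => (hpt ω).2 (hLL₁ h)⟩

/-- A cutoff function `X` defines a separating cycle, with density `-∂̄X / (π z)` with respect to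
area. -/
theorem exists_separates {L U : Set ℂ} (hL : IsCompact L) (hU : IsOpen U) (hLU : L ⊆ U)
    (h0 : (0 : ℂ) ∈ L) : ∃ c : Cycle, c.Separates L U := by
  obtain ⟨X, hX, hX1, hXs, hXU⟩ := exists_cutoff hL hU hLU
  obtain ⟨L', hL'o, hLL', hL'⟩ := eventually_nhdsSet_iff_exists.1 hX1
  let S : Set ℂ := tsupport X \ L'
  have hS : IsCompact S := hXs.isCompact.diff hL'o
  have hS0 : ∀ z ∈ S, z ≠ 0 := fun z hz h => hz.2 (h ▸ hLL' h0)
  have : CompactSpace S := isCompact_iff_compactSpace.1 hS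
  have : IsFiniteMeasure (Measure.comap ((↑) : S → ℂ) volume) := by
    constructor
    rw [comap_subtype_coe_apply hS.measurableSet volume]
    simpa using hS.measure_lt_top
  let c : Cycle :=
    { Ω := S
      μ := Measure.comap (↑) (volume : Measure ℂ)
      pt := (↑)
      wt := fun ω => -(Real.pi : ℂ)⁻¹ * dbar X ω / ω
      cont_pt := continuous_subtype_val
      cont_wt := ((continuous_const.mul ((continuous_dbar hX).comp continuous_subtype_val)).div
        continuous_subtype_val fun ω => hS0 _ ω.2) }
  have hdb : ∀ z, z ∉ S → dbar X z = 0 := by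
    intro z hz
    by_cases h : z ∈ L'
    · have : X =ᶠ[𝓝 z] fun _ => 1 := by
        filter_upwards [hL'o.mem_nhds h] with y hy using hL' y hy
      rw [dbar_congr this]
      exact dbar_eq_zero_of_differentiableAt (differentiableAt_const (1 : ℂ))
    · exact dbar_eq_zero_of_notMem_tsupport fun h' => hz ⟨h', h⟩
  -- by the Cauchy-Pompeiu formula, the Cauchy transform of this cycle is the cutoff function
  have hc : ∀ z, c.cauchy z = X z := by
    intro z
    have h1 : c.cauchy z = ∫ ω : S, -(Real.pi : ℂ)⁻¹ * (dbar X ω / (ω - z))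
        ∂(Measure.comap (↑) (volume : Measure ℂ)) := by
      refine integral_congr_ae (.of_forall fun ω => ?_)
      have := hS0 _ ω.2
      simp only [c]
      field_simp
    rw [h1, integral_subtype_comap hS.measurableSet
      (fun ω : ℂ => -(Real.pi : ℂ)⁻¹ * (dbar X ω / (ω - z))),
      setIntegral_eq_integral_of_forall_compl_eq_zero, integral_const_mul,
      integral_dbar_div_sub hX hXs]
    · have hpi : (Real.pi : ℂ) ≠ 0 := by exact_mod_cast Real.pi_ne_zero
      field_simp
    · intro y hy
      simp [hdb y hy]
  refine ⟨c, L', tsupport X, hL'o, hLL', hXs, hXU, fun ω => ω.2, fun z hz => ?_, fun z hz => ?_⟩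
  · rw [hc, hL' z hz]
  · rw [hc, image_eq_zero_of_notMem_tsupport hz]

/-! ### Multiple integrals over cycles -/

/-- The integral of a function of `n` variables over a product of `n` cycles. -/
noncomputable def multiInt {n : ℕ} (c : Fin n → Cycle) (G : (Fin n → ℂ) → ℂ) : ℂ :=
  ∫ ω : ∀ j, (c j).Ω, G (fun j => (c j).pt (ω j)) * ∏ j, (c j).wt (ω j)
    ∂Measure.pi fun j => (c j).μ

lemma multiInt_congr {n : ℕ} {c : Fin n → Cycle} {G G' : (Fin n → ℂ) → ℂ}
    (h : ∀ ω : ∀ j, (c j).Ω, G (fun j => (c j).pt (ω j)) = G' fun j => (c j).pt (ω j)) :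
    multiInt c G = multiInt c G' := by
  simp only [multiInt, h]

section

variable {n : ℕ} {N : Set ℂ}

lemma continuous_multi_integrand {c : Fin n → Cycle} (hc : ∀ j ω, (c j).pt ω ∈ N)
    {G : (Fin n → ℂ) → ℂ} (hG : ContinuousOn G (Set.univ.pi fun _ => N)) :
    Continuous fun ω : ∀ j, (c j).Ω => G (fun j => (c j).pt (ω j)) * ∏ j, (c j).wt (ω j) := by
  have h1 : Continuous fun ω : ∀ j, (c j).Ω => fun j => (c j).pt (ω j) :=
    continuous_pi fun j => (c j).cont_pt.comp (continuous_apply j)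
  exact (hG.comp_continuous h1 fun ω j _ => hc j _).mul
    (continuous_finsetProd _ fun j _ => (c j).cont_wt.comp (continuous_apply j))

lemma cons_mem_pi {z : ℂ} (hz : z ∈ N) {y : Fin n → ℂ} (hy : y ∈ Set.univ.pi fun _ : Fin n => N) :
    (Fin.cons z y : Fin (n + 1) → ℂ) ∈ Set.univ.pi fun _ : Fin (n + 1) => N := by
  intro j _
  refine Fin.cases ?_ (fun i => ?_) j
  · simpa using hz
  · simpa using hy i trivial

lemma continuous_cons' : Continuous fun x : ℂ × (Fin n → ℂ) => (Fin.cons x.1 x.2 : Fin (n + 1) → ℂ) :=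
  Continuous.finCons continuous_fst continuous_snd

/-- Fubini's theorem for the first variable. -/
lemma multiInt_succ {c : Fin (n + 1) → Cycle} (hc : ∀ j ω, (c j).pt ω ∈ N)
    {G : (Fin (n + 1) → ℂ) → ℂ} (hG : ContinuousOn G (Set.univ.pi fun _ => N)) :
    multiInt c G = ∫ ω₀, multiInt (fun j => c j.succ) (fun y => G (Fin.cons ((c 0).pt ω₀) y)) *
        (c 0).wt ω₀ ∂(c 0).μ ∧
    multiInt c G = multiInt (fun j => c j.succ)
      (fun y => ∫ ω₀, G (Fin.cons ((c 0).pt ω₀) y) * (c 0).wt ω₀ ∂(c 0).μ) := by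
  have hF := continuous_multi_integrand hc hG
  set F : (∀ j, (c j).Ω) → ℂ := fun ω =>
    G (fun j => (c j).pt (ω j)) * ∏ j, (c j).wt (ω j) with hFdef
  let e := MeasurableEquiv.piFinSuccAbove (fun j => (c j).Ω) 0
  have hmp : MeasurePreserving e (Measure.pi fun j => (c j).μ)
      ((c 0).μ.prod (Measure.pi fun j : Fin n => (c (Fin.succAbove 0 j)).μ)) :=
    measurePreserving_piFinSuccAbove (fun j => (c j).μ) 0
  have h1 : multiInt c G = ∫ x, F (e.symm x)
      ∂((c 0).μ.prod (Measure.pi fun j : Fin n => (c (Fin.succAbove 0 j)).μ)) := by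
    rw [multiInt, ← (hmp.symm e).integral_comp' (g := F)]
  have hes : Continuous e.symm := by
    refine continuous_pi fun j => ?_
    refine Fin.cases ?_ (fun i => ?_) j
    · exact continuous_fst
    · exact (continuous_apply i).comp continuous_snd
  have hFe : Continuous fun x => F (e.symm x) := hF.comp hes
  have hint : Integrable (fun x => F (e.symm x))
      ((c 0).μ.prod (Measure.pi fun j : Fin n => (c (Fin.succAbove 0 j)).μ)) :=
    hFe.integrable_of_hasCompactSupport (HasCompactSupport.of_compactSpace _)
  have hval : ∀ ω₀ (ω : ∀ j : Fin n, (c (Fin.succAbove 0 j)).Ω), F (e.symm (ω₀, ω)) =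
      G (Fin.cons ((c 0).pt ω₀) fun j => (c j.succ).pt (ω j)) *
        ((c 0).wt ω₀ * ∏ j : Fin n, (c j.succ).wt (ω j)) := by
    intro ω₀ ω
    have e0 : e.symm (ω₀, ω) 0 = ω₀ := rfl
    have es : ∀ j : Fin n, e.symm (ω₀, ω) j.succ = ω j := fun j => rfl
    simp only [hFdef]
    rw [Fin.prod_univ_succ, e0]
    simp only [es]
    congr 2
    funext j
    refine Fin.cases ?_ (fun i => ?_) j
    · exact congrArg _ e0
    · exact congrArg _ (es i)
  constructor
  · rw [h1, integral_prod _ hint]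
    refine integral_congr_ae (.of_forall fun ω₀ => ?_)
    simp only [hval, multiInt]
    rw [← integral_mul_const]
    refine integral_congr_ae (.of_forall fun ω => ?_)
    simp only
    ring
  · rw [h1, integral_prod_symm _ hint, multiInt]
    refine integral_congr_ae (.of_forall fun ω => ?_)
    simp only [hval]
    rw [← integral_mul_const]
    refine integral_congr_ae (.of_forall fun ω₀ => ?_)
    simp only
    ring

/-- Cauchy's theorem for functions of several variables that are continuous on `(U \ L)^n` and
holomorphic in each variable. -/
theorem multiInt_eq_of_separates {L U : Set ℂ} (hL : IsClosed L) (hU : IsOpen U)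
    (h0 : (0 : ℂ) ∈ L) {n : ℕ} {c c' : Fin n → Cycle} (hc : ∀ j, (c j).Separates L U)
    (hc' : ∀ j, (c' j).Separates L U) {G : (Fin n → ℂ) → ℂ}
    (hG : ContinuousOn G (Set.univ.pi fun _ => U \ L))
    (hGd : ∀ z ∈ Set.univ.pi fun _ : Fin n => U \ L, ∀ j,
      DifferentiableOn ℂ (fun x => G (Function.update z j x)) (U \ L)) :
    multiInt c G = multiInt c' G := by
  induction n with
  | zero =>
    have : ∀ c : Fin 0 → Cycle, multiInt c G = G Fin.elim0 := fun c => by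
      simp only [multiInt, Finset.univ_eq_empty, Finset.prod_empty, mul_one]
      rw [Measure.pi_of_empty (fun j => (c j).μ) (fun j => j.elim0), integral_dirac]
      congr 1
      exact Subsingleton.elim _ _
    rw [this, this]
  | succ n ih =>
    have hpt := fun j ω => (hc j).pt_mem ω
    have hpt' := fun j ω => (hc' j).pt_mem ω
    let d : Fin (n + 1) → Cycle := Fin.cons (c 0) fun j => c' j.succ
    have hd : ∀ j, (d j).Separates L U := by
      intro j
      refine Fin.cases ?_ (fun i => ?_) j
      · exact hc 0
      · exact hc' i.succ
    have hptd := fun j ω => (hd j).pt_mem ω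
    have s1 : multiInt c G = multiInt d G := by
      rw [(multiInt_succ hpt hG).1, (multiInt_succ hptd hG).1]
      refine integral_congr_ae (.of_forall fun ω₀ => ?_)
      change multiInt (fun j => c j.succ) (fun y => G (Fin.cons ((c 0).pt ω₀) y)) * _ =
        multiInt (fun j => c' j.succ) (fun y => G (Fin.cons ((c 0).pt ω₀) y)) * _
      congr 1
      refine ih (fun j => hc j.succ) (fun j => hc' j.succ) ?_ ?_
      · refine hG.comp (continuous_cons'.comp (Continuous.prodMk_right _)).continuousOn ?_
        exact fun y hy => cons_mem_pi (hpt 0 ω₀) hy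
      · intro z hz j
        have := hGd (Fin.cons ((c 0).pt ω₀) z) (cons_mem_pi (hpt 0 ω₀) hz) j.succ
        simpa only [Fin.cons_update] using this
    have s2 : multiInt d G = multiInt c' G := by
      rw [(multiInt_succ hptd hG).2, (multiInt_succ hpt' hG).2]
      change multiInt (fun j => c' j.succ) _ = multiInt (fun j => c' j.succ) _
      refine multiInt_congr fun ω => ?_
      refine Separates.integral_eq hL hU h0 (hc 0) (hc' 0)
        (φ := fun x => G (Fin.cons x fun j => (c' j.succ).pt (ω j))) ?_
      intro x hx
      have := hGd (Fin.cons x fun j => (c' j.succ).pt (ω j))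
        (cons_mem_pi hx fun j _ => hpt' j.succ _) 0
      simp only [Fin.update_cons_zero] at this
      exact this x hx
    rw [s1, s2]

end

end Cycle

/-! ### Closed chains as cycles -/

namespace ClosedChain

variable (C : ClosedChain)

lemma continuous_path (j : Fin C.num) : Continuous (C.path j) := (C.contDiff j).continuous

lemma continuous_deriv_path (j : Fin C.num) : Continuous (deriv (C.path j)) :=
  (C.contDiff j).continuous_deriv (by norm_num)

lemma path_mem_support (j : Fin C.num) {s : ℝ} (hs : s ∈ Set.Icc (0 : ℝ) 1) :
    C.path j s ∈ C.support := Set.mem_iUnion.2 ⟨j, s, hs, rfl⟩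

lemma isCompact_support : IsCompact C.support :=
  isCompact_iUnion fun j => isCompact_Icc.image (C.continuous_path j)

lemma ne_zero_of_mem_support {z : ℂ} (hz : z ∈ C.support) : z ≠ 0 := by
  obtain ⟨j, s, hs, rfl⟩ := Set.mem_iUnion.1 hz
  exact C.ne_zero j s hs

/-- The image of the chain `C` under a map `m` of `ℂ^*` to the plane, as a cycle with the density
`dz / (2πi z)` of `C`. -/
noncomputable def cycle (m : ℂ → ℂ) (hm : ContinuousOn m {0}ᶜ) : Cycle where
  Ω := Fin C.num × unitInterval
  μ := Measure.count.prod volume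
  pt := fun ω => m (C.path ω.1 ω.2)
  wt := fun ω => deriv (C.path ω.1) ω.2 / (2 * Real.pi * Complex.I * C.path ω.1 ω.2)
  cont_pt := by
    refine continuous_prod_of_discrete_left.2 fun j => ?_
    exact hm.comp_continuous ((C.continuous_path j).comp continuous_subtype_val)
      fun s => C.ne_zero j s s.2
  cont_wt := by
    refine continuous_prod_of_discrete_left.2 fun j => ?_
    refine ((C.continuous_deriv_path j).comp continuous_subtype_val).div
      (continuous_const.mul ((C.continuous_path j).comp continuous_subtype_val)) fun s => ?_
    exact mul_ne_zero Complex.two_pi_I_ne_zero (C.ne_zero j s s.2)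

lemma integral_cycle {m : ℂ → ℂ} (hm : ContinuousOn m {0}ᶜ) {F : Fin C.num → ℝ → ℂ}
    (hF : ∀ j, ContinuousOn (F j) (Set.Icc 0 1)) :
    ∫ ω, F ω.1 ω.2 ∂(C.cycle m hm).μ = ∑ j, ∫ s in (0 : ℝ)..1, F j s := by
  have hc : Continuous fun ω : Fin C.num × unitInterval => F ω.1 ω.2 :=
    continuous_prod_of_discrete_left.2 fun j =>
      (hF j).comp_continuous continuous_subtype_val fun s => s.2
  have hi : Integrable (fun ω : Fin C.num × unitInterval => F ω.1 ω.2)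
      (Measure.count.prod volume) :=
    hc.integrable_of_hasCompactSupport (HasCompactSupport.of_compactSpace _)
  change ∫ ω : Fin C.num × unitInterval, F ω.1 ω.2 ∂Measure.count.prod volume = _
  rw [integral_prod _ hi, integral_count]
  refine Finset.sum_congr rfl fun j _ => ?_
  rw [unitInterval.measurePreserving_coe.integral_comp unitInterval.measurableEmbedding_coe (F j),
    intervalIntegral.integral_of_le zero_le_one, integral_Icc_eq_integral_Ioc]

lemma cauchy_cycle_mul {u : ℂ} (hu : u ≠ 0) (hm : ContinuousOn (fun z => u * z) {0}ᶜ) {z : ℂ}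
    (hz : z / u ∉ C.support) : (C.cycle (fun z => u * z) hm).cauchy z = C.winding (z / u) := by
  have e : ∀ ω : Fin C.num × unitInterval,
      deriv (C.path ω.1) ω.2 / (2 * Real.pi * Complex.I * C.path ω.1 ω.2) *
        (u * C.path ω.1 ω.2) / (u * C.path ω.1 ω.2 - z) =
      (2 * Real.pi * Complex.I)⁻¹ * (deriv (C.path ω.1) ω.2 / (C.path ω.1 ω.2 - z / u)) := by
    intro ω
    have h1 : C.path ω.1 ω.2 ≠ 0 := C.ne_zero _ _ ω.2.2
    have h2 : C.path ω.1 ω.2 - z / u ≠ 0 := fun h =>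
      hz (by rw [← sub_eq_zero.1 h]; exact C.path_mem_support _ ω.2.2)
    have h3 : u * C.path ω.1 ω.2 - z = u * (C.path ω.1 ω.2 - z / u) := by field_simp
    have h4 := Complex.two_pi_I_ne_zero
    rw [h3]
    field_simp
  have h := C.integral_cycle hm (F := fun j s => (2 * Real.pi * Complex.I)⁻¹ *
    (deriv (C.path j) s / (C.path j s - z / u))) fun j => by
      refine continuousOn_const.mul ((C.continuous_deriv_path j).continuousOn.div
        ((C.continuous_path j).continuousOn.sub continuousOn_const) fun s hs h => hz ?_)
      rw [← sub_eq_zero.1 h]; exact C.path_mem_support _ hs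
  rw [Cycle.cauchy, winding]
  simp only [intervalIntegral.integral_const_mul] at h
  rw [← h]
  exact integral_congr_ae (.of_forall e)

lemma cauchy_cycle_mul_inv {u : ℂ} (hm : ContinuousOn (fun z => u * z⁻¹) {0}ᶜ)
    {z : ℂ} (hz0 : z ≠ 0) (hz : u / z ∉ C.support) :
    (C.cycle (fun z => u * z⁻¹) hm).cauchy z = C.winding 0 - C.winding (u / z) := by
  have hne : ∀ j, ∀ s ∈ Set.Icc (0 : ℝ) 1, C.path j s - u / z ≠ 0 := fun j s hs h =>
    hz (by rw [← sub_eq_zero.1 h]; exact C.path_mem_support _ hs)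
  have e : ∀ ω : Fin C.num × unitInterval,
      deriv (C.path ω.1) ω.2 / (2 * Real.pi * Complex.I * C.path ω.1 ω.2) *
        (u * (C.path ω.1 ω.2)⁻¹) / (u * (C.path ω.1 ω.2)⁻¹ - z) =
      (2 * Real.pi * Complex.I)⁻¹ * (deriv (C.path ω.1) ω.2 / (C.path ω.1 ω.2 - 0)) -
      (2 * Real.pi * Complex.I)⁻¹ * (deriv (C.path ω.1) ω.2 / (C.path ω.1 ω.2 - u / z)) := by
    intro ω
    have h1 : C.path ω.1 ω.2 ≠ 0 := C.ne_zero _ _ ω.2.2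
    have h2 := hne ω.1 ω.2 ω.2.2
    have h3 : u * (C.path ω.1 ω.2)⁻¹ - z = -z * (C.path ω.1 ω.2 - u / z) / C.path ω.1 ω.2 := by
      field_simp; ring
    have h4 := Complex.two_pi_I_ne_zero
    have h5 : C.path ω.1 ω.2 * z - u ≠ 0 := fun h => h2 (by
      rw [sub_eq_zero] at h ⊢; rw [← h]; field_simp)
    rw [h3, sub_zero]
    field_simp
    ring
  have hc : ∀ (y : ℂ) j, (∀ s ∈ Set.Icc (0 : ℝ) 1, C.path j s - y ≠ 0) →
      ContinuousOn (fun s => (2 * Real.pi * Complex.I)⁻¹ *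
        (deriv (C.path j) s / (C.path j s - y))) (Set.Icc 0 1) := fun y j hy =>
    continuousOn_const.mul ((C.continuous_deriv_path j).continuousOn.div
        ((C.continuous_path j).continuousOn.sub continuousOn_const) hy)
  have hc0 := fun j => hc 0 j fun s hs => by simpa using C.ne_zero j s hs
  have hcz := fun j => hc (u / z) j (hne j)
  have h := C.integral_cycle hm (F := fun j s =>
    (2 * Real.pi * Complex.I)⁻¹ * (deriv (C.path j) s / (C.path j s - 0)) -
    (2 * Real.pi * Complex.I)⁻¹ * (deriv (C.path j) s / (C.path j s - u / z)))
    fun j => (hc0 j).sub (hcz j)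
  rw [Cycle.cauchy, winding, winding, ← Finset.sum_sub_distrib]
  refine (integral_congr_ae (.of_forall e)).trans (h.trans (Finset.sum_congr rfl fun j _ => ?_))
  rw [intervalIntegral.integral_sub, intervalIntegral.integral_const_mul,
    intervalIntegral.integral_const_mul]
  · exact ContinuousOn.intervalIntegrable (by rw [Set.uIcc_of_le zero_le_one]; exact hc0 j)
  · exact ContinuousOn.intervalIntegrable (by rw [Set.uIcc_of_le zero_le_one]; exact hcz j)

lemma continuousAt_winding {w : ℂ} (hw : w ∉ C.support) : ContinuousAt C.winding w := by
  have hm : ContinuousOn (fun z : ℂ => 1 * z) {0}ᶜ := by fun_prop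
  let c := C.cycle (fun z => 1 * z) hm
  have hopen : IsOpen C.supportᶜ := C.isCompact_support.isClosed.isOpen_compl
  have hev : C.winding =ᶠ[𝓝 w] c.cauchy := by
    filter_upwards [hopen.mem_nhds hw] with z hz
    have := C.cauchy_cycle_mul one_ne_zero hm (z := z) (by simpa using hz)
    rw [div_one] at this
    exact this.symm
  refine ContinuousAt.congr ?_ hev.symm
  have hpos : 0 < Metric.infDist w C.support ∨ C.support = ∅ := by
    rcases C.support.eq_empty_or_nonempty with h | h
    · exact Or.inr h
    · exact Or.inl ((C.isCompact_support.isClosed.notMem_iff_infDist_pos h).1 hw)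
  obtain ⟨K, hK, hwK, hKs⟩ := exists_compact_between (isCompact_singleton (x := w)) hopen
    (Set.singleton_subset_iff.2 hw)
  have hcont : ContinuousOn (Function.uncurry fun (z : ℂ) (ω : c.Ω) =>
      c.wt ω * c.pt ω / (c.pt ω - z)) (K ×ˢ Set.univ) := by
    refine ContinuousOn.div ?_ ?_ ?_
    · exact ((c.cont_wt.comp continuous_snd).mul (c.cont_pt.comp continuous_snd)).continuousOn
    · exact ((c.cont_pt.comp continuous_snd).sub continuous_fst).continuousOn
    · rintro ⟨z, ω⟩ ⟨hz, -⟩ h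
      refine hKs hz ?_
      have h' : c.pt ω - z = 0 := h
      rw [← sub_eq_zero.1 h']
      change 1 * C.path ω.1 ω.2 ∈ C.support
      rw [one_mul]
      exact C.path_mem_support _ ω.2.2
  have := continuousOn_integral_of_compact_support (μ := c.μ) (k := Set.univ) isCompact_univ hcont
    (fun p x _ hx => absurd trivial hx)
  exact this.continuousAt (mem_interior_iff_mem_nhds.1 (hwK rfl))

lemma isOpen_inside (hC : C.IsContour) : IsOpen C.inside := by
  rw [isOpen_iff_mem_nhds]
  rintro w ⟨hw, h1⟩
  have h2 := ContinuousAt.eventually_ne (C.continuousAt_winding hw) (y := 0)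
    (by rw [h1]; exact one_ne_zero)
  filter_upwards [C.isCompact_support.isClosed.isOpen_compl.mem_nhds hw, h2] with z hz hz2
  rcases hC z hz with h | h
  · exact h
  · exact absurd h.2 hz2

lemma isOpen_outside (hC : C.IsContour) : IsOpen C.outside := by
  rw [isOpen_iff_mem_nhds]
  rintro w ⟨hw, h1⟩
  have h2 := ContinuousAt.eventually_ne (C.continuousAt_winding hw) (y := 1)
    (by rw [h1]; exact zero_ne_one)
  filter_upwards [C.isCompact_support.isClosed.isOpen_compl.mem_nhds hw, h2] with z hz hz2
  rcases hC z hz with h | h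
  · exact absurd h.2 hz2
  · exact h

/-- The set of points that are not excluded. -/
def filled : Set ℂ := C.inside ∪ C.support

lemma notMem_filled_iff (hC : C.IsContour) {z : ℂ} : z ∉ C.filled ↔ z ∈ C.outside := by
  constructor
  · intro h
    exact (hC z fun hs => h (Or.inr hs)).resolve_left fun hi => h (Or.inl hi)
  · rintro ⟨h1, h2⟩ (h | h)
    · exact one_ne_zero (h.2.symm.trans h2)
    · exact h1 h

lemma tendsto_winding_cocompact : Tendsto C.winding (cocompact ℂ) (𝓝 0) := by
  have : C.winding = fun w => ∑ j, (2 * Real.pi * Complex.I)⁻¹ *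
    ∫ s in (0 : ℝ)..1, deriv (C.path j) s / (C.path j s - w) := rfl
  have hz0 : (0 : ℂ) = ∑ _j : Fin C.num, (0 : ℂ) := by simp
  rw [this, hz0]
  refine tendsto_finsetSum _ fun j _ => ?_
  rw [← mul_zero (2 * Real.pi * Complex.I)⁻¹]
  refine Tendsto.const_mul _ ?_
  obtain ⟨M, hM⟩ := (isCompact_Icc (a := (0 : ℝ)) (b := 1)).exists_bound_of_continuousOn
    (C.continuous_path j).continuousOn
  obtain ⟨D, hD⟩ := (isCompact_Icc (a := (0 : ℝ)) (b := 1)).exists_bound_of_continuousOn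
    (C.continuous_deriv_path j).continuousOn
  have hb : ∀ᶠ w in cocompact ℂ, ‖∫ s in (0 : ℝ)..1, deriv (C.path j) s / (C.path j s - w)‖ ≤
      D / (‖w‖ - M) := by
    filter_upwards [tendsto_norm_cocompact_atTop.eventually (eventually_gt_atTop M)] with w hw
    have := intervalIntegral.norm_integral_le_of_norm_le_const (a := (0 : ℝ)) (b := 1)
      (f := fun s => deriv (C.path j) s / (C.path j s - w)) (C := D / (‖w‖ - M)) ?_
    · simpa using this
    · intro s hs
      rw [Set.uIoc_of_le zero_le_one] at hs
      have hs' := Set.Ioc_subset_Icc_self hs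
      rw [norm_div]
      have h1 : ‖w‖ - M ≤ ‖C.path j s - w‖ := by
        have := norm_sub_norm_le w (C.path j s)
        rw [norm_sub_rev] at this
        linarith [hM s hs']
      have h2 : 0 < ‖w‖ - M := sub_pos.2 hw
      have h3 : 0 ≤ D := (norm_nonneg _).trans (hD s hs')
      gcongr
      exact hD s hs'
  refine squeeze_zero_norm' hb ?_
  exact Tendsto.div_atTop tendsto_const_nhds
    (tendsto_atTop_add_const_right _ _ tendsto_norm_cocompact_atTop)

/-- The winding number tends to `0` at infinity, so the set is bounded. -/
lemma isCompact_filled (hC : C.IsContour) : IsCompact C.filled := by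
  have hcl : IsClosed C.filled := by
    rw [← isOpen_compl_iff]
    convert C.isOpen_outside hC
    ext z
    exact C.notMem_filled_iff hC
  have h := C.tendsto_winding_cocompact.eventually_ne (zero_ne_one (α := ℂ))
  obtain ⟨K, hK, hKs⟩ := mem_cocompact.1 h
  refine (hK.union C.isCompact_support).of_isClosed_subset hcl ?_
  rintro z (hz | hz)
  · left
    by_contra hzK
    exact hKs hzK hz.2
  · exact Or.inr hz

/-- The image of a contour under a dilation separates a part of its inside from its exterior. -/
lemma separates_mul (hC : C.IsContour) {u : ℂ} (hu : u ≠ 0)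
    (hm : ContinuousOn (fun z => u * z) {0}ᶜ) {L U : Set ℂ} (hL : ∀ z ∈ L, z / u ∈ C.inside)
    (hU : ∀ z, z / u ∈ C.filled → z ∈ U) : (C.cycle (fun z => u * z) hm).Separates L U := by
  have hcont : Continuous fun z : ℂ => z / u := continuous_id.div_const u
  have himg : (fun z : ℂ => z / u) ⁻¹' C.filled = (fun z => u * z) '' C.filled := by
    ext z
    constructor
    · intro h
      exact ⟨z / u, h, by field_simp⟩
    · rintro ⟨y, hy, rfl⟩
      simpa [hu] using hy
  refine ⟨(fun z => z / u) ⁻¹' C.inside, (fun z => z / u) ⁻¹' C.filled,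
    (C.isOpen_inside hC).preimage hcont, hL, ?_, hU, fun ω => ?_, fun z hz => ?_, fun z hz => ?_⟩
  · rw [himg]
    exact (C.isCompact_filled hC).image (by fun_prop)
  · have h1 : C.path ω.1 ω.2 ∈ C.support := C.path_mem_support _ ω.2.2
    have h2 : (C.cycle (fun z => u * z) hm).pt ω / u = C.path ω.1 ω.2 := by
      change u * C.path ω.1 ω.2 / u = _
      field_simp
    constructor
    · change _ / u ∈ C.filled
      rw [h2]; exact Or.inr h1
    · change _ / u ∉ C.inside
      rw [h2]; exact fun h => h.1 h1
  · rw [C.cauchy_cycle_mul hu hm hz.1, hz.2]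
  · have := (C.notMem_filled_iff hC).1 hz
    rw [C.cauchy_cycle_mul hu hm this.1, this.2]

/-- For a contour that is exchanged with its complement by inversion, the image under an inversion
separates the same sets as the contour itself. -/
lemma separates_mul_inv (hC : C.IsContour) (h0 : (0 : ℂ) ∈ C.inside)
    (hsi : ∀ z ∈ C.support, z⁻¹ ∈ C.support) (hii : ∀ z ∈ C.inside, z ≠ 0 → z⁻¹ ∈ C.outside)
    (hoi : ∀ z ∈ C.outside, z ≠ 0 → z⁻¹ ∈ C.inside) {u : ℂ} (hu : u ≠ 0)
    (hm : ContinuousOn (fun z => u * z⁻¹) {0}ᶜ) {L U : Set ℂ} (hL : ∀ z ∈ L, z / u ∈ C.inside)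
    (hU : ∀ z, z / u ∈ C.filled → z ∈ U) : (C.cycle (fun z => u * z⁻¹) hm).Separates L U := by
  have hcont : Continuous fun z : ℂ => z / u := continuous_id.div_const u
  have himg : (fun z : ℂ => z / u) ⁻¹' C.filled = (fun z => u * z) '' C.filled := by
    ext z
    constructor
    · intro h
      exact ⟨z / u, h, by field_simp⟩
    · rintro ⟨y, hy, rfl⟩
      simpa [hu] using hy
  have hwz : (C.cycle (fun z => u * z⁻¹) hm).cauchy 0 = 1 := by
    have hm' : ContinuousOn (fun z => u * z) {0}ᶜ := by fun_prop
    have h2 := C.cauchy_cycle_mul hu hm' (z := 0) (by rw [zero_div]; exact h0.1)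
    rw [zero_div, h0.2] at h2
    rw [← h2]
    refine integral_congr_ae (.of_forall fun ω => ?_)
    have h1 : C.path ω.1 ω.2 ≠ 0 := C.ne_zero _ _ ω.2.2
    change deriv (C.path ω.1) ω.2 / (2 * Real.pi * Complex.I * C.path ω.1 ω.2) *
        (u * (C.path ω.1 ω.2)⁻¹) / (u * (C.path ω.1 ω.2)⁻¹ - 0) =
      deriv (C.path ω.1) ω.2 / (2 * Real.pi * Complex.I * C.path ω.1 ω.2) *
        (u * C.path ω.1 ω.2) / (u * C.path ω.1 ω.2 - 0)
    rw [sub_zero, sub_zero, mul_div_cancel_right₀ _ (mul_ne_zero hu (inv_ne_zero h1)),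
      mul_div_cancel_right₀ _ (mul_ne_zero hu h1)]
  refine ⟨(fun z => z / u) ⁻¹' C.inside, (fun z => z / u) ⁻¹' C.filled,
    (C.isOpen_inside hC).preimage hcont, hL, ?_, hU, fun ω => ?_, fun z hz => ?_, fun z hz => ?_⟩
  · rw [himg]
    exact (C.isCompact_filled hC).image (by fun_prop)
  · have h1 : (C.path ω.1 ω.2)⁻¹ ∈ C.support := hsi _ (C.path_mem_support _ ω.2.2)
    have h2 : (C.cycle (fun z => u * z⁻¹) hm).pt ω / u = (C.path ω.1 ω.2)⁻¹ := by
      change u * (C.path ω.1 ω.2)⁻¹ / u = _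
      field_simp
    constructor
    · change _ / u ∈ C.filled
      rw [h2]; exact Or.inr h1
    · change _ / u ∉ C.inside
      rw [h2]; exact fun h => h.1 h1
  · by_cases hz0 : z = 0
    · rw [hz0, hwz]
    · have h3 := hii _ hz (div_ne_zero hz0 hu)
      rw [inv_div] at h3
      rw [C.cauchy_cycle_mul_inv hm hz0 h3.1, h3.2, h0.2, sub_zero]
  · have h2 := (C.notMem_filled_iff hC).1 hz
    have hz0 : z ≠ 0 := by
      rintro rfl
      exact hz (by change 0 / u ∈ C.filled; rw [zero_div]; exact Or.inl h0)
    have h3 := hoi _ h2 (div_ne_zero hz0 hu)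
    rw [inv_div] at h3
    rw [C.cauchy_cycle_mul_inv hm hz0 h3.1, h3.2, h0.2, sub_self]

/-- Torus integrals are multiple integrals over the associated cycles. -/
theorem torusIntegral_eq_multiInt {n : ℕ} (m : Fin n → ℂ → ℂ) (hm : ∀ j, ContinuousOn (m j) {0}ᶜ)
    {N : Set ℂ} (hN : ∀ j, ∀ z ∈ C.support, m j z ∈ N) {G : (Fin n → ℂ) → ℂ}
    (hG : ContinuousOn G (Set.univ.pi fun _ => N)) :
    C.torusIntegral n (fun z => G fun j => m j (z j)) =
      Cycle.multiInt (fun j => C.cycle (m j) (hm j)) G := by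
  have hF := Cycle.continuous_multi_integrand (c := fun j => C.cycle (m j) (hm j))
    (fun j ω => hN j _ (C.path_mem_support _ ω.2.2)) hG
  let H : (Fin n → Fin C.num) → (Fin n → ℝ) → ℂ := fun e s =>
    G (fun j => m j (C.path (e j) (s j))) *
      ∏ j, deriv (C.path (e j)) (s j) / (2 * Real.pi * Complex.I * C.path (e j) (s j))
  have hmp := measurePreserving_arrowProdEquivProdArrow (Fin C.num) unitInterval (Fin n)
    (fun _ => Measure.count) (fun _ => volume)
  let E := MeasurableEquiv.arrowProdEquivProdArrow (Fin C.num) unitInterval (Fin n)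
  have h1 : Cycle.multiInt (fun j => C.cycle (m j) (hm j)) G =
      ∫ x : (Fin n → Fin C.num) × (Fin n → unitInterval), H x.1 (fun j => x.2 j)
        ∂((Measure.pi fun _ => Measure.count).prod (Measure.pi fun _ => volume)) := by
    rw [← hmp.integral_comp' (g := fun x : (Fin n → Fin C.num) × (Fin n → unitInterval) =>
      H x.1 (fun j => x.2 j))]
    rfl
  have hcont : Continuous fun x : (Fin n → Fin C.num) × (Fin n → unitInterval) =>
      H x.1 (fun j => x.2 j) := by
    have hsymm : Continuous fun (x : (Fin n → Fin C.num) × (Fin n → unitInterval)) =>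
        (fun j => (x.1 j, x.2 j) : Fin n → Fin C.num × unitInterval) := by fun_prop
    exact hF.comp hsymm
  have hint : Integrable (fun x : (Fin n → Fin C.num) × (Fin n → unitInterval) =>
      H x.1 (fun j => x.2 j))
      ((Measure.pi fun _ => Measure.count).prod (Measure.pi fun _ => volume)) :=
    hcont.integrable_of_hasCompactSupport (HasCompactSupport.of_compactSpace _)
  have hcount : (Measure.pi fun _ : Fin n => (Measure.count : Measure (Fin C.num))) =
      Measure.count := by
    refine Measure.ext_of_singleton fun e => ?_
    rw [Measure.pi_singleton, Measure.count_singleton]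
    simp
  rw [h1, integral_prod _ hint, hcount, integral_count, torusIntegral]
  refine Finset.sum_congr rfl fun e _ => ?_
  have hI : (Set.Icc 0 1 : Set (Fin n → ℝ)) = Set.univ.pi fun _ => unitInterval := by
    rw [← Set.pi_univ_Icc]; rfl
  have hmp2 := measurePreserving_pi (fun _ : Fin n => (volume : Measure unitInterval))
    (fun _ : Fin n => (volume : Measure ℝ).restrict unitInterval)
    (f := fun _ => ((↑) : unitInterval → ℝ)) (fun _ => unitInterval.measurePreserving_coe)
  have hemb : MeasurableEmbedding fun (a : Fin n → unitInterval) (i : Fin n) => (a i : ℝ) := by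
    have : Continuous fun (a : Fin n → unitInterval) (i : Fin n) => (a i : ℝ) := by fun_prop
    refine (this.isClosedEmbedding fun a b h => ?_).measurableEmbedding
    funext i
    exact Subtype.ext (congrFun h i)
  rw [hI, volume_pi, Measure.restrict_pi_pi, ← hmp2.integral_comp hemb]

/-! ### Exceptional sets of torus integrals -/

lemma volume_fiber_eq_zero (j : Fin C.num) (c : ℂ) :
    volume {s : ℝ | deriv (C.path j) s ≠ 0 ∧ C.path j s = c} = 0 := by
  refine measure_null_of_locally_null _ fun s hs => ⟨{s}, ?_, by simp⟩
  have hd : HasDerivAt (C.path j) (deriv (C.path j) s) s :=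
    ((C.contDiff j).differentiable (by norm_num) s).hasDerivAt
  have := hd.eventually_ne (c := c) hs.1
  rw [eventually_nhdsWithin_iff] at this
  rw [mem_nhdsWithin_iff_eventually]
  filter_upwards [this] with x hx hxs
  by_contra h
  exact hx h hxs.2

end ClosedChain

/-- A nonzero polynomial vanishes almost nowhere with respect to a product of measures whose images
in the plane have no atoms. -/
lemma pi_eval_eq_zero_null {n : ℕ} (ν : Fin n → Measure ℝ) [∀ j, SigmaFinite (ν j)]
    (γ : Fin n → ℝ → ℂ) (hγ : ∀ j, Measurable (γ j)) (hν : ∀ j c, ν j {s | γ j s = c} = 0)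
    {P : MvPolynomial (Fin n) ℂ} (hP : P ≠ 0) :
    Measure.pi ν {s | MvPolynomial.eval (fun j => γ j (s j)) P = 0} = 0 := by
  induction n with
  | zero =>
    have : {s : Fin 0 → ℝ | MvPolynomial.eval (fun j => γ j (s j)) P = 0} = ∅ := by
      ext s
      simp only [Set.mem_ofPred_eq, Set.mem_empty_iff_false, iff_false]
      intro h
      apply hP
      apply MvPolynomial.funext
      intro x
      rw [map_zero, ← h]
      congr 2
      exact Subsingleton.elim _ _
    rw [this, measure_empty]
  | succ n ih =>
    have hmp := measurePreserving_piFinSuccAbove ν 0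
    let e := MeasurableEquiv.piFinSuccAbove (fun _ : Fin (n + 1) => ℝ) 0
    have hmeas : MeasurableSet {s : Fin (n + 1) → ℝ |
        MvPolynomial.eval (fun j => γ j (s j)) P = 0} := by
      have h1 : Measurable fun s : Fin (n + 1) → ℝ => MvPolynomial.eval (fun j => γ j (s j)) P :=
        (MvPolynomial.continuous_eval P).measurable.comp
          (measurable_pi_lambda _ fun j => (hγ j).comp (measurable_pi_apply j))
      exact h1 (measurableSet_singleton 0)
    have hpre : Measure.pi ν {s | MvPolynomial.eval (fun j => γ j (s j)) P = 0} =
        ((ν 0).prod (Measure.pi fun j : Fin n => ν j.succ))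
          (e.symm ⁻¹' {s | MvPolynomial.eval (fun j => γ j (s j)) P = 0}) :=
      ((hmp.symm e).measure_preimage hmeas.nullMeasurableSet).symm
    rw [hpre, Measure.measure_prod_null (e.symm.measurable hmeas)]
    let P' := MvPolynomial.finSuccEquiv ℂ n P
    have hP' : P' ≠ 0 := (map_ne_zero_iff _ (MvPolynomial.finSuccEquiv ℂ n).injective).2 hP
    have hfin : {c : ℂ | P'.IsRoot (MvPolynomial.C c)}.Finite :=
      (Polynomial.finite_setOfPred_isRoot hP').preimage (MvPolynomial.C_injective _ _).injOn
    have hnull : ν 0 {s | γ 0 s ∈ {c : ℂ | P'.IsRoot (MvPolynomial.C c)}} = 0 := by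
      have : {s | γ 0 s ∈ {c : ℂ | P'.IsRoot (MvPolynomial.C c)}} =
          ⋃ c ∈ {c : ℂ | P'.IsRoot (MvPolynomial.C c)}, {s | γ 0 s = c} := by
        ext s; simp
      rw [this, measure_biUnion_null_iff hfin.countable]
      exact fun c _ => hν 0 c
    have hae : ∀ᵐ s ∂ν 0, ¬ P'.IsRoot (MvPolynomial.C (γ 0 s)) := by
      rw [ae_iff]
      simpa using hnull
    filter_upwards [hae] with s hs
    have := ih (fun j => ν j.succ) (fun j => γ j.succ) (fun j => hγ _) (fun j => hν _)
      (P := P'.eval (MvPolynomial.C (γ 0 s))) hs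
    rw [Pi.zero_apply, ← this]
    congr 1
    ext y
    simp only [Set.mem_preimage, Set.mem_ofPred_eq]
    have hcons : (fun j => γ j (e.symm (s, y) j)) =
        (Fin.cons (γ 0 s) fun j => γ j.succ (y j) : Fin (n + 1) → ℂ) := by
      funext j
      refine Fin.cases ?_ (fun i => ?_) j <;> rfl
    rw [hcons, MvPolynomial.eval_eq_eval_mv_eval', Polynomial.eval_map, Polynomial.eval,
      Polynomial.hom_eval₂]
    simp [P']

namespace ClosedChain

/-- Torus integrals do not depend on the values of the integrand on the zero sets of countably many
nonzero polynomials: the part of the parameter space where the curves do not stand still is mapped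
to the plane without atoms. -/
theorem torusIntegral_congr_of_polynomials (C : ClosedChain) {n : ℕ} {ι : Type*} [Countable ι]
    (P : ι → MvPolynomial (Fin n) ℂ) (hP : ∀ i, P i ≠ 0) {G₁ G₂ : (Fin n → ℂ) → ℂ}
    (h : ∀ z, (∀ j, z j ∈ C.support) → (∀ i, MvPolynomial.eval z (P i) ≠ 0) → G₁ z = G₂ z) :
    C.torusIntegral n G₁ = C.torusIntegral n G₂ := by
  refine Finset.sum_congr rfl fun e _ => ?_
  have hI : (Set.Icc 0 1 : Set (Fin n → ℝ)) = Set.univ.pi fun _ => unitInterval := by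
    rw [← Set.pi_univ_Icc]; rfl
  have hmd : ∀ j : Fin n, MeasurableSet {s : ℝ | deriv (C.path (e j)) s ≠ 0} := fun j =>
    (C.continuous_deriv_path (e j)).measurable (measurableSet_singleton (0 : ℂ)).compl
  let D : Set (Fin n → ℝ) := Set.univ.pi fun j => {s : ℝ | deriv (C.path (e j)) s ≠ 0}
  have hnull : ∀ i, volume.restrict D
      {s | MvPolynomial.eval (fun j => C.path (e j) (s j)) (P i) = 0} = 0 := by
    intro i
    rw [volume_pi, Measure.restrict_pi_pi]
    refine pi_eval_eq_zero_null _ (fun j => C.path (e j))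
      (fun j => (C.continuous_path _).measurable) (fun j c => ?_) (hP i)
    have hms : MeasurableSet {s | C.path (e j) s = c} :=
      (C.continuous_path _).measurable (measurableSet_singleton c)
    rw [Measure.restrict_apply hms,
      ← C.volume_fiber_eq_zero (e j) c]
    congr 1
    ext s
    simp [and_comm]
  have hD : MeasurableSet D := MeasurableSet.univ_pi hmd
  have hae : ∀ᵐ s : Fin n → ℝ, s ∈ D →
      ∀ i, MvPolynomial.eval (fun j => C.path (e j) (s j)) (P i) ≠ 0 := by
    rw [← ae_restrict_iff' hD, ae_all_iff]
    intro i
    rw [ae_iff]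
    simpa using hnull i
  refine setIntegral_congr_ae (by rw [hI]; exact MeasurableSet.univ_pi fun _ => measurableSet_Icc) ?_
  filter_upwards [hae] with s hs hsI
  by_cases hsD : s ∈ D
  · rw [h _ (fun j => C.path_mem_support _ ⟨hsI.1 j, hsI.2 j⟩) (hs hsD)]
  · have : ∃ j, deriv (C.path (e j)) (s j) = 0 := by
      by_contra! hne
      exact hsD fun j _ => hne j
    obtain ⟨j, hj⟩ := this
    rw [Finset.prod_eq_zero (Finset.mem_univ j) (by rw [hj, zero_div]), mul_zero, mul_zero]

end ClosedChain

/-! ### Quasiperiodic functions on the punctured plane -/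

/-- Division by a function with simple zeros only. -/
lemma exists_eq_mul_of_simple_zeros {U : Set ℂ} (hU : IsOpen U) {f d : ℂ → ℂ}
    (hf : DifferentiableOn ℂ f U) (hd : DifferentiableOn ℂ d U)
    (hs : ∀ x ∈ U, d x = 0 → deriv d x ≠ 0) (h0 : ∀ x ∈ U, d x = 0 → f x = 0) :
    ∃ h : ℂ → ℂ, DifferentiableOn ℂ h U ∧ ∀ x ∈ U, f x = d x * h x := by
  refine ⟨fun x => if d x = 0 then deriv f x / deriv d x else f x / d x, ?_, ?_⟩
  · intro a ha
    refine DifferentiableAt.differentiableWithinAt ?_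
    have hda := hd.differentiableAt (hU.mem_nhds ha)
    by_cases h : d a = 0
    · have e : ∀ g : ℂ → ℂ, g a = 0 → ∀ x, g x = (x - a) * dslope g a x := fun g hg x => by
        have := sub_smul_dslope g a x
        rw [hg, sub_zero, smul_eq_mul] at this
        exact this.symm
      have hdd : DifferentiableAt ℂ (dslope d a) a :=
        ((Complex.differentiableOn_dslope (hU.mem_nhds ha)).2 hd).differentiableAt (hU.mem_nhds ha)
      have hdf : DifferentiableAt ℂ (dslope f a) a :=
        ((Complex.differentiableOn_dslope (hU.mem_nhds ha)).2 hf).differentiableAt (hU.mem_nhds ha)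
      have hne : dslope d a a ≠ 0 := by rw [dslope_same]; exact hs a ha h
      refine (hdf.div hdd hne).congr_of_eventuallyEq ?_
      filter_upwards [hdd.continuousAt.eventually_ne hne] with x hx
      by_cases hxa : x = a
      · subst hxa
        simp [h, dslope_same]
      · have hxa' := sub_ne_zero.2 hxa
        have hdx : d x ≠ 0 := by rw [e d h x]; exact mul_ne_zero hxa' hx
        rw [if_neg hdx, e d h x, e f (h0 a ha h) x, Pi.div_apply, mul_div_mul_left _ _ hxa']
    · refine ((hf.differentiableAt (hU.mem_nhds ha)).div hda h).congr_of_eventuallyEq ?_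
      filter_upwards [hda.continuousAt.eventually_ne h] with x hx
      rw [if_neg hx]; rfl
  · intro x hx
    by_cases h : d x = 0
    · simp [h, h0 x hx h]
    · simp only [h, if_false]
      field_simp

lemma exists_eq_prod_mul_of_simple_zeros {U : Set ℂ} (hU : IsOpen U) {ι : Type*} (s : Finset ι)
    {f : ℂ → ℂ} {d : ι → ℂ → ℂ} (hf : DifferentiableOn ℂ f U)
    (hd : ∀ i, DifferentiableOn ℂ (d i) U)
    (hs : ∀ i, ∀ x ∈ U, d i x = 0 → deriv (d i) x ≠ 0)
    (hdis : ∀ i j, i ≠ j → ∀ x ∈ U, d i x = 0 → d j x ≠ 0)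
    (h0 : ∀ i, ∀ x ∈ U, d i x = 0 → f x = 0) :
    ∃ h : ℂ → ℂ, DifferentiableOn ℂ h U ∧ ∀ x ∈ U, f x = (∏ i ∈ s, d i x) * h x := by
  induction s using Finset.induction_on with
  | empty => exact ⟨f, hf, fun x _ => by simp⟩
  | insert a s has ih =>
    obtain ⟨h, hh, hfh⟩ := ih
    obtain ⟨k, hk, hhk⟩ := exists_eq_mul_of_simple_zeros hU hh (hd a) (hs a) fun x hx hax => by
      have h1 := hfh x hx
      rw [h0 a x hx hax] at h1
      refine (mul_eq_zero.1 h1.symm).resolve_left (Finset.prod_ne_zero_iff.2 fun j hj => ?_)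
      exact hdis a j (fun h => has (h ▸ hj)) x hx hax
    refine ⟨k, hk, fun x hx => ?_⟩
    rw [hfh x hx, hhk x hx, Finset.prod_insert has]
    ring

/-- A holomorphic function on the punctured plane that is invariant under `x ↦ q x` is constant. -/
lemma eq_of_mul_invariant {q : ℂ} (hq0 : q ≠ 0) (hq : ‖q‖ < 1) {h : ℂ → ℂ}
    (hh : DifferentiableOn ℂ h {0}ᶜ) (hinv : ∀ x, x ≠ 0 → h (q * x) = h x) {x y : ℂ}
    (hx : x ≠ 0) (hy : y ≠ 0) : h x = h y := by
  have hz : ∀ (m : ℤ) (x : ℂ), x ≠ 0 → h (q ^ m * x) = h x := by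
    intro m x hx
    induction m with
    | zero => simp
    | succ i ih =>
      rw [zpow_add_one₀ hq0, mul_comm (q ^ _) q, mul_assoc,
        hinv _ (mul_ne_zero (zpow_ne_zero _ hq0) hx), ih]
    | pred i ih =>
      rw [← ih, ← hinv _ (mul_ne_zero (zpow_ne_zero _ hq0) hx), ← mul_assoc, ← zpow_one_add₀ hq0,
        add_sub_cancel]
  have hqn : 0 < ‖q‖ := norm_pos_iff.2 hq0
  have hK : IsCompact {x : ℂ | ‖q‖ ≤ ‖x‖ ∧ ‖x‖ ≤ 1} := by
    refine Metric.isCompact_of_isClosed_isBounded ?_ ?_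
    · exact (isClosed_le continuous_const continuous_norm).inter
        (isClosed_le continuous_norm continuous_const)
    · exact (Metric.isBounded_closedBall (x := (0 : ℂ)) (r := 1)).subset fun x hx => by
        simpa using hx.2
  obtain ⟨M, hM⟩ := hK.exists_bound_of_continuousOn (f := h) (hh.continuousOn.mono fun x hx => by
    rintro rfl
    have h1 : ‖q‖ ≤ ‖(0 : ℂ)‖ := hx.1
    rw [norm_zero] at h1
    exact absurd h1 hqn.not_ge)
  have hb : ∀ x, x ≠ 0 → ‖h x‖ ≤ M := by
    intro x hx
    obtain ⟨m, hm⟩ := exists_mem_Ioc_zpow (norm_pos_iff.2 hx) ((one_lt_inv₀ hqn).2 hq)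
    rw [← hz (m + 1) x hx]
    have h2 : 0 < ‖q‖ ^ (m + 1) := zpow_pos hqn _
    have h3 : ‖q‖ ^ (m + 1) * ‖q‖⁻¹ ^ (m + 1) = 1 := by
      rw [← mul_zpow, mul_inv_cancel₀ hqn.ne', one_zpow]
    have h4 : ‖q‖ ^ (m + 1) * ‖q‖⁻¹ ^ m = ‖q‖ := by
      rw [zpow_add_one₀ hqn.ne', mul_right_comm, ← mul_zpow, mul_inv_cancel₀ hqn.ne', one_zpow,
        one_mul]
    refine hM _ ⟨?_, ?_⟩
    · rw [norm_mul, norm_zpow]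
      exact h4.symm.le.trans (mul_le_mul_of_nonneg_left hm.1.le h2.le)
    · rw [norm_mul, norm_zpow, ← h3]
      exact mul_le_mul_of_nonneg_left hm.2 h2.le
  have hd : Differentiable ℂ fun w => h (Complex.exp w) := fun w =>
    (hh.differentiableAt (isOpen_compl_singleton.mem_nhds (Complex.exp_ne_zero w))).comp w
      Complex.differentiableAt_exp
  have hbd : Bornology.IsBounded (Set.range fun w => h (Complex.exp w)) :=
    (Metric.isBounded_closedBall (x := (0 : ℂ)) (r := M)).subset (by
      rintro _ ⟨w, rfl⟩
      simpa using hb _ (Complex.exp_ne_zero w))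
  have := hd.apply_eq_apply_of_bounded hbd (Complex.log x) (Complex.log y)
  simpa only [Complex.exp_log hx, Complex.exp_log hy] using this

/-- A function with the same multiplier as a product `∏ dᵢ` of functions with simple and pairwise
different zeros is zero if it vanishes at all these zeros and at one further point. -/
lemma eq_zero_of_quasiperiodic {q : ℂ} (hq0 : q ≠ 0) (hq : ‖q‖ < 1) {ι : Type*} [Fintype ι]
    {f : ℂ → ℂ} {d : ι → ℂ → ℂ} (hf : DifferentiableOn ℂ f {0}ᶜ)
    (hd : ∀ i, DifferentiableOn ℂ (d i) {0}ᶜ)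
    (hs : ∀ i, ∀ x, x ≠ 0 → d i x = 0 → deriv (d i) x ≠ 0)
    (hdis : ∀ i j, i ≠ j → ∀ x, x ≠ 0 → d i x = 0 → d j x ≠ 0)
    (h0 : ∀ i, ∀ x, x ≠ 0 → d i x = 0 → f x = 0) {e : ℂ → ℂ}
    (he : ∀ x, x ≠ 0 → e x ≠ 0)
    (hfe : ∀ x, x ≠ 0 → f (q * x) = e x * f x)
    (hde : ∀ x, x ≠ 0 → ∏ i, d i (q * x) = e x * ∏ i, d i x) {y : ℂ} (hy : y ≠ 0)
    (hdy : ∀ i, d i y ≠ 0) (hfy : f y = 0) {x : ℂ} (hx : x ≠ 0) : f x = 0 := by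
  obtain ⟨h, hh, hfh⟩ := exists_eq_prod_mul_of_simple_zeros isOpen_compl_singleton Finset.univ
    hf hd hs hdis h0
  have hinv : ∀ x, x ≠ 0 → h (q * x) = h x := by
    intro x hx
    have hcx : ContinuousAt h x :=
      (hh.differentiableAt (isOpen_compl_singleton.mem_nhds hx)).continuousAt
    have hcq : ContinuousAt (fun x => h (q * x)) x :=
      ((hh.differentiableAt (isOpen_compl_singleton.mem_nhds
        (mul_ne_zero hq0 hx))).continuousAt).comp (f := fun x => q * x) (by fun_prop)
    have hev : ∀ᶠ w in 𝓝[≠] x, h (q * w) = h w := by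
      have h1 : ∀ᶠ w in 𝓝[≠] x, ∀ i, d i w ≠ 0 := by
        rw [eventually_all]
        intro i
        have hdi := (hd i).differentiableAt (isOpen_compl_singleton.mem_nhds hx)
        by_cases hi : d i x = 0
        · exact hdi.hasDerivAt.eventually_ne (hs i x hx hi)
        · exact (hdi.continuousAt.eventually_ne hi).filter_mono nhdsWithin_le_nhds
      filter_upwards [h1, (eventually_ne_nhds hx).filter_mono nhdsWithin_le_nhds] with w hw hw0
      have h2 := hfe w hw0
      rw [hfh w hw0, hfh _ (mul_ne_zero hq0 hw0), hde w hw0, mul_assoc] at h2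
      exact mul_left_cancel₀ (Finset.prod_ne_zero_iff.2 fun i _ => hw i)
        (mul_left_cancel₀ (he w hw0) h2)
    have h3 := (hcq.tendsto.mono_left nhdsWithin_le_nhds).congr' hev
    exact tendsto_nhds_unique h3 (hcx.tendsto.mono_left nhdsWithin_le_nhds)
  have hhy : h y = 0 := by
    have := hfh y hy
    rw [hfy] at this
    exact (mul_eq_zero.1 this.symm).resolve_left (Finset.prod_ne_zero_iff.2 fun i _ => hdy i)
  rw [hfh x hx, eq_of_mul_invariant hq0 hq hh hinv hx hy, hhy, mul_zero]

/-! ### Symmetrization of a product of theta functions -/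

/-- `z` or `1 / z`. -/
noncomputable def signPow (e : Bool) (z : ℂ) : ℂ := if e then z⁻¹ else z

@[simp] lemma signPow_false (z : ℂ) : signPow false z = z := rfl
@[simp] lemma signPow_true (z : ℂ) : signPow true z = z⁻¹ := rfl

lemma signPow_ne_zero (e : Bool) {z : ℂ} (hz : z ≠ 0) : signPow e z ≠ 0 := by
  cases e <;> simp [hz]

lemma signPow_not (e : Bool) (z : ℂ) : signPow (!e) z = (signPow e z)⁻¹ := by
  cases e <;> simp

/-- The product over pairs `j < k`, split at the index `i`. -/
lemma prod_pairs_succAbove {M : Type*} [CommMonoid M] {n : ℕ} (f : Fin (n + 1) → Fin (n + 1) → M)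
    (hf : ∀ i j, f i j = f j i) (i : Fin (n + 1)) :
    ∏ j, ∏ k ∈ Finset.univ.filter (fun k => j < k), f j k =
      (∏ l, f i (i.succAbove l)) *
        ∏ j, ∏ k ∈ Finset.univ.filter (fun k => j < k), f (i.succAbove j) (i.succAbove k) := by
  simp_rw [Finset.prod_filter]
  rw [Fin.prod_univ_succAbove _ i, Fin.prod_univ_succAbove _ i]
  simp_rw [fun l => Fin.prod_univ_succAbove (fun k => if i.succAbove l < k then
    f (i.succAbove l) k else 1) i]
  rw [Finset.prod_mul_distrib, if_neg (lt_irrefl _), one_mul, ← mul_assoc, ← Finset.prod_mul_distrib]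
  congr 1
  · refine Finset.prod_congr rfl fun l _ => ?_
    rcases lt_or_gt_of_ne (Fin.succAbove_ne i l) with h | h
    · rw [if_neg h.not_gt, if_pos h, one_mul, hf]
    · rw [if_pos h, if_neg h.not_gt, mul_one]
  · simp only [Fin.succAbove_lt_succAbove_iff]

/-- The summand of the symmetrization identity `sum_thetaTerm`. -/
noncomputable def thetaTerm {n : ℕ} (q t u₀ u₁ u₂ u₃ : ℂ) (y : Fin n → ℂ) : ℂ :=
  (∏ j, theta (u₀ * y j) q * theta (u₁ * y j) q * theta (u₂ * y j) q * theta (u₃ * y j) q /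
      theta (y j ^ 2) q) *
    ∏ j, ∏ k ∈ Finset.univ.filter (fun k => j < k),
      theta (t * y j * y k) q / theta (y j * y k) q

section

variable {q t : ℂ} {n : ℕ}

lemma thetaTerm_swap (u₀ u₁ u₂ u₃ : ℂ) (y : Fin n → ℂ) :
    thetaTerm q t u₀ u₁ u₂ u₃ y = thetaTerm q t u₀ u₂ u₁ u₃ y := by
  unfold thetaTerm
  congr 1
  exact Finset.prod_congr rfl fun j _ => by ring

/-- If `u₁ = y_i`, the summand reduces to one in fewer variables. -/
lemma thetaTerm_of_eq (u₀ u₂ u₃ : ℂ) (y : Fin (n + 1) → ℂ) (i : Fin (n + 1))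
    (h2 : theta (y i ^ 2) q ≠ 0) (hne : ∀ l, theta (y i * y (i.succAbove l)) q ≠ 0) :
    thetaTerm q t u₀ (y i) u₂ u₃ y = theta (u₀ * y i) q * theta (u₂ * y i) q * theta (u₃ * y i) q *
      thetaTerm q t u₀ (t * y i) u₂ u₃ (fun l => y (i.succAbove l)) := by
  unfold thetaTerm
  rw [Fin.prod_univ_succAbove _ i, prod_pairs_succAbove _ (fun j k => by
    rw [mul_right_comm, mul_comm (y j) (y k)]) i]
  have h1 : theta (u₀ * y i) q * theta (y i * y i) q * theta (u₂ * y i) q * theta (u₃ * y i) q /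
      theta (y i ^ 2) q = theta (u₀ * y i) q * theta (u₂ * y i) q * theta (u₃ * y i) q := by
    rw [← pow_two]
    field_simp
  have key : (∏ l, theta (u₀ * y (i.succAbove l)) q * theta (t * y i * y (i.succAbove l)) q *
        theta (u₂ * y (i.succAbove l)) q * theta (u₃ * y (i.succAbove l)) q /
        theta (y (i.succAbove l) ^ 2) q) =
      (∏ l, theta (u₀ * y (i.succAbove l)) q * theta (y i * y (i.succAbove l)) q *
        theta (u₂ * y (i.succAbove l)) q * theta (u₃ * y (i.succAbove l)) q /
        theta (y (i.succAbove l) ^ 2) q) *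
      ∏ l, theta (t * y i * y (i.succAbove l)) q / theta (y i * y (i.succAbove l)) q := by
    rw [← Finset.prod_mul_distrib]
    refine Finset.prod_congr rfl fun l _ => ?_
    have := hne l
    generalize theta (y i * y (i.succAbove l)) q = w at this ⊢
    field_simp
  rw [h1, key]
  ring

lemma theta_one (hq : ‖q‖ < 1) : theta 1 q = 0 := by
  rw [theta, (qPoch_eq_zero_iff hq 1).2 ⟨0, by simp⟩, zero_mul]

lemma thetaTerm_eq_zero (hq : ‖q‖ < 1) (u₀ u₂ u₃ : ℂ) {u₁ : ℂ} {y : Fin n → ℂ} {i : Fin n}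
    (h : u₁ * y i = 1) : thetaTerm q t u₀ u₁ u₂ u₃ y = 0 := by
  rw [thetaTerm, Finset.prod_eq_zero (Finset.mem_univ i), zero_mul]
  rw [h, theta_one hq]
  ring

/-- The points at which the summands of the symmetrization identity have no poles. -/
structure ThetaGeneric (q : ℂ) (z : Fin n → ℂ) : Prop where
  ne_zero : ∀ k, z k ≠ 0
  sq : ∀ k, theta (z k ^ 2) q ≠ 0
  pair : ∀ k l, k ≠ l → ∀ e, theta (z k * signPow e (z l)) q ≠ 0

namespace ThetaGeneric

variable {z : Fin n → ℂ}

lemma sq' (hz : ThetaGeneric q z) (hq : ‖q‖ < 1) (e : Bool) (k : Fin n) :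
    theta (signPow e (z k) ^ 2) q ≠ 0 := by
  cases e
  · exact hz.sq k
  · rw [signPow_true, inv_pow, Ne, theta_ne_zero_iff_inv hq (pow_ne_zero 2 (hz.ne_zero k))]
    exact hz.sq k

lemma pair' (hz : ThetaGeneric q z) (hq : ‖q‖ < 1) {k l : Fin n} (hkl : k ≠ l) (e e' : Bool) :
    theta (signPow e (z k) * signPow e' (z l)) q ≠ 0 := by
  cases e
  · exact hz.pair k l hkl e'
  · have h0 := mul_ne_zero (hz.ne_zero k) (signPow_ne_zero (!e') (hz.ne_zero l))
    have h1 := hz.pair k l hkl (!e')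
    rw [Ne, ← theta_ne_zero_iff_inv hq h0, signPow_not, mul_inv, inv_inv] at h1
    exact h1

lemma succAbove {z : Fin (n + 1) → ℂ} (hz : ThetaGeneric q z) (i : Fin (n + 1)) :
    ThetaGeneric q (fun l => z (i.succAbove l)) :=
  ⟨fun _ => hz.ne_zero _, fun _ => hz.sq _,
    fun _ _ h => hz.pair _ _ fun h' => h (Fin.succAbove_right_injective h')⟩

end ThetaGeneric

/-- The symmetrization identity in `n + 1` variables at `u₁ = z_i^{±1}`, from the one in `n`
variables. -/
lemma sum_thetaTerm_of_eq (hq0 : q ≠ 0) (hq : ‖q‖ < 1) {u₀ u₂ u₃ : ℂ} {z : Fin (n + 1) → ℂ}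
    (hz : ThetaGeneric q z) (i : Fin (n + 1)) (e : Bool)
    (hu : t ^ n * (u₀ * signPow e (z i) * u₂ * u₃) = q)
    (ih : ∑ ε : Fin n → Bool, thetaTerm q t u₀ (t * signPow e (z i)) u₂ u₃
        (fun l => signPow (ε l) (z (i.succAbove l))) =
      ∏ i' ∈ Finset.range n, (theta (t ^ i' * u₀ * (t * signPow e (z i))) q *
        theta (t ^ i' * u₀ * u₂) q * theta (t ^ i' * u₀ * u₃) q)) :
    ∑ ε : Fin (n + 1) → Bool, thetaTerm q t u₀ (signPow e (z i)) u₂ u₃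
        (fun j => signPow (ε j) (z j)) =
      ∏ i' ∈ Finset.range (n + 1), (theta (t ^ i' * u₀ * signPow e (z i)) q *
        theta (t ^ i' * u₀ * u₂) q * theta (t ^ i' * u₀ * u₃) q) := by
  have hne := signPow_ne_zero e (hz.ne_zero i)
  rw [← (Fin.insertNthEquiv (fun _ => Bool) i).sum_comp, Fintype.sum_prod_type,
    Fintype.sum_eq_single e]
  · have h1 : ∀ ε : Fin n → Bool, thetaTerm q t u₀ (signPow e (z i)) u₂ u₃
        (fun j => signPow (Fin.insertNthEquiv (fun _ => Bool) i (e, ε) j) (z j)) =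
        theta (u₀ * signPow e (z i)) q * theta (u₂ * signPow e (z i)) q *
          theta (u₃ * signPow e (z i)) q * thetaTerm q t u₀ (t * signPow e (z i)) u₂ u₃
            (fun l => signPow (ε l) (z (i.succAbove l))) := by
      intro ε
      have := thetaTerm_of_eq (q := q) (t := t) u₀ u₂ u₃
        (fun j => signPow (Fin.insertNthEquiv (fun _ => Bool) i (e, ε) j) (z j)) i
        (hz.sq' hq _ _) (fun l => hz.pair' hq (Fin.succAbove_ne i l).symm _ _)
      simpa using this
    rw [Finset.sum_congr rfl fun ε _ => h1 ε, ← Finset.mul_sum, ih, Finset.prod_mul_distrib,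
      Finset.prod_mul_distrib, Finset.prod_mul_distrib, Finset.prod_mul_distrib,
      Finset.prod_range_succ' (fun i' => theta (t ^ i' * u₀ * signPow e (z i)) q),
      Finset.prod_range_succ, Finset.prod_range_succ]
    have h2 : theta (u₃ * signPow e (z i)) q = theta (t ^ n * u₀ * u₂) q := by
      rw [← theta_div_self hq0]
      congr 1
      have h3 : u₃ ≠ 0 := by rintro rfl; simp at hu; exact hq0 hu.symm
      rw [← hu]; field_simp
    have h3 : theta (u₂ * signPow e (z i)) q = theta (t ^ n * u₀ * u₃) q := by
      rw [← theta_div_self hq0]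
      congr 1
      have h3 : u₂ ≠ 0 := by rintro rfl; simp at hu; exact hq0 hu.symm
      rw [← hu]; field_simp
    have h4 : ∀ i', theta (t ^ (i' + 1) * u₀ * signPow e (z i)) q =
        theta (t ^ i' * u₀ * (t * signPow e (z i))) q := fun i' => by congr 1; ring
    simp only [h4, h2, h3, pow_zero, one_mul]
    ring
  · intro e' he'
    refine Finset.sum_eq_zero fun ε _ => thetaTerm_eq_zero hq _ _ _ (i := i) ?_
    have : e' = !e := by cases e <;> cases e' <;> simp_all
    simp [this, signPow_not, hne]

/-- The product of two theta functions with inverse arguments is quasiperiodic. -/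
lemma theta_mul_theta_shift (hq0 : q ≠ 0) (hq : ‖q‖ < 1) {a b u : ℂ} (ha : a ≠ 0) (hb : b ≠ 0)
    (hu : u ≠ 0) : theta (a * (q * u)) q * theta (b / (q * u)) q =
      b / (a * u ^ 2 * q) * (theta (a * u) q * theta (b / u) q) := by
  have h1 := theta_mul hq0 hq (x := a * u) (by positivity)
  have h2 := theta_mul hq0 hq (x := b / (q * u)) (by positivity)
  have h3 : q * (b / (q * u)) = b / u := by field_simp
  rw [h3] at h2
  rw [h2, show a * (q * u) = q * (a * u) by ring, h1]
  field_simp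

/-- The symmetrization identity of type `BC_n`: with `t^(n-1) u₀ u₁ u₂ u₃ = q`,
`∑_{y_j = z_j^{±1}} ∏_j ∏_r θ(u_r y_j) / θ(y_j²) ∏_{j<k} θ(t y_j y_k) / θ(y_j y_k) =
∏_{i<n} ∏_{r=1}^3 θ(t^i u₀ u_r)`. As functions of `u₁` with `u₁ u₂` fixed, both sides have the
same multiplier, and they agree at the `4n` points `u₁ = z_k^{±1}`, `u₂ = z_k^{±1}`, of which
`2n + 1` would be enough. -/
theorem sum_thetaTerm (hq0 : q ≠ 0) (hq : ‖q‖ < 1) (ht0 : t ≠ 0) {u₀ u₁ u₂ u₃ : ℂ}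
    (hu : t ^ n * (u₀ * u₁ * u₂ * u₃) = q * t) {z : Fin n → ℂ} (hz : ThetaGeneric q z)
    (hc : ∀ i < n, ∀ k l e, theta (t ^ i * (u₁ * u₂) * (z k * signPow e (z l))) q ≠ 0) :
    ∑ ε : Fin n → Bool, thetaTerm q t u₀ u₁ u₂ u₃ (fun j => signPow (ε j) (z j)) =
      ∏ i ∈ Finset.range n, (theta (t ^ i * u₀ * u₁) q * theta (t ^ i * u₀ * u₂) q *
        theta (t ^ i * u₀ * u₃) q) := by
  induction n generalizing u₀ u₁ u₂ u₃ with
  | zero => simp [thetaTerm]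
  | succ n ih =>
    have hu' : t ^ n * (u₀ * u₁ * u₂ * u₃) = q :=
      mul_right_cancel₀ ht0 (by rw [← hu]; ring)
    have hprod : u₀ * u₁ * u₂ * u₃ ≠ 0 := fun h => hq0 (by rw [← hu', h, mul_zero])
    have hu3 := right_ne_zero_of_mul hprod
    have hu2 := right_ne_zero_of_mul (left_ne_zero_of_mul hprod)
    have hu1 := right_ne_zero_of_mul (left_ne_zero_of_mul (left_ne_zero_of_mul hprod))
    have hu0 := left_ne_zero_of_mul (left_ne_zero_of_mul (left_ne_zero_of_mul hprod))
    obtain ⟨c, hcdef⟩ : ∃ c, c = u₁ * u₂ := ⟨_, rfl⟩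
    have hc0 : c ≠ 0 := by rw [hcdef]; exact mul_ne_zero hu1 hu2
    -- the difference of both sides, as a function of `u₁`, with `u₁ u₂ = c` fixed
    let F : ℂ → ℂ := fun u =>
      ∑ ε : Fin (n + 1) → Bool, thetaTerm q t u₀ u (c / u) u₃ (fun j => signPow (ε j) (z j)) -
      ∏ i ∈ Finset.range (n + 1), (theta (t ^ i * u₀ * u) q * theta (t ^ i * u₀ * (c / u)) q *
        theta (t ^ i * u₀ * u₃) q)
    have hFsw : ∀ u, u ≠ 0 → F (c / u) = F u := by
      intro u hu
      have h1 : c / (c / u) = u := by field_simp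
      simp only [F, h1]
      congr 1
      · exact Finset.sum_congr rfl fun ε _ => thetaTerm_swap _ _ _ _ _
      · exact Finset.prod_congr rfl fun i _ => by ring
    have hFz : ∀ k e, F (signPow e (z k)) = 0 := by
      intro k e
      have hne := signPow_ne_zero e (hz.ne_zero k)
      have h1 : signPow e (z k) * (c / signPow e (z k)) = c := by field_simp
      refine sub_eq_zero.2 (sum_thetaTerm_of_eq hq0 hq hz k e ?_ (ih ?_ (hz.succAbove k) ?_))
      · rw [← hu', mul_assoc u₀, h1, hcdef]; ring
      · rw [show t ^ n * (u₀ * (t * signPow e (z k)) * (c / signPow e (z k)) * u₃) =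
          t ^ n * (u₀ * (signPow e (z k) * (c / signPow e (z k))) * u₃) * t by ring, h1, hcdef,
          ← hu']
        ring
      · intro i hi k' l e'
        rw [show t ^ i * (t * signPow e (z k) * (c / signPow e (z k))) =
          t ^ (i + 1) * (signPow e (z k) * (c / signPow e (z k))) by ring, h1, hcdef]
        exact hc (i + 1) (by omega) _ _ _
    -- the zeros of a quasiperiodic function are invariant under multiplication by `q`
    have hsh : ∀ f : ℂ → ℂ, (∀ u, u ≠ 0 → ∃ e, e ≠ 0 ∧ f (q * u) = e * f u) →
        ∀ (m : ℤ) u, u ≠ 0 → f u = 0 → f (q ^ m * u) = 0 := by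
      intro f hf m u hu hfu
      induction m with
      | zero => simpa using hfu
      | succ i ih =>
        obtain ⟨e, -, h⟩ := hf (q ^ (i : ℤ) * u) (mul_ne_zero (zpow_ne_zero _ hq0) hu)
        rw [zpow_add_one₀ hq0, mul_comm (q ^ _) q, mul_assoc, h, ih, mul_zero]
      | pred i ih =>
        obtain ⟨e, he, h⟩ := hf (q ^ (-(i : ℤ) - 1) * u) (mul_ne_zero (zpow_ne_zero _ hq0) hu)
        rw [← mul_assoc, ← zpow_one_add₀ hq0, show 1 + (-(i : ℤ) - 1) = -i by ring, ih] at h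
        exact (mul_eq_zero.1 h.symm).resolve_left he
    have hpow : ∀ x : ℂ, x ^ (n + 1) = ∏ _j : Fin (n + 1), x := fun x => by simp
    have hFe : ∀ u, u ≠ 0 → F (q * u) = (c / (u ^ 2 * q)) ^ (n + 1) * F u := by
      intro u hu
      simp only [F]
      rw [mul_sub, Finset.mul_sum]
      congr 1
      · refine Finset.sum_congr rfl fun ε _ => ?_
        unfold thetaTerm
        rw [← mul_assoc]
        congr 1
        rw [hpow, ← Finset.prod_mul_distrib]
        refine Finset.prod_congr rfl fun j _ => ?_
        have hy := signPow_ne_zero (ε j) (hz.ne_zero j)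
        have := theta_mul_theta_shift hq0 hq hy (mul_ne_zero hc0 hy) hu
        rw [show q * u * signPow (ε j) (z j) = signPow (ε j) (z j) * (q * u) by ring,
          div_mul_eq_mul_div c, div_mul_eq_mul_div c, mul_assoc (theta _ q) (theta _ q), this,
          show c * signPow (ε j) (z j) / (signPow (ε j) (z j) * u ^ 2 * q) = c / (u ^ 2 * q) by
            field_simp, mul_comm u]
        ring_nf
      · have hpow' : ∀ x : ℂ, x ^ (n + 1) = ∏ _j ∈ Finset.range (n + 1), x := fun x => by simp
        rw [hpow' (c / (u ^ 2 * q)), ← Finset.prod_mul_distrib]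
        refine Finset.prod_congr rfl fun i _ => ?_
        have ha : t ^ i * u₀ ≠ 0 := mul_ne_zero (pow_ne_zero _ ht0) hu0
        have := theta_mul_theta_shift hq0 hq ha (mul_ne_zero ha hc0) hu
        rw [← mul_div_assoc, ← mul_div_assoc, this,
          show t ^ i * u₀ * c / (t ^ i * u₀ * u ^ 2 * q) = c / (u ^ 2 * q) by field_simp]
        ring
    have hee : ∀ u : ℂ, u ≠ 0 → (c / (u ^ 2 * q)) ^ (n + 1) ≠ 0 := fun u hu => by positivity
    have hFm := hsh F fun u hu => ⟨_, hee u hu, hFe u hu⟩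
    -- theta functions with zeros at `u₁ = z_k⁻¹` and `u₂ = z_k⁻¹`; their product has the multiplier
    -- of `F`, which also vanishes at `u₁ = z_0`
    let d : Fin (n + 1) ⊕ Fin (n + 1) → ℂ → ℂ :=
      Sum.elim (fun k u => theta (u * z k) q) (fun k u => theta (c * z k / u) q)
    have hdiff : ∀ (g : ℂ → ℂ), (∀ u, u ≠ 0 → g u ≠ 0) → (∀ u, u ≠ 0 → DifferentiableAt ℂ g u) →
        ∀ u, u ≠ 0 → DifferentiableAt ℂ (fun u => theta (g u) q) u := fun g hg hgd u hu =>
      (differentiableAt_theta hq (hg u hu)).comp u (hgd u hu)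
    have hc' : ∀ k l e, theta (c * (z k * signPow e (z l))) q ≠ 0 := fun k l e => by
      have := hc 0 n.succ_pos k l e
      rwa [pow_zero, one_mul, ← hcdef] at this
    have hz0 := hz.ne_zero
    have hcz : ∀ k, c * z k ≠ 0 := fun k => mul_ne_zero hc0 (hz0 k)
    have key : F u₁ = 0 := by
      refine eq_zero_of_quasiperiodic hq0 hq (f := F) (d := d) ?_ ?_ ?_ ?_ ?_ hee hFe ?_
        (hz0 0) ?_ (hFz 0 false) hu1
      · intro u hu
        refine DifferentiableAt.differentiableWithinAt (DifferentiableAt.sub ?_ ?_)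
        · refine DifferentiableAt.fun_sum fun ε _ => ?_
          unfold thetaTerm
          refine DifferentiableAt.mul_const (DifferentiableAt.fun_finsetProd fun j _ => ?_) _
          have hy := signPow_ne_zero (ε j) (hz0 j)
          have h1 := hdiff (fun u => u * signPow (ε j) (z j)) (fun u hu => mul_ne_zero hu hy)
            (fun u _ => by fun_prop) u hu
          have h2 := hdiff (fun u => c / u * signPow (ε j) (z j))
            (fun u hu => mul_ne_zero (div_ne_zero hc0 hu) hy)
            (fun u hu => by fun_prop (disch := exact hu)) u hu
          fun_prop
        · refine DifferentiableAt.fun_finsetProd fun i _ => ?_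
          have hti : t ^ i * u₀ ≠ 0 := mul_ne_zero (pow_ne_zero _ ht0) hu0
          have h1 := hdiff (fun u => t ^ i * u₀ * u) (fun u hu => mul_ne_zero hti hu)
            (fun u _ => by fun_prop) u hu
          have h2 := hdiff (fun u => t ^ i * u₀ * (c / u))
            (fun u hu => mul_ne_zero hti (div_ne_zero hc0 hu))
            (fun u hu => by fun_prop (disch := exact hu)) u hu
          fun_prop
      · rintro (k | k) u hu
        · exact (hdiff (fun u => u * z k) (fun u hu => mul_ne_zero hu (hz0 k))
            (fun u _ => by fun_prop) u hu).differentiableWithinAt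
        · exact (hdiff (fun u => c * z k / u) (fun u hu => div_ne_zero (hcz k) hu)
            (fun u hu => by fun_prop (disch := exact hu)) u hu).differentiableWithinAt
      · have hder : ∀ (g : ℂ → ℂ) (g' u : ℂ), g u ≠ 0 → HasDerivAt g g' u → g' ≠ 0 →
            theta (g u) q = 0 → deriv (fun u => theta (g u) q) u ≠ 0 := by
          intro g g' u hgu hg hg' h0
          have h1 : deriv (fun u => theta (g u) q) u = _ :=
            ((differentiableAt_theta hq hgu).hasDerivAt.comp u hg).deriv
          rw [h1]
          exact mul_ne_zero (deriv_theta_ne_zero hq0 hq hgu h0) hg'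
        rintro (k | k) u hu h0
        · exact hder (fun u => u * z k) (1 * z k) u (mul_ne_zero hu (hz0 k))
            ((hasDerivAt_id u).mul_const (z k)) (by simpa using hz0 k) h0
        · refine hder (fun u => c * z k / u) _ u (div_ne_zero (hcz k) hu)
            ((hasDerivAt_inv hu).const_mul (c * z k)) ?_ h0
          exact mul_ne_zero (hcz k) (neg_ne_zero.2 (inv_ne_zero (pow_ne_zero 2 hu)))
      · have hdiv : ∀ x y : ℂ, x ≠ 0 → y ≠ 0 → theta x q = 0 → theta y q = 0 →
            theta (x * y⁻¹) q = 0 ∧ theta (x * y) q = 0 := by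
          intro x y hx hy h1 h2
          obtain ⟨m, rfl⟩ := (theta_eq_zero_iff hq0 hq hx).1 h1
          obtain ⟨m', rfl⟩ := (theta_eq_zero_iff hq0 hq hy).1 h2
          rw [theta_eq_zero_iff hq0 hq (mul_ne_zero hx (inv_ne_zero hy)),
            theta_eq_zero_iff hq0 hq (mul_ne_zero hx hy)]
          exact ⟨⟨m - m', by rw [zpow_sub₀ hq0, div_eq_mul_inv]⟩, ⟨m + m', by rw [zpow_add₀ hq0]⟩⟩
        rintro (k | k) (l | l) hkl u hu h1 h2
        · have := (hdiv _ _ (mul_ne_zero hu (hz0 k)) (mul_ne_zero hu (hz0 l)) h1 h2).1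
          have h3 : u * z k * (u * z l)⁻¹ = z k * signPow true (z l) := by
            have := hz0 l
            simp; field_simp
          rw [h3] at this
          exact hz.pair k l (fun h => hkl (by rw [h])) true this
        · have := (hdiv _ _ (mul_ne_zero hu (hz0 k)) (div_ne_zero (hcz l) hu) h1 h2).2
          have h3 : u * z k * (c * z l / u) = c * (z k * signPow false (z l)) := by
            simp; field_simp
          rw [h3] at this
          exact hc' k l false this
        · have := (hdiv _ _ (div_ne_zero (hcz k) hu) (mul_ne_zero hu (hz0 l)) h1 h2).2
          have h3 : c * z k / u * (u * z l) = c * (z k * signPow false (z l)) := by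
            simp; field_simp
          rw [h3] at this
          exact hc' k l false this
        · have := (hdiv _ _ (div_ne_zero (hcz k) hu) (div_ne_zero (hcz l) hu) h1 h2).1
          have h3 : c * z k / u * (c * z l / u)⁻¹ = z k * signPow true (z l) := by
            have := hz0 l
            simp; field_simp
          rw [h3] at this
          exact hz.pair k l (fun h => hkl (by rw [h])) true this
      · rintro (k | k) u hu h0
        · obtain ⟨m, hm⟩ := (theta_eq_zero_iff hq0 hq (mul_ne_zero hu (hz0 k))).1 h0
          rw [show u = q ^ m * signPow true (z k) by
            have := hz0 k
            rw [← hm, signPow_true]; field_simp]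
          exact hFm m _ (signPow_ne_zero true (hz0 k)) (hFz k true)
        · obtain ⟨m, hm⟩ := (theta_eq_zero_iff hq0 hq (div_ne_zero (hcz k) hu)).1 h0
          rw [show u = q ^ (-m) * (c / signPow true (z k)) by
            have := hz0 k
            rw [zpow_neg, ← hm, signPow_true]; field_simp]
          have hne := signPow_ne_zero true (hz0 k)
          refine hFm _ _ (div_ne_zero hc0 hne) ?_
          rw [hFsw _ hne]
          exact hFz k true
      · intro u hu
        rw [Fintype.prod_sum_type, Fintype.prod_sum_type, hpow, ← Finset.prod_mul_distrib,
          ← Finset.prod_mul_distrib, ← Finset.prod_mul_distrib]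
        refine Finset.prod_congr rfl fun k _ => ?_
        have := theta_mul_theta_shift hq0 hq (hz0 k) (hcz k) hu
        rw [show c * z k / (z k * u ^ 2 * q) = c / (u ^ 2 * q) by
          have := hz0 k
          field_simp, mul_comm (z k) (q * u), mul_comm (z k) u] at this
        exact this
      · rintro (k | k)
        · by_cases hk : k = 0
          · subst hk
            have := hz.sq 0
            rwa [pow_two] at this
          · exact hz.pair 0 k (Ne.symm hk) false
        · have := hc' k 0 true
          rwa [signPow_true, ← mul_assoc, ← div_eq_mul_inv] at this
    have h1 : c / u₁ = u₂ := by rw [hcdef]; field_simp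
    simp only [F, h1] at key
    exact sub_eq_zero.1 key

end

/-! ### Deformation of contours -/

/-- The pairs `L ⊆ U` of a compact and an open set such that contours in `U \ L` that surround `L`
separate the poles of the integrand. Here `T` stands for the set of the `t p^i q^j`, `A` for the
poles to be surrounded, `B` for the reciprocals of the poles to be avoided, and `κ τ` and
`1 / (l τ)` with `τ ∈ T` are the values of `x y` at which the cross terms have poles; the poles of
the second kind matter only if `P` holds. -/
structure AdmissiblePair (P : Prop) (T A B : Set ℂ) (κ l : ℂ) (L U : Set ℂ) : Prop where
  isCompact : IsCompact L
  isOpen : IsOpen U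
  subset : L ⊆ U
  zero_mem : (0 : ℂ) ∈ L
  mul_mem : ∀ τ ∈ T, ∀ x ∈ U, τ * x ∈ L
  mul_ne : ∀ τ ∈ T, ∀ x, x ∉ L → ∀ y, y ∉ L → x * y ≠ κ * τ
  cross : P → ∀ τ ∈ T, ∀ x ∈ U, ∀ y ∈ U, l * τ * x * y ≠ 1
  contains : A ⊆ L
  excludes : ∀ β ∈ B, ∀ x ∈ U, β * x ≠ 1

/-- The tube lemma. -/
lemma isOpen_forall_mem_of_isCompact {X : Type*} [TopologicalSpace X] {T : Set ℂ}
    (hT : IsCompact T) {W : Set (ℂ × X)} (hW : IsOpen W) :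
    IsOpen {x : X | ∀ τ ∈ T, (τ, x) ∈ W} := by
  rw [isOpen_iff_mem_nhds]
  intro x hx
  obtain ⟨u, v, -, hv, hTu, hxv, huv⟩ := generalized_tube_lemma hT (isCompact_singleton (x := x)) hW
    (by rintro ⟨τ, y⟩ ⟨h1, h2⟩; obtain rfl : y = x := h2; exact hx τ h1)
  exact mem_of_superset (hv.mem_nhds (hxv rfl)) fun y hy τ hτ => huv ⟨hTu hτ, hy⟩

/-- A set of numbers below 1, as dilations, can be used to enlarge a triple of open sets to an
exhaustion of the plane that it shrinks. -/
lemma exists_exhaustion {T : Set ℂ} (hT : IsCompact T) {η : ℝ} (hη0 : 0 < η) (hη1 : η < 1)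
    (hTη : ∀ τ ∈ T, ‖τ‖ ≤ η ^ 3) {V₀ V₁ V₂ : Set ℂ} (h₀ : IsOpen V₀) (h₁ : IsOpen V₁)
    (h₂ : IsOpen V₂) (h₀₁ : closure V₀ ⊆ V₁) (h₁₂ : closure V₁ ⊆ V₂)
    (h₂₀ : ∀ τ ∈ T, ∀ x ∈ closure V₂, τ * x ∈ V₀) {ρ : ℝ} (hρ0 : 0 ≤ ρ)
    (hρ : Metric.ball 0 (ρ / η ^ 2) ⊆ V₀) :
    ∃ V : ℕ → Set ℂ, V 0 = V₀ ∧ V 2 = V₂ ∧ (∀ m, IsOpen (V m)) ∧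
      (∀ m, closure (V m) ⊆ V (m + 1)) ∧ (∀ m, ∀ τ ∈ T, ∀ x ∈ V (m + 2), τ * x ∈ V m) ∧
      (∀ m, Metric.ball 0 (ρ / η ^ m) ⊆ V m) ∧
      ∀ R : ℝ, 0 ≤ R → V₂ ⊆ Metric.ball 0 R → (∃ τ ∈ T, ‖τ‖ = η ^ 3) →
        ∀ m, V m ⊆ Metric.ball 0 (R / η ^ m) := by
  let V : ℕ → Set ℂ := fun m => Nat.rec (motive := fun _ => Set ℂ × Set ℂ × Set ℂ) (V₀, V₁, V₂)
    (fun _ S => (S.2.1, S.2.2, {x | ∀ τ ∈ T, τ * x ∈ S.1})) m |>.1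
  have hV3 : ∀ m, V (m + 3) = {x | ∀ τ ∈ T, τ * x ∈ V m} := fun m => rfl
  have hV0 : V 0 = V₀ := rfl
  have hV1 : V 1 = V₁ := rfl
  have hV2 : V 2 = V₂ := rfl
  have ind : ∀ Q : ℕ → Prop, Q 0 → Q 1 → Q 2 → (∀ m, Q m → Q (m + 3)) → ∀ m, Q m := by
    intro Q q0 q1 q2 q3 m
    have : Q m ∧ Q (m + 1) ∧ Q (m + 2) := by
      induction m with
      | zero => exact ⟨q0, q1, q2⟩
      | succ m ih => exact ⟨ih.2.1, ih.2.2, q3 m ih.1⟩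
    exact this.1
  have hcl : ∀ m, closure (V m) ⊆ V (m + 1) := by
    refine ind _ h₀₁ h₁₂ (fun x hx τ hτ => h₂₀ τ hτ x hx) fun m hm x hx τ hτ => ?_
    refine hm (map_mem_closure (continuous_const_mul τ) hx fun y hy => hy τ hτ)
  have hmono : ∀ m, V m ⊆ V (m + 1) := fun m => subset_closure.trans (hcl m)
  have hV0m : ∀ m, V 0 ⊆ V m := fun m => by
    induction m with
    | zero => exact le_rfl
    | succ m ih => exact ih.trans (hmono m)
  refine ⟨V, hV0, hV2, ind _ h₀ h₁ h₂ fun m hm => ?_, hcl,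
    fun m τ hτ x hx => (hmono (m + 2) hx : x ∈ V (m + 3)) τ hτ, ?_, ?_⟩
  · exact isOpen_forall_mem_of_isCompact hT (W := {z : ℂ × ℂ | z.1 * z.2 ∈ V m})
      (hm.preimage (by fun_prop))
  · have hb : ∀ m ≤ 2, Metric.ball (0 : ℂ) (ρ / η ^ m) ⊆ V 0 := fun m hm => by
      refine (Metric.ball_subset_ball ?_).trans hρ
      exact div_le_div_of_nonneg_left hρ0 (pow_pos hη0 _) (pow_le_pow_of_le_one hη0.le hη1.le hm)
    refine ind _ (hb 0 (by norm_num)) ((hb 1 (by norm_num)).trans (hV0m 1))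
      ((hb 2 le_rfl).trans (hV0m 2)) fun m hm x hx τ hτ => hm ?_
    rw [mem_ball_zero_iff] at hx ⊢
    rw [norm_mul]
    rcases eq_or_ne τ 0 with rfl | hτ0
    · rw [norm_zero, zero_mul]
      have := (norm_nonneg x).trans_lt hx
      have h3 : 0 < ρ := by
        by_contra h
        rw [le_antisymm (not_lt.1 h) hρ0, zero_div] at this
        exact lt_irrefl _ this
      positivity
    · calc ‖τ‖ * ‖x‖ < ‖τ‖ * (ρ / η ^ (m + 3)) :=
            mul_lt_mul_of_pos_left hx (norm_pos_iff.2 hτ0)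
        _ ≤ η ^ 3 * (ρ / η ^ (m + 3)) :=
            mul_le_mul_of_nonneg_right (hTη τ hτ) (by positivity)
        _ = ρ / η ^ m := by field_simp; ring
  · rintro R hR0 hR ⟨τ, hτ, hτη⟩
    have hb : ∀ m, V₂ ⊆ Metric.ball (0 : ℂ) (R / η ^ m) := fun m => by
      refine hR.trans (Metric.ball_subset_ball ?_)
      exact le_div_self hR0 (pow_pos hη0 _) (pow_le_one₀ hη0.le hη1.le)
    refine ind _ (((hmono 0).trans (hmono 1)).trans (hb 0)) ((hmono 1).trans (hb 1)) (hb 2)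
      fun m hm x hx => ?_
    have h1 := hm (hx τ hτ)
    rw [mem_ball_zero_iff] at h1 ⊢
    rw [norm_mul, hτη] at h1
    rw [show R / η ^ (m + 3) = (R / η ^ m) / η ^ 3 by rw [pow_add]; field_simp,
      lt_div_iff₀ (by positivity), mul_comm]
    exact h1

/-- Between a compact set and an open neighbourhood there are an open set and its compact
closure. -/
lemma exists_isOpen_closure_subset {K U : Set ℂ} (hK : IsCompact K) (hU : IsOpen U) (hKU : K ⊆ U) :
    ∃ V, IsOpen V ∧ K ⊆ V ∧ closure V ⊆ U ∧ IsCompact (closure V) := by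
  obtain ⟨Q, hQ, hKQ, hQU⟩ := exists_compact_between hK hU hKU
  have h1 : closure (interior Q) ⊆ Q := closure_minimal interior_subset hQ.isClosed
  exact ⟨interior Q, isOpen_interior, hKQ, h1.trans hQU, hQ.of_isClosed_subset isClosed_closure h1⟩

section Deformation

variable {P : Prop} {T A B : Set ℂ} {κ l : ℂ} {n : ℕ} {G : (Fin n → ℂ) → ℂ}

/-- The pairs of sets for which the integral of `G` over all separating cycles is `I`. -/
def HasMultiInt (G : (Fin n → ℂ) → ℂ) (L U : Set ℂ) (I : ℂ) : Prop :=
  ∀ c : Fin n → Cycle, (∀ j, (c j).Separates L U) → Cycle.multiInt c G = I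

/-- `G` is continuous and separately holomorphic on `N^n`. -/
structure SepHolomorphic (G : (Fin n → ℂ) → ℂ) (N : Set ℂ) : Prop where
  continuousOn : ContinuousOn G (Set.univ.pi fun _ => N)
  differentiableOn : ∀ z ∈ Set.univ.pi fun _ : Fin n => N, ∀ j,
    DifferentiableOn ℂ (fun x => G (Function.update z j x)) N

/-- If each of two admissible pairs fits into both open sets, then one smooth cycle separates both
pairs. -/
lemma HasMultiInt.of_adjacent {L U L' U' : Set ℂ} {I : ℂ}
    (h : AdmissiblePair P T A B κ l L U) (h' : AdmissiblePair P T A B κ l L' U')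
    (hG : ∀ L U, AdmissiblePair P T A B κ l L U → SepHolomorphic G (U \ L))
    (hLL : L ∪ L' ⊆ U ∩ U') (hI : HasMultiInt G L U I) : HasMultiInt G L' U' I := by
  obtain ⟨b, hb⟩ := Cycle.exists_separates (h.isCompact.union h'.isCompact)
    (h.isOpen.inter h'.isOpen) hLL (Or.inl h.zero_mem)
  intro c hc
  rw [Cycle.multiInt_eq_of_separates h'.isCompact.isClosed h'.isOpen h'.zero_mem hc
    (c' := fun _ => b) (fun _ => hb.mono Set.subset_union_right Set.inter_subset_right)
    (hG _ _ h').continuousOn (hG _ _ h').differentiableOn]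
  exact hI _ fun _ => hb.mono Set.subset_union_left Set.inter_subset_left

/-- The deformation between two admissible pairs, the first one arbitrary and the second one given
by a triple of open sets `V₀ ⊆ V₁ ⊆ V₂`, if `κ` is small in terms of the triple. The first step is
the intersection of the first pair with the members of an exhaustion of the plane that starts with
the triple, the second step the intersection of the triple with the members of an exhaustion that
starts with the result of the first step; discs about the origin make up for the points lost near
the origin. -/
theorem HasMultiInt.of_triple (hT : IsCompact T) {η : ℝ} (hη0 : 0 < η) (hη1 : η < 1)
    (hTη : ∀ τ ∈ T, ‖τ‖ ≤ η ^ 3) (hTη' : ∃ τ ∈ T, ‖τ‖ = η ^ 3)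
    (hG : ∀ L U, AdmissiblePair P T A B κ l L U → SepHolomorphic G (U \ L))
    {L U : Set ℂ} (h : AdmissiblePair P T A B κ l L U) (h0 : (0 : ℂ) ∈ interior L)
    {V₀ V₁ V₂ : Set ℂ} (h₀ : IsOpen V₀) (h₁ : IsOpen V₁)
    (h₂ : IsOpen V₂) (h₀₁ : closure V₀ ⊆ V₁) (h₁₂ : closure V₁ ⊆ V₂)
    (h₂₀ : ∀ τ ∈ T, ∀ x ∈ closure V₂, τ * x ∈ V₀) {ρ R β : ℝ} (hρ0 : 0 < ρ) (hR0 : 0 < R)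
    (hβ0 : 0 < β)
    (hρ : Metric.ball 0 (ρ / η ^ 2) ⊆ V₀) (hR : V₂ ⊆ Metric.ball 0 R)
    (hA : A ⊆ V₀) (hB : ∀ b ∈ B, ∀ x ∈ V₂, b * x ≠ 1) (hBβ : ∀ b ∈ B, ‖b‖ ≤ β)
    (hcr : P → ∀ τ ∈ T, ∀ x ∈ V₂, ∀ y ∈ V₂, l * τ * x * y ≠ 1) (hl : ‖l‖ ≤ 1)
    (hκ0 : κ ≠ 0) (hκ₁ : ‖κ‖ < ρ ^ 2) (hκ₂ : ‖κ‖ * R < ρ * η ^ 2) (hκ₃ : ‖κ‖ < ρ * R * η)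
    (hκ₄ : ‖κ‖ * β < ρ * η ^ 3) {I : ℂ} (hI : HasMultiInt G L U I) :
    HasMultiInt G (closure V₀) V₂ I := by
  obtain ⟨V, hV0, hV2, hVo, hVc, hVT, hVρ, hVR⟩ :=
    exists_exhaustion hT hη0 hη1 hTη h₀ h₁ h₂ h₀₁ h₁₂ h₂₀ hρ0.le hρ
  replace hVR := hVR R hR0.le hR hTη'
  have hVmono : Monotone V := monotone_nat_of_le_succ fun m => subset_closure.trans (hVc m)
  have hκn : 0 < ‖κ‖ := norm_pos_iff.2 hκ0
  let r : ℕ → ℝ := fun m => ‖κ‖ * η ^ m / ρ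
  have hr0 : ∀ m, 0 < r m := fun m => by positivity
  let L' : ℕ → Set ℂ := fun m => (L ∩ closure (V m)) ∪ Metric.closedBall 0 (r m)
  let U' : ℕ → Set ℂ := fun m => (U ∩ V (m + 2)) ∪ Metric.ball 0 (r m / η ^ 3)
  have hη3 : 0 < η ^ 3 := by positivity
  have hη31 : η ^ 3 < 1 := pow_lt_one₀ hη0.le hη1 (by norm_num)
  have hrlt : ∀ m, r m < r m / η ^ 3 := fun m => by
    rw [lt_div_iff₀ hη3]; exact mul_lt_of_lt_one_right (hr0 m) hη31
  -- The radius `r m` is such that a point outside `V m` and a point outside the disc of `L' m` have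
  -- a product of absolute value at least `‖κ‖`.
  have hadm : ∀ m, AdmissiblePair P T A B κ l (L' m) (U' m) := by
    intro m
    -- the disc of `U' m` is contained in the disc that contains `V (m + 2)`
    have hrR : r m / η ^ 3 ≤ R / η ^ (m + 2) := by
      have hm1 : η ^ m * η ^ m ≤ 1 := by
        rw [← pow_add]; exact pow_le_one₀ hη0.le hη1.le
      rw [div_le_div_iff₀ hη3 (by positivity)]
      change ‖κ‖ * η ^ m / ρ * η ^ (m + 2) ≤ R * η ^ 3
      rw [div_mul_eq_mul_div, div_le_iff₀ hρ0]
      calc ‖κ‖ * η ^ m * η ^ (m + 2) = ‖κ‖ * (η ^ m * η ^ m) * η ^ 2 := by ring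
        _ ≤ (ρ * R * η) * 1 * η ^ 2 := by gcongr
        _ = R * η ^ 3 * ρ := by ring
    have hUR : ∀ x ∈ U' m, ‖x‖ < R / η ^ (m + 2) := by
      rintro x (hx | hx)
      · exact mem_ball_zero_iff.1 (hVR _ hx.2)
      · exact (mem_ball_zero_iff.1 hx).trans_le hrR
    have hsmall : ∀ τ ∈ T, ∀ x ∈ Metric.ball (0 : ℂ) (r m / η ^ 3), ∀ y ∈ U' m,
        l * τ * x * y ≠ 1 := by
      intro τ hτ x hx y hy heq
      have h1 : ‖l * τ * x * y‖ < 1 := by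
        rw [norm_mul, norm_mul, norm_mul]
        have hx' := (mem_ball_zero_iff.1 hx).le
        have hy' := (hUR y hy).le
        calc ‖l‖ * ‖τ‖ * ‖x‖ * ‖y‖ ≤ 1 * η ^ 3 * (r m / η ^ 3) * (R / η ^ (m + 2)) := by
              have := hTη τ hτ
              have := (hr0 m).le
              gcongr
          _ = ‖κ‖ * R / (ρ * η ^ 2) := by
              change 1 * η ^ 3 * (‖κ‖ * η ^ m / ρ / η ^ 3) * (R / η ^ (m + 2)) = _
              rw [pow_add]; field_simp
          _ < 1 := by rw [div_lt_one (by positivity)]; exact hκ₂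
      rw [heq, norm_one] at h1
      exact lt_irrefl _ h1
    refine ⟨?_, ?_, ?_, ?_, ?_, ?_, ?_, ?_, ?_⟩
    · exact (h.isCompact.inter_right isClosed_closure).union (isCompact_closedBall _ _)
    · exact (h.isOpen.inter (hVo _)).union Metric.isOpen_ball
    · refine Set.union_subset_union ?_ ?_
      · exact Set.inter_subset_inter h.subset ((hVc m).trans (hVmono (by omega)))
      · exact Metric.closedBall_subset_ball (hrlt m)
    · exact Or.inr (by simpa using (hr0 m).le)
    · rintro τ hτ x (hx | hx)
      · exact Or.inl ⟨h.mul_mem τ hτ x hx.1, subset_closure (hVT m τ hτ x hx.2)⟩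
      · right
        rw [mem_ball_zero_iff, lt_div_iff₀ hη3] at hx
        rw [mem_closedBall_zero_iff, norm_mul, mul_comm]
        exact (mul_le_mul_of_nonneg_left (hTη τ hτ) (norm_nonneg _)).trans hx.le
    · intro τ hτ x hx y hy heq
      have key : ∀ x y : ℂ, x ∈ L → x ∉ L' m → y ∉ L' m → x * y ≠ κ * τ := by
        intro x y hxL hx hy heq
        have hxV : x ∉ V m := fun hV => hx (Or.inl ⟨hxL, subset_closure hV⟩)
        have h1 : ρ / η ^ m ≤ ‖x‖ := by
          by_contra hlt
          exact hxV (hVρ m (mem_ball_zero_iff.2 (not_le.1 hlt)))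
        have h2 : r m < ‖y‖ := by
          by_contra hle
          exact hy (Or.inr (mem_closedBall_zero_iff.2 (not_lt.1 hle)))
        have h3 : ‖κ‖ < ‖x * y‖ := by
          rw [norm_mul]
          calc ‖κ‖ = ρ / η ^ m * r m := by
                change _ = ρ / η ^ m * (‖κ‖ * η ^ m / ρ); field_simp
            _ < ‖x‖ * ‖y‖ := mul_lt_mul' h1 h2 (hr0 m).le
                ((by positivity : 0 < ρ / η ^ m).trans_le h1)
        rw [heq, norm_mul] at h3
        exact absurd ((mul_le_of_le_one_right hκn.le ((hTη τ hτ).trans hη31.le))) h3.not_ge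
      by_cases hxL : x ∈ L
      · exact key x y hxL hx hy heq
      · by_cases hyL : y ∈ L
        · exact key y x hyL hy hx (by rw [mul_comm, heq])
        · exact h.mul_ne τ hτ x hxL y hyL heq
    · intro hP τ hτ x hx y hy
      rcases hx with hx | hx
      · rcases hy with hy' | hy'
        · exact h.cross hP τ hτ x hx.1 y hy'.1
        · rw [mul_right_comm]
          exact hsmall τ hτ y hy' x (Or.inl hx)
      · exact hsmall τ hτ x hx y hy
    · intro a ha
      exact Or.inl ⟨h.contains ha, subset_closure (hVmono (Nat.zero_le m) (hV0 ▸ hA ha))⟩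
    · rintro b hb x (hx | hx)
      · exact h.excludes b hb x hx.1
      · intro heq
        have h1 : ‖b * x‖ < 1 := by
          rw [norm_mul]
          have hx' := mem_ball_zero_iff.1 hx
          calc ‖b‖ * ‖x‖ ≤ β * (r m / η ^ 3) := by
                have := hBβ b hb
                gcongr
            _ ≤ β * (‖κ‖ / ρ / η ^ 3) := by
                gcongr
                change ‖κ‖ * η ^ m / ρ ≤ ‖κ‖ / ρ
                gcongr
                exact mul_le_of_le_one_right hκn.le (pow_le_one₀ hη0.le hη1.le)
            _ = ‖κ‖ * β / (ρ * η ^ 3) := by field_simp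
            _ < 1 := by rw [div_lt_one (by positivity)]; exact hκ₄
        rw [heq, norm_one] at h1
        exact lt_irrefl _ h1
  have hrsucc : ∀ m, r (m + 1) = r m * η := fun m => by
    change ‖κ‖ * η ^ (m + 1) / ρ = ‖κ‖ * η ^ m / ρ * η
    ring
  -- neighbouring pairs are near enough for a common cycle
  have hadj : ∀ m, L' (m + 1) ∪ L' m ⊆ U' (m + 1) ∩ U' m := by
    intro m
    have hVcc : ∀ k k', k < k' → closure (V k) ⊆ V k' := fun k k' hk =>
      (hVc k).trans (hVmono hk)
    have h1 : r m < r (m + 1) / η ^ 3 := by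
      rw [hrsucc, lt_div_iff₀ hη3, show η ^ 3 = η ^ 2 * η by ring, ← mul_assoc]
      exact mul_lt_mul_of_pos_right (mul_lt_of_lt_one_right (hr0 m)
        (pow_lt_one₀ hη0.le hη1 (by norm_num))) hη0
    have h2 : r (m + 1) ≤ r m := by
      rw [hrsucc]; exact mul_le_of_le_one_right (hr0 m).le hη1.le
    refine Set.union_subset (Set.subset_inter (hadm _).subset ?_) (Set.subset_inter ?_ (hadm _).subset)
    · exact Set.union_subset_union (Set.inter_subset_inter h.subset (hVcc _ _ (by omega)))
        (Metric.closedBall_subset_ball (h2.trans_lt (hrlt m)))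
    · exact Set.union_subset_union (Set.inter_subset_inter h.subset (hVcc _ _ (by omega)))
        (Metric.closedBall_subset_ball h1)
  -- for large `m`, the pair is near `(L, U)`; descend from there to `m = 0`
  have hI0 : HasMultiInt G (L' 0) (U' 0) I := by
    obtain ⟨ε, hε, hεL⟩ := Metric.isOpen_iff.1 isOpen_interior 0 h0
    obtain ⟨M, hM0, hM⟩ := h.isCompact.isBounded.subset_ball_lt 0 0
    have htend : Tendsto (fun m : ℕ => η ^ m) atTop (𝓝 0) :=
      tendsto_pow_atTop_nhds_zero_of_lt_one hη0.le hη1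
    obtain ⟨m, hm1, hm2⟩ := ((htend.eventually_lt_const (u := ε * ρ / ‖κ‖) (by positivity)).and
      (htend.eventually_lt_const (u := ρ / M) (by positivity))).exists
    have hball : Metric.closedBall 0 (r m) ⊆ L := by
      refine (Metric.closedBall_subset_ball ?_).trans (hεL.trans interior_subset)
      change ‖κ‖ * η ^ m / ρ < ε
      rw [lt_div_iff₀ hκn] at hm1
      rw [div_lt_iff₀ hρ0]
      linarith
    have hLV : L ⊆ V (m + 2) := by
      refine hM.trans ((Metric.ball_subset_ball ?_).trans ((hVρ m).trans (hVmono (by omega))))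
      rw [lt_div_iff₀ hM0] at hm2
      rw [le_div_iff₀ (by positivity)]
      linarith
    have hIm : HasMultiInt G (L' m) (U' m) I := by
      refine hI.of_adjacent h (hadm m) hG ?_
      refine Set.union_subset (Set.subset_inter h.subset fun x hx => Or.inl ⟨h.subset hx, hLV hx⟩)
        (Set.subset_inter ?_ (hadm m).subset)
      exact (Set.union_subset Set.inter_subset_left hball).trans h.subset
    clear hm1 hm2 hball hLV
    induction m with
    | zero => exact hIm
    | succ m ih => exact ih (hIm.of_adjacent (hadm (m + 1)) (hadm m) hG (hadj m))
  -- the second step: an exhaustion `W` that starts between `L' 0` and `U' 0`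
  have hE := hadm 0
  have hr0' : r 0 < ρ := by
    change ‖κ‖ * η ^ 0 / ρ < ρ
    rw [pow_zero, mul_one, div_lt_iff₀ hρ0, ← pow_two]
    exact hκ₁
  have hρV : Metric.closedBall (0 : ℂ) (r 0) ⊆ V₀ := by
    refine (Metric.closedBall_subset_ball (hr0'.trans_le ?_)).trans hρ
    exact le_div_self hρ0.le (by positivity) (pow_le_one₀ hη0.le hη1.le)
  have hEV : L' 0 ⊆ closure V₀ :=
    Set.union_subset (Set.inter_subset_right.trans (by rw [hV0])) (hρV.trans subset_closure)
  have hV₀₂ : closure V₀ ⊆ V₂ := h₀₁.trans (subset_closure.trans h₁₂)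
  have hV₀c : IsCompact (closure V₀) := Metric.isCompact_of_isClosed_isBounded isClosed_closure
    (Metric.isBounded_ball.subset (hV₀₂.trans hR))
  obtain ⟨W₀, hW₀, hLW₀, hW₀U, hW₀c⟩ := exists_isOpen_closure_subset hE.isCompact hE.isOpen
    hE.subset
  obtain ⟨W₁, hW₁, hW₀₁, hW₁U, hW₁c⟩ := exists_isOpen_closure_subset hW₀c hE.isOpen hW₀U
  obtain ⟨W₂, hW₂, hW₁₂, hW₂U, hW₂c⟩ := exists_isOpen_closure_subset hW₁c hE.isOpen hW₁U
  obtain ⟨W, hW0, hW2, hWo, hWc, hWT, hWρ, -⟩ :=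
    exists_exhaustion hT hη0 hη1 hTη hW₀ hW₁ hW₂ hW₀₁ hW₁₂
      (fun τ hτ x hx => hLW₀ (hE.mul_mem τ hτ x (hW₂U hx))) (ρ := r 0 * η ^ 2)
      (by have := hr0 0; positivity) (by
        rw [mul_div_cancel_right₀ _ (by positivity)]
        exact Metric.ball_subset_closedBall.trans (Set.subset_union_right.trans hLW₀))
  have hWmono : Monotone W := monotone_nat_of_le_succ fun m => subset_closure.trans (hWc m)
  have hLW : ∀ m, L' 0 ⊆ W m := fun m => by
    rw [← hW0] at hLW₀
    exact hLW₀.trans (hWmono (Nat.zero_le m))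
  have hVV₀ : ∀ x, x ∉ closure V₀ → ρ ≤ ‖x‖ := by
    intro x hx
    by_contra hlt
    refine hx (subset_closure (hρ (mem_ball_zero_iff.2 ((not_le.1 hlt).trans_le ?_))))
    exact le_div_self hρ0.le (by positivity) (pow_le_one₀ hη0.le hη1.le)
  -- two points with product `κ τ` of which one is outside `V₀`: the other one is near the origin
  have hVsmall : ∀ τ ∈ T, ∀ x, x ∉ closure V₀ → ∀ y, x * y = κ * τ → y ∈ L' 0 := by
    intro τ hτ x hx y heq
    refine Or.inr (mem_closedBall_zero_iff.2 ?_)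
    change ‖y‖ ≤ ‖κ‖ * η ^ 0 / ρ
    rw [pow_zero, mul_one, le_div_iff₀ hρ0]
    calc ‖y‖ * ρ ≤ ‖y‖ * ‖x‖ := mul_le_mul_of_nonneg_left (hVV₀ x hx) (norm_nonneg _)
      _ = ‖κ‖ * ‖τ‖ := by rw [mul_comm, ← norm_mul, heq, norm_mul]
      _ ≤ ‖κ‖ := mul_le_of_le_one_right hκn.le ((hTη τ hτ).trans hη31.le)
  have hadmW : ∀ m, AdmissiblePair P T A B κ l (closure V₀ ∩ closure (W m)) (V₂ ∩ W (m + 2)) := by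
    intro m
    refine ⟨hV₀c.inter_right isClosed_closure, h₂.inter (hWo _),
      Set.inter_subset_inter hV₀₂ ((hWc m).trans (hWmono (by omega))),
      ⟨hEV hE.zero_mem, subset_closure (hLW m hE.zero_mem)⟩, ?_, ?_, ?_, ?_, ?_⟩
    · exact fun τ hτ x hx => ⟨subset_closure (h₂₀ τ hτ x (subset_closure hx.1)),
        subset_closure (hWT m τ hτ x hx.2)⟩
    · intro τ hτ x hx y hy heq
      have key : ∀ x y : ℂ, x ∈ closure (W m) → x ∉ closure V₀ ∩ closure (W m) →
          y ∉ closure V₀ ∩ closure (W m) → x * y ≠ κ * τ := by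
        intro x y hxW hx hy heq
        have := hVsmall τ hτ x (fun hV => hx ⟨hV, hxW⟩) y heq
        exact hy ⟨hEV this, subset_closure (hLW m this)⟩
      by_cases hxW : x ∈ closure (W m)
      · exact key x y hxW hx hy heq
      · by_cases hyW : y ∈ closure (W m)
        · exact key y x hyW hy hx (by rw [mul_comm, heq])
        · exact hE.mul_ne τ hτ x (fun h => hxW (subset_closure (hLW m h))) y
            (fun h => hyW (subset_closure (hLW m h))) heq
    · exact fun hP τ hτ x hx y hy => hcr hP τ hτ x hx.1 y hy.1
    · exact fun a ha => ⟨subset_closure (hA ha), subset_closure (hLW m (hE.contains ha))⟩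
    · exact fun b hb x hx => hB b hb x hx.1
  have hIW : ∀ m, HasMultiInt G (closure V₀ ∩ closure (W m)) (V₂ ∩ W (m + 2)) I := by
    intro m
    induction m with
    | zero =>
      refine hI0.of_adjacent hE (hadmW 0) hG ?_
      refine Set.union_subset (Set.subset_inter hE.subset ?_) (Set.subset_inter ?_ (hadmW 0).subset)
      · exact Set.subset_inter (hEV.trans hV₀₂) (hLW _)
      · rw [hW0]
        exact Set.inter_subset_right.trans hW₀U
    | succ m ih =>
      refine ih.of_adjacent (hadmW m) (hadmW (m + 1)) hG ?_
      refine Set.union_subset (Set.subset_inter (hadmW m).subset ?_)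
        (Set.subset_inter ?_ (hadmW (m + 1)).subset)
      · exact Set.inter_subset_inter hV₀₂ ((hWc m).trans (hWmono (by omega)))
      · exact Set.inter_subset_inter hV₀₂ (hWc (m + 1))
  -- for large `m`, the intersection with `W m` has no effect
  obtain ⟨m, hm⟩ : ∃ m, V₂ ⊆ W m := by
    have htend : Tendsto (fun m : ℕ => η ^ m) atTop (𝓝 0) :=
      tendsto_pow_atTop_nhds_zero_of_lt_one hη0.le hη1
    have := hr0 0
    obtain ⟨m, hm⟩ := (htend.eventually_lt_const (u := r 0 * η ^ 2 / R) (by positivity)).exists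
    refine ⟨m, hR.trans ((Metric.ball_subset_ball ?_).trans (hWρ m))⟩
    rw [lt_div_iff₀ hR0] at hm
    rw [le_div_iff₀ (by positivity)]
    linarith
  have := hIW m
  rwa [Set.inter_eq_left.2 ((hV₀₂.trans hm).trans subset_closure),
    Set.inter_eq_left.2 (hm.trans (hWmono (by omega)))] at this

end Deformation

/-! ### The contours of the elliptic and of the limiting form -/

/-- The numbers `p^i q^j`, together with their limit point `0`. -/
def dpows (p q : ℂ) : Set ℂ := insert 0 (Set.range fun ij : ℕ × ℕ => p ^ ij.1 * q ^ ij.2)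

section dpows

variable {p q : ℂ}

lemma zero_mem_dpows (p q : ℂ) : (0 : ℂ) ∈ dpows p q := Set.mem_insert _ _

lemma mem_dpows (p q : ℂ) (i j : ℕ) : p ^ i * q ^ j ∈ dpows p q := Or.inr ⟨(i, j), rfl⟩

lemma isCompact_dpows (hp : ‖p‖ < 1) (hq : ‖q‖ < 1) : IsCompact (dpows p q) :=
  (tendsto_zero_iff_norm_tendsto_zero.2
    (summable_norm_pow_mul_pow hp hq).tendsto_cofinite_zero).isCompact_insert_range_of_cofinite

lemma mul_mem_dpows {s : ℂ} (hs : s ∈ dpows p q) : p * s ∈ dpows p q := by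
  rcases hs with rfl | ⟨ij, rfl⟩
  · rw [mul_zero]; exact zero_mem_dpows p q
  · exact Or.inr ⟨(ij.1 + 1, ij.2), by simp only [pow_succ']; ring⟩

lemma dpows_cases (hp : ‖p‖ < 1) (hq : ‖q‖ < 1) {s : ℂ} (hs : s ∈ dpows p q) :
    s ∈ dpows 0 q ∨ ‖s‖ ≤ ‖p‖ := by
  rcases hs with rfl | ⟨⟨i, j⟩, rfl⟩
  · exact Or.inl (zero_mem_dpows 0 q)
  · rcases i with _ | i
    · exact Or.inl (by simpa using mem_dpows 0 q 0 j)
    · right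
      rw [norm_mul, norm_pow, norm_pow, pow_succ, mul_right_comm]
      refine mul_le_of_le_one_left (norm_nonneg _) (mul_le_one₀ ?_ (by positivity) ?_) <;>
        exact pow_le_one₀ (norm_nonneg _) (by linarith)

lemma norm_le_one_of_mem_dpows (hp : ‖p‖ < 1) (hq : ‖q‖ < 1) {s : ℂ} (hs : s ∈ dpows p q) :
    ‖s‖ ≤ 1 := by
  rcases hs with rfl | ⟨⟨i, j⟩, rfl⟩
  · simp
  · rw [norm_mul, norm_pow, norm_pow]
    refine mul_le_one₀ ?_ (by positivity) ?_ <;> exact pow_le_one₀ (norm_nonneg _) (by linarith)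

end dpows

lemma eq_empty_of_isCompact_of_isOpen {Z : Set ℂ} (h1 : IsCompact Z) (h2 : IsOpen Z) : Z = ∅ := by
  rcases isClopen_iff.1 ⟨h1.isClosed, h2⟩ with h | h
  · exact h
  · exact absurd (h ▸ h1) (noncompact_univ ℂ)

namespace ClosedChain

variable {C : ClosedChain}

lemma disjoint_inside_outside {z : ℂ} (h : z ∈ C.inside) (h' : z ∈ C.outside) : False :=
  one_ne_zero (h.2.symm.trans h'.2)

lemma zero_notMem_support (C : ClosedChain) : (0 : ℂ) ∉ C.support :=
  fun h => C.ne_zero_of_mem_support h rfl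

lemma zero_mem_inside (hC : C.IsContour) {s : ℕ → ℂ} (hs : Tendsto s atTop (𝓝 0))
    (h : ∀ j, s j ∈ C.inside) : (0 : ℂ) ∈ C.inside := by
  refine (hC 0 C.zero_notMem_support).resolve_right fun h0 => ?_
  obtain ⟨j, hj⟩ := (hs.eventually ((C.isOpen_outside hC).mem_nhds h0)).exists
  exact disjoint_inside_outside (h j) hj

/-- A dilation that maps a contour to the inside and whose inverse maps it to the outside maps all
that is contained in the contour to the inside: the set of exceptions would be compact and open. -/
lemma mul_mem_inside (hC : C.IsContour) {τ : ℂ} (hτ : τ ≠ 0)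
    (h1 : ∀ c ∈ C.support, τ * c ∈ C.inside) (h2 : ∀ c ∈ C.support, τ⁻¹ * c ∈ C.outside) {x : ℂ}
    (hx : x ∈ C.filled) : τ * x ∈ C.inside := by
  have hZ : {x | x ∈ C.filled ∧ τ * x ∉ C.inside} = ∅ := by
    have hcont : Continuous fun x : ℂ => τ * x := continuous_const_mul τ
    refine eq_empty_of_isCompact_of_isOpen ?_ ?_
    · exact (C.isCompact_filled hC).inter_right ((C.isOpen_inside hC).preimage hcont).isClosed_compl
    · rw [isOpen_iff_mem_nhds]
      rintro x ⟨hx1, hx2⟩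
      have hxi : x ∈ C.inside := hx1.resolve_right fun h => hx2 (h1 x h)
      have hxs : τ * x ∉ C.support := fun h => by
        have := h2 _ h
        rw [inv_mul_cancel_left₀ hτ] at this
        exact disjoint_inside_outside hxi this
      have hxo := (hC _ hxs).resolve_left hx2
      filter_upwards [(C.isOpen_inside hC).mem_nhds hxi,
        ((C.isOpen_outside hC).preimage hcont).mem_nhds hxo] with y hy1 hy2
      exact ⟨Or.inl hy1, fun h => disjoint_inside_outside h hy2⟩
  by_contra h
  exact Set.eq_empty_iff_forall_notMem.1 hZ x ⟨hx, h⟩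

/-- If `x ↦ 1 / (τ x)` maps a contour to the outside, then no two points in or on the contour have the
product `1 / τ`: the set of the `x` that belong to such a pair would be compact and open. -/
lemma mul_mul_ne_one (hC : C.IsContour) {τ : ℂ} (h1 : ∀ c ∈ C.support, (τ * c)⁻¹ ∈ C.outside)
    {x y : ℂ} (hx : x ∈ C.filled) (hy : y ∈ C.filled) : τ * x * y ≠ 1 := by
  have hK := C.isCompact_filled hC
  have hinv : ∀ {x y : ℂ}, τ * x * y = 1 → y = (τ * x)⁻¹ := fun h =>
    eq_inv_of_mul_eq_one_right h
  have hZ : Prod.fst '' ((C.filled ×ˢ C.filled) ∩ {z : ℂ × ℂ | τ * z.1 * z.2 = 1}) = ∅ := by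
    refine eq_empty_of_isCompact_of_isOpen ?_ ?_
    · exact ((hK.prod hK).inter_right (isClosed_eq (by fun_prop) (by fun_prop))).image
        continuous_fst
    · rw [isOpen_iff_mem_nhds]
      rintro _ ⟨⟨x, y⟩, ⟨⟨hx, hy⟩, hxy⟩, rfl⟩
      change τ * x * y = 1 at hxy
      have hyx : τ * y * x = 1 := by rw [mul_right_comm]; exact hxy
      have hxi : x ∈ C.inside := hx.resolve_right fun h =>
        (C.notMem_filled_iff hC).2 (h1 x h) (hinv hxy ▸ hy)
      have hyi : y ∈ C.inside := hy.resolve_right fun h =>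
        (C.notMem_filled_iff hC).2 (h1 y h) (hinv hyx ▸ hx)
      have hne : τ * x ≠ 0 := left_ne_zero_of_mul_eq_one hxy
      have hcont : ContinuousAt (fun x => (τ * x)⁻¹) x :=
        ContinuousAt.inv₀ (by fun_prop) hne
      rw [hinv hxy] at hyi
      filter_upwards [(C.isOpen_inside hC).mem_nhds hxi,
        hcont.eventually ((C.isOpen_inside hC).mem_nhds hyi),
        ((continuous_const_mul τ).continuousAt (x := x)).eventually_ne hne] with w hw1 hw2 hw3
      exact ⟨(w, (τ * w)⁻¹), ⟨⟨Or.inl hw1, Or.inl hw2⟩, mul_inv_cancel₀ hw3⟩, rfl⟩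
  intro h
  exact Set.eq_empty_iff_forall_notMem.1 hZ x ⟨(x, y), ⟨⟨hx, hy⟩, h⟩, rfl⟩

end ClosedChain

/-- A compact set `K` with interior part `D` that are exchanged with their complements by the
inversion `x ↦ κ / x` lie around an admissible pair `L ⊆ D`, `K ⊆ U` that is exchanged in the same
way. -/
theorem AdmissiblePair.exists_of_selfDual {P : Prop} {T A B : Set ℂ} {κ l : ℂ} {K D : Set ℂ}
    (hK : IsCompact K) (hD : IsOpen D) (hDK : D ⊆ K) (hT : IsCompact T) (hA : IsCompact A)
    (hA0 : (0 : ℂ) ∈ A) (hTK : ∀ τ ∈ T, ∀ x ∈ K, τ * x ∈ D) (hAD : A ⊆ D)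
    (hDne : ∀ x ∈ D, ∀ y ∈ K, x * y ≠ κ) (hDex : ∀ x, x ∉ D → ∃ y ∈ K, x * y = κ)
    (hlT : ∀ τ ∈ T, l * κ * τ ∈ T) (hBA : ∀ β ∈ B, κ * β ∈ A) (hκ : κ ≠ 0) :
    ∃ L U, AdmissiblePair P T A B κ l L U ∧ L ⊆ D ∧ K ⊆ U ∧ (0 : ℂ) ∈ interior L := by
  have hTKc : IsCompact (Set.image2 (fun τ x : ℂ => τ * x) T K) := by
    rw [← Set.image_uncurry_prod]
    exact (hT.prod hK).image (by fun_prop)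
  obtain ⟨Y, hY, hNY, hYD, hYc⟩ := exists_isOpen_closure_subset (hTKc.union hA) hD (by
    rintro _ (⟨τ, hτ, x, hx, rfl⟩ | h)
    · exact hTK τ hτ x hx
    · exact hAD h)
  have hAY : A ⊆ Y := Set.subset_union_right.trans hNY
  -- `L` is the complement of the image of `U` under `x ↦ κ / x`
  let U : Set ℂ := {x | (∀ τ ∈ T, τ * x ∈ Y) ∧ ∀ y ∈ closure Y, x * y ≠ κ}
  let L : Set ℂ := {x | ∀ u ∈ U, x * u ≠ κ}
  have hYL : Y ⊆ L := fun y hy u hu => by rw [mul_comm]; exact hu.2 y (subset_closure hy)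
  have hU : IsOpen U := by
    refine IsOpen.inter ?_ ?_
    · exact isOpen_forall_mem_of_isCompact hT (W := {z : ℂ × ℂ | z.1 * z.2 ∈ Y})
        (hY.preimage (by fun_prop))
    · exact isOpen_forall_mem_of_isCompact hYc (W := {z : ℂ × ℂ | z.2 * z.1 ≠ κ})
        (isOpen_ne_fun (by fun_prop) (by fun_prop))
  have hKU : K ⊆ U := fun x hx => ⟨fun τ hτ => hNY (Or.inl ⟨τ, hτ, x, hx, rfl⟩), fun y hy => by
    rw [mul_comm]; exact hDne y (hYD hy) x hx⟩
  have hLD : L ⊆ D := fun x hx => by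
    by_contra h
    obtain ⟨y, hy, hxy⟩ := hDex x h
    exact hx y (hKU hy) hxy
  have hLc : IsClosed L := by
    have h1 : Lᶜ = {0}ᶜ ∩ (fun x => κ / x) ⁻¹' U := by
      ext x
      simp only [L, Set.mem_compl_iff, Set.mem_ofPred_eq, not_forall, not_not, Set.mem_inter_iff,
        Set.mem_singleton_iff, Set.mem_preimage]
      constructor
      · rintro ⟨u, hu, rfl⟩
        have hx := left_ne_zero_of_mul hκ
        exact ⟨hx, by rwa [mul_div_cancel_left₀ _ hx]⟩
      · rintro ⟨hx, hu⟩
        exact ⟨_, hu, mul_div_cancel₀ _ hx⟩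
    rw [← isOpen_compl_iff, h1]
    exact ContinuousOn.isOpen_inter_preimage (continuousOn_const.div continuousOn_id fun x hx => hx)
      isOpen_compl_singleton hU
  refine ⟨L, U, ⟨hK.of_isClosed_subset hLc (hLD.trans hDK), hU, hLD.trans (hDK.trans hKU),
    hYL (hAY hA0), fun τ hτ x hx => hYL (hx.1 τ hτ), ?_, ?_, hAY.trans hYL, ?_⟩, hLD, hKU,
    mem_interior.2 ⟨Y, hYL, hY, hAY hA0⟩⟩
  · intro τ hτ x hx y hy hxy
    simp only [L, Set.mem_ofPred_eq, not_forall, not_not] at hx hy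
    obtain ⟨u, hu, hxu⟩ := hx
    obtain ⟨u', hu', hyu⟩ := hy
    refine hu'.2 (τ * u) (subset_closure (hu.1 τ hτ)) (mul_left_cancel₀ hκ ?_)
    calc κ * (u' * (τ * u)) = x * y * (u * u') := by rw [hxy]; ring
      _ = (x * u) * (y * u') := by ring
      _ = κ * κ := by rw [hxu, hyu]
  · intro _ τ hτ x hx y hy h
    refine hy.2 _ (subset_closure (hx.1 _ (hlT τ hτ))) ?_
    calc y * (l * κ * τ * x) = κ * (l * τ * x * y) := by ring
      _ = κ := by rw [h, mul_one]
  · intro β hβ x hx h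
    refine hx.2 _ (subset_closure (hAY (hBA β hβ))) ?_
    calc x * (κ * β) = κ * (β * x) := by ring
      _ = κ := by rw [h, mul_one]

section

variable {p q t : ℂ}

/-- The contours of the elliptic form, dilated by `u`, lie in `U \ L` for an admissible pair. -/
theorem IsFormContour.exists_admissiblePair {τ' : Fin 6 → ℂ} {C : ClosedChain}
    (hC : IsFormContour p q t τ' C) (hp0 : p ≠ 0) (hp : ‖p‖ < 1) (hq0 : q ≠ 0) (hq : ‖q‖ < 1)
    (ht0 : t ≠ 0) {u κ l : ℂ} (hu : u ≠ 0) (hκ : κ = u ^ 2) (hl : l * κ = p) {P : Prop}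
    {B : Set ℂ} (hB : ∀ β ∈ B, ∃ r, ∃ s ∈ dpows p q, κ * β = s * (u * τ' r))
    (hm : ContinuousOn (fun z : ℂ => u * z) {0}ᶜ) (hm' : ContinuousOn (fun z : ℂ => u * z⁻¹) {0}ᶜ) :
    ∃ L U, AdmissiblePair P ((fun s => t * s) '' dpows p q)
        (⋃ r, (fun s => s * (u * τ' r)) '' dpows p q) B κ l L U ∧ (0 : ℂ) ∈ interior L ∧
      (C.cycle _ hm).Separates L U ∧ (C.cycle _ hm').Separates L U := by
  have hCc := hC.isContour
  have h0 : (0 : ℂ) ∈ C.inside := by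
    have h1 : Tendsto (fun j : ℕ => p ^ 0 * q ^ j * τ' 0) atTop (𝓝 0) := by
      have := (tendsto_pow_atTop_nhds_zero_of_norm_lt_one hq).mul_const (τ' 0)
      simpa using this
    exact C.zero_mem_inside hCc h1 fun j => hC.contains 0 0 j
  have hcont : Continuous fun z : ℂ => z / u := continuous_id.div_const u
  have himg : (fun z : ℂ => z / u) ⁻¹' C.filled = (fun z => u * z) '' C.filled := by
    ext z
    constructor
    · intro h
      exact ⟨z / u, h, by field_simp⟩
    · rintro ⟨y, hy, rfl⟩
      simpa [hu] using hy
  have hTin : ∀ i j : ℕ, ∀ x ∈ C.filled, p ^ i * q ^ j * t * x ∈ C.inside := by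
    intro i j x hx
    have hne : p ^ i * q ^ j * t ≠ 0 := by positivity
    refine C.mul_mem_inside hCc hne (hC.contains_image i j) (fun c hc => ?_) hx
    have h2 := hC.contains_image i j _ (hC.support_inv c hc)
    have hc0 := C.ne_zero_of_mem_support hc
    have h3 := hC.inside_inv _ h2 (mul_ne_zero hne (inv_ne_zero hc0))
    rwa [mul_inv, inv_inv] at h3
  have hdp := isCompact_dpows hp hq
  have hκ0 : κ ≠ 0 := by rw [hκ]; positivity
  have key : ∃ L U, AdmissiblePair P ((fun s => t * s) '' dpows p q)
      (⋃ r, (fun s => s * (u * τ' r)) '' dpows p q) B κ l L U ∧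
      L ⊆ (fun z => z / u) ⁻¹' C.inside ∧ (fun z => z / u) ⁻¹' C.filled ⊆ U ∧
      (0 : ℂ) ∈ interior L := by
    refine AdmissiblePair.exists_of_selfDual
      (by rw [himg]; exact (C.isCompact_filled hCc).image (by fun_prop))
      ((C.isOpen_inside hCc).preimage hcont) (fun x hx => Or.inl hx) (hdp.image (by fun_prop))
      (isCompact_iUnion fun r => hdp.image (by fun_prop))
      (Set.mem_iUnion.2 ⟨0, 0, zero_mem_dpows p q, by simp⟩) ?_ ?_ ?_ ?_ ?_ ?_ hκ0
    · rintro _ ⟨s, hs, rfl⟩ x hx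
      change t * s * x / u ∈ C.inside
      rcases hs with rfl | ⟨⟨i, j⟩, rfl⟩
      · simpa using h0
      · have := hTin i j _ hx
        convert this using 1
        simp only; ring
    · intro x hx
      obtain ⟨r, s, hs, rfl⟩ := Set.mem_iUnion.1 hx
      change s * (u * τ' r) / u ∈ C.inside
      rcases hs with rfl | ⟨⟨i, j⟩, rfl⟩
      · simpa using h0
      · have := hC.contains r i j
        convert this using 1
        field_simp
    · intro x hx y hy hxy
      have hx0 : x ≠ 0 := by rintro rfl; rw [zero_mul] at hxy; exact hκ0 hxy.symm
      have h1 := hC.inside_inv _ hx (div_ne_zero hx0 hu)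
      refine (C.notMem_filled_iff hCc).2 h1 ?_
      have h2 : (x / u)⁻¹ = y / u := by
        rw [inv_div, div_eq_div_iff hx0 hu, ← pow_two, ← hκ, ← hxy, mul_comm]
      rw [h2]; exact hy
    · intro x hx
      have hx0 : x ≠ 0 := by rintro rfl; exact hx (by simpa using h0)
      refine ⟨κ / x, ?_, by field_simp⟩
      have h2 : κ / x / u = (x / u)⁻¹ := by rw [hκ]; field_simp
      change κ / x / u ∈ C.filled
      rw [h2]
      by_cases hs : x / u ∈ C.support
      · exact Or.inr (hC.support_inv _ hs)
      · exact Or.inl (hC.outside_inv _ ((hCc _ hs).resolve_left hx) (div_ne_zero hx0 hu))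
    · rintro _ ⟨s, hs, rfl⟩
      exact ⟨p * s, mul_mem_dpows hs, by rw [hl]; ring⟩
    · intro β hβ
      obtain ⟨r, s, hs, h⟩ := hB β hβ
      exact Set.mem_iUnion.2 ⟨r, s, hs, h.symm⟩
  obtain ⟨L, U, h, hLD, hKU, hL0⟩ := key
  exact ⟨L, U, h, hL0, C.separates_mul hCc hu hm hLD hKU, C.separates_mul_inv hCc h0
    hC.support_inv hC.inside_inv hC.outside_inv hu hm' hLD hKU⟩

/-- The exponents of `p` in the reciprocals of those poles of the dilated integrand that are to be
avoided: the pole at `x = 1 / (p^i q^j p^e τ'_r)` survives in the limit if `e = 0`. -/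
noncomputable def poleExp (a b : Fin 6) (α : Fin 6 → ℝ) (ζ : ℝ) (r : Fin 6) : ℝ :=
  if r = a ∨ r = b then 1 + 2 * ζ else α r + ζ

/-- Around a contour of the limiting form there is a triple of open sets as in `HasMultiInt.of_triple`,
for the set of dilations `t q^j` and the poles that survive in the limit. The closure `{q^j} ∪ {0}` of
the powers of `q` is compact, so the conditions on the contour extend to neighbourhoods. -/
theorem IsLimitContour.exists_triple {n : ℕ} {τ' : Fin 6 → ℂ} {a b : Fin 6} {α : Fin 6 → ℝ} {ζ : ℝ}
    {C : ClosedChain} (hC : IsLimitContour n q t τ' a b α ζ C) (hq0 : q ≠ 0) (hq : ‖q‖ < 1)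
    (ht0 : t ≠ 0) :
    ∃ (V₀ V₁ V₂ : Set ℂ) (ρ R : ℝ), IsOpen V₀ ∧ IsOpen V₁ ∧ IsOpen V₂ ∧ closure V₀ ⊆ V₁ ∧
      closure V₁ ⊆ V₂ ∧ 0 < ρ ∧ 0 < R ∧ Metric.ball 0 ρ ⊆ V₀ ∧ closure V₂ ⊆ Metric.ball 0 R ∧
      closure V₀ ⊆ C.inside ∧ C.filled ⊆ V₂ ∧
      (∀ s ∈ dpows 0 q, ∀ x ∈ closure V₂, t * s * x ∈ V₀) ∧
      (∀ s ∈ dpows 0 q, s * τ' a ∈ V₀ ∧ s * τ' b ∈ V₀) ∧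
      (∀ r, poleExp a b α ζ r = 0 → ∀ s ∈ dpows 0 q, ∀ x ∈ V₂, s * τ' r * x ≠ 1) ∧
      (2 ≤ n → ζ = -1 / 2 → ∀ s ∈ dpows 0 q, ∀ x ∈ V₂, ∀ y ∈ V₂, t * s * x * y ≠ 1) := by
  have hCc := hC.isContour
  have hK := C.isCompact_filled hCc
  have hI := C.isOpen_inside hCc
  have h0 : (0 : ℂ) ∈ C.inside := by
    have h1 : Tendsto (fun j : ℕ => q ^ j * τ' a) atTop (𝓝 0) := by
      have := (tendsto_pow_atTop_nhds_zero_of_norm_lt_one hq).mul_const (τ' a)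
      simpa using this
    exact C.zero_mem_inside hCc h1 hC.contains_a
  have hdp : IsCompact (dpows 0 q) := isCompact_dpows (by simp) hq
  have hcase : ∀ s ∈ dpows 0 q, s = 0 ∨ ∃ j : ℕ, s = q ^ j := by
    rintro s (rfl | ⟨⟨i, j⟩, rfl⟩)
    · exact Or.inl rfl
    · rcases i with _ | i
      · exact Or.inr ⟨j, by simp⟩
      · left; simp
  have hTin : ∀ s ∈ dpows 0 q, ∀ x ∈ C.filled, t * s * x ∈ C.inside := by
    intro s hs x hx
    rcases hcase s hs with rfl | ⟨j, rfl⟩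
    · simpa using h0
    · exact C.mul_mem_inside hCc (by positivity) (fun c hc => (hC.contains_image j c hc).1)
        (fun c hc => (hC.contains_image j c hc).2) hx
  have hpole : ∀ r, poleExp a b α ζ r = 0 → ∀ j : ℕ, (q ^ j * τ' r)⁻¹ ∈ C.outside := by
    intro r hr j
    unfold poleExp at hr
    split_ifs at hr with h
    · have hζ : ζ = -1 / 2 := by linarith
      rcases h with rfl | rfl
      · exact hC.excludes_a hζ j
      · exact hC.excludes_b hζ j
    · exact hC.excludes r (by linarith) j
  let S : Set ℂ := ⋃ r, ⋃ (_ : poleExp a b α ζ r = 0), (fun s => s * τ' r) '' dpows 0 q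
  have hS : IsCompact S := isCompact_iUnion fun r => isCompact_iUnion fun _ =>
    hdp.image (by fun_prop)
  obtain ⟨O₃, hO₃, hKO₃, hcr⟩ : ∃ O₃ : Set ℂ, IsOpen O₃ ∧ C.filled ⊆ O₃ ∧
      (2 ≤ n → ζ = -1 / 2 → ∀ s ∈ dpows 0 q, ∀ x ∈ O₃, ∀ y ∈ O₃, t * s * x * y ≠ 1) := by
    by_cases h : 2 ≤ n ∧ ζ = -1 / 2
    · have hopen := isOpen_forall_mem_of_isCompact hdp
        (W := {z : ℂ × (ℂ × ℂ) | t * z.1 * z.2.1 * z.2.2 ≠ 1})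
        (isOpen_ne_fun (by fun_prop) (by fun_prop))
      obtain ⟨v, w, hv, hw, hKv, hKw, hvw⟩ := generalized_tube_lemma hK hK hopen (by
        rintro ⟨x, y⟩ ⟨hx, hy⟩ s hs
        rcases hcase s hs with rfl | ⟨j, rfl⟩
        · simp
        · exact C.mul_mul_ne_one hCc (hC.excludes_image_inv h.2 h.1 j) hx hy)
      exact ⟨v ∩ w, hv.inter hw, Set.subset_inter hKv hKw, fun _ _ s hs x hx y hy =>
        hvw (Set.mk_mem_prod hx.1 hy.2) s hs⟩
    · exact ⟨Set.univ, isOpen_univ, Set.subset_univ _, fun h1 h2 => absurd ⟨h1, h2⟩ h⟩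
  -- the points near which contours may pass: by compactness, an open neighbourhood of the contour
  -- and its inside
  let O : Set ℂ := ({x | ∀ s ∈ dpows 0 q, t * s * x ∈ C.inside} ∩ {x | ∀ s ∈ S, s * x ≠ 1}) ∩ O₃
  have hO : IsOpen O := by
    refine (IsOpen.inter ?_ ?_).inter hO₃
    · exact isOpen_forall_mem_of_isCompact hdp (W := {z : ℂ × ℂ | t * z.1 * z.2 ∈ C.inside})
        (hI.preimage (by fun_prop))
    · exact isOpen_forall_mem_of_isCompact hS (W := {z : ℂ × ℂ | z.1 * z.2 ≠ 1})
        (isOpen_ne_fun (by fun_prop) (by fun_prop))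
  have hKO : C.filled ⊆ O := by
    refine Set.subset_inter (Set.subset_inter (fun x hx s hs => hTin s hs x hx) ?_) hKO₃
    intro x hx s hs hsx
    obtain ⟨r, hr⟩ := Set.mem_iUnion.1 hs
    obtain ⟨hr0, s, hs', rfl⟩ := Set.mem_iUnion.1 hr
    rcases hcase s hs' with rfl | ⟨j, rfl⟩
    · simp at hsx
    · refine (C.notMem_filled_iff hCc).2 (hpole r hr0 j) ?_
      rwa [← eq_inv_of_mul_eq_one_right hsx]
  obtain ⟨V₂, hV₂, hKV₂, hV₂O, hV₂c⟩ := exists_isOpen_closure_subset hK hO hKO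
  have hN : IsCompact (Set.image2 (fun s x : ℂ => t * s * x) (dpows 0 q) (closure V₂) ∪
      ((fun s => s * τ' a) '' dpows 0 q ∪ (fun s => s * τ' b) '' dpows 0 q)) := by
    refine IsCompact.union ?_ ((hdp.image (by fun_prop)).union (hdp.image (by fun_prop)))
    rw [← Set.image_uncurry_prod]
    exact (hdp.prod hV₂c).image (by fun_prop)
  obtain ⟨V₀, hV₀, hNV₀, hV₀I, hV₀c⟩ := exists_isOpen_closure_subset hN hI (by
    rintro _ (⟨s, hs, x, hx, rfl⟩ | ⟨s, hs, rfl⟩ | ⟨s, hs, rfl⟩)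
    · exact (hV₂O hx).1.1 s hs
    · rcases hcase s hs with rfl | ⟨j, rfl⟩
      · simpa using h0
      · exact hC.contains_a j
    · rcases hcase s hs with rfl | ⟨j, rfl⟩
      · simpa using h0
      · exact hC.contains_b j)
  obtain ⟨V₁, hV₁, hV₀₁, hV₁I, -⟩ := exists_isOpen_closure_subset hV₀c hI hV₀I
  have h0V₀ : (0 : ℂ) ∈ V₀ := hNV₀ (Or.inr (Or.inl ⟨0, zero_mem_dpows 0 q, by simp⟩))
  obtain ⟨ρ, hρ, hρV⟩ := Metric.isOpen_iff.1 hV₀ 0 h0V₀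
  obtain ⟨R, hR, hRV⟩ := hV₂c.isBounded.subset_ball_lt 0 0
  refine ⟨V₀, V₁, V₂, ρ, R, hV₀, hV₁, hV₂, hV₀₁,
    hV₁I.trans ((Set.subset_union_left : C.inside ⊆ C.filled).trans hKV₂), hρ, hR, hρV, hRV, hV₀I,
    hKV₂, fun s hs x hx => hNV₀ (Or.inl ⟨s, hs, x, hx, rfl⟩),
    fun s hs => ⟨hNV₀ (Or.inr (Or.inl ⟨s, hs, rfl⟩)), hNV₀ (Or.inr (Or.inr ⟨s, hs, rfl⟩))⟩,
    fun r hr s hs x hx => ?_, fun hn hζ s hs x hx y hy => hcr hn hζ s hs x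
      (hV₂O (subset_closure hx)).2 y (hV₂O (subset_closure hy)).2⟩
  exact (hV₂O (subset_closure hx)).1.2 _ (Set.mem_iUnion.2 ⟨r, Set.mem_iUnion.2 ⟨hr, s, hs, rfl⟩⟩)

end

/-! ### Independence of the contour -/

lemma cpow_ofReal_add {p : ℂ} (hp : p ≠ 0) (x y : ℝ) :
    p ^ ((x + y : ℝ) : ℂ) = p ^ (x : ℂ) * p ^ (y : ℂ) := by
  rw [Complex.ofReal_add, Complex.cpow_add _ _ hp]

lemma eventually_norm_cpow_lt {e c : ℝ} (he : 0 < e) (hc : 0 < c) :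
    ∀ᶠ p in 𝓝[≠] (0 : ℂ), ‖p ^ (e : ℂ)‖ < c := by
  have h1 : Tendsto (fun p : ℂ => ‖p‖ ^ e) (𝓝 0) (𝓝 0) := by
    have : ContinuousAt (fun p : ℂ => ‖p‖ ^ e) 0 :=
      continuous_norm.continuousAt.rpow_const (Or.inr he.le)
    simpa [ContinuousAt, he.ne'] using this
  filter_upwards [(h1.mono_left nhdsWithin_le_nhds).eventually_lt_const hc] with p hp
  rwa [Complex.norm_cpow_real]

/-- The poles to be surrounded, in the variables `x = p^(-ζ) z`. -/
noncomputable def innerPoles (q : ℂ) (τ' : Fin 6 → ℂ) (α : Fin 6 → ℝ) (ζ : ℝ) (p : ℂ) : Set ℂ :=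
  ⋃ r, (fun s => s * (p ^ ((-ζ : ℝ) : ℂ) * (p ^ (α r : ℂ) * τ' r))) '' dpows p q

/-- The reciprocals of the poles to be avoided, in the variables `x = p^(-ζ) z`. -/
noncomputable def outerPoleInvs (q : ℂ) (τ' : Fin 6 → ℂ) (a b : Fin 6) (α : Fin 6 → ℝ) (ζ : ℝ)
    (p : ℂ) : Set ℂ :=
  ⋃ r, (fun s => s * (p ^ (poleExp a b α ζ r : ℂ) * τ' r)) '' dpows p q

/-- The functions whose integrals over the contours of the elliptic form agree with those over the
contours of the limiting form. -/
def IsDeformable (n : ℕ) (q t : ℂ) (τ' : Fin 6 → ℂ) (a b : Fin 6) (α : Fin 6 → ℝ) (ζ : ℝ) (p : ℂ)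
    (G : (Fin n → ℂ) → ℂ) : Prop :=
  ∀ L U, AdmissiblePair (2 ≤ n) ((fun s => t * s) '' dpows p q) (innerPoles q τ' α ζ p)
    (outerPoleInvs q τ' a b α ζ p) (p ^ ((-2 * ζ : ℝ) : ℂ)) (p ^ ((1 + 2 * ζ : ℝ) : ℂ)) L U →
    SepHolomorphic G (U \ L)

/-- For small `p`, the integral over any contour of the elliptic form, in rescaled and possibly
inverted variables, is the integral over a given contour of the limiting form. -/
theorem IsLimitContour.eventually_torusIntegral_eq {n : ℕ} {q t : ℂ} {τ' : Fin 6 → ℂ} {a b : Fin 6}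
    {α : Fin 6 → ℝ} {ζ : ℝ} {C : ClosedChain} (hC : IsLimitContour n q t τ' a b α ζ C)
    (hq0 : q ≠ 0) (hq : ‖q‖ < 1) (ht0 : t ≠ 0) (ht : ‖t‖ < 1) (hζ : -1 / 2 ≤ ζ) (hζ0 : ζ < 0)
    (ha : α a = ζ) (hb : α b = ζ) (hα : ∀ r, r ≠ a → r ≠ b → -ζ ≤ α r) :
    ∀ᶠ p in 𝓝[≠] (0 : ℂ), ∀ G : (Fin n → ℂ) → ℂ, IsDeformable n q t τ' a b α ζ p G →
      ContinuousOn G (Set.univ.pi fun _ => C.support) ∧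
      ∀ D, IsFormContour p q t (fun r => p ^ (α r : ℂ) * τ' r) D → ∀ ε : Fin n → Bool,
          ContinuousOn (fun z => G fun j => p ^ ((-ζ : ℝ) : ℂ) * signPow (ε j) (z j))
            (Set.univ.pi fun _ => D.support) ∧
          D.torusIntegral n (fun z => G fun j => p ^ ((-ζ : ℝ) : ℂ) * signPow (ε j) (z j)) =
            C.torusIntegral n G := by
  obtain ⟨V₀, V₁, V₂, ρ, R, hV₀, hV₁, hV₂, hV₀₁, hV₁₂, hρ, hR, hρV, hRV, hV₀I, hKV, hTV, habV, hBV,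
    hcrV⟩ := hC.exists_triple hq0 hq ht0
  obtain ⟨η, hη0, hη1, hη⟩ : ∃ η : ℝ, 0 < η ∧ η < 1 ∧ η ^ 3 = ‖t‖ := by
    have ht' : 0 < ‖t‖ := norm_pos_iff.2 ht0
    refine ⟨‖t‖ ^ (1 / 3 : ℝ), by positivity, Real.rpow_lt_one ht'.le ht (by norm_num), ?_⟩
    rw [← Real.rpow_natCast, ← Real.rpow_mul ht'.le]
    norm_num
  let M : ℝ := 1 + ∑ r, ‖τ' r‖
  have hM0 : 0 < M := by
    have : 0 ≤ ∑ r, ‖τ' r‖ := Finset.sum_nonneg fun _ _ => norm_nonneg _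
    linarith
  have hM : ∀ r, ‖τ' r‖ ≤ M := fun r => by
    have := Finset.single_le_sum (f := fun r => ‖τ' r‖) (fun _ _ => norm_nonneg _)
      (Finset.mem_univ r)
    simp only [M]
    linarith
  let ρ₁ := ρ * η ^ 2
  have hρ₁ : 0 < ρ₁ := by positivity
  -- a bound `c` for the positive powers of `p` that makes every number with such a factor harmless
  obtain ⟨c, hc0, hc1, hcT, hcA, hcB, hcl, hcκ₁, hcκ₂, hcκ₃, hcκ₄⟩ : ∃ c : ℝ, 0 < c ∧ c * 1 < 1 ∧
      c * (‖t‖ * R) < ρ ∧ c * M < ρ ∧ c * (M * R) < 1 ∧ c * (‖t‖ * R * R) < 1 ∧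
      c * 1 < ρ₁ ^ 2 ∧ c * R < ρ₁ * η ^ 2 ∧ c * 1 < ρ₁ * R * η ∧ c * M < ρ₁ * η ^ 3 := by
    have h : ∀ x y : ℝ, 0 < y → ∀ᶠ c in 𝓝[>] (0 : ℝ), c * x < y := fun x y hy => by
      have : Tendsto (fun c : ℝ => c * x) (𝓝[>] 0) (𝓝 (0 * x)) :=
        (tendsto_id.mono_left nhdsWithin_le_nhds).mul_const x
      rw [zero_mul] at this
      exact this.eventually_lt_const hy
    exact ((eventually_mem_nhdsWithin.and (h _ _ one_pos)).and ((h _ _ hρ).and ((h _ _ hρ).and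
      ((h _ _ one_pos).and ((h _ _ one_pos).and ((h _ _ (by positivity)).and
      ((h _ _ (by positivity)).and ((h _ _ (by positivity)).and (h _ _ (by positivity)))))))))).exists.imp
      fun c hc => ⟨hc.1.1, hc.1.2, hc.2⟩
  rw [mul_one] at hc1 hcκ₁ hcκ₃
  have hev : ∀ e : ℝ, ∀ᶠ p in 𝓝[≠] (0 : ℂ), 0 < e → ‖p ^ (e : ℂ)‖ < c := fun e => by
    by_cases he : 0 < e
    · filter_upwards [eventually_norm_cpow_lt he hc0] with p hp _ using hp
    · exact Eventually.of_forall fun p h => absurd h he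
  have he0 : ∀ r, 0 ≤ poleExp a b α ζ r := fun r => by
    unfold poleExp
    split_ifs with h
    · linarith
    · push Not at h
      linarith [hα r h.1 h.2]
  filter_upwards [hev 1, hev (-2 * ζ), hev (1 + 2 * ζ), eventually_all.2 fun r => hev (α r - ζ),
    eventually_all.2 fun r => hev (poleExp a b α ζ r), eventually_mem_nhdsWithin]
    with p hp1 hpκ hpl hpA hpB hp0 G hG
  replace hp0 : p ≠ 0 := hp0
  replace hp1 : ‖p‖ < c := by simpa using hp1 one_pos
  replace hpκ := hpκ (by linarith)
  have hp : ‖p‖ < 1 := hp1.trans hc1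
  have hcases : ∀ s ∈ dpows p q, s ∈ dpows 0 q ∨ ‖s‖ ≤ c := fun s hs =>
    (dpows_cases hp hq hs).imp_right fun h => h.trans hp1.le
  -- a number from one of the geometric progressions is a limiting one or small
  have hcases' : ∀ s ∈ dpows p q, ∀ e : ℝ, 0 ≤ e → (0 < e → ‖p ^ (e : ℂ)‖ < c) →
      (e = 0 ∧ s ∈ dpows 0 q) ∨ ‖s * p ^ (e : ℂ)‖ ≤ c := by
    intro s hs e he hec
    have hs1 := norm_le_one_of_mem_dpows hp hq hs
    rcases he.eq_or_lt with rfl | he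
    · rcases hcases s hs with h | h
      · exact Or.inl ⟨rfl, h⟩
      · right; simpa using h
    · right
      rw [norm_mul]
      exact (mul_le_of_le_one_left (norm_nonneg _) hs1).trans (hec he).le
  let u : ℂ := p ^ ((-ζ : ℝ) : ℂ)
  have hu : u ≠ 0 := by simp [u, Complex.cpow_eq_zero_iff, hp0]
  let κ : ℂ := p ^ ((-2 * ζ : ℝ) : ℂ)
  let l : ℂ := p ^ ((1 + 2 * ζ : ℝ) : ℂ)
  have hκu : κ = u ^ 2 := by
    rw [pow_two]
    change p ^ ((-2 * ζ : ℝ) : ℂ) = p ^ ((-ζ : ℝ) : ℂ) * p ^ ((-ζ : ℝ) : ℂ)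
    rw [← cpow_ofReal_add hp0, show -ζ + -ζ = -2 * ζ by ring]
  have hlκ : l * κ = p := by
    change p ^ ((1 + 2 * ζ : ℝ) : ℂ) * p ^ ((-2 * ζ : ℝ) : ℂ) = p
    rw [← cpow_ofReal_add hp0, show 1 + 2 * ζ + -2 * ζ = 1 by ring]
    simp
  have hκ0 : κ ≠ 0 := by rw [hκu]; positivity
  let T : Set ℂ := (fun s => t * s) '' dpows p q
  have hm : ContinuousOn (fun z : ℂ => u * z) {0}ᶜ := by fun_prop
  have hm' : ContinuousOn (fun z : ℂ => u * z⁻¹) {0}ᶜ :=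
    continuousOn_const.mul (continuousOn_id.inv₀ fun z hz => hz)
  have hm1 : ContinuousOn (fun z : ℂ => 1 * z) {0}ᶜ := by fun_prop
  have hTη : ∀ τ ∈ T, ‖τ‖ ≤ η ^ 3 := by
    rintro _ ⟨s, hs, rfl⟩
    rw [norm_mul, hη]
    exact mul_le_of_le_one_right (norm_nonneg _) (norm_le_one_of_mem_dpows hp hq hs)
  have hTη' : ∃ τ ∈ T, ‖τ‖ = η ^ 3 :=
    ⟨t * (p ^ 0 * q ^ 0), ⟨_, mem_dpows p q 0 0, rfl⟩, by simp [hη]⟩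
  have hV₂R : ∀ x ∈ closure V₂, ‖x‖ < R := fun x hx => mem_ball_zero_iff.1 (hRV hx)
  have h₂₀ : ∀ τ ∈ T, ∀ x ∈ closure V₂, τ * x ∈ V₀ := by
    rintro _ ⟨s, hs, rfl⟩ x hx
    rcases hcases s hs with h | h
    · exact hTV s h x hx
    · refine hρV (mem_ball_zero_iff.2 ?_)
      have := (hV₂R x hx).le
      calc ‖t * s * x‖ = ‖s‖ * (‖t‖ * ‖x‖) := by rw [norm_mul, norm_mul]; ring
        _ ≤ c * (‖t‖ * R) := by gcongr
        _ < ρ := hcT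
  have hA : innerPoles q τ' α ζ p ⊆ V₀ := by
    intro x hx
    obtain ⟨r, s, hs, rfl⟩ := Set.mem_iUnion.1 hx
    have h1 : s * (p ^ ((-ζ : ℝ) : ℂ) * (p ^ (α r : ℂ) * τ' r)) =
        s * p ^ ((α r - ζ : ℝ) : ℂ) * τ' r := by
      rw [← mul_assoc (p ^ _), ← cpow_ofReal_add hp0, neg_add_eq_sub]; ring
    simp only [h1]
    have hre : r = a ∨ r = b ∨ 0 < α r - ζ := by
      by_cases h1 : r = a
      · exact Or.inl h1
      by_cases h2 : r = b
      · exact Or.inr (Or.inl h2)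
      · exact Or.inr (Or.inr (by linarith [hα r h1 h2]))
    have hre0 : 0 ≤ α r - ζ := by
      rcases hre with rfl | rfl | h
      · rw [ha, sub_self]
      · rw [hb, sub_self]
      · exact h.le
    rcases hcases' s hs _ hre0 (hpA r) with ⟨h0, h⟩ | h
    · rw [h0, Complex.ofReal_zero, Complex.cpow_zero, mul_one]
      rcases hre with rfl | rfl | h'
      · exact (habV s h).1
      · exact (habV s h).2
      · exact absurd h0 h'.ne'
    · refine hρV (mem_ball_zero_iff.2 ?_)
      rw [norm_mul]
      exact (mul_le_mul h (hM r) (norm_nonneg _) hc0.le).trans_lt hcA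
  have hB : ∀ b' ∈ outerPoleInvs q τ' a b α ζ p, ∀ x ∈ V₂, b' * x ≠ 1 := by
    intro b' hb' x hx
    obtain ⟨r, s, hs, rfl⟩ := Set.mem_iUnion.1 hb'
    rcases hcases' s hs _ (he0 r) (hpB r) with ⟨h0, h⟩ | h
    · simp only [h0, Complex.ofReal_zero, Complex.cpow_zero, one_mul]
      exact hBV r h0 s h x hx
    · intro h1
      have hxR := (hV₂R x (subset_closure hx)).le
      have : ‖s * (p ^ (poleExp a b α ζ r : ℂ) * τ' r) * x‖ < 1 := by
        rw [← mul_assoc, norm_mul, norm_mul, mul_assoc]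
        refine (mul_le_mul h (mul_le_mul (hM r) hxR (norm_nonneg _) hM0.le) (by positivity)
          hc0.le).trans_lt hcB
      rw [h1, norm_one] at this
      exact lt_irrefl _ this
  have hBβ : ∀ b' ∈ outerPoleInvs q τ' a b α ζ p, ‖b'‖ ≤ M := by
    intro b' hb'
    obtain ⟨r, s, hs, rfl⟩ := Set.mem_iUnion.1 hb'
    have h1 : ‖p ^ (poleExp a b α ζ r : ℂ)‖ ≤ 1 := by
      rcases (he0 r).eq_or_lt with h | h
      · rw [← h]; simp
      · exact (hpB r h).le.trans hc1.le
    rw [norm_mul, norm_mul]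
    calc ‖s‖ * (‖p ^ (poleExp a b α ζ r : ℂ)‖ * ‖τ' r‖) ≤ 1 * (1 * M) := by
          have := norm_le_one_of_mem_dpows hp hq hs
          have := hM r
          gcongr
      _ = M := by ring
  have hl1 : ‖l‖ ≤ 1 := by
    rcases (by linarith : (0 : ℝ) ≤ 1 + 2 * ζ).eq_or_lt with h | h
    · simp only [l, ← h]; simp
    · exact (hpl h).le.trans hc1.le
  have hcr : 2 ≤ n → ∀ τ ∈ T, ∀ x ∈ V₂, ∀ y ∈ V₂, l * τ * x * y ≠ 1 := by
    rintro hn _ ⟨s, hs, rfl⟩ x hx y hy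
    rcases hcases' s hs (1 + 2 * ζ) (by linarith) hpl with ⟨h0, h⟩ | h
    · simp only [l, h0, Complex.ofReal_zero, Complex.cpow_zero, one_mul]
      exact hcrV hn (by linarith) s h x hx y hy
    · intro h1
      have hxR := (hV₂R x (subset_closure hx)).le
      have hyR := (hV₂R y (subset_closure hy)).le
      have : ‖l * (t * s) * x * y‖ < 1 := by
        calc ‖l * (t * s) * x * y‖ = ‖s * l‖ * (‖t‖ * ‖x‖ * ‖y‖) := by
              simp only [norm_mul]; ring
          _ ≤ c * (‖t‖ * R * R) := by gcongr
          _ < 1 := hcl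
      rw [h1, norm_one] at this
      exact lt_irrefl _ this
  -- two points outside `V₀` have a product of absolute value at least `ρ²`, more than `‖κ‖`
  have hadm : AdmissiblePair (2 ≤ n) T (innerPoles q τ' α ζ p) (outerPoleInvs q τ' a b α ζ p) κ l
      (closure V₀) V₂ := by
    have hV₀₂ : closure V₀ ⊆ V₂ := hV₀₁.trans (subset_closure.trans hV₁₂)
    refine ⟨(C.isCompact_filled hC.isContour).of_isClosed_subset isClosed_closure
      (hV₀I.trans Set.subset_union_left), hV₂, hV₀₂, subset_closure
      (hρV (Metric.mem_ball_self hρ)), fun τ hτ x hx => subset_closure (h₂₀ τ hτ x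
      (subset_closure hx)), ?_, hcr, hA.trans subset_closure, hB⟩
    rintro _ ⟨s, hs, rfl⟩ x hx y hy hxy
    have hout : ∀ x, x ∉ closure V₀ → ρ ≤ ‖x‖ := fun x hx => by
      by_contra h
      exact hx (subset_closure (hρV (mem_ball_zero_iff.2 (not_le.1 h))))
    have h1 : ρ * ρ ≤ ‖κ‖ := by
      calc ρ * ρ ≤ ‖x‖ * ‖y‖ := mul_le_mul (hout x hx) (hout y hy) hρ.le (norm_nonneg _)
        _ = ‖κ‖ * ‖t * s‖ := by rw [← norm_mul, hxy, norm_mul]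
        _ ≤ ‖κ‖ := mul_le_of_le_one_right (norm_nonneg _)
            ((hTη _ ⟨s, hs, rfl⟩).trans (hη.le.trans ht.le))
    have h2 : ρ₁ ^ 2 ≤ ρ * ρ := by
      rw [← pow_two]
      have : ρ₁ ≤ ρ := mul_le_of_le_one_right hρ.le (pow_le_one₀ hη0.le hη1.le)
      gcongr
    linarith [hpκ.trans hcκ₁]
  have hGV := hG _ _ hadm
  have hsepC : (C.cycle _ hm1).Separates (closure V₀) V₂ :=
    C.separates_mul hC.isContour one_ne_zero hm1 (fun z hz => by rw [div_one]; exact hV₀I hz)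
      fun z hz => hKV (by rwa [div_one] at hz)
  have hsuppC : ∀ z ∈ C.support, z ∈ V₂ \ closure V₀ := fun z hz =>
    ⟨hKV (Or.inr hz), fun h => (hV₀I h).1 hz⟩
  refine ⟨hGV.continuousOn.mono (Set.pi_mono fun _ _ z hz => hsuppC z hz), fun D hD ε => ?_⟩
  obtain ⟨L, U, hLU, h0L, hsep, hsep'⟩ := hD.exists_admissiblePair hp0 hp hq0 hq ht0 hu hκu hlκ
    (P := 2 ≤ n) (B := outerPoleInvs q τ' a b α ζ p) (by
      intro β hβ
      obtain ⟨r, s, hs, rfl⟩ := Set.mem_iUnion.1 hβ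
      by_cases h : r = a ∨ r = b
      -- for `r = a, b` the pole `1 / (s τ_r)` is cancelled by a theta function, whence the factor `p`
      · refine ⟨r, p * s, mul_mem_dpows hs, ?_⟩
        have h1 : α r = ζ := by rcases h with rfl | rfl <;> assumption
        have h2 : u * p ^ (α r : ℂ) = 1 := by
          change p ^ ((-ζ : ℝ) : ℂ) * p ^ (α r : ℂ) = 1
          rw [← cpow_ofReal_add hp0, h1, neg_add_cancel]; simp
        simp only [poleExp, if_pos h]
        calc κ * (s * (l * τ' r)) = (l * κ) * s * (1 * τ' r) := by ring
          _ = p * s * (u * (p ^ (α r : ℂ) * τ' r)) := by rw [hlκ, ← h2]; ring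
      · refine ⟨r, s, hs, ?_⟩
        have h2 : κ * p ^ ((α r + ζ : ℝ) : ℂ) = u * p ^ (α r : ℂ) := by
          change p ^ ((-2 * ζ : ℝ) : ℂ) * _ = p ^ ((-ζ : ℝ) : ℂ) * _
          rw [← cpow_ofReal_add hp0, ← cpow_ofReal_add hp0,
            show -2 * ζ + (α r + ζ) = -ζ + α r by ring]
        simp only [poleExp, if_neg h]
        calc κ * (s * (p ^ ((α r + ζ : ℝ) : ℂ) * τ' r)) =
            s * ((κ * p ^ ((α r + ζ : ℝ) : ℂ)) * τ' r) := by ring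
          _ = s * (u * (p ^ (α r : ℂ) * τ' r)) := by rw [h2]; ring) hm hm'
  have hdefo := fun (I : ℂ) (hI : HasMultiInt G L U I) => HasMultiInt.of_triple
    ((isCompact_dpows hp hq).image (by fun_prop)) hη0 hη1 hTη hTη' hG hLU h0L hV₀ hV₁ hV₂ hV₀₁ hV₁₂
    h₂₀ hρ₁ hR hM0 (by
      simp only [ρ₁]; rw [mul_div_cancel_right₀ _ (by positivity)]; exact hρV)
    (subset_closure.trans hRV) hA hB hBβ hcr hl1 hκ0 (hpκ.trans hcκ₁)
    ((mul_le_mul_of_nonneg_right hpκ.le hR.le).trans_lt hcκ₂) (hpκ.trans hcκ₃)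
    ((mul_le_mul_of_nonneg_right hpκ.le hM0.le).trans_lt hcκ₄) hI
  have hGLU := hG L U hLU
  have hms : ∀ j, ContinuousOn (fun z => u * signPow (ε j) z) {0}ᶜ := fun j => by
    cases ε j
    · exact hm
    · exact hm'
  have hsepj : ∀ j, (D.cycle _ (hms j)).Separates L U := fun j => by
    have : ∀ e (he : ContinuousOn (fun z => u * signPow e z) {0}ᶜ),
        (D.cycle _ he).Separates L U := by
      rintro (_ | _) he
      · exact hsep
      · exact hsep'
    exact this _ (hms j)
  have hsuppD : ∀ j, ∀ z ∈ D.support, u * signPow (ε j) z ∈ U \ L := by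
    intro j z hz
    obtain ⟨k, s, hs, rfl⟩ := Set.mem_iUnion.1 hz
    exact (hsepj j).pt_mem (k, ⟨s, hs⟩)
  constructor
  · refine hGLU.continuousOn.comp (continuousOn_pi.2 fun j => ?_) fun z hz j _ =>
      hsuppD j _ (hz j trivial)
    exact (hms j).comp (continuous_apply j).continuousOn fun z hz =>
      D.ne_zero_of_mem_support (hz j trivial)
  · rw [D.torusIntegral_eq_multiInt (fun j z => u * signPow (ε j) z) hms hsuppD hGLU.continuousOn]
    have h1 := C.torusIntegral_eq_multiInt (n := n) (fun _ z => 1 * z) (fun _ => hm1)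
      (N := V₂ \ closure V₀) (fun _ z hz => by rw [one_mul]; exact hsuppC z hz) hGV.continuousOn
    simp only [one_mul] at h1
    have h2 := hdefo _ (fun c hc => Cycle.multiInt_eq_of_separates hLU.isCompact.isClosed
      hLU.isOpen hLU.zero_mem hc hsepj hGLU.continuousOn hGLU.differentiableOn)
      (fun _ => C.cycle _ hm1) fun _ => hsepC
    rw [← h2]
    simp only [one_mul]
    exact h1.symm

/-! ### Limits of the infinite products as `p → 0` -/

section Limits

variable {β : Type*} {l : Filter β} {P Y : β → ℂ} {q y₀ : ℂ}

lemma eventually_norm_lt_of_tendsto_zero (hP : Tendsto P l (𝓝 0)) {c : ℝ} (hc : 0 < c) :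
    ∀ᶠ b in l, ‖P b‖ < c := by
  have := hP.norm
  rw [norm_zero] at this
  exact this.eventually_lt_const hc

lemma tendsto_one_of_norm_sub_one_le {F : β → ℂ} {c : ℝ} (hP : Tendsto P l (𝓝 0))
    (h : ∀ᶠ b in l, ‖F b - 1‖ ≤ Real.exp (c * ‖P b‖) - 1) : Tendsto F l (𝓝 1) := by
  rw [tendsto_iff_norm_sub_tendsto_zero]
  refine squeeze_zero' (.of_forall fun b => norm_nonneg _) h ?_
  have h1 : Tendsto (fun b => Real.exp (c * ‖P b‖) - 1) l (𝓝 (Real.exp (c * ‖(0 : ℂ)‖) - 1)) :=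
    ((Real.continuous_exp.tendsto _).comp (hP.norm.const_mul c)).sub_const 1
  simpa using h1

lemma tendsto_dPoch (hq : ‖q‖ < 1) (hP : Tendsto P l (𝓝 0)) (hY : Tendsto Y l (𝓝 y₀)) :
    Tendsto (fun b => dPoch (P b) q (Y b)) l (𝓝 (qPoch y₀ q)) := by
  have h1 := ((differentiable_qPoch hq).continuous.tendsto y₀).comp hY
  have hPY : Tendsto (fun b => P b * Y b) l (𝓝 0) := by simpa using hP.mul hY
  have h2 : Tendsto (fun b => dPoch (P b) q (P b * Y b)) l (𝓝 1) := by
    refine tendsto_one_of_norm_sub_one_le (c := 2 * (1 - ‖q‖)⁻¹) hPY ?_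
    filter_upwards [eventually_norm_lt_of_tendsto_zero hP (c := 1 / 2) (by norm_num)] with b hb
    refine (norm_dPoch_sub_one_le (by linarith) hq _).trans ?_
    have h3 : (1 - ‖P b‖)⁻¹ ≤ 2 := by
      rw [inv_le_comm₀ (by linarith) (by norm_num)]; linarith
    have h4 : 0 < 1 - ‖q‖ := by linarith
    gcongr
  have h3 := h1.mul h2
  rw [mul_one] at h3
  refine h3.congr' ?_
  filter_upwards [eventually_norm_lt_of_tendsto_zero hP one_pos] with b hb
  exact (dPoch_rec_left hb hq _).symm

lemma tendsto_qPoch_small (hP : Tendsto P l (𝓝 0)) (hY : Tendsto Y l (𝓝 y₀)) :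
    Tendsto (fun b => qPoch (Y b) (P b)) l (𝓝 (1 - y₀)) := by
  have hPY : Tendsto (fun b => P b * Y b) l (𝓝 0) := by simpa using hP.mul hY
  have h2 : Tendsto (fun b => qPoch (P b * Y b) (P b)) l (𝓝 1) := by
    refine tendsto_one_of_norm_sub_one_le (c := 2) hPY ?_
    filter_upwards [eventually_norm_lt_of_tendsto_zero hP (c := 1 / 2) (by norm_num)] with b hb
    have hb1 : ‖P b‖ < 1 := by linarith
    rw [qPoch_eq_genProd]
    refine (norm_genProd_sub_one_le (summable_norm_pow hb1) _).trans ?_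
    have h3 : ∑' k : ℕ, ‖P b ^ k‖ ≤ 2 := by
      simp only [norm_pow]
      rw [tsum_geometric_of_lt_one (norm_nonneg _) hb1, inv_le_comm₀ (by linarith) (by norm_num)]
      linarith
    gcongr
  have h3 := (hY.const_sub 1).mul h2
  rw [mul_one] at h3
  refine h3.congr' ?_
  filter_upwards [eventually_norm_lt_of_tendsto_zero hP one_pos] with b hb
  exact (qPoch_rec hb _).symm

/-- The limit of `p^e y` as `p → 0`, for `e ≥ 0`. -/
noncomputable def powLim (e : ℝ) (y : ℂ) : ℂ := if e = 0 then y else 0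

lemma tendsto_cpow_mul (hP : Tendsto P l (𝓝[≠] 0)) (hY : Tendsto Y l (𝓝 y₀)) {e : ℝ} (he : 0 ≤ e) :
    Tendsto (fun b => P b ^ (e : ℂ) * Y b) l (𝓝 (powLim e y₀)) := by
  unfold powLim
  split_ifs with h
  · simpa [h] using hY
  · have h1 : Tendsto (fun p : ℂ => p ^ (e : ℂ)) (𝓝[≠] 0) (𝓝 0) := by
      rw [Metric.tendsto_nhds]
      intro c hc
      filter_upwards [eventually_norm_cpow_lt (lt_of_le_of_ne he (Ne.symm h)) hc] with p hp
      rwa [dist_zero_right]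
    simpa using (h1.comp hP).mul hY

/-- The limit of `Γ(p^e y; p, q)` as `p → 0`, for `0 ≤ e ≤ 1`. -/
noncomputable def gammaLim (q : ℂ) (e : ℝ) (y : ℂ) : ℂ :=
  qPoch (powLim (1 - e) (q / y)) q / qPoch (powLim e y) q

lemma mul_div_cpow_mul {p y : ℂ} (hp : p ≠ 0) (e : ℝ) (q : ℂ) :
    p * q / (p ^ (e : ℂ) * y) = p ^ ((1 - e : ℝ) : ℂ) * (q / y) := by
  have h1 : p ^ ((1 - e : ℝ) : ℂ) * p ^ (e : ℂ) = p := by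
    rw [← cpow_ofReal_add hp, sub_add_cancel]; simp
  have h2 : p ^ (e : ℂ) ≠ 0 := by simp [Complex.cpow_eq_zero_iff, hp]
  nth_rewrite 1 [← h1]
  rw [mul_right_comm, mul_comm (p ^ (e : ℂ)), mul_div_mul_right _ _ h2, mul_div_assoc]

lemma tendsto_ellGamma_num (hq : ‖q‖ < 1) (hP : Tendsto P l (𝓝[≠] 0)) (hY : Tendsto Y l (𝓝 y₀))
    (hy₀ : y₀ ≠ 0) {e : ℝ} (he : e ≤ 1) :
    Tendsto (fun b => dPoch (P b) q (P b * q / (P b ^ (e : ℂ) * Y b))) l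
      (𝓝 (qPoch (powLim (1 - e) (q / y₀)) q)) := by
  refine tendsto_dPoch hq (hP.mono_right nhdsWithin_le_nhds) ?_
  refine (tendsto_cpow_mul hP (tendsto_const_nhds.div hY hy₀) (sub_nonneg.2 he)).congr' ?_
  filter_upwards [hP.eventually eventually_mem_nhdsWithin] with b hb
  exact (mul_div_cpow_mul hb e q).symm

lemma tendsto_ellGamma (hq : ‖q‖ < 1) (hP : Tendsto P l (𝓝[≠] 0)) (hY : Tendsto Y l (𝓝 y₀))
    (hy₀ : y₀ ≠ 0) {e : ℝ} (he0 : 0 ≤ e) (he : e ≤ 1) (h : qPoch (powLim e y₀) q ≠ 0) :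
    Tendsto (fun b => ellGamma (P b) q (P b ^ (e : ℂ) * Y b)) l (𝓝 (gammaLim q e y₀)) := by
  simp only [ellGamma_eq]
  exact (tendsto_ellGamma_num hq hP hY hy₀ he).div
    (tendsto_dPoch hq (hP.mono_right nhdsWithin_le_nhds) (tendsto_cpow_mul hP hY he0)) h

lemma tendsto_ellGamma_inv (hq : ‖q‖ < 1) (hP : Tendsto P l (𝓝[≠] 0)) (hY : Tendsto Y l (𝓝 y₀))
    (hy₀ : y₀ ≠ 0) {e : ℝ} (he0 : 0 ≤ e) (he : e ≤ 1) (h : qPoch (powLim (1 - e) (q / y₀)) q ≠ 0) :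
    Tendsto (fun b => (ellGamma (P b) q (P b ^ (e : ℂ) * Y b))⁻¹) l (𝓝 (gammaLim q e y₀)⁻¹) := by
  simp only [ellGamma_eq, gammaLim, inv_div]
  exact (tendsto_dPoch hq (hP.mono_right nhdsWithin_le_nhds) (tendsto_cpow_mul hP hY he0)).div
    (tendsto_ellGamma_num hq hP hY hy₀ he) h

/-- The limit of `θ(p^e y; p)` as `p → 0`, for `0 ≤ e ≤ 1`. -/
noncomputable def thetaLim (e : ℝ) (y : ℂ) : ℂ := (1 - powLim e y) * (1 - powLim (1 - e) y⁻¹)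

lemma tendsto_theta_cpow (hP : Tendsto P l (𝓝[≠] 0)) (hY : Tendsto Y l (𝓝 y₀)) (hy₀ : y₀ ≠ 0)
    {e : ℝ} (he0 : 0 ≤ e) (he : e ≤ 1) :
    Tendsto (fun b => theta (P b ^ (e : ℂ) * Y b) (P b)) l (𝓝 (thetaLim e y₀)) := by
  have hP' := hP.mono_right nhdsWithin_le_nhds
  refine (tendsto_qPoch_small hP' (tendsto_cpow_mul hP hY he0)).mul
    (tendsto_qPoch_small hP' ?_)
  refine (tendsto_cpow_mul hP (hY.inv₀ hy₀) (sub_nonneg.2 he)).congr' ?_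
  filter_upwards [hP.eventually eventually_mem_nhdsWithin] with b hb
  have := mul_div_cpow_mul (y := Y b) hb e 1
  rw [mul_one, one_div] at this
  exact this.symm

end Limits

/-! ### Leading coefficients -/

/-- The restriction of a nonzero polynomial to a generic line through a given point is nonzero. -/
lemma exists_direction {ι : Type} {H : MvPolynomial ι ℂ} (hH : H ≠ 0) (y : ι → ℂ) :
    ∃ w : ι → ℂ, ∀ᶠ s in 𝓝[≠] (0 : ℂ), MvPolynomial.eval (fun i => y i + s * w i) H ≠ 0 := by
  obtain ⟨x, hx⟩ : ∃ x, MvPolynomial.eval x H ≠ 0 := by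
    by_contra! h
    exact hH (MvPolynomial.funext fun x => by rw [h x, map_zero])
  let Q : Polynomial ℂ := MvPolynomial.aeval
    (fun i => Polynomial.C (y i) + Polynomial.X * Polynomial.C (x i - y i)) H
  have hQ : ∀ s, Q.eval s = MvPolynomial.eval (fun i => y i + s * (x i - y i)) H := by
    intro s
    have : (Polynomial.evalRingHom s).comp (MvPolynomial.aeval (R := ℂ)
        (fun i => Polynomial.C (y i) + Polynomial.X * Polynomial.C (x i - y i))).toRingHom =
        MvPolynomial.eval (fun i => y i + s * (x i - y i)) := by
      refine MvPolynomial.ringHom_ext (fun c => by simp) fun i => by simp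
    exact congrArg (fun φ => φ H) this
  have hQ0 : Q ≠ 0 := fun h => hx (by
    have := hQ 1
    rw [h, Polynomial.eval_zero] at this
    simpa using this.symm)
  refine ⟨fun i => x i - y i, ?_⟩
  have hfin : {s | Q.IsRoot s}.Finite := Polynomial.finite_setOfPred_isRoot hQ0
  have := (hfin.subset (Set.sdiff_subset (t := {0}))).isClosed.isOpen_compl.mem_nhds (x := (0 : ℂ))
    (by simp)
  filter_upwards [nhdsWithin_le_nhds this, eventually_mem_nhdsWithin] with s hs hs0 h
  exact hs ⟨by rw [Set.mem_ofPred_eq, Polynomial.IsRoot, hQ]; exact h, hs0⟩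

/-- Functions that are holomorphic on `(ℂ^*)^ι` and converge, as `p → 0`, locally uniformly outside
the zero set of a nonzero polynomial, converge locally uniformly everywhere: by the maximum
principle on small circles that avoid the exceptional set. -/
theorem exists_tendsto_of_generic {ι : Type} [Fintype ι] {Φ : ℂ → (ι → ℂ) → ℂ}
    (hΦ : ∀ᶠ p in 𝓝[≠] (0 : ℂ), DifferentiableOn ℂ (Φ p) (cstar ι)) {H : MvPolynomial ι ℂ}
    (hH : H ≠ 0) {g : (ι → ℂ) → ℂ}
    (hg : ∀ y ∈ cstar ι, MvPolynomial.eval y H ≠ 0 →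
      Tendsto (fun x : ℂ × (ι → ℂ) => Φ x.1 x.2) (𝓝[≠] 0 ×ˢ 𝓝 y) (𝓝 (g y))) :
    ∃ G : (ι → ℂ) → ℂ, ∀ y ∈ cstar ι,
      Tendsto (fun x : ℂ × (ι → ℂ) => Φ x.1 x.2) (𝓝[≠] 0 ×ˢ 𝓝 y) (𝓝 (G y)) := by
  suffices h : ∀ y ∈ cstar ι, ∃ c,
      Tendsto (fun x : ℂ × (ι → ℂ) => Φ x.1 x.2) (𝓝[≠] 0 ×ˢ 𝓝 y) (𝓝 c) by
    choose G hG using h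
    exact ⟨fun y => if hy : y ∈ cstar ι then G y hy else 0, fun y hy => by
      simpa only [dif_pos hy] using hG y hy⟩
  intro y hy
  have hopen : IsOpen (cstar ι) := by
    have : cstar ι = ⋂ i, {x : ι → ℂ | x i ≠ 0} := by ext; simp [cstar]
    rw [this]
    exact isOpen_iInter_of_finite fun i => isOpen_ne_fun (continuous_apply i) continuous_const
  obtain ⟨w, hw⟩ := exists_direction hH y
  -- a radius for which the circle avoids the zero set and the disc avoids the axes
  obtain ⟨r, hr0, hrH, hrc⟩ : ∃ r : ℝ, 0 < r ∧
      (∀ s ∈ Metric.sphere (0 : ℂ) r, MvPolynomial.eval (fun i => y i + s * w i) H ≠ 0) ∧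
      ∀ s ∈ Metric.closedBall (0 : ℂ) r, (fun i => y i + s * w i) ∈ cstar ι := by
    have hc : ∀ᶠ s in 𝓝 (0 : ℂ), (fun i => y i + s * w i) ∈ cstar ι := by
      have hcont : Continuous fun s : ℂ => (fun i => y i + s * w i) := by fun_prop
      exact hcont.continuousAt.eventually (hopen.mem_nhds (by simpa using hy))
    rw [eventually_nhdsWithin_iff] at hw
    obtain ⟨ε, hε, hball⟩ := Metric.eventually_nhds_iff_ball.1 (hw.and hc)
    refine ⟨ε / 2, by positivity, fun s hs => ?_, fun s hs => ?_⟩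
    · have hs' := mem_sphere_zero_iff_norm.1 hs
      refine (hball s (by rw [mem_ball_zero_iff, hs']; linarith)).1 ?_
      rintro rfl
      rw [norm_zero] at hs'
      linarith
    · have hs' := mem_closedBall_zero_iff.1 hs
      exact (hball s (by rw [mem_ball_zero_iff]; linarith)).2
  have hK : IsCompact (Metric.sphere (0 : ℂ) r) := isCompact_sphere _ _
  refine cauchy_map_iff_exists_tendsto.1 (cauchy_map_iff.2 ⟨inferInstance, ?_⟩)
  rw [Metric.uniformity_basis_dist.tendsto_right_iff]
  intro ε hε
  have h1 : ∀ᶠ x : (ℂ × (ι → ℂ)) × (ℂ × (ι → ℂ)) in 𝓝 ((0, y), (0, y)),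
      ∀ s ∈ Metric.sphere (0 : ℂ) r, x.1.1 ≠ 0 → x.2.1 ≠ 0 →
        dist (Φ x.1.1 (fun i => x.1.2 i + s * w i)) (Φ x.2.1 (fun i => x.2.2 i + s * w i)) <
          ε / 2 := by
    refine hK.eventually_forall_of_forall_eventually fun s hs => ?_
    have h2 := hg _ (hrc s (Metric.sphere_subset_closedBall hs)) (hrH s hs)
    have h3 := (Metric.tendsto_nhds.1 h2) (ε / 4) (by positivity)
    rw [← nhdsWithin_univ (fun i => y i + s * w i), ← nhdsWithin_prod_eq,
      eventually_nhdsWithin_iff] at h3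
    have hc1 : Continuous fun x : ((ℂ × (ι → ℂ)) × (ℂ × (ι → ℂ))) × ℂ =>
        ((x.1.1.1, fun i => x.1.1.2 i + x.2 * w i) : ℂ × (ι → ℂ)) := by fun_prop
    have hc2 : Continuous fun x : ((ℂ × (ι → ℂ)) × (ℂ × (ι → ℂ))) × ℂ =>
        ((x.1.2.1, fun i => x.1.2.2 i + x.2 * w i) : ℂ × (ι → ℂ)) := by fun_prop
    filter_upwards [(hc1.tendsto (((0, y), (0, y)), s)).eventually h3,
      (hc2.tendsto (((0, y), (0, y)), s)).eventually h3] with x hx1 hx2 hx1' hx2'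
    have h4 := hx1 ⟨hx1', trivial⟩
    have h5 := hx2 ⟨hx2', trivial⟩
    exact (dist_triangle_right _ _ (g fun i => y i + s * w i)).trans_lt (by linarith)
  have h2 : ∀ᶠ x in 𝓝 y, ∀ s ∈ Metric.closedBall (0 : ℂ) r, (fun i => x i + s * w i) ∈ cstar ι := by
    refine (isCompact_closedBall (0 : ℂ) r).eventually_forall_of_forall_eventually fun s hs => ?_
    have hc : Continuous fun x : (ι → ℂ) × ℂ => (fun i => x.1 i + x.2 * w i) := by fun_prop
    exact (hc.tendsto (y, s)).eventually (hopen.mem_nhds (hrc s hs))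
  have h3 : ∀ᶠ x : ℂ × (ι → ℂ) in 𝓝[≠] 0 ×ˢ 𝓝 y, (DifferentiableOn ℂ (Φ x.1) (cstar ι) ∧ x.1 ≠ 0) ∧
      ∀ s ∈ Metric.closedBall (0 : ℂ) r, (fun i => x.2 i + s * w i) ∈ cstar ι :=
    (hΦ.and eventually_mem_nhdsWithin).prod_mk h2
  have hle : (𝓝[≠] (0 : ℂ) ×ˢ 𝓝 y) ×ˢ (𝓝[≠] (0 : ℂ) ×ˢ 𝓝 y) ≤ 𝓝 ((0, y), (0, y)) := by
    rw [nhds_prod_eq, nhds_prod_eq]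
    exact Filter.prod_mono (Filter.prod_mono nhdsWithin_le_nhds le_rfl)
      (Filter.prod_mono nhdsWithin_le_nhds le_rfl)
  filter_upwards [h3.prod_mk h3, hle h1] with x hx hx'
  have hdiff : ∀ x : ℂ × (ι → ℂ), DifferentiableOn ℂ (Φ x.1) (cstar ι) →
      (∀ s ∈ Metric.closedBall (0 : ℂ) r, (fun i => x.2 i + s * w i) ∈ cstar ι) →
      DiffContOnCl ℂ (fun s : ℂ => Φ x.1 (fun i => x.2 i + s * w i)) (Metric.ball 0 r) := by
    intro x h4 h5
    refine DifferentiableOn.diffContOnCl ?_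
    rw [closure_ball _ hr0.ne']
    exact h4.comp (by fun_prop) h5
  have h6 := Complex.norm_le_of_forall_mem_frontier_norm_le Metric.isBounded_ball
    ((hdiff x.1 hx.1.1.1 hx.1.2).sub (hdiff x.2 hx.2.1.1 hx.2.2)) (C := ε / 2) (fun s hs => by
      rw [frontier_ball _ hr0.ne'] at hs
      have := hx' s hs hx.1.1.2 hx.2.1.2
      rw [dist_eq_norm] at this
      exact this.le) (z := 0) (subset_closure (Metric.mem_ball_self hr0))
  simp only [Pi.sub_apply, zero_mul, add_zero] at h6
  rw [dist_eq_norm]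
  linarith

lemma differentiableAt_finsetProd {E κ : Type*} [NormedAddCommGroup E] [NormedSpace ℂ E]
    {s : Finset κ} {F : κ → E → ℂ} {x : E} (h : ∀ i ∈ s, DifferentiableAt ℂ (F i) x) :
    DifferentiableAt ℂ (fun y => ∏ i ∈ s, F i y) x :=
  (HasFDerivAt.finsetProd fun i hi => (h i hi).hasFDerivAt).differentiableAt

lemma differentiableAt_div {E : Type*} [NormedAddCommGroup E] [NormedSpace ℂ E]
    {F G : E → ℂ} {x : E} (hF : DifferentiableAt ℂ F x) (hG : DifferentiableAt ℂ G x)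
    (h : G x ≠ 0) : DifferentiableAt ℂ (fun y => F y / G y) x := by
  simp only [div_eq_mul_inv]
  exact hF.fun_mul (hG.fun_inv h)

section LeadingTerm

variable {ι : Type} [Fintype ι]

lemma isOpen_cstar : IsOpen (cstar ι) := by
  have : cstar ι = ⋂ i, {x : ι → ℂ | x i ≠ 0} := by ext; simp [cstar]
  rw [this]
  exact isOpen_iInter_of_finite fun i => isOpen_ne_fun (continuous_apply i) continuous_const

omit [Fintype ι] in
lemma ratEval_zero (x : ι → ℂ) : ratEval (0 : FractionRing (MvPolynomial ι ℂ)) x = 0 := by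
  simp [ratEval]

/-- The series of a function with leading term `c p^v`, divided by `p^v`, tends to `c`: the
exponents are separated from `v` by a gap `ε`, so the remainder is `O(|p|^ε)`. -/
lemma HasLeadingTerm.exists_tendsto {F : (ι → ℂ) → ℂ → ℂ} {v : ℝ}
    {c : FractionRing (MvPolynomial ι ℂ)} (hF : HasLeadingTerm F v c) :
    ∃ H : MvPolynomial ι ℂ, H ≠ 0 ∧ ∀ y ∈ cstar ι, MvPolynomial.eval y H ≠ 0 →
      MvPolynomial.eval y (IsFractionRing.den (MvPolynomial ι ℂ) c : MvPolynomial ι ℂ) ≠ 0 ∧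
      Tendsto (fun x : ℂ × (ι → ℂ) => x.1 ^ ((-v : ℝ) : ℂ) * F x.2 x.1) (𝓝[≠] 0 ×ˢ 𝓝 y)
        (𝓝 (ratEval c y)) := by
  obtain ⟨a, ⟨hfin, h, hh0, -, hconv⟩, hav, hc0, hlow⟩ := hF
  have hden : (IsFractionRing.den (MvPolynomial ι ℂ) c : MvPolynomial ι ℂ) ≠ 0 :=
    nonZeroDivisors.ne_zero (IsFractionRing.den (MvPolynomial ι ℂ) c).2
  refine ⟨h * IsFractionRing.den (MvPolynomial ι ℂ) c, mul_ne_zero hh0 hden, fun y hy hyH => ?_⟩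
  rw [map_mul, mul_ne_zero_iff] at hyH
  refine ⟨hyH.2, ?_⟩
  have hcont : ContinuousAt (ratEval c) y :=
    (MvPolynomial.continuous_eval _).continuousAt.div (MvPolynomial.continuous_eval _).continuousAt
      hyH.2
  have hopen : IsOpen {x : ι → ℂ | x ∈ cstar ι ∧ MvPolynomial.eval x h ≠ 0} :=
    isOpen_cstar.inter (isOpen_ne_fun (MvPolynomial.continuous_eval h) continuous_const)
  obtain ⟨K, hKy, hKs, hK⟩ := local_compact_nhds (hopen.mem_nhds ⟨hy, hyH.1⟩)
  obtain ⟨δ, hδ0, hδ1, ⟨B, hB, hBK⟩, hsum⟩ := hconv K hK hKs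
  have hyK := mem_of_mem_nhds hKy
  have hB0 : ∀ s, 0 ≤ B s := fun s => le_trans (by positivity) (hBK s y hyK)
  -- the gap above the leading exponent
  obtain ⟨ε, hε0, hε⟩ : ∃ ε : ℝ, 0 < ε ∧ ∀ s, a s ≠ 0 → s ≠ v → v + ε ≤ s := by
    have hf : ({s : ℝ | s ≤ v + 1 ∧ a s ≠ 0} \ {v}).Finite := (hfin (v + 1)).subset Set.sdiff_subset
    obtain ⟨ε, hε0, hε⟩ := Metric.isOpen_iff.1 hf.isClosed.isOpen_compl v (by simp)
    refine ⟨min ε 1, by positivity, fun s hs hsv => ?_⟩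
    have hlt : v < s := lt_of_le_of_ne (not_lt.1 fun h => hs (hlow s h)) (Ne.symm hsv)
    by_contra! hlt'
    have h1 : s < v + ε := hlt'.trans_le (by gcongr; exact min_le_left _ _)
    have h2 : s < v + 1 := hlt'.trans_le (by gcongr; exact min_le_right _ _)
    exact hε (show s ∈ Metric.ball v ε by
      rw [Metric.mem_ball, Real.dist_eq, abs_of_pos (by linarith)]; linarith)
      ⟨⟨h2.le, hs⟩, hsv⟩
  have key : ∀ p : ℂ, 0 < ‖p‖ → ‖p‖ < δ → ∀ x ∈ K,
      ‖p ^ ((-v : ℝ) : ℂ) * F x p - ratEval c x‖ ≤ (∑' s, B s) * (δ ^ (-v) * (‖p‖ / δ) ^ ε) := by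
    intro p hp0 hpδ x hx
    have hp : p ≠ 0 := norm_pos_iff.1 hp0
    have h1 := ((hsum p hp0 hpδ x hx).mul_left (p ^ ((-v : ℝ) : ℂ))).sub
      (hasSum_ite_eq v (ratEval c x))
    refine h1.norm_le_of_bounded (hB.hasSum.mul_right _) fun s => ?_
    have hpos : 0 ≤ δ ^ (-v) * (‖p‖ / δ) ^ ε := by positivity
    rcases eq_or_ne s v with rfl | hsv
    · have : p ^ ((-s : ℝ) : ℂ) * p ^ (s : ℂ) = 1 := by
        rw [← cpow_ofReal_add hp]; simp
      rw [if_pos rfl, hav, mul_left_comm, this, mul_one, sub_self, norm_zero]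
      exact mul_nonneg (hB0 s) hpos
    · rw [if_neg hsv, sub_zero]
      by_cases has : a s = 0
      · rw [has, ratEval_zero, zero_mul, mul_zero, norm_zero]
        exact mul_nonneg (hB0 s) hpos
      · rw [mul_left_comm, ← cpow_ofReal_add hp, norm_mul, Complex.norm_cpow_real]
        have h2 : ‖p‖ ^ (-v + s) ≤ δ ^ s * (δ ^ (-v) * (‖p‖ / δ) ^ ε) := by
          have h3 : ‖p‖ ^ (-v + s) = δ ^ (-v + s) * (‖p‖ / δ) ^ (-v + s) := by
            rw [← Real.mul_rpow hδ0.le (by positivity), mul_div_cancel₀ _ hδ0.ne']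
          rw [h3, Real.rpow_add hδ0, mul_comm (δ ^ (-v)), mul_assoc]
          gcongr ?_ * (?_ * ?_)
          exact Real.rpow_le_rpow_of_exponent_ge (by positivity) ((div_le_one hδ0).2 hpδ.le)
            (by linarith [hε s has hsv])
        calc ‖ratEval (a s) x‖ * ‖p‖ ^ (-v + s)
            ≤ ‖ratEval (a s) x‖ * (δ ^ s * (δ ^ (-v) * (‖p‖ / δ) ^ ε)) := by gcongr
          _ ≤ B s * (δ ^ (-v) * (‖p‖ / δ) ^ ε) := by
            rw [← mul_assoc]; gcongr; exact hBK s x hx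
  have h0 : Tendsto (fun x : ℂ × (ι → ℂ) => (∑' s, B s) * (δ ^ (-v) * (‖x.1‖ / δ) ^ ε))
      (𝓝[≠] 0 ×ˢ 𝓝 y) (𝓝 0) := by
    have h1 : Tendsto (fun x : ℂ × (ι → ℂ) => ‖x.1‖ / δ) (𝓝[≠] 0 ×ˢ 𝓝 y) (𝓝 0) := by
      have := ((tendsto_fst (f := 𝓝[≠] (0 : ℂ)) (g := 𝓝 y)).mono_right nhdsWithin_le_nhds).norm.div_const δ
      simpa using this
    have h2 := (h1.rpow_const (p := ε) (Or.inr hε0.le))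
    rw [Real.zero_rpow hε0.ne'] at h2
    simpa using (h2.const_mul (δ ^ (-v))).const_mul (∑' s, B s)
  have h1 : Tendsto (fun x : ℂ × (ι → ℂ) => x.1 ^ ((-v : ℝ) : ℂ) * F x.2 x.1 - ratEval c x.2)
      (𝓝[≠] 0 ×ˢ 𝓝 y) (𝓝 0) := by
    refine squeeze_zero_norm' ?_ h0
    have hsm : ∀ᶠ p : ℂ in 𝓝[≠] 0, p ≠ 0 ∧ ‖p‖ < δ :=
      eventually_mem_nhdsWithin.and
        (eventually_norm_lt_of_tendsto_zero (tendsto_id.mono_right nhdsWithin_le_nhds) hδ0)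
    filter_upwards [hsm.prod_mk hKy] with x hx
    exact key x.1 (norm_pos_iff.2 hx.1.1) hx.1.2 x.2 hx.2
  simpa using h1.add (hcont.tendsto.comp (tendsto_snd (f := 𝓝[≠] (0 : ℂ)) (g := 𝓝 y)))

/-- Two functions that are continuous on `(ℂ^*)^ι` and agree outside the zero set of a nonzero
polynomial agree. -/
lemma eq_of_eq_of_eval_ne_zero {G₁ G₂ : (ι → ℂ) → ℂ} {y : ι → ℂ} (hy : y ∈ cstar ι)
    (h₁ : ContinuousAt G₁ y) (h₂ : ContinuousAt G₂ y) {H : MvPolynomial ι ℂ} (hH : H ≠ 0)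
    (h : ∀ x ∈ cstar ι, MvPolynomial.eval x H ≠ 0 → G₁ x = G₂ x) : G₁ y = G₂ y := by
  obtain ⟨w, hw⟩ := exists_direction hH y
  have hcont : Continuous fun s : ℂ => (fun i => y i + s * w i) := by fun_prop
  have ht : Tendsto (fun s : ℂ => (fun i => y i + s * w i)) (𝓝[≠] 0) (𝓝 y) := by
    have := (hcont.tendsto 0).mono_left (nhdsWithin_le_nhds (s := {0}ᶜ))
    simpa using this
  refine tendsto_nhds_unique_of_eventuallyEq (h₁.tendsto.comp ht) (h₂.tendsto.comp ht) ?_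
  filter_upwards [hw, ht.eventually (isOpen_cstar.mem_nhds hy)] with s hs hs'
  exact h _ hs' hs

omit [Fintype ι] in
lemma continuousAt_of_tendsto_prod {Φ : ℂ → (ι → ℂ) → ℂ} {G : (ι → ℂ) → ℂ} {S : Set (ι → ℂ)}
    (hS : IsOpen S)
    (hG : ∀ y ∈ S, Tendsto (fun x : ℂ × (ι → ℂ) => Φ x.1 x.2) (𝓝[≠] 0 ×ˢ 𝓝 y) (𝓝 (G y)))
    {y : ι → ℂ} (hy : y ∈ S) : ContinuousAt G y := by
  rw [ContinuousAt, (closed_nhds_basis (G y)).tendsto_right_iff]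
  intro U hU
  obtain ⟨A, hA, B, hB, hAB⟩ := Filter.eventually_prod_iff.1 ((hG y hy).eventually hU.1)
  filter_upwards [hB, hS.mem_nhds hy] with x hx hxS
  have h1 : Tendsto (fun p => Φ p x) (𝓝[≠] 0) (𝓝 (G x)) :=
    (hG x hxS).comp (tendsto_id.prodMk (tendsto_const_nhds (x := x)))
  exact hU.2.mem_of_tendsto h1 (hA.mono fun p hp => hAB hp hx)

end LeadingTerm

/-! ### The polar factor and the normalized functions -/

/-- The polar factor `D_m(p^ζ x; p^γ u)`, up to a monomial that brings the arguments of the theta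
functions into the fundamental range: here `s₁ = γ - ζ` and `s₂` is `γ + ζ` or `γ + ζ + 1`. -/
noncomputable def normDen (n : ℕ) (q : ℂ) (m : ℕ) (s₁ s₂ : ℝ) (p : ℂ) (x : Fin n → ℂ) (u : ℂ) : ℂ :=
  ∏ i, ∏ k ∈ Finset.range m, theta (p ^ ((1 - s₁ : ℝ) : ℂ) * (q ^ (k + 1) * x i / u)) p *
    theta (p ^ ((1 - s₂ : ℝ) : ℂ) * (q ^ (k + 1) / (x i * u))) p

/-- The limit of `normDen` as `p → 0`. -/
noncomputable def normDenLim (n : ℕ) (q : ℂ) (m : ℕ) (s₁ s₂ : ℝ) (x : Fin n → ℂ) (u : ℂ) : ℂ :=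
  ∏ i, ∏ k ∈ Finset.range m, thetaLim (1 - s₁) (q ^ (k + 1) * x i / u) *
    thetaLim (1 - s₂) (q ^ (k + 1) / (x i * u))

section normDen

variable {n m : ℕ} {q : ℂ} {s₁ s₂ : ℝ}

lemma thetaLim_ne_zero {e : ℝ} {y : ℂ} (hy : y ≠ 1) : thetaLim e y ≠ 0 := by
  have h1 : (1 : ℂ) - y ≠ 0 := sub_ne_zero.2 hy.symm
  have h2 : (1 : ℂ) - y⁻¹ ≠ 0 := sub_ne_zero.2 (by rw [ne_comm, Ne, inv_eq_one]; exact hy)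
  unfold thetaLim powLim
  split_ifs <;> simp [h1, h2]

lemma continuousAt_thetaLim (e : ℝ) {y : ℂ} (hy : y ≠ 0) : ContinuousAt (thetaLim e) y := by
  unfold thetaLim powLim
  have h2 := continuousAt_inv₀ hy
  split_ifs <;> fun_prop

lemma tendsto_normDen {β : Type*} {l : Filter β} {P : β → ℂ} {X : β → Fin n → ℂ} {U : β → ℂ}
    {x : Fin n → ℂ} {u : ℂ} (hq0 : q ≠ 0) (hP : Tendsto P l (𝓝[≠] 0)) (hX : Tendsto X l (𝓝 x))
    (hU : Tendsto U l (𝓝 u)) (hx : ∀ i, x i ≠ 0) (hu : u ≠ 0)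
    (h₁ : 0 ≤ s₁ ∧ s₁ ≤ 1) (h₂ : 0 ≤ s₂ ∧ s₂ ≤ 1) :
    Tendsto (fun b => normDen n q m s₁ s₂ (P b) (X b) (U b)) l
      (𝓝 (normDenLim n q m s₁ s₂ x u)) := by
  refine tendsto_finsetProd _ fun i _ => tendsto_finsetProd _ fun k _ => ?_
  have hXi := (tendsto_pi_nhds.1 hX) i
  have hqk := pow_ne_zero (k + 1) hq0
  refine (tendsto_theta_cpow hP ((hXi.const_mul _).div hU hu)
    (div_ne_zero (mul_ne_zero hqk (hx i)) hu) (by linarith) (by linarith)).mul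
    (tendsto_theta_cpow hP (tendsto_const_nhds.div (hXi.mul hU) (mul_ne_zero (hx i) hu))
      (div_ne_zero hqk (mul_ne_zero (hx i) hu)) (by linarith) (by linarith))

lemma normDenLim_ne_zero {x : Fin n → ℂ} {u : ℂ}
    (h : ∀ i, ∀ k : ℕ, q ^ (k + 1) * x i / u ≠ 1 ∧ q ^ (k + 1) / (x i * u) ≠ 1) :
    normDenLim n q m s₁ s₂ x u ≠ 0 :=
  Finset.prod_ne_zero_iff.2 fun i _ => Finset.prod_ne_zero_iff.2 fun k _ =>
    mul_ne_zero (thetaLim_ne_zero (h i k).1) (thetaLim_ne_zero (h i k).2)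

lemma continuousAt_normDenLim (hq0 : q ≠ 0) {y : Option (Fin n) → ℂ} (hy : y ∈ cstar _) :
    ContinuousAt (fun y : Option (Fin n) → ℂ => normDenLim n q m s₁ s₂ (fun i => y (some i))
      (y none)) y := by
  unfold normDenLim
  refine tendsto_finsetProd _ fun i _ => tendsto_finsetProd _ fun k _ => ?_
  have hqk := pow_ne_zero (k + 1) hq0
  have c1 : ContinuousAt (fun y : Option (Fin n) → ℂ => y (some i)) y :=
    (continuous_apply (some i)).continuousAt
  have c2 : ContinuousAt (fun y : Option (Fin n) → ℂ => y none) y :=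
    (continuous_apply none).continuousAt
  refine Tendsto.mul ?_ ?_
  · exact ContinuousAt.comp (f := fun y : Option (Fin n) → ℂ => q ^ (k + 1) * y (some i) / y none)
      (continuousAt_thetaLim _ (div_ne_zero (mul_ne_zero hqk (hy _)) (hy _)))
      ((c1.const_mul _).div c2 (hy _))
  · exact ContinuousAt.comp (f := fun y : Option (Fin n) → ℂ => q ^ (k + 1) / (y (some i) * y none))
      (continuousAt_thetaLim _ (div_ne_zero hqk (mul_ne_zero (hy _) (hy _))))
      (continuousAt_const.div (c1.mul c2) (mul_ne_zero (hy _) (hy _)))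

/-- The monomial between `normDen` and `polarDen` is trivial if `s₂ = γ + ζ`, and comes from
`θ(p y; p) = -y⁻¹ θ(y; p)` if `s₂ = γ + ζ + 1`. -/
lemma exists_monomial_normDen (hq0 : q ≠ 0) {ζ γ : ℝ} (h₁ : s₁ = γ - ζ)
    (h₂ : s₂ = γ + ζ ∨ s₂ = γ + ζ + 1) :
    ∃ M : ℂ → (Option (Fin n) → ℂ) → ℂ, ∀ p : ℂ, p ≠ 0 → ‖p‖ < 1 →
      DifferentiableOn ℂ (M p) (cstar _) ∧ ∀ x ∈ cstar (Option (Fin n)), M p x ≠ 0 ∧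
        normDen n q m s₁ s₂ p (fun i => x (some i)) (x none) = M p x *
          polarDen n q m p (p ^ (γ : ℂ) * x none) (fun i => p ^ (ζ : ℂ) * x (some i)) := by
  have e1 : ∀ (p : ℂ), p ≠ 0 → ∀ (k : ℕ) (x u : ℂ), u ≠ 0 →
      p * q ^ (k + 1) * (p ^ (ζ : ℂ) * x) / (p ^ (γ : ℂ) * u) =
        p ^ ((1 - s₁ : ℝ) : ℂ) * (q ^ (k + 1) * x / u) := by
    intro p hp k x u hu
    have h3 : p ^ ((1 - s₁ : ℝ) : ℂ) * p ^ (γ : ℂ) = p * p ^ (ζ : ℂ) := by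
      rw [← cpow_ofReal_add hp, h₁, show 1 - (γ - ζ) + γ = 1 + ζ by ring, cpow_ofReal_add hp]
      simp
    have hpγ : p ^ (γ : ℂ) ≠ 0 := by simp [Complex.cpow_eq_zero_iff, hp]
    field_simp
    linear_combination -x * h3
  have e2 : ∀ (p : ℂ), p ≠ 0 → ∀ (k : ℕ) (x u : ℂ), x ≠ 0 → u ≠ 0 →
      p * q ^ (k + 1) / (p ^ (ζ : ℂ) * x * (p ^ (γ : ℂ) * u)) =
        p ^ ((1 - (γ + ζ) : ℝ) : ℂ) * (q ^ (k + 1) / (x * u)) := by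
    intro p hp k x u hx hu
    have h3 : p ^ ((1 - (γ + ζ) : ℝ) : ℂ) * (p ^ (ζ : ℂ) * p ^ (γ : ℂ)) = p := by
      rw [← cpow_ofReal_add hp, ← cpow_ofReal_add hp, show 1 - (γ + ζ) + (ζ + γ) = 1 by ring]
      simp
    have hpγ : p ^ (γ : ℂ) ≠ 0 := by simp [Complex.cpow_eq_zero_iff, hp]
    have hpζ : p ^ (ζ : ℂ) ≠ 0 := by simp [Complex.cpow_eq_zero_iff, hp]
    field_simp
    linear_combination -h3
  rcases h₂ with h₂ | h₂
  · refine ⟨fun _ _ => 1, fun p hp _ => ⟨differentiableOn_const _, fun x hx => ⟨one_ne_zero, ?_⟩⟩⟩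
    rw [one_mul, normDen, polarDen]
    refine Finset.prod_congr rfl fun i _ => Finset.prod_congr rfl fun k _ => ?_
    rw [e1 p hp _ _ _ (hx none), e2 p hp _ _ _ (hx _) (hx none), h₂]
  · refine ⟨fun p x => ∏ i, ∏ k ∈ Finset.range m,
      -(p ^ ((1 - s₂ : ℝ) : ℂ) * (q ^ (k + 1) / (x (some i) * x none))),
      fun p hp hp1 => ⟨?_, fun x hx => ⟨?_, ?_⟩⟩⟩
    · intro x hx
      refine DifferentiableAt.differentiableWithinAt ?_
      refine differentiableAt_finsetProd fun i _ => differentiableAt_finsetProd fun k _ => ?_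
      have c1 : DifferentiableAt ℂ (fun x : Option (Fin n) → ℂ => x (some i) * x none) x :=
        (differentiable_apply (𝕜 := ℂ) (some i) x).fun_mul (differentiable_apply (𝕜 := ℂ) none x)
      exact ((differentiableAt_div (differentiableAt_const _) c1
        (mul_ne_zero (hx _) (hx _))).const_mul _).neg
    · refine Finset.prod_ne_zero_iff.2 fun i _ => Finset.prod_ne_zero_iff.2 fun k _ => ?_
      simp [Complex.cpow_eq_zero_iff, hp, hx none, hx (some i), hq0]
    · rw [normDen, polarDen, ← Finset.prod_mul_distrib]
      refine Finset.prod_congr rfl fun i _ => ?_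
      rw [← Finset.prod_mul_distrib]
      refine Finset.prod_congr rfl fun k _ => ?_
      have hY : p ^ ((1 - s₂ : ℝ) : ℂ) * (q ^ (k + 1) / (x (some i) * x none)) ≠ 0 := by
        simp [Complex.cpow_eq_zero_iff, hp, hx none, hx (some i), hq0]
      have h3 : p ^ ((1 - (γ + ζ) : ℝ) : ℂ) = p * p ^ ((1 - s₂ : ℝ) : ℂ) := by
        rw [show 1 - (γ + ζ) = 1 + (1 - s₂) by rw [h₂]; ring, cpow_ofReal_add hp]
        simp
      rw [e1 p hp _ _ _ (hx none), e2 p hp _ _ _ (hx _) (hx none), h3, mul_assoc p,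
        theta_mul hp hp1 hY, mul_left_comm]
      congr 1
      rw [← mul_assoc, neg_mul_neg, mul_inv_cancel₀ hY, one_mul]

/-- The function `f(p^ζ x; p^γ u; p)`, multiplied by its polar factor and divided by `p^v`, is
holomorphic and converges locally uniformly on all of `(ℂ^*)^{n+1}`. -/
theorem exists_normalized (hq0 : q ≠ 0) {f : (Fin n → ℂ) → ℂ → ℂ → ℂ} (hf : MemATilde n q m f)
    {ζ γ v : ℝ} {c : FractionRing (MvPolynomial (Option (Fin n)) ℂ)}
    (hc : HasLeadingTerm (rescale f (fun _ => ζ) γ) v c) (h₁ : s₁ = γ - ζ)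
    (h₂ : s₂ = γ + ζ ∨ s₂ = γ + ζ + 1) (h₁' : 0 ≤ s₁ ∧ s₁ ≤ 1) (h₂' : 0 ≤ s₂ ∧ s₂ ≤ 1) :
    ∃ (Φ : ℂ → (Option (Fin n) → ℂ) → ℂ) (G : (Option (Fin n) → ℂ) → ℂ),
      (∀ᶠ p in 𝓝[≠] (0 : ℂ), DifferentiableOn ℂ (Φ p) (cstar _) ∧ ∀ x ∈ cstar (Option (Fin n)),
        normDen n q m s₁ s₂ p (fun i => x (some i)) (x none) ≠ 0 →
          polarDen n q m p (p ^ (γ : ℂ) * x none) (fun i => p ^ (ζ : ℂ) * x (some i)) ≠ 0 ∧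
          Φ p x = normDen n q m s₁ s₂ p (fun i => x (some i)) (x none) *
            (p ^ ((-v : ℝ) : ℂ) * rescale f (fun _ => ζ) γ x p)) ∧
      (∀ y ∈ cstar (Option (Fin n)),
        Tendsto (fun x : ℂ × (Option (Fin n) → ℂ) => Φ x.1 x.2) (𝓝[≠] 0 ×ˢ 𝓝 y) (𝓝 (G y))) ∧
      ∀ y ∈ cstar (Option (Fin n)),
        MvPolynomial.eval y (IsFractionRing.den (MvPolynomial (Option (Fin n)) ℂ) c :
          MvPolynomial (Option (Fin n)) ℂ) * G y =
          MvPolynomial.eval y (IsFractionRing.num (MvPolynomial (Option (Fin n)) ℂ) c) *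
            normDenLim n q m s₁ s₂ (fun i => y (some i)) (y none) := by
  obtain ⟨M, hM⟩ := exists_monomial_normDen (n := n) (m := m) hq0 h₁ h₂
  obtain ⟨H, hH0, hH⟩ := hc.exists_tendsto
  have hjoint : ∀ p : ℂ, ∃ F : (Option (Fin n) → ℂ) → ℂ, (0 < ‖p‖ → ‖p‖ < 1 / 2 →
    DifferentiableOn ℂ F (cstar (Option (Fin n))) ∧
    ∀ x ∈ cstar (Option (Fin n)), polarDen n q m p (x none) (fun i => x (some i)) ≠ 0 →
      F x = polarDen n q m p (x none) (fun i => x (some i)) *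
        f (fun i => x (some i)) (x none) p) := by
    intro p
    by_cases h : 0 < ‖p‖ ∧ ‖p‖ < 1 / 2
    · obtain ⟨F, hF⟩ := hf.joint p h.1 h.2
      exact ⟨F, fun _ _ => hF⟩
    · exact ⟨0, fun h1 h2 => absurd ⟨h1, h2⟩ h⟩
  choose F hF using hjoint
  let R : ℂ → (Option (Fin n) → ℂ) → Option (Fin n) → ℂ := fun p x o =>
    o.elim (p ^ (γ : ℂ) * x none) (fun i => p ^ (ζ : ℂ) * x (some i))
  have hR : ∀ p : ℂ, p ≠ 0 → Set.MapsTo (R p) (cstar _) (cstar _) := by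
    intro p hp x hx o
    have h1 : ∀ e : ℝ, p ^ (e : ℂ) ≠ 0 := fun e => by simp [Complex.cpow_eq_zero_iff, hp]
    cases o
    · exact mul_ne_zero (h1 _) (hx _)
    · exact mul_ne_zero (h1 _) (hx _)
  let Φ : ℂ → (Option (Fin n) → ℂ) → ℂ := fun p x => p ^ ((-v : ℝ) : ℂ) * M p x * F p (R p x)
  have hsm : ∀ᶠ p : ℂ in 𝓝[≠] 0, p ≠ 0 ∧ ‖p‖ < 1 / 2 :=
    eventually_mem_nhdsWithin.and (eventually_norm_lt_of_tendsto_zero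
      (tendsto_id.mono_right nhdsWithin_le_nhds) (by norm_num))
  have hΦ : ∀ᶠ p in 𝓝[≠] (0 : ℂ), DifferentiableOn ℂ (Φ p) (cstar _) ∧
      ∀ x ∈ cstar (Option (Fin n)), normDen n q m s₁ s₂ p (fun i => x (some i)) (x none) ≠ 0 →
        polarDen n q m p (p ^ (γ : ℂ) * x none) (fun i => p ^ (ζ : ℂ) * x (some i)) ≠ 0 ∧
        Φ p x = normDen n q m s₁ s₂ p (fun i => x (some i)) (x none) *
          (p ^ ((-v : ℝ) : ℂ) * rescale f (fun _ => ζ) γ x p) := by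
    filter_upwards [hsm] with p hp
    obtain ⟨hd, hMx⟩ := hM p hp.1 (by linarith)
    obtain ⟨hFd, hFx⟩ := hF p (norm_pos_iff.2 hp.1) hp.2
    constructor
    · refine (hd.const_mul _).mul (hFd.comp ?_ (hR p hp.1))
      refine Differentiable.differentiableOn (differentiable_pi.2 fun o => ?_)
      cases o
      · simp only [R, Option.elim]; fun_prop
      · simp only [R, Option.elim]; fun_prop
    · intro x hx hN
      rw [(hMx x hx).2] at hN
      refine ⟨right_ne_zero_of_mul hN, ?_⟩
      have := hFx (R p x) (hR p hp.1 hx) (right_ne_zero_of_mul hN)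
      simp only [Φ]
      rw [this, (hMx x hx).2]
      simp only [R, Option.elim, rescale]
      ring
  -- the hypersurface where the limit of the polar factor vanishes
  let HD : MvPolynomial (Option (Fin n)) ℂ := ∏ i : Fin n, ∏ k ∈ Finset.range m,
    ((MvPolynomial.C (q ^ (k + 1)) * MvPolynomial.X (some i) - MvPolynomial.X none) *
      (MvPolynomial.C (q ^ (k + 1)) - MvPolynomial.X (some i) * MvPolynomial.X none))
  have hgen : ∀ y ∈ cstar (Option (Fin n)), MvPolynomial.eval y H ≠ 0 →
      Tendsto (fun x : ℂ × (Option (Fin n) → ℂ) =>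
        normDen n q m s₁ s₂ x.1 (fun i => x.2 (some i)) (x.2 none) *
          (x.1 ^ ((-v : ℝ) : ℂ) * rescale f (fun _ => ζ) γ x.2 x.1)) (𝓝[≠] 0 ×ˢ 𝓝 y)
        (𝓝 (normDenLim n q m s₁ s₂ (fun i => y (some i)) (y none) * ratEval c y)) := by
    intro y hy hyH
    refine Tendsto.mul ?_ (hH y hy hyH).2
    have hs : Tendsto (fun x : ℂ × (Option (Fin n) → ℂ) => x.2) (𝓝[≠] 0 ×ˢ 𝓝 y) (𝓝 y) :=
      tendsto_snd
    exact tendsto_normDen hq0 tendsto_fst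
      (tendsto_pi_nhds.2 fun i => (tendsto_pi_nhds.1 hs) (some i))
      ((tendsto_pi_nhds.1 hs) none) (fun i => hy _) (hy _) h₁' h₂'
  have hHD0 : HD ≠ 0 := by
    refine Finset.prod_ne_zero_iff.2 fun i _ => Finset.prod_ne_zero_iff.2 fun k _ =>
      mul_ne_zero ?_ ?_
    · intro h
      have := congrArg (MvPolynomial.eval fun o : Option (Fin n) => o.elim 1 fun _ => 0) h
      simp at this
    · intro h
      have := congrArg (MvPolynomial.eval fun o : Option (Fin n) => 0) h
      simp [hq0] at this
  have hlim : ∀ y ∈ cstar (Option (Fin n)), MvPolynomial.eval y (H * HD) ≠ 0 →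
      Tendsto (fun x : ℂ × (Option (Fin n) → ℂ) => Φ x.1 x.2) (𝓝[≠] 0 ×ˢ 𝓝 y)
        (𝓝 (normDenLim n q m s₁ s₂ (fun i => y (some i)) (y none) * ratEval c y)) := by
    intro y hy hyH
    rw [map_mul, mul_ne_zero_iff] at hyH
    have hs : Tendsto (fun x : ℂ × (Option (Fin n) → ℂ) => x.2) (𝓝[≠] 0 ×ˢ 𝓝 y) (𝓝 y) :=
      tendsto_snd
    have hN := tendsto_normDen (m := m) hq0 (tendsto_fst (f := 𝓝[≠] (0 : ℂ)) (g := 𝓝 y))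
      (tendsto_pi_nhds.2 fun i => (tendsto_pi_nhds.1 hs) (some i))
      ((tendsto_pi_nhds.1 hs) none) (fun i => hy (some i)) (hy none) h₁' h₂'
    have hlim0 : normDenLim n q m s₁ s₂ (fun i => y (some i)) (y none) ≠ 0 := by
      have h3 := hyH.2
      simp only [HD, map_prod, map_mul, map_sub, MvPolynomial.eval_C, MvPolynomial.eval_X,
        Finset.prod_ne_zero_iff, mul_ne_zero_iff, sub_ne_zero] at h3
      refine Finset.prod_ne_zero_iff.2 fun i _ => Finset.prod_ne_zero_iff.2 fun k hk => ?_
      have h4 := h3 i (Finset.mem_univ i) k hk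
      refine mul_ne_zero (thetaLim_ne_zero fun h => h4.1 ?_) (thetaLim_ne_zero fun h => h4.2 ?_)
      · exact (div_eq_one_iff_eq (hy none)).1 h
      · exact (div_eq_one_iff_eq (mul_ne_zero (hy _) (hy none))).1 h
    refine (hgen y hy hyH.1).congr' ?_
    filter_upwards [hN.eventually_ne hlim0, (hΦ.prod_mk (isOpen_cstar.mem_nhds hy))] with x hx hx'
    exact ((hx'.1.2 x.2 hx'.2 hx).2).symm
  obtain ⟨G, hG⟩ := exists_tendsto_of_generic (hΦ.mono fun p hp => hp.1) (mul_ne_zero hH0 hHD0) hlim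
  refine ⟨Φ, G, hΦ, hG, fun y hy => ?_⟩
  have hGc : ContinuousAt G y := continuousAt_of_tendsto_prod isOpen_cstar hG hy
  refine eq_of_eq_of_eval_ne_zero (G₁ := fun y => MvPolynomial.eval y
      (IsFractionRing.den (MvPolynomial (Option (Fin n)) ℂ) c :
          MvPolynomial (Option (Fin n)) ℂ) * G y)
    (G₂ := fun y => MvPolynomial.eval y (IsFractionRing.num (MvPolynomial (Option (Fin n)) ℂ) c) *
      normDenLim n q m s₁ s₂ (fun i => y (some i)) (y none)) hy
    ((MvPolynomial.continuous_eval _).continuousAt.mul hGc)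
    ((MvPolynomial.continuous_eval _).continuousAt.mul (continuousAt_normDenLim hq0 hy))
    (mul_ne_zero hH0 hHD0) fun x hx hxH => ?_
  have h3 := tendsto_nhds_unique (hG x hx) (hlim x hx hxH)
  rw [map_mul, mul_ne_zero_iff] at hxH
  have h4 := (hH x hx hxH.1).1
  simp only [h3, ratEval]
  field_simp

end normDen

/-! ### The broken density -/

section ellGamma

variable {p q : ℂ}

lemma ellGamma_comm (p q x : ℂ) : ellGamma p q x = ellGamma q p x := by
  rw [ellGamma_eq, ellGamma_eq, dPoch_comm, dPoch_comm p q x, mul_comm p q]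

lemma ellGamma_p_mul (hp0 : p ≠ 0) (hp : ‖p‖ < 1) (hq : ‖q‖ < 1) {x : ℂ} (h : theta x q ≠ 0) :
    ellGamma p q (p * x) = theta x q * ellGamma p q x := by
  have h1 : qPoch x q ≠ 0 := left_ne_zero_of_mul h
  rw [ellGamma_eq, ellGamma_eq, mul_div_mul_left _ _ hp0, dPoch_rec_left hp hq (q / x),
    dPoch_rec_left hp hq x, mul_div_assoc', theta]
  have h2 := mul_div_mul_left (qPoch (q / x) q * dPoch p q (p * q / x)) (dPoch p q (p * x)) h1
  rw [← h2]
  ring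

lemma ellGamma_q_mul (hq0 : q ≠ 0) (hp : ‖p‖ < 1) (hq : ‖q‖ < 1) {x : ℂ} (h : theta x p ≠ 0) :
    ellGamma p q (q * x) = theta x p * ellGamma p q x := by
  rw [ellGamma_comm, ellGamma_p_mul hq0 hq hp h, ellGamma_comm]

/-- The reflection formula `1 / (Γ(x) Γ(1/x)) = θ(x; q) θ(1/x; p)`, divided by `θ(x; q)`. -/
lemma inv_ellGamma_mul_ellGamma (hp : ‖p‖ < 1) (hq : ‖q‖ < 1) {x : ℂ}
    (h : ∀ i j : ℤ, x ≠ p ^ i * q ^ j) :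
    (ellGamma p q x * ellGamma p q (1 / x))⁻¹ = theta x q * theta x⁻¹ p := by
  have h1 : dPoch p q (p * q * x) ≠ 0 := by
    rw [Ne, dPoch_eq_zero_iff hp hq]
    rintro ⟨i, j, hij⟩
    refine h (-(i + 1 : ℕ)) (-(j + 1 : ℕ)) ?_
    rw [zpow_neg, zpow_neg, zpow_natCast, zpow_natCast, ← mul_inv]
    refine eq_inv_of_mul_eq_one_right ?_
    rw [← hij]; ring
  have h2 : dPoch p q (p * q / x) ≠ 0 := by
    rw [Ne, dPoch_eq_zero_iff hp hq]
    rintro ⟨i, j, hij⟩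
    refine h (i + 1 : ℕ) (j + 1 : ℕ) ?_
    rw [zpow_natCast, zpow_natCast]
    have hx : x ≠ 0 := by rintro rfl; simp at hij
    field_simp at hij
    rw [← hij]
    ring
  rw [ellGamma_eq, ellGamma_eq, one_div, div_inv_eq_mul, div_mul_div_comm, inv_div, theta, theta,
    div_eq_iff (mul_ne_zero h2 h1), dPoch_rec_left hp hq x, dPoch_rec_right hp hq (p * x),
    dPoch_rec_right hp hq x⁻¹, dPoch_rec_left hp hq (q * x⁻¹), div_inv_eq_mul,
    show q * (p * x) = p * q * x by ring, show p * (q * x⁻¹) = p * q / x by rw [div_eq_mul_inv]; ring,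
    show q * x⁻¹ = q / x from rfl]
  ring

end ellGamma

/-- The factor of the broken density for a pair of variables; `κ = p^(-2ζ)`, `l = p^(1+2ζ)`. -/
noncomputable def brokenPair (p q t κ l x y : ℂ) : ℂ :=
  ellGamma p q (l * (t * x * y)) * ellGamma p q (κ * (t / (x * y))) *
    (ellGamma p q (t * x / y) * ellGamma p q (t * y / x)) *
    (theta (κ * (x * y)⁻¹) p * (theta (x / y) p * theta (y / x) q))

/-- The factor `Γ(τ z^{±1})`, for `z = p^ζ x` and `τ` replaced by `p^γ τ`, where `s₁ = γ - ζ`; if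
`s₂ = γ + ζ + 1` instead of `γ + ζ`, then it includes a theta function. -/
noncomputable def gammaPair (p q : ℂ) (s₁ s₂ : ℝ) (τ x : ℂ) : ℂ :=
  ellGamma p q (p ^ (s₂ : ℂ) * (τ * x)) * ellGamma p q (p ^ (s₁ : ℂ) * (τ / x))

/-- The product of the elliptic Selberg density at `z = p^ζ x` and a summand of `sum_thetaTerm`. The
theta functions to the base `q` cancel some of the poles, and destroy the symmetry under
`z_j ↦ 1 / z_j`. -/
noncomputable def brokenDensity (n : ℕ) (p q t : ℂ) (τ : Fin 6 → ℂ) (a b : Fin 6) (α : Fin 6 → ℝ)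
    (ζ : ℝ) (v w : ℂ) (x : Fin n → ℂ) : ℂ :=
  (∏ j, ∏ k ∈ Finset.univ.filter (fun k => j < k),
    brokenPair p q t (p ^ ((-2 * ζ : ℝ) : ℂ)) (p ^ ((1 + 2 * ζ : ℝ) : ℂ)) (x j) (x k)) *
  ∏ j, (∏ r, gammaPair p q (α r - ζ) (poleExp a b α ζ r) (τ r) (x j)) *
    (theta (p ^ ((-2 * ζ : ℝ) : ℂ) * (x j ^ 2)⁻¹) p * (theta (v * x j) q * theta (w * x j) q))

/-! ### Generic points -/

/-- A set of nonzero numbers that is closed under multiplication and inversion. -/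
structure IsMulGroup (Λ : Set ℂ) : Prop where
  one_mem : (1 : ℂ) ∈ Λ
  mul_mem : ∀ x ∈ Λ, ∀ y ∈ Λ, x * y ∈ Λ
  inv_mem : ∀ x ∈ Λ, x⁻¹ ∈ Λ
  ne_zero : ∀ x ∈ Λ, x ≠ 0

namespace IsMulGroup

variable {Λ : Set ℂ}

/-- A countable set of nonzero numbers generates a countable group. -/
lemma exists_countable {A : Set ℂ} (hA : A.Countable) (h0 : ∀ x ∈ A, x ≠ 0) :
    ∃ Λ : Set ℂ, Λ.Countable ∧ IsMulGroup Λ ∧ A ⊆ Λ := by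
  have := hA.to_subtype
  have hne : ∀ (f : A →₀ ℤ), f.prod (fun x m => (x : ℂ) ^ m) ≠ 0 := fun f =>
    Finset.prod_ne_zero_iff.2 fun x _ => zpow_ne_zero _ (h0 x x.2)
  have hadd : ∀ f g : A →₀ ℤ, (f + g).prod (fun x m => (x : ℂ) ^ m) =
      f.prod (fun x m => (x : ℂ) ^ m) * g.prod (fun x m => (x : ℂ) ^ m) := fun f g =>
    Finsupp.prod_add_index' (fun x => zpow_zero _) fun x m k => zpow_add₀ (h0 x x.2) m k
  refine ⟨Set.range fun f : A →₀ ℤ => f.prod fun x m => (x : ℂ) ^ m, Set.countable_range _,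
    ⟨⟨0, by simp⟩, ?_, ?_, ?_⟩, fun x hx => ⟨Finsupp.single ⟨x, hx⟩ 1, by simp⟩⟩
  · rintro _ ⟨f, rfl⟩ _ ⟨g, rfl⟩
    exact ⟨f + g, hadd f g⟩
  · rintro _ ⟨f, rfl⟩
    refine ⟨-f, eq_inv_of_mul_eq_one_left ?_⟩
    rw [← hadd, neg_add_cancel, Finsupp.prod_zero_index]
  · rintro _ ⟨f, rfl⟩
    exact hne f

lemma zpow_mem (hΛ : IsMulGroup Λ) {x : ℂ} (hx : x ∈ Λ) (m : ℤ) : x ^ m ∈ Λ := by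
  have h : ∀ k : ℕ, x ^ k ∈ Λ := fun k => by
    induction k with
    | zero => simpa using hΛ.one_mem
    | succ k ih => rw [pow_succ]; exact hΛ.mul_mem _ ih _ hx
  rcases m with k | k
  · simpa using h k
  · rw [zpow_negSucc]; exact hΛ.inv_mem _ (h _)

lemma pow_mem (hΛ : IsMulGroup Λ) {x : ℂ} (hx : x ∈ Λ) (m : ℕ) : x ^ m ∈ Λ := by
  simpa using hΛ.zpow_mem hx m

lemma div_mem (hΛ : IsMulGroup Λ) {x y : ℂ} (hx : x ∈ Λ) (hy : y ∈ Λ) : x / y ∈ Λ :=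
  hΛ.mul_mem _ hx _ (hΛ.inv_mem _ hy)

lemma notMem_mul (hΛ : IsMulGroup Λ) {c x : ℂ} (hc : c ∈ Λ) (hx : x ∉ Λ) : c * x ∉ Λ := fun h =>
  hx (by simpa [inv_mul_cancel_left₀ (hΛ.ne_zero c hc)] using hΛ.mul_mem _ (hΛ.inv_mem _ hc) _ h)

lemma notMem_inv (hΛ : IsMulGroup Λ) {x : ℂ} (hx : x ∉ Λ) : x⁻¹ ∉ Λ := fun h =>
  hx (by simpa using hΛ.inv_mem _ h)

lemma notMem_div (hΛ : IsMulGroup Λ) {c x : ℂ} (hc : c ∈ Λ) (hx : x ∉ Λ) : c / x ∉ Λ :=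
  hΛ.notMem_mul hc (hΛ.notMem_inv hx)

lemma theta_ne_zero (hΛ : IsMulGroup Λ) {q : ℂ} (hq : ‖q‖ < 1) (hqΛ : q ∈ Λ) {x : ℂ} (hx : x ∉ Λ)
    (hx0 : x ≠ 0) : theta x q ≠ 0 := by
  rw [Ne, theta_eq_zero_iff (hΛ.ne_zero q hqΛ) hq hx0]
  rintro ⟨m, rfl⟩
  exact hx (hΛ.zpow_mem hqΛ m)

end IsMulGroup

/-- The points outside countably many hypersurfaces `z_k = λ`, `z_k² = λ`, `z_k z_l^{±1} = λ`. -/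
structure GenericPoint {n : ℕ} (Λ : Set ℂ) (z : Fin n → ℂ) : Prop where
  ne_zero : ∀ k, z k ≠ 0
  notMem : ∀ k, z k ∉ Λ
  sq : ∀ k, z k ^ 2 ∉ Λ
  mul : ∀ k l, k ≠ l → z k * z l ∉ Λ
  div : ∀ k l, k ≠ l → z k / z l ∉ Λ

namespace GenericPoint

variable {n : ℕ} {Λ : Set ℂ} {z : Fin n → ℂ}

lemma signPow (hz : GenericPoint Λ z) (hΛ : IsMulGroup Λ) (ε : Fin n → Bool) :
    GenericPoint Λ fun j => signPow (ε j) (z j) := by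
  have inv_mul : ∀ k l, (z k)⁻¹ * z l = z l / z k := fun k l => by rw [mul_comm, div_eq_mul_inv]
  constructor
  · exact fun k => signPow_ne_zero _ (hz.ne_zero k)
  · intro k
    rcases ε k
    · exact hz.notMem k
    · exact hΛ.notMem_inv (hz.notMem k)
  · intro k
    rcases ε k
    · exact hz.sq k
    · simpa [inv_pow] using hΛ.notMem_inv (hz.sq k)
  · intro k l hkl
    rcases ε k <;> rcases ε l
    · exact hz.mul k l hkl
    · exact hz.div k l hkl
    · simpa [inv_mul] using hz.div l k hkl.symm
    · simpa [mul_comm] using hΛ.notMem_inv (hz.mul k l hkl)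
  · intro k l hkl
    rcases ε k <;> rcases ε l
    · exact hz.div k l hkl
    · simpa [div_inv_eq_mul] using hz.mul k l hkl
    · simpa [div_eq_mul_inv, mul_comm] using hΛ.notMem_inv (hz.mul k l hkl)
    · simpa [div_eq_mul_inv, mul_comm] using hz.div l k hkl.symm

lemma thetaGeneric (hz : GenericPoint Λ z) (hΛ : IsMulGroup Λ) {q : ℂ} (hq : ‖q‖ < 1)
    (hqΛ : q ∈ Λ) : ThetaGeneric q z where
  ne_zero := hz.ne_zero
  sq k := hΛ.theta_ne_zero hq hqΛ (hz.sq k) (pow_ne_zero 2 (hz.ne_zero k))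
  pair k l hkl e := by
    refine hΛ.theta_ne_zero hq hqΛ ?_ (mul_ne_zero (hz.ne_zero k)
      (signPow_ne_zero e (hz.ne_zero l)))
    rcases e
    · exact hz.mul k l hkl
    · exact hz.div k l hkl

end GenericPoint

/-- The hypersurfaces avoided by generic points, as a countable family of nonzero polynomials. -/
lemma exists_polynomials_genericPoint {n : ℕ} {Λ : Set ℂ} (hΛc : Λ.Countable) (hΛ : IsMulGroup Λ) :
    ∃ (ι : Type) (_ : Countable ι) (P : ι → MvPolynomial (Fin n) ℂ), (∀ i, P i ≠ 0) ∧
      ∀ z : Fin n → ℂ, (∀ j, z j ≠ 0) → (∀ i, MvPolynomial.eval z (P i) ≠ 0) →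
        GenericPoint Λ z := by
  have := hΛc.to_subtype
  let P : (Λ × Fin n × Fin n) × Fin 4 → MvPolynomial (Fin n) ℂ := fun i =>
    ![MvPolynomial.X i.1.2.1 - MvPolynomial.C (i.1.1 : ℂ),
      MvPolynomial.X i.1.2.1 ^ 2 - MvPolynomial.C (i.1.1 : ℂ),
      MvPolynomial.X i.1.2.1 * MvPolynomial.X i.1.2.2 - MvPolynomial.C (i.1.1 : ℂ),
      if i.1.2.1 = i.1.2.2 then 1 else
        MvPolynomial.X i.1.2.1 - MvPolynomial.C (i.1.1 : ℂ) * MvPolynomial.X i.1.2.2] i.2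
  refine ⟨(Λ × Fin n × Fin n) × Fin 4, inferInstance, P, ?_, fun z hz hP => ?_⟩
  · rintro ⟨⟨⟨c, hc⟩, k, l⟩, i⟩ h
    have hc0 := hΛ.ne_zero c hc
    fin_cases i
    · simpa [P, hc0] using congrArg (MvPolynomial.eval 0) h
    · simpa [P, hc0] using congrArg (MvPolynomial.eval 0) h
    · simpa [P, hc0] using congrArg (MvPolynomial.eval 0) h
    · by_cases hkl : k = l
      · simp [P, hkl] at h
      · simpa [P, hkl, Pi.single_apply, Ne.symm hkl] using
          congrArg (MvPolynomial.eval (Pi.single k 1)) h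
  · refine ⟨hz, fun k hk => ?_, fun k hk => ?_, fun k l _ hk => ?_, fun k l hkl hk => ?_⟩
    · exact hP ((⟨_, hk⟩, k, k), 0) (by simp [P])
    · exact hP ((⟨_, hk⟩, k, k), 1) (by simp [P])
    · exact hP ((⟨_, hk⟩, k, l), 2) (by simp [P])
    · refine hP ((⟨_, hk⟩, k, l), 3) ?_
      have := hz l
      simp [P, hkl, div_mul_cancel₀ _ this]

lemma prod_ite_eq_or {M : Type*} [CommMonoid M] {a b : Fin 6} (hab : a ≠ b) (F : Fin 6 → M) :
    ∏ r, (if r = a ∨ r = b then F r else 1) = F a * F b := by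
  rw [← Finset.prod_filter, ← Finset.prod_pair hab]
  congr 1
  ext r
  simp

/-! ### The product of the density and a summand of the symmetrization identity -/

section identity

variable {n : ℕ} {p q t : ℂ} {τ : Fin 6 → ℂ} {a b : Fin 6} {α : Fin 6 → ℝ} {ζ : ℝ} {v w : ℂ}
  {Λ : Set ℂ}

/-- The theta functions to the base `q` in a summand of the symmetrization identity combine with the
elliptic gamma functions by the reflection formula and by `Γ(p x) = θ(x; q) Γ(x)`. -/
theorem ellDensity_mul_thetaTerm (hp : ‖p‖ < 1) (hq : ‖q‖ < 1) (hab : a ≠ b) (ha : α a = ζ)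
    (hb : α b = ζ) (hΛ : IsMulGroup Λ) (hpΛ : p ∈ Λ) (hqΛ : q ∈ Λ) (htΛ : t ∈ Λ)
    (haΛ : p ^ (ζ : ℂ) * τ a ∈ Λ) (hbΛ : p ^ (ζ : ℂ) * τ b ∈ Λ) {x : Fin n → ℂ}
    (hx : GenericPoint Λ fun j => p ^ (ζ : ℂ) * x j) :
    ellDensity n p q t (fun r => p ^ (α r : ℂ) * τ r) (fun j => p ^ (ζ : ℂ) * x j) *
        thetaTerm q t (p ^ (ζ : ℂ) * τ a) (p ^ (ζ : ℂ) * τ b) (p ^ ((-ζ : ℝ) : ℂ) * v)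
          (p ^ ((-ζ : ℝ) : ℂ) * w) (fun j => p ^ (ζ : ℂ) * x j) =
      brokenDensity n p q t τ a b α ζ v w x := by
  have hp0 : p ≠ 0 := hΛ.ne_zero p hpΛ
  have hq0 : q ≠ 0 := hΛ.ne_zero q hqΛ
  have hP : ∀ e : ℝ, p ^ (e : ℂ) ≠ 0 := fun e => by simp [Complex.cpow_eq_zero_iff, hp0]
  have hx0 : ∀ j, x j ≠ 0 := fun j => right_ne_zero_of_mul (hx.ne_zero j)
  have hκ : p ^ ((-2 * ζ : ℝ) : ℂ) * (p ^ (ζ : ℂ) * p ^ (ζ : ℂ)) = 1 := by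
    rw [← cpow_ofReal_add hp0, ← cpow_ofReal_add hp0, show -2 * ζ + (ζ + ζ) = 0 by ring]; simp
  have hl : p ^ ((1 + 2 * ζ : ℝ) : ℂ) = p * (p ^ (ζ : ℂ) * p ^ (ζ : ℂ)) := by
    rw [show 1 + 2 * ζ = 1 + (ζ + ζ) by ring, cpow_ofReal_add hp0, cpow_ofReal_add hp0]; simp
  have hκ' : p ^ ((-2 * ζ : ℝ) : ℂ) = (p ^ (ζ : ℂ) * p ^ (ζ : ℂ))⁻¹ := eq_inv_of_mul_eq_one_left hκ
  have hz1 : ∀ u : ℂ, ∀ j, p ^ ((-ζ : ℝ) : ℂ) * u * (p ^ (ζ : ℂ) * x j) = u * x j := fun u j => by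
    have : p ^ ((-ζ : ℝ) : ℂ) * p ^ (ζ : ℂ) = 1 := by rw [← cpow_ofReal_add hp0]; simp
    linear_combination u * x j * this
  have refl : ∀ y : ℂ, y ∉ Λ → y ≠ 0 →
      (ellGamma p q y * ellGamma p q (1 / y))⁻¹ = theta y q * theta y⁻¹ p := fun y hy _ =>
    inv_ellGamma_mul_ellGamma hp hq fun i j h => hy (by
      rw [h]; exact hΛ.mul_mem _ (hΛ.zpow_mem hpΛ i) _ (hΛ.zpow_mem hqΛ j))
  generalize hPz : p ^ (ζ : ℂ) = P at *
  have hP0 : P ≠ 0 := hPz ▸ hP ζ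
  rw [ellDensity, thetaTerm, brokenDensity, mul_comm (∏ j, _ / theta _ _), mul_mul_mul_comm]
  congr 1
  -- the factors for pairs of variables: the reflection formula for `z_j z_k` and for `z_k / z_j`, and
  -- `θ(t z_j z_k; q) Γ(t z_j z_k) = Γ(p t z_j z_k)`
  · rw [← Finset.prod_mul_distrib]
    refine Finset.prod_congr rfl fun j _ => ?_
    rw [← Finset.prod_mul_distrib]
    refine Finset.prod_congr rfl fun k hk => ?_
    have hjk : j ≠ k := (Finset.mem_filter.1 hk).2.ne
    have hzz := hx.mul j k hjk
    have hzd := hx.div j k hjk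
    have hzz0 := mul_ne_zero (hx.ne_zero j) (hx.ne_zero k)
    have hzd0 := div_ne_zero (hx.ne_zero j) (hx.ne_zero k)
    have e1 := refl _ hzz hzz0
    have e2 := refl _ (hΛ.notMem_inv hzd) (inv_ne_zero hzd0)
    have hθ := hΛ.theta_ne_zero hq hqΛ hzz hzz0
    have e3 := ellGamma_p_mul hp0 hp hq (x := t * (P * x j) * (P * x k)) (by
      refine hΛ.theta_ne_zero hq hqΛ ?_ ?_
      · rw [mul_assoc]; exact hΛ.notMem_mul htΛ hzz
      · rw [mul_assoc]; exact mul_ne_zero (hΛ.ne_zero t htΛ) hzz0)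
    rw [one_div, inv_inv, inv_div, mul_div_mul_left _ _ hP0, mul_div_mul_left _ _ hP0] at e2
    rw [brokenPair, hl, hκ',
      show p * (P * P) * (t * x j * x k) = p * (t * (P * x j) * (P * x k)) by ring, e3,
      show (P * P)⁻¹ * (t / (x j * x k)) = t / (P * x j * (P * x k)) by field_simp,
      show (P * P)⁻¹ * (x j * x k)⁻¹ = (P * x j * (P * x k))⁻¹ by
        rw [← mul_inv]; congr 1; ring,
      mul_div_mul_left _ _ hP0, mul_div_mul_left _ _ hP0,
      show t * (P * x j) / (P * x k) = t * x j / x k by field_simp,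
      show t * (P * x k) / (P * x j) = t * x k / x j by field_simp]
    rw [div_mul_div_comm, div_eq_iff (mul_ne_zero ?_ hθ)]
    rotate_left
    · intro h0
      have h1 : (ellGamma p q (P * x j * (P * x k)) * ellGamma p q (1 / (P * x j * (P * x k)))) *
          (ellGamma p q (x k / x j) * ellGamma p q (x j / x k)) = 0 := by
        rw [← h0]; ring
      rcases mul_eq_zero.1 h1 with h1 | h1
      · rw [h1, inv_zero] at e1
        exact mul_ne_zero hθ (hΛ.theta_ne_zero hp hpΛ (hΛ.notMem_inv hzz) (inv_ne_zero hzz0)) e1.symm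
      · rw [h1, inv_zero] at e2
        have hd : P * x j / (P * x k) = x j / x k := mul_div_mul_left _ _ hP0
        rw [hd] at hzd hzd0
        refine mul_ne_zero ?_ ?_ e2.symm
        · rw [← inv_div]
          exact hΛ.theta_ne_zero hq hqΛ (hΛ.notMem_inv hzd) (inv_ne_zero hzd0)
        · exact hΛ.theta_ne_zero hp hpΛ hzd hzd0
    have e1' : theta (P * x j * (P * x k)) q * theta (P * x j * (P * x k))⁻¹ p *
        (ellGamma p q (P * x j * (P * x k)) * ellGamma p q (1 / (P * x j * (P * x k)))) = 1 := by
      rw [← e1]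
      refine inv_mul_cancel₀ fun h => ?_
      rw [h, inv_zero] at e1
      exact mul_ne_zero hθ (hΛ.theta_ne_zero hp hpΛ (hΛ.notMem_inv hzz) (inv_ne_zero hzz0)) e1.symm
    have e2' : theta (x k / x j) q * theta (x j / x k) p *
        (ellGamma p q (x k / x j) * ellGamma p q (x j / x k)) = 1 := by
      rw [← e2]
      refine inv_mul_cancel₀ fun h => ?_
      rw [h, inv_zero] at e2
      have hd : P * x j / (P * x k) = x j / x k := mul_div_mul_left _ _ hP0
      rw [hd] at hzd hzd0
      refine mul_ne_zero ?_ ?_ e2.symm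
      · rw [← inv_div]
        exact hΛ.theta_ne_zero hq hqΛ (hΛ.notMem_inv hzd) (inv_ne_zero hzd0)
      · exact hΛ.theta_ne_zero hp hpΛ hzd hzd0
    generalize ellGamma p q (P * x j * (P * x k)) = g1 at *
    generalize ellGamma p q (1 / (P * x j * (P * x k))) = g2 at *
    generalize ellGamma p q (x k / x j) = g3 at *
    generalize ellGamma p q (x j / x k) = g4 at *
    generalize theta (P * x j * (P * x k)) q = h1 at *
    generalize theta (P * x j * (P * x k))⁻¹ p = h2 at *
    generalize theta (x k / x j) q = h3 at *
    generalize theta (x j / x k) p = h4 at *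
    generalize ellGamma p q (t * (P * x j) * (P * x k)) = g5
    generalize theta (t * (P * x j) * (P * x k)) q = h5
    generalize ellGamma p q (t / (P * x j * (P * x k))) = g6
    generalize ellGamma p q (t * x j / x k) = g7
    generalize ellGamma p q (t * x k / x j) = g8
    linear_combination (-g5 * h5 * g6 * g7 * g8) * (h3 * h4 * (g3 * g4)) * e1' -
      g5 * h5 * g6 * g7 * g8 * e2'
  -- the factors for single variables: the reflection formula for `z_j²`, and
  -- `θ(t_r z_j; q) Γ(t_r z_j) = Γ(p t_r z_j)` for `r = a, b`
  · rw [← Finset.prod_mul_distrib]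
    refine Finset.prod_congr rfl fun j _ => ?_
    have hsq := hx.sq j
    have hsq0 := pow_ne_zero 2 (hx.ne_zero j)
    have e1 := refl _ hsq hsq0
    have hθ := hΛ.theta_ne_zero hq hqΛ hsq hsq0
    have e2 : ∀ r, gammaPair p q (α r - ζ) (poleExp a b α ζ r) (τ r) (x j) =
        (ellGamma p q (p ^ (α r : ℂ) * τ r * (P * x j)) *
          ellGamma p q (p ^ (α r : ℂ) * τ r / (P * x j))) *
        (if r = a ∨ r = b then theta (P * τ r * (P * x j)) q else 1) := by
      intro r
      have h1 : p ^ ((α r - ζ : ℝ) : ℂ) * (τ r / x j) = p ^ (α r : ℂ) * τ r / (P * x j) := by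
        have : p ^ ((α r - ζ : ℝ) : ℂ) * P = p ^ (α r : ℂ) := by
          rw [← hPz, ← cpow_ofReal_add hp0, sub_add_cancel]
        have := hx0 j
        rw [← ‹_ = p ^ (α r : ℂ)›]
        field_simp
      rw [gammaPair, h1, poleExp]
      split_ifs with hr
      · have hr' : α r = ζ ∧ P * τ r ∈ Λ := by
          rcases hr with rfl | rfl
          · exact ⟨ha, haΛ⟩
          · exact ⟨hb, hbΛ⟩
        rw [hl, hr'.1, hPz, show p * (P * P) * (τ r * x j) = p * (P * τ r * (P * x j)) by ring,
          ellGamma_p_mul hp0 hp hq (hΛ.theta_ne_zero hq hqΛ (hΛ.notMem_mul hr'.2 (hx.notMem j))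
            (mul_ne_zero (hΛ.ne_zero _ hr'.2) (hx.ne_zero j)))]
        ring
      · have : p ^ ((α r + ζ : ℝ) : ℂ) = p ^ (α r : ℂ) * P := by rw [← hPz, cpow_ofReal_add hp0]
        rw [this, mul_one]
        congr 2
        ring
    rw [Finset.prod_congr rfl fun r _ => e2 r,
      Finset.prod_mul_distrib (g := fun r => if r = a ∨ r = b then _ else _), prod_ite_eq_or hab, hκ',
      show (P * P)⁻¹ * (x j ^ 2)⁻¹ = ((P * x j) ^ 2)⁻¹ by rw [← mul_inv]; congr 1; ring, hz1, hz1,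
      div_eq_mul_inv (∏ r, _), e1, mul_div_assoc', div_eq_iff hθ]
    ring

/-- The effect of the shift of a parameter by `q^(-m)`. -/
lemma gammaPair_eq_normDen {m : ℕ} (hq0 : q ≠ 0) (hp0 : p ≠ 0) (hp : ‖p‖ < 1) (hq : ‖q‖ < 1)
    {s₁ s₂ : ℝ} {u : ℂ} (hu : u ≠ 0) {x : Fin n → ℂ} (hx : ∀ j, x j ≠ 0)
    (h : normDen n q m s₁ s₂ p x u ≠ 0) :
    ∏ j, gammaPair p q s₁ s₂ u (x j) =
      normDen n q m s₁ s₂ p x u * ∏ j, gammaPair p q s₁ s₂ (u / q ^ m) (x j) := by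
  have shift : ∀ (e : ℝ) (y : ℂ), y ≠ 0 → ∀ m : ℕ,
      (∏ k ∈ Finset.range m, theta (p ^ ((1 - e : ℝ) : ℂ) * (q ^ (k + 1) / y)) p) ≠ 0 →
      ellGamma p q (p ^ (e : ℂ) * y) =
        (∏ k ∈ Finset.range m, theta (p ^ ((1 - e : ℝ) : ℂ) * (q ^ (k + 1) / y)) p) *
          ellGamma p q (p ^ (e : ℂ) * (y / q ^ m)) := by
    intro e y hy m
    induction m with
    | zero => simp
    | succ m ih =>
      intro h
      rw [Finset.prod_range_succ] at h ⊢
      have e1 : p ^ ((1 - e : ℝ) : ℂ) * (q ^ (m + 1) / y) = p / (p ^ (e : ℂ) * (y / q ^ (m + 1))) := by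
        have h1 := mul_div_cpow_mul (y := y / q ^ (m + 1)) hp0 e 1
        rw [mul_one, one_div, inv_div] at h1
        exact h1.symm
      rw [ih (left_ne_zero_of_mul h)]
      have h2 := right_ne_zero_of_mul h
      rw [e1, theta_div_self hp0] at h2
      rw [e1, theta_div_self hp0, mul_assoc, ← ellGamma_q_mul hq0 hp hq h2]
      congr 2
      field_simp
      ring
  rw [normDen] at h ⊢
  rw [← Finset.prod_mul_distrib]
  refine Finset.prod_congr rfl fun j _ => ?_
  have hj := Finset.prod_ne_zero_iff.1 h j (Finset.mem_univ j)
  rw [Finset.prod_mul_distrib] at hj ⊢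
  have e3 : ∀ k : ℕ, q ^ (k + 1) * x j / u = q ^ (k + 1) / (u / x j) := fun k => by
    rw [div_div_eq_mul_div]
  have e4 : ∀ k : ℕ, q ^ (k + 1) / (x j * u) = q ^ (k + 1) / (u * x j) := fun k => by
    rw [mul_comm (x j)]
  simp only [e3, e4] at hj ⊢
  rw [gammaPair, gammaPair, shift s₂ (u * x j) (mul_ne_zero hu (hx j)) m (right_ne_zero_of_mul hj),
    shift s₁ (u / x j) (div_ne_zero hu (hx j)) m (left_ne_zero_of_mul hj), div_mul_eq_mul_div,
    div_right_comm u]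
  ring

end identity

/-! ### The elliptic integral over a fixed contour -/

section Holomorphic

variable {n : ℕ}

lemma SepHolomorphic.of_differentiableAt {G : (Fin n → ℂ) → ℂ} {N : Set ℂ}
    (h : ∀ z, (∀ j, z j ∈ N) → DifferentiableAt ℂ G z) : SepHolomorphic G N where
  continuousOn z hz := (h z fun j => hz j trivial).continuousAt.continuousWithinAt
  differentiableOn z hz j x hx := by
    refine DifferentiableAt.differentiableWithinAt ?_
    refine DifferentiableAt.comp x (h (Function.update z j x) fun k => ?_) ?_
    · rcases eq_or_ne k j with rfl | hk
      · simpa using hx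
      · simpa [hk] using hz k trivial
    · exact (hasDerivAt_update z j x).differentiableAt

variable {E : Type*} [NormedAddCommGroup E] [NormedSpace ℂ E] {p q : ℂ} {F : E → ℂ} {x : E}

lemma differentiableAt_ellGamma_comp (hp : ‖p‖ < 1) (hq : ‖q‖ < 1) (hF : DifferentiableAt ℂ F x)
    (h0 : F x ≠ 0) (h : ∀ i j : ℕ, p ^ i * q ^ j * F x ≠ 1) :
    DifferentiableAt ℂ (fun y => ellGamma p q (F y)) x := by
  simp only [ellGamma_eq]
  refine differentiableAt_div ?_ ?_ ?_
  · exact DifferentiableAt.comp x (differentiable_dPoch hp hq _)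
      (differentiableAt_div (differentiableAt_const _) hF h0)
  · exact DifferentiableAt.comp x (differentiable_dPoch hp hq _) hF
  · rw [Ne, dPoch_eq_zero_iff hp hq]
    push Not
    exact h

lemma differentiableAt_theta_comp (hq : ‖q‖ < 1) (hF : DifferentiableAt ℂ F x) (h0 : F x ≠ 0) :
    DifferentiableAt ℂ (fun y => theta (F y) q) x :=
  DifferentiableAt.comp (g := fun y => theta y q) x (differentiableAt_theta hq h0) hF

/-- The broken density has no poles where contours may pass. -/
theorem isDeformable_mul_brokenDensity {t : ℂ} {τ' : Fin 6 → ℂ} {a b : Fin 6} {α : Fin 6 → ℝ}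
    {ζ : ℝ} {v w : ℂ} (hp0 : p ≠ 0) (hp : ‖p‖ < 1) (hq : ‖q‖ < 1) (ht0 : t ≠ 0)
    (hτ' : ∀ r, τ' r ≠ 0) (hv : v ≠ 0) (hw : w ≠ 0) {Ψ : (Fin n → ℂ) → ℂ}
    (hΨ : DifferentiableOn ℂ Ψ (cstar (Fin n))) :
    IsDeformable n q t τ' a b α ζ p fun x => Ψ x * brokenDensity n p q t τ' a b α ζ v w x := by
  intro L U h
  have hP : ∀ e : ℝ, p ^ (e : ℂ) ≠ 0 := fun e => by simp [Complex.cpow_eq_zero_iff, hp0]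
  refine SepHolomorphic.of_differentiableAt fun z hz => ?_
  have hz0 : ∀ j, z j ≠ 0 := fun j h0 => (hz j).2 (h0 ▸ h.zero_mem)
  have hT : ∀ i j : ℕ, t * (p ^ i * q ^ j) ∈ (fun s => t * s) '' dpows p q := fun i j =>
    ⟨_, mem_dpows p q i j, rfl⟩
  have hd : ∀ j, DifferentiableAt ℂ (fun x : Fin n → ℂ => x j) z := fun j =>
    (differentiable_apply (𝕜 := ℂ) j) z
  refine (hΨ.differentiableAt (isOpen_cstar.mem_nhds hz0)).fun_mul (DifferentiableAt.fun_mul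
    (differentiableAt_finsetProd fun j _ => differentiableAt_finsetProd fun k hk => ?_)
    (differentiableAt_finsetProd fun j _ => ?_))
  · have hjk : j < k := (Finset.mem_filter.1 hk).2
    have hn : 2 ≤ n := by
      have := k.2
      have : (j : ℕ) < k := hjk
      omega
    have hmul := (hd j).fun_mul (hd k)
    have hjk0 := mul_ne_zero (hz0 j) (hz0 k)
    unfold brokenPair
    refine ((DifferentiableAt.fun_mul ?_ ?_).fun_mul (DifferentiableAt.fun_mul ?_ ?_)).fun_mul
      (DifferentiableAt.fun_mul ?_ (DifferentiableAt.fun_mul ?_ ?_))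
    · refine differentiableAt_ellGamma_comp hp hq
        ((((hd j).const_mul t).fun_mul (hd k)).const_mul _)
        (mul_ne_zero (hP _) (mul_ne_zero (mul_ne_zero ht0 (hz0 j)) (hz0 k))) fun i i' h1 => ?_
      refine h.cross hn _ (hT i i') _ (hz j).1 _ (hz k).1 ?_
      rw [← h1]; ring
    · refine differentiableAt_ellGamma_comp hp hq
        ((differentiableAt_div (differentiableAt_const _) hmul hjk0).const_mul _)
        (mul_ne_zero (hP _) (div_ne_zero ht0 hjk0)) fun i i' h1 => ?_
      refine h.mul_ne _ (hT i i') _ (hz j).2 _ (hz k).2 ?_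
      rw [mul_div_assoc', mul_div_assoc', div_eq_one_iff_eq hjk0] at h1
      rw [← h1]; ring
    · refine differentiableAt_ellGamma_comp hp hq
        (differentiableAt_div ((hd j).const_mul t) (hd k) (hz0 k))
        (div_ne_zero (mul_ne_zero ht0 (hz0 j)) (hz0 k)) fun i i' h1 => (hz k).2 ?_
      have := hz0 k
      field_simp at h1
      rw [← h1]
      convert h.mul_mem _ (hT i i') _ (hz j).1 using 1
      ring
    · refine differentiableAt_ellGamma_comp hp hq
        (differentiableAt_div ((hd k).const_mul t) (hd j) (hz0 j))
        (div_ne_zero (mul_ne_zero ht0 (hz0 k)) (hz0 j)) fun i i' h1 => (hz j).2 ?_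
      have := hz0 j
      field_simp at h1
      rw [← h1]
      convert h.mul_mem _ (hT i i') _ (hz k).1 using 1
      ring
    · exact differentiableAt_theta_comp hp ((hmul.fun_inv hjk0).const_mul _)
        (mul_ne_zero (hP _) (inv_ne_zero hjk0))
    · exact differentiableAt_theta_comp hp (differentiableAt_div (hd j) (hd k) (hz0 k))
        (div_ne_zero (hz0 j) (hz0 k))
    · exact differentiableAt_theta_comp hq (differentiableAt_div (hd k) (hd j) (hz0 j))
        (div_ne_zero (hz0 k) (hz0 j))
  · refine DifferentiableAt.fun_mul (differentiableAt_finsetProd fun r _ =>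
      DifferentiableAt.fun_mul ?_ ?_)
      (DifferentiableAt.fun_mul ?_ (DifferentiableAt.fun_mul ?_ ?_))
    · refine differentiableAt_ellGamma_comp hp hq (((hd j).const_mul _).const_mul _)
        (mul_ne_zero (hP _) (mul_ne_zero (hτ' r) (hz0 j))) fun i i' h1 => ?_
      refine h.excludes _ (Set.mem_iUnion.2 ⟨r, _, mem_dpows p q i i', rfl⟩) _ (hz j).1 ?_
      rw [← h1]; ring
    · refine differentiableAt_ellGamma_comp hp hq
        ((differentiableAt_div (differentiableAt_const _) (hd j) (hz0 j)).const_mul _)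
        (mul_ne_zero (hP _) (div_ne_zero (hτ' r) (hz0 j))) fun i i' h1 => (hz j).2 ?_
      refine h.contains (Set.mem_iUnion.2 ⟨r, _, mem_dpows p q i i', ?_⟩)
      have := hz0 j
      rw [sub_eq_add_neg, add_comm, cpow_ofReal_add hp0] at h1
      field_simp at h1
      rw [← h1]
      ring
    · exact differentiableAt_theta_comp hp
        ((((hd j).fun_pow 2).fun_inv (pow_ne_zero 2 (hz0 j))).const_mul _)
        (mul_ne_zero (hP _) (inv_ne_zero (pow_ne_zero 2 (hz0 j))))
    · exact differentiableAt_theta_comp hq ((hd j).const_mul v) (mul_ne_zero hv (hz0 j))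
    · exact differentiableAt_theta_comp hq ((hd j).const_mul w) (mul_ne_zero hw (hz0 j))

end Holomorphic

namespace ClosedChain

variable {C : ClosedChain} {n : ℕ}

lemma continuousOn_integrand {F : (Fin n → ℂ) → ℂ}
    (hF : ContinuousOn F (Set.univ.pi fun _ => C.support)) (e : Fin n → Fin C.num) :
    ContinuousOn (fun s : Fin n → ℝ => F (fun j => C.path (e j) (s j)) *
      ∏ j, deriv (C.path (e j)) (s j) / (2 * Real.pi * Complex.I * C.path (e j) (s j)))
      (Set.Icc 0 1) := by
  have hs : ∀ s ∈ (Set.Icc 0 1 : Set (Fin n → ℝ)), ∀ j, s j ∈ Set.Icc (0 : ℝ) 1 := fun s hs j =>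
    ⟨hs.1 j, hs.2 j⟩
  refine ContinuousOn.mul (hF.comp ?_ fun s h j _ => C.path_mem_support _ (hs s h j))
    (continuousOn_finsetProd _ fun j _ => ?_)
  · exact (continuous_pi fun j => (C.continuous_path (e j)).comp (continuous_apply j)).continuousOn
  · refine ContinuousOn.div
      ((C.continuous_deriv_path (e j)).comp (continuous_apply j)).continuousOn
      (continuous_const.mul ((C.continuous_path (e j)).comp (continuous_apply j))).continuousOn
      fun s h => ?_
    have h1 := C.ne_zero (e j) (s j) (hs s h j)
    have h2 : (Real.pi : ℂ) ≠ 0 := by exact_mod_cast Real.pi_ne_zero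
    simp [h1, h2]

lemma torusIntegral_const_mul (C : ClosedChain) (c : ℂ) (F : (Fin n → ℂ) → ℂ) :
    C.torusIntegral n (fun z => c * F z) = c * C.torusIntegral n F := by
  simp only [torusIntegral, mul_assoc, Finset.mul_sum, integral_const_mul]

lemma torusIntegral_sum {κ : Type*} {s : Finset κ} {F : κ → (Fin n → ℂ) → ℂ}
    (hF : ∀ i ∈ s, ContinuousOn (F i) (Set.univ.pi fun _ => C.support)) :
    C.torusIntegral n (fun z => ∑ i ∈ s, F i z) = ∑ i ∈ s, C.torusIntegral n (F i) := by
  simp only [torusIntegral]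
  rw [Finset.sum_comm]
  refine Finset.sum_congr rfl fun e _ => ?_
  simp only [Finset.sum_mul]
  exact integral_finsetSum _ fun i hi =>
    (continuousOn_integrand (hF i hi) e).integrableOn_compact isCompact_Icc

end ClosedChain

section SignFlips

variable {n : ℕ} {p q t : ℂ}

/-- The density of the elliptic Selberg integral is invariant under inversions of variables. -/
lemma ellDensity_signPow (τ : Fin 6 → ℂ) (ε : Fin n → Bool) (z : Fin n → ℂ) :
    ellDensity n p q t τ (fun j => signPow (ε j) (z j)) = ellDensity n p q t τ z := by
  have pair : ∀ (e e' : Bool) (x y : ℂ) (T : ℂ),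
      ellGamma p q (T * signPow e x * signPow e' y) * ellGamma p q (T * signPow e x / signPow e' y) *
        ellGamma p q (T * signPow e' y / signPow e x) *
        ellGamma p q (T / (signPow e x * signPow e' y)) =
      ellGamma p q (T * x * y) * ellGamma p q (T * x / y) * ellGamma p q (T * y / x) *
        ellGamma p q (T / (x * y)) := by
    intro e e' x y T
    have h1 : ∀ x y : ℂ, T * x⁻¹ * y = T * y / x := fun x y => by rw [div_eq_mul_inv]; ring
    have h2 : ∀ x y : ℂ, T * x⁻¹ / y = T / (x * y) := fun x y => by
      rw [div_eq_mul_inv, div_eq_mul_inv, mul_inv, mul_assoc]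
    have h3 : ∀ x y : ℂ, T / (x⁻¹ * y) = T * x / y := fun x y => by
      rw [div_eq_mul_inv, div_eq_mul_inv, mul_inv, inv_inv, mul_assoc]
    have h4 : ∀ x y : ℂ, T / (x * y⁻¹) = T * y / x := fun x y => by rw [mul_comm x, h3]
    rcases e <;> rcases e' <;> simp only [signPow_false, signPow_true]
    · rw [← div_eq_mul_inv (T * x) y, div_inv_eq_mul, h2, h4, mul_comm y x]
      ring
    · rw [h1, h2, h3, div_inv_eq_mul, mul_right_comm T y x]
      ring
    · rw [h1 x, h2 y x, h2 x y⁻¹, h4 x y, h2 y x⁻¹, h4 y x, h3 x y⁻¹, div_inv_eq_mul, mul_comm y x]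
      ring
  have pair1 := fun e e' x y => pair e e' x y 1
  simp only [one_mul] at pair1
  unfold ellDensity
  congr 1
  · refine Finset.prod_congr rfl fun j _ => Finset.prod_congr rfl fun k _ => ?_
    rw [pair, pair1]
  · refine Finset.prod_congr rfl fun j _ => ?_
    dsimp only
    rcases ε j
    · rfl
    · simp only [signPow_true, div_inv_eq_mul, inv_pow, one_div, one_mul]
      congr 1
      · exact Finset.prod_congr rfl fun r _ => by rw [mul_comm, ← div_eq_mul_inv]
      · rw [mul_comm]

/-- Invariance under the inversion of one variable implies invariance under all inversions; generic
points stay generic. -/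
lemma eq_signPow_of_eq_update {Λ : Set ℂ} (hΛ : IsMulGroup Λ) {F : (Fin n → ℂ) → ℂ}
    (hF : ∀ z, GenericPoint Λ z → ∀ i, F (Function.update z i (z i)⁻¹) = F z) {z : Fin n → ℂ}
    (hz : GenericPoint Λ z) (ε : Fin n → Bool) : F (fun j => signPow (ε j) (z j)) = F z := by
  have key : ∀ s : Finset (Fin n), F (fun j => signPow (decide (j ∈ s)) (z j)) = F z := by
    intro s
    induction s using Finset.induction_on with
    | empty => simp
    | insert i s hi ih =>
      rw [← ih, ← hF _ (hz.signPow hΛ fun j => decide (j ∈ s)) i]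
      congr 1
      funext j
      rcases eq_or_ne j i with rfl | hj
      · simp [hi]
      · simp [hj]
  rw [← key (Finset.univ.filter fun j => ε j = true)]
  simp

end SignFlips

/-- `Φ(x)` is `p^(-v) F(p^ζ x)` times its normalized polar factor, and `F` is symmetric. -/
structure IsNormalization (n : ℕ) (q : ℂ) (m : ℕ) (s₁ s₂ ζ v : ℝ) (p u : ℂ)
    (F Φ : (Fin n → ℂ) → ℂ) : Prop where
  inversion : ∀ x ∈ cstar (Fin n), normDen n q m s₁ s₂ p x u ≠ 0 → ∀ i,
    F (Function.update (fun j => p ^ (ζ : ℂ) * x j) i (p ^ (ζ : ℂ) * x i)⁻¹) =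
      F (fun j => p ^ (ζ : ℂ) * x j)
  eq : ∀ x ∈ cstar (Fin n), normDen n q m s₁ s₂ p x u ≠ 0 →
    Φ x = normDen n q m s₁ s₂ p x u * (p ^ ((-v : ℝ) : ℂ) * F (fun j => p ^ (ζ : ℂ) * x j))

/-- The polar factor does not vanish at generic points. -/
lemma GenericPoint.normDen_ne_zero {n m : ℕ} {q : ℂ} {s₁ s₂ ζ : ℝ} {p u : ℂ} {Λ : Set ℂ}
    (hp : ‖p‖ < 1) (hΛ : IsMulGroup Λ) (hpΛ : p ∈ Λ) (hqΛ : q ∈ Λ) (huΛ : u ∈ Λ)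
    (hΛP : ∀ e ∈ ({ζ, 1 - s₁, 1 - s₂} : Set ℝ), p ^ (e : ℂ) ∈ Λ) {x : Fin n → ℂ}
    (hx : GenericPoint Λ fun j => p ^ (ζ : ℂ) * x j) : normDen n q m s₁ s₂ p x u ≠ 0 := by
  have hxΛ : ∀ j, x j ∉ Λ := fun j hj => hx.notMem j (hΛ.mul_mem _ (hΛP ζ (by simp)) _ hj)
  have hx0 : ∀ j, x j ≠ 0 := fun j => right_ne_zero_of_mul (hx.ne_zero j)
  refine Finset.prod_ne_zero_iff.2 fun i _ => Finset.prod_ne_zero_iff.2 fun k _ =>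
    mul_ne_zero ?_ ?_
  · have h1 := hΛP (1 - s₁) (by simp)
    have h2 := hΛ.mul_mem _ h1 _ (hΛ.div_mem (hΛ.pow_mem hqΛ (k + 1)) huΛ)
    rw [show p ^ ((1 - s₁ : ℝ) : ℂ) * (q ^ (k + 1) * x i / u) =
      p ^ ((1 - s₁ : ℝ) : ℂ) * (q ^ (k + 1) / u) * x i by ring]
    exact hΛ.theta_ne_zero hp hpΛ (hΛ.notMem_mul h2 (hxΛ i)) (mul_ne_zero (hΛ.ne_zero _ h2) (hx0 i))
  · have h1 := hΛP (1 - s₂) (by simp)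
    have h2 := hΛ.mul_mem _ h1 _ (hΛ.div_mem (hΛ.pow_mem hqΛ (k + 1)) huΛ)
    rw [show p ^ ((1 - s₂ : ℝ) : ℂ) * (q ^ (k + 1) / (x i * u)) =
      p ^ ((1 - s₂ : ℝ) : ℂ) * (q ^ (k + 1) / u) / x i by rw [mul_comm (x i), ← div_div]; ring]
    exact hΛ.theta_ne_zero hp hpΛ (hΛ.notMem_div h2 (hxΛ i)) (div_ne_zero (hΛ.ne_zero _ h2) (hx0 i))

section

variable {n mf mg : ℕ} {p q t : ℂ} {τ : Fin 6 → ℂ} {a b : Fin 6} {α : Fin 6 → ℝ} {ζ : ℝ} {v w : ℂ}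

lemma tildeParam_of_ne {r : Fin 6} (h4 : r ≠ 4) (h5 : r ≠ 5) :
    tildeParam q mf mg τ r = τ r := by
  fin_cases r <;> simp_all [tildeParam]

lemma tildeParam_four : tildeParam q mf mg τ 4 = τ 4 / q ^ mf := by simp [tildeParam]

lemma tildeParam_five : tildeParam q mf mg τ 5 = τ 5 / q ^ mg := by simp [tildeParam]

/-- The shift of the parameters `t_4`, `t_5` absorbs the polar factors of `f` and `g`. -/
lemma brokenDensity_eq_tildeParam (hp0 : p ≠ 0) (hp : ‖p‖ < 1) (hq0 : q ≠ 0) (hq : ‖q‖ < 1)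
    (hτ : ∀ r, τ r ≠ 0) {x : Fin n → ℂ} (hx : ∀ j, x j ≠ 0)
    (h4 : normDen n q mf (α 4 - ζ) (poleExp a b α ζ 4) p x (τ 4) ≠ 0)
    (h5 : normDen n q mg (α 5 - ζ) (poleExp a b α ζ 5) p x (τ 5) ≠ 0) :
    brokenDensity n p q t τ a b α ζ v w x =
      normDen n q mf (α 4 - ζ) (poleExp a b α ζ 4) p x (τ 4) *
      normDen n q mg (α 5 - ζ) (poleExp a b α ζ 5) p x (τ 5) *
      brokenDensity n p q t (tildeParam q mf mg τ) a b α ζ v w x := by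
  have e4 := gammaPair_eq_normDen hq0 hp0 hp hq (hτ 4) hx h4
  have e5 := gammaPair_eq_normDen hq0 hp0 hp hq (hτ 5) hx h5
  have key : ∏ j, ∏ r, gammaPair p q (α r - ζ) (poleExp a b α ζ r) (τ r) (x j) =
      normDen n q mf (α 4 - ζ) (poleExp a b α ζ 4) p x (τ 4) *
      normDen n q mg (α 5 - ζ) (poleExp a b α ζ 5) p x (τ 5) *
      ∏ j, ∏ r, gammaPair p q (α r - ζ) (poleExp a b α ζ r) (tildeParam q mf mg τ r) (x j) := by
    rw [Finset.prod_comm, Finset.prod_comm (s := Finset.univ (α := Fin n))]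
    simp only [Fin.prod_univ_succ, Fin.prod_univ_zero (M := ℂ)]
    simp only [Fin.isValue, Fin.succ_zero_eq_one, Fin.succ_one_eq_two, mul_one,
      show Fin.succ (2 : Fin 3) = 3 from rfl, show Fin.succ (2 : Fin 4) = 3 from rfl,
      show Fin.succ (2 : Fin 5) = 3 from rfl, show Fin.succ (3 : Fin 4) = 4 from rfl,
      show Fin.succ (3 : Fin 5) = 4 from rfl, show Fin.succ (4 : Fin 5) = 5 from rfl]
    rw [e4, e5, tildeParam_four, tildeParam_five, tildeParam_of_ne (r := 0) (by decide) (by decide),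
      tildeParam_of_ne (r := 1) (by decide) (by decide),
      tildeParam_of_ne (r := 2) (by decide) (by decide),
      tildeParam_of_ne (r := 3) (by decide) (by decide)]
    ring
  rw [brokenDensity, brokenDensity, Finset.prod_mul_distrib (s := Finset.univ (α := Fin n)),
    Finset.prod_mul_distrib (s := Finset.univ (α := Fin n)) (f := fun j => ∏ r, _), key]
  ring

/-- Symmetrization turns the elliptic integral into `2^n` copies of an integral of the broken
density, each of which can be deformed to the contour of the limiting form. -/
theorem prod_theta_mul_torusIntegral (hn : 1 ≤ n) (hp0 : p ≠ 0) (hp : ‖p‖ < 1) (hq0 : q ≠ 0)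
    (hq : ‖q‖ < 1) (ht0 : t ≠ 0) (hτ : ∀ r, τ r ≠ 0) (hab : a ≠ b) (ha : α a = ζ) (hb : α b = ζ)
    (hv0 : v ≠ 0) (hw : w = q / (t ^ (n - 1) * v * τ a * τ b))
    (hvb : ∀ i < n, theta (t ^ i * τ b * v) q ≠ 0) {vf vg : ℝ} {F G Φ Ψ : (Fin n → ℂ) → ℂ}
    (hF : IsNormalization n q mf (α 4 - ζ) (poleExp a b α ζ 4) ζ vf p (τ 4) F Φ)
    (hG : IsNormalization n q mg (α 5 - ζ) (poleExp a b α ζ 5) ζ vg p (τ 5) G Ψ)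
    {D : ClosedChain} {I : ℂ}
    (hI : ∀ ε : Fin n → Bool,
      ContinuousOn (fun z : Fin n → ℂ => (fun x : Fin n → ℂ => Φ x * Ψ x *
        brokenDensity n p q t (tildeParam q mf mg τ) a b α ζ v w x)
          fun j => p ^ ((-ζ : ℝ) : ℂ) * signPow (ε j) (z j)) (Set.univ.pi fun _ => D.support) ∧
      D.torusIntegral n (fun z : Fin n → ℂ => (fun x : Fin n → ℂ => Φ x * Ψ x *
        brokenDensity n p q t (tildeParam q mf mg τ) a b α ζ v w x)
          fun j => p ^ ((-ζ : ℝ) : ℂ) * signPow (ε j) (z j)) = I) :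
    (∏ i ∈ Finset.range n, (theta (t ^ i * (p ^ (ζ : ℂ) * τ a) * (p ^ (ζ : ℂ) * τ b)) q *
        theta (t ^ i * τ a * v) q * theta (t ^ i * τ a * w) q)) *
      D.torusIntegral n (fun z => F z * G z * ellDensity n p q t (fun r => p ^ (α r : ℂ) * τ r) z) =
      2 ^ n * (p ^ ((vf + vg : ℝ) : ℂ) * I) := by
  have hP : ∀ e : ℝ, p ^ (e : ℂ) ≠ 0 := fun e => by simp [Complex.cpow_eq_zero_iff, hp0]
  have hPP : p ^ ((-ζ : ℝ) : ℂ) * p ^ (ζ : ℂ) = 1 := by rw [← cpow_ofReal_add hp0]; simp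
  let A : Set ℂ := {p, q, t, v} ∪ Set.range τ ∪ (fun e : ℝ => p ^ (e : ℂ)) ''
    {ζ, 1 - (α 4 - ζ), 1 - poleExp a b α ζ 4, 1 - (α 5 - ζ), 1 - poleExp a b α ζ 5}
  have hAc : A.Countable := by
    refine Set.Countable.union (Set.Countable.union ?_ (Set.countable_range _))
      (Set.Countable.image ?_ _)
    · exact (Set.toFinite _).countable
    · exact (Set.toFinite _).countable
  obtain ⟨Λ, hΛc, hΛ, hAΛ⟩ := IsMulGroup.exists_countable hAc (by
    rintro x ((hx | ⟨r, rfl⟩) | ⟨e, -, rfl⟩)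
    · rcases hx with rfl | rfl | rfl | rfl <;> assumption
    · exact hτ r
    · exact hP e)
  have hpΛ : p ∈ Λ := hAΛ (by simp [A])
  have hqΛ : q ∈ Λ := hAΛ (by simp [A])
  have htΛ : t ∈ Λ := hAΛ (by simp [A])
  have hvΛ : v ∈ Λ := hAΛ (by simp [A])
  have hτΛ : ∀ r, τ r ∈ Λ := fun r => hAΛ (Or.inl (Or.inr ⟨r, rfl⟩))
  have hPΛ : ∀ e ∈ ({ζ, 1 - (α 4 - ζ), 1 - poleExp a b α ζ 4, 1 - (α 5 - ζ),
      1 - poleExp a b α ζ 5} : Set ℝ), p ^ (e : ℂ) ∈ Λ := fun e he => hAΛ (Or.inr ⟨e, he, rfl⟩)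
  have hζΛ : p ^ (ζ : ℂ) ∈ Λ := hPΛ ζ (by simp)
  obtain ⟨ι, hι, P, hP0, hPgen⟩ := exists_polynomials_genericPoint (n := n) hΛc hΛ
  -- `z` is recovered from the point `p^(-ζ) z`
  have hback : ∀ z : Fin n → ℂ, (fun j => p ^ (ζ : ℂ) * (p ^ ((-ζ : ℝ) : ℂ) * z j)) = z := fun z => by
    funext j
    rw [← mul_assoc, mul_comm (p ^ (ζ : ℂ)), hPP, one_mul]
  have hgen : ∀ z : Fin n → ℂ, GenericPoint Λ z →
      GenericPoint Λ (fun j => p ^ (ζ : ℂ) * (p ^ ((-ζ : ℝ) : ℂ) * z j)) := fun z hz => by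
    rw [hback]; exact hz
  have hcs : ∀ z : Fin n → ℂ, GenericPoint Λ z → (fun j => p ^ ((-ζ : ℝ) : ℂ) * z j) ∈ cstar (Fin n) :=
    fun z hz j => mul_ne_zero (hP _) (hz.ne_zero j)
  have h4 : ∀ z : Fin n → ℂ, GenericPoint Λ z → normDen n q mf (α 4 - ζ) (poleExp a b α ζ 4) p
      (fun j => p ^ ((-ζ : ℝ) : ℂ) * z j) (τ 4) ≠ 0 := fun z hz =>
    (hgen z hz).normDen_ne_zero hp hΛ hpΛ hqΛ (hτΛ 4) (fun e he => hPΛ e (by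
      rcases he with rfl | rfl | rfl <;> simp))
  have h5 : ∀ z : Fin n → ℂ, GenericPoint Λ z → normDen n q mg (α 5 - ζ) (poleExp a b α ζ 5) p
      (fun j => p ^ ((-ζ : ℝ) : ℂ) * z j) (τ 5) ≠ 0 := fun z hz =>
    (hgen z hz).normDen_ne_zero hp hΛ hpΛ hqΛ (hτΛ 5) (fun e he => hPΛ e (by
      rcases he with rfl | rfl | rfl <;> simp))
  have hFs : ∀ z : Fin n → ℂ, GenericPoint Λ z → ∀ ε : Fin n → Bool,
      F (fun j => signPow (ε j) (z j)) = F z := fun z hz =>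
    eq_signPow_of_eq_update hΛ (fun z hz i => by
      have := hF.inversion _ (hcs z hz) (h4 z hz) i
      rwa [hback, ← mul_assoc, mul_comm (p ^ (ζ : ℂ)), hPP, one_mul] at this) hz
  have hGs : ∀ z : Fin n → ℂ, GenericPoint Λ z → ∀ ε : Fin n → Bool,
      G (fun j => signPow (ε j) (z j)) = G z := fun z hz =>
    eq_signPow_of_eq_update hΛ (fun z hz i => by
      have := hG.inversion _ (hcs z hz) (h5 z hz) i
      rwa [hback, ← mul_assoc, mul_comm (p ^ (ζ : ℂ)), hPP, one_mul] at this) hz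
  -- the product of the integrand with the summand without inversions
  have hterm : ∀ z : Fin n → ℂ, GenericPoint Λ z →
      F z * G z * ellDensity n p q t (fun r => p ^ (α r : ℂ) * τ r) z *
        thetaTerm q t (p ^ (ζ : ℂ) * τ a) (p ^ (ζ : ℂ) * τ b) (p ^ ((-ζ : ℝ) : ℂ) * v)
          (p ^ ((-ζ : ℝ) : ℂ) * w) z =
      p ^ ((vf + vg : ℝ) : ℂ) * (fun x : Fin n → ℂ => Φ x * Ψ x *
        brokenDensity n p q t (tildeParam q mf mg τ) a b α ζ v w x)
          fun j => p ^ ((-ζ : ℝ) : ℂ) * z j := by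
    intro z hz
    have e1 := ellDensity_mul_thetaTerm (v := v) (w := w) hp hq hab ha hb hΛ hpΛ hqΛ htΛ
      (hΛ.mul_mem _ hζΛ _ (hτΛ a)) (hΛ.mul_mem _ hζΛ _ (hτΛ b)) (hgen z hz)
    have e2 := hF.eq _ (hcs z hz) (h4 z hz)
    have e3 := hG.eq _ (hcs z hz) (h5 z hz)
    have e4 := brokenDensity_eq_tildeParam (t := t) (v := v) (w := w) hp0 hp hq0 hq hτ (hcs z hz)
      (h4 z hz) (h5 z hz)
    rw [hback] at e1 e2 e3
    have e5 : p ^ ((vf + vg : ℝ) : ℂ) * (p ^ ((-vf : ℝ) : ℂ) * p ^ ((-vg : ℝ) : ℂ)) = 1 := by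
      rw [← cpow_ofReal_add hp0, ← cpow_ofReal_add hp0,
        show vf + vg + (-vf + -vg) = 0 by ring]
      simp
    dsimp only
    rw [mul_assoc, e1, e4, e2, e3]
    linear_combination -(F z * G z *
      normDen n q mf (α 4 - ζ) (poleExp a b α ζ 4) p (fun j => p ^ ((-ζ : ℝ) : ℂ) * z j) (τ 4) *
      normDen n q mg (α 5 - ζ) (poleExp a b α ζ 5) p (fun j => p ^ ((-ζ : ℝ) : ℂ) * z j) (τ 5) *
      brokenDensity n p q t (tildeParam q mf mg τ) a b α ζ v w
        (fun j => p ^ ((-ζ : ℝ) : ℂ) * z j)) * e5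
  have hcancel : ∀ y : ℂ, p ^ (ζ : ℂ) * τ a * (p ^ ((-ζ : ℝ) : ℂ) * y) = τ a * y := fun y => by
    linear_combination τ a * y * hPP
  have hsum : ∀ z : Fin n → ℂ, GenericPoint Λ z →
      ∑ ε : Fin n → Bool, thetaTerm q t (p ^ (ζ : ℂ) * τ a) (p ^ (ζ : ℂ) * τ b)
        (p ^ ((-ζ : ℝ) : ℂ) * v) (p ^ ((-ζ : ℝ) : ℂ) * w) (fun j => signPow (ε j) (z j)) =
      ∏ i ∈ Finset.range n, (theta (t ^ i * (p ^ (ζ : ℂ) * τ a) * (p ^ (ζ : ℂ) * τ b)) q *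
        theta (t ^ i * τ a * v) q * theta (t ^ i * τ a * w) q) := by
    intro z hz
    rw [sum_thetaTerm hq0 hq ht0 ?_ (hz.thetaGeneric hΛ hq hqΛ) ?_]
    · refine Finset.prod_congr rfl fun i _ => ?_
      rw [mul_assoc (t ^ i) _ (_ * v), hcancel, mul_assoc (t ^ i) _ (_ * w), hcancel,
        mul_assoc (t ^ i) (τ a) v, mul_assoc (t ^ i) (τ a) w]
    · have h1 : p ^ (ζ : ℂ) * τ a * (p ^ (ζ : ℂ) * τ b) * (p ^ ((-ζ : ℝ) : ℂ) * v) *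
          (p ^ ((-ζ : ℝ) : ℂ) * w) = τ a * τ b * v * w := by
        linear_combination τ a * τ b * v * w * (p ^ ((-ζ : ℝ) : ℂ) * p ^ (ζ : ℂ) + 1) * hPP
      obtain ⟨k, rfl⟩ : ∃ k, n = k + 1 := ⟨n - 1, by omega⟩
      have := hτ a
      have := hτ b
      rw [h1, hw, Nat.add_sub_cancel, pow_succ]
      field_simp
    · intro i hi k l e
      have h1 : p ^ (ζ : ℂ) * τ b * (p ^ ((-ζ : ℝ) : ℂ) * v) = τ b * v := by
        linear_combination τ b * v * hPP
      have h2 : t ^ i * (τ b * v) ∈ Λ :=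
        hΛ.mul_mem _ (hΛ.pow_mem htΛ i) _ (hΛ.mul_mem _ (hτΛ b) _ hvΛ)
      rw [h1]
      by_cases hkl : k = l ∧ e = true
      · obtain ⟨rfl, rfl⟩ := hkl
        rw [signPow_true, mul_inv_cancel₀ (hz.ne_zero k), mul_one, ← mul_assoc]
        exact hvb i hi
      · refine hΛ.theta_ne_zero hq hqΛ (hΛ.notMem_mul h2 ?_) (mul_ne_zero (hΛ.ne_zero _ h2)
          (mul_ne_zero (hz.ne_zero k) (signPow_ne_zero e (hz.ne_zero l))))
        rcases e
        · rcases eq_or_ne k l with rfl | hkl'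
          · simpa [sq] using hz.sq k
          · exact hz.mul k l hkl'
        · exact hz.div k l fun h => hkl ⟨h, rfl⟩
  rw [← D.torusIntegral_const_mul]
  have hcongr : D.torusIntegral n (fun z =>
      (∏ i ∈ Finset.range n, (theta (t ^ i * (p ^ (ζ : ℂ) * τ a) * (p ^ (ζ : ℂ) * τ b)) q *
        theta (t ^ i * τ a * v) q * theta (t ^ i * τ a * w) q)) *
      (F z * G z * ellDensity n p q t (fun r => p ^ (α r : ℂ) * τ r) z)) =
    D.torusIntegral n (fun z => ∑ ε : Fin n → Bool, p ^ ((vf + vg : ℝ) : ℂ) *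
      (fun x : Fin n → ℂ => Φ x * Ψ x *
        brokenDensity n p q t (tildeParam q mf mg τ) a b α ζ v w x)
          fun j => p ^ ((-ζ : ℝ) : ℂ) * signPow (ε j) (z j)) := by
    refine D.torusIntegral_congr_of_polynomials P hP0 fun z hzD hzP => ?_
    have hz := hPgen z (fun j => D.ne_zero_of_mem_support (hzD j)) hzP
    rw [← hsum z hz, Finset.sum_mul]
    refine Finset.sum_congr rfl fun ε _ => ?_
    rw [← hterm _ (hz.signPow hΛ ε), hFs z hz, hGs z hz, ellDensity_signPow]
    ring
  rw [hcongr, ClosedChain.torusIntegral_sum fun ε _ => (hI ε).1.const_mul _]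
  simp only [ClosedChain.torusIntegral_const_mul, fun ε => (hI ε).2]
  simp

end

/-! ### The limit of the integral over a fixed contour -/

namespace ClosedChain

/-- Passage to the limit under the integral. Locally uniform convergence provides a bound for the
integrand on the compact set of integration. -/
theorem tendsto_torusIntegral (C : ClosedChain) {n : ℕ} {G : ℂ → (Fin n → ℂ) → ℂ}
    {G₀ : (Fin n → ℂ) → ℂ}
    (h : ∀ x : Fin n → ℂ, (∀ j, x j ∈ C.support) →
      Tendsto (fun y : ℂ × (Fin n → ℂ) => G y.1 y.2) (𝓝[≠] 0 ×ˢ 𝓝 x) (𝓝 (G₀ x)))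
    (hcont : ∀ᶠ p in 𝓝[≠] (0 : ℂ), ContinuousOn (G p) (Set.univ.pi fun _ => C.support)) :
    Tendsto (fun p => C.torusIntegral n (G p)) (𝓝[≠] 0) (𝓝 (C.torusIntegral n G₀)) := by
  have hK : IsCompact (Set.univ.pi fun _ : Fin n => C.support) :=
    isCompact_univ_pi fun _ => C.isCompact_support
  obtain ⟨M, hM⟩ : ∃ M : ℝ, ∀ᶠ p in 𝓝[≠] (0 : ℂ), ∀ x ∈ Set.univ.pi fun _ : Fin n => C.support,
      ‖G p x‖ ≤ M := by
    refine hK.induction_on (p := fun S => ∃ M : ℝ, ∀ᶠ p in 𝓝[≠] (0 : ℂ), ∀ x ∈ S, ‖G p x‖ ≤ M)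
      ⟨0, by simp⟩ ?_ ?_ ?_
    · rintro s t hst ⟨M, hM⟩
      exact ⟨M, hM.mono fun p hp x hx => hp x (hst hx)⟩
    · rintro s t ⟨M, hM⟩ ⟨M', hM'⟩
      refine ⟨max M M', (hM.and hM').mono fun p hp x hx => ?_⟩
      rcases hx with hx | hx
      · exact (hp.1 x hx).trans (le_max_left _ _)
      · exact (hp.2 x hx).trans (le_max_right _ _)
    · intro x hx
      obtain ⟨A, hA, B, hB, hAB⟩ := Filter.eventually_prod_iff.1
        ((h x fun j => hx j trivial).norm.eventually_lt_const (lt_add_one ‖G₀ x‖))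
      exact ⟨{y | B y}, nhdsWithin_le_nhds hB, ‖G₀ x‖ + 1, hA.mono fun p hp y hy => (hAB hp hy).le⟩
  refine tendsto_finsetSum _ fun e _ => ?_
  have hmem : ∀ s ∈ (Set.Icc 0 1 : Set (Fin n → ℝ)), ∀ j, C.path (e j) (s j) ∈ C.support :=
    fun s hs j => C.path_mem_support _ ⟨hs.1 j, hs.2 j⟩
  have hw := (continuousOn_integrand (C := C) (F := fun _ => (1 : ℂ)) continuousOn_const
    e).integrableOn_compact (μ := volume) isCompact_Icc
  simp only [one_mul] at hw
  refine tendsto_integral_filter_of_dominated_convergence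
    (fun s => M * ‖∏ j, deriv (C.path (e j)) (s j) /
      (2 * Real.pi * Complex.I * C.path (e j) (s j))‖) ?_ ?_ (hw.norm.const_mul M) ?_
  · filter_upwards [hcont] with p hp
    exact (continuousOn_integrand hp e).aestronglyMeasurable measurableSet_Icc
  · filter_upwards [hM] with p hp
    filter_upwards [ae_restrict_mem measurableSet_Icc] with s hs
    rw [norm_mul]
    gcongr
    exact hp _ fun j _ => hmem s hs j
  · filter_upwards [ae_restrict_mem measurableSet_Icc] with s hs
    refine Tendsto.mul_const _ ?_
    exact (h _ (hmem s hs)).comp (tendsto_id.prodMk tendsto_const_nhds)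

end ClosedChain

/-- The limit of the broken density as `p → 0`. -/
noncomputable def brokenLim (n : ℕ) (q t : ℂ) (τ : Fin 6 → ℂ) (a b : Fin 6) (α : Fin 6 → ℝ)
    (ζ : ℝ) (v w : ℂ) (x : Fin n → ℂ) : ℂ :=
  (∏ j, ∏ k ∈ Finset.univ.filter (fun k => j < k),
    gammaLim q (1 + 2 * ζ) (t * x j * x k) * gammaLim q (-2 * ζ) (t / (x j * x k)) *
      (gammaLim q 0 (t * x j / x k) * gammaLim q 0 (t * x k / x j)) *
      (thetaLim (-2 * ζ) (x j * x k)⁻¹ * (thetaLim 0 (x j / x k) * theta (x k / x j) q))) *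
  ∏ j, (∏ r, gammaLim q (poleExp a b α ζ r) (τ r * x j) * gammaLim q (α r - ζ) (τ r / x j)) *
    (thetaLim (-2 * ζ) (x j ^ 2)⁻¹ * (theta (v * x j) q * theta (w * x j) q))

/-- The conditions under which no denominator of `brokenLim` vanishes. -/
structure LimRegular (n : ℕ) (q t : ℂ) (τ : Fin 6 → ℂ) (a b : Fin 6) (α : Fin 6 → ℝ) (ζ : ℝ)
    (x : Fin n → ℂ) : Prop where
  ne_zero : ∀ j, x j ≠ 0
  cross : ∀ j k, j < k → qPoch (powLim (1 + 2 * ζ) (t * x j * x k)) q ≠ 0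
  div : ∀ j k, j ≠ k → qPoch (t * x j / x k) q ≠ 0
  outer : ∀ j r, qPoch (powLim (poleExp a b α ζ r) (τ r * x j)) q ≠ 0
  inner : ∀ j r, qPoch (powLim (α r - ζ) (τ r / x j)) q ≠ 0

lemma powLim_of_ne {e : ℝ} (he : e ≠ 0) (y : ℂ) : powLim e y = 0 := if_neg he

lemma powLim_zero (y : ℂ) : powLim 0 y = y := if_pos rfl

lemma qPoch_powLim_of_ne {e : ℝ} (he : e ≠ 0) (y q : ℂ) : qPoch (powLim e y) q = 1 := by
  rw [powLim_of_ne he, qPoch_zero]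

/-- The ranges of the exponents that are common to most statements below. -/
structure ExpRange (a b : Fin 6) (α : Fin 6 → ℝ) (ζ : ℝ) : Prop where
  ne : a ≠ b
  neg : ζ < 0
  ge : -1 / 2 ≤ ζ
  eq_a : α a = ζ
  eq_b : α b = ζ
  ge_neg : ∀ r, r ≠ a → r ≠ b → -ζ ≤ α r
  le : ∀ r, r ≠ a → r ≠ b → α r ≤ 1 + ζ

namespace ExpRange

variable {a b : Fin 6} {α : Fin 6 → ℝ} {ζ : ℝ}

lemma eq_of_or (h : ExpRange a b α ζ) {r : Fin 6} (hr : r = a ∨ r = b) : α r = ζ := by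
  rcases hr with rfl | rfl
  exacts [h.eq_a, h.eq_b]

lemma inner_mem (h : ExpRange a b α ζ) (r : Fin 6) : 0 ≤ α r - ζ ∧ α r - ζ ≤ 1 := by
  by_cases hr : r = a ∨ r = b
  · rw [h.eq_of_or hr]; simp
  · push Not at hr
    have h1 := h.ge_neg r hr.1 hr.2
    have h2 := h.le r hr.1 hr.2
    have h3 := h.neg
    constructor <;> linarith

lemma poleExp_mem (h : ExpRange a b α ζ) (r : Fin 6) :
    0 ≤ poleExp a b α ζ r ∧ poleExp a b α ζ r ≤ 1 := by
  have h3 := h.neg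
  have h4 := h.ge
  unfold poleExp
  split_ifs with hr
  · constructor <;> linarith
  · push Not at hr
    have h1 := h.ge_neg r hr.1 hr.2
    have h2 := h.le r hr.1 hr.2
    constructor <;> linarith

lemma poleExp_eq (h : ExpRange a b α ζ) (r : Fin 6) :
    poleExp a b α ζ r = α r + ζ ∨ poleExp a b α ζ r = α r + ζ + 1 := by
  unfold poleExp
  split_ifs with hr
  · right; rw [h.eq_of_or hr]; ring
  · left; rfl

lemma inner_eq_zero_iff (h : ExpRange a b α ζ) (r : Fin 6) : α r - ζ = 0 ↔ r = a ∨ r = b := by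
  constructor
  · intro h1
    by_contra hr
    push Not at hr
    have h2 := h.ge_neg r hr.1 hr.2
    have h3 := h.neg
    linarith
  · intro hr; rw [h.eq_of_or hr, sub_self]

lemma one_add_two_mul_eq_zero_iff : 1 + 2 * ζ = 0 ↔ ζ = -1 / 2 := by
  constructor <;> intro h <;> linarith

end ExpRange

section limit

variable {n mf mg : ℕ} {q t : ℂ} {τ : Fin 6 → ℂ} {a b : Fin 6} {α : Fin 6 → ℝ} {ζ : ℝ} {v w : ℂ}

/-- The arguments of all factors are of the form `p^e y` with `0 ≤ e ≤ 1`, and for such arguments the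
elliptic gamma function and the theta function converge. -/
theorem tendsto_brokenDensity {β : Type*} {l : Filter β} {P : β → ℂ} {X : β → Fin n → ℂ}
    {x : Fin n → ℂ} (hq : ‖q‖ < 1) (ht0 : t ≠ 0) (hτ : ∀ r, τ r ≠ 0) (hv : v ≠ 0)
    (hw : w ≠ 0) (hR : ExpRange a b α ζ) (hP : Tendsto P l (𝓝[≠] 0)) (hX : Tendsto X l (𝓝 x))
    (hx : LimRegular n q t τ a b α ζ x) :
    Tendsto (fun i => brokenDensity n (P i) q t τ a b α ζ v w (X i)) l
      (𝓝 (brokenLim n q t τ a b α ζ v w x)) := by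
  have hXj : ∀ j, Tendsto (fun i => X i j) l (𝓝 (x j)) := tendsto_pi_nhds.1 hX
  have hx0 := hx.ne_zero
  have h3 := hR.neg
  have h4 := hR.ge
  have hθ : ∀ {Y : β → ℂ} {y : ℂ}, Tendsto Y l (𝓝 y) → y ≠ 0 →
      Tendsto (fun i => theta (Y i) q) l (𝓝 (theta y q)) := fun hY hy =>
    ((differentiableAt_theta hq hy).continuousAt.tendsto).comp hY
  refine Tendsto.mul (tendsto_finsetProd _ fun j _ => tendsto_finsetProd _ fun k hk => ?_)
    (tendsto_finsetProd _ fun j _ => ?_)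
  · have hjk : j < k := (Finset.mem_filter.1 hk).2
    have hjk0 := mul_ne_zero (hx0 j) (hx0 k)
    have hd1 := (((hXj j).const_mul t).div (hXj k) (hx0 k))
    have hd2 := (((hXj k).const_mul t).div (hXj j) (hx0 j))
    have hΓ : ∀ {Y : β → ℂ} {y : ℂ}, Tendsto Y l (𝓝 y) → y ≠ 0 → qPoch y q ≠ 0 →
        Tendsto (fun i => ellGamma (P i) q (Y i)) l (𝓝 (gammaLim q 0 y)) := by
      intro Y y hY hy hqy
      simpa using tendsto_ellGamma hq hP hY hy le_rfl zero_le_one (by rwa [powLim_zero])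
    refine ((Tendsto.mul ?_ ?_).mul (Tendsto.mul ?_ ?_)).mul
      (Tendsto.mul ?_ (Tendsto.mul ?_ ?_))
    · exact tendsto_ellGamma hq hP (((hXj j).const_mul t).mul (hXj k))
        (mul_ne_zero (mul_ne_zero ht0 (hx0 j)) (hx0 k)) (by linarith) (by linarith)
        (hx.cross j k hjk)
    · refine tendsto_ellGamma hq hP (tendsto_const_nhds.div ((hXj j).mul (hXj k)) hjk0)
        (div_ne_zero ht0 hjk0) (by linarith) (by linarith) ?_
      rw [qPoch_powLim_of_ne (by linarith)]
      exact one_ne_zero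
    · exact hΓ hd1 (div_ne_zero (mul_ne_zero ht0 (hx0 j)) (hx0 k)) (hx.div j k hjk.ne)
    · exact hΓ hd2 (div_ne_zero (mul_ne_zero ht0 (hx0 k)) (hx0 j)) (hx.div k j hjk.ne')
    · exact tendsto_theta_cpow hP (((hXj j).mul (hXj k)).inv₀ hjk0) (inv_ne_zero hjk0)
        (by linarith) (by linarith)
    · simpa using tendsto_theta_cpow hP ((hXj j).div (hXj k) (hx0 k))
        (div_ne_zero (hx0 j) (hx0 k)) le_rfl zero_le_one
    · exact hθ ((hXj k).div (hXj j) (hx0 j)) (div_ne_zero (hx0 k) (hx0 j))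
  · refine Tendsto.mul (tendsto_finsetProd _ fun r _ => Tendsto.mul ?_ ?_)
      (Tendsto.mul ?_ (Tendsto.mul ?_ ?_))
    · exact tendsto_ellGamma hq hP ((hXj j).const_mul _) (mul_ne_zero (hτ r) (hx0 j))
        (hR.poleExp_mem r).1 (hR.poleExp_mem r).2 (hx.outer j r)
    · exact tendsto_ellGamma hq hP (tendsto_const_nhds.div (hXj j) (hx0 j))
        (div_ne_zero (hτ r) (hx0 j)) (hR.inner_mem r).1 (hR.inner_mem r).2 (hx.inner j r)
    · exact tendsto_theta_cpow hP (((hXj j).pow 2).inv₀ (pow_ne_zero 2 (hx0 j)))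
        (inv_ne_zero (pow_ne_zero 2 (hx0 j))) (by linarith) (by linarith)
    · exact hθ ((hXj j).const_mul v) (mul_ne_zero hv (hx0 j))
    · exact hθ ((hXj j).const_mul w) (mul_ne_zero hw (hx0 j))

/-- The conditions on the contours of the limiting form exclude the poles of the limit. -/
lemma IsLimitContour.limRegular {C : ClosedChain} (hC : IsLimitContour n q t τ a b α ζ C)
    (hq : ‖q‖ < 1) (hR : ExpRange a b α ζ) {x : Fin n → ℂ} (hx : ∀ j, x j ∈ C.support) :
    LimRegular n q t τ a b α ζ x := by
  have hx0 : ∀ j, x j ≠ 0 := fun j => C.ne_zero_of_mem_support (hx j)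
  refine ⟨hx0, fun j k hjk => ?_, fun j k _ => ?_, fun j r => ?_, fun j r => ?_⟩
  · by_cases h : 1 + 2 * ζ = 0
    · have hn : 2 ≤ n := by
        have := k.2
        have : (j : ℕ) < k := hjk
        omega
      rw [h, powLim_zero, Ne, qPoch_eq_zero_iff hq]
      rintro ⟨i, hi⟩
      refine (hC.excludes_image_inv (ExpRange.one_add_two_mul_eq_zero_iff.1 h) hn i _ (hx j)).1 ?_
      rw [inv_eq_of_mul_eq_one_right (b := x k) (by rw [← hi]; ring)]
      exact hx k
    · rw [qPoch_powLim_of_ne h]; exact one_ne_zero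
  · rw [Ne, qPoch_eq_zero_iff hq]
    rintro ⟨i, hi⟩
    refine (hC.contains_image i _ (hx j)).1.1 ?_
    have := hx0 k
    rw [mul_div_assoc', div_eq_one_iff_eq this] at hi
    convert hx k using 1
    rw [← hi]; ring
  · by_cases h : poleExp a b α ζ r = 0
    · rw [h, powLim_zero, Ne, qPoch_eq_zero_iff hq]
      rintro ⟨i, hi⟩
      have hout : (q ^ i * τ r)⁻¹ ∈ C.outside := by
        unfold poleExp at h
        split_ifs at h with hr
        · rcases hr with rfl | rfl
          · exact hC.excludes_a (ExpRange.one_add_two_mul_eq_zero_iff.1 h) i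
          · exact hC.excludes_b (ExpRange.one_add_two_mul_eq_zero_iff.1 h) i
        · exact hC.excludes r (by linarith) i
      refine hout.1 ?_
      rw [inv_eq_of_mul_eq_one_right (b := x j) (by rw [← hi]; ring)]
      exact hx j
    · rw [qPoch_powLim_of_ne h]; exact one_ne_zero
  · by_cases h : α r - ζ = 0
    · rw [h, powLim_zero, Ne, qPoch_eq_zero_iff hq]
      rintro ⟨i, hi⟩
      have hin : q ^ i * τ r ∈ C.inside := by
        rcases (hR.inner_eq_zero_iff r).1 h with rfl | rfl
        · exact hC.contains_a i
        · exact hC.contains_b i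
      refine hin.1 ?_
      rw [mul_div_assoc', div_eq_one_iff_eq (hx0 j)] at hi
      rw [hi]
      exact hx j
    · rw [qPoch_powLim_of_ne h]; exact one_ne_zero

/-- For generic points, regularity does not depend on the parameters `τ`. -/
lemma LimRegular.of_genericPoint {Λ : Set ℂ} {τ' : Fin 6 → ℂ} (hq : ‖q‖ < 1) (hΛ : IsMulGroup Λ)
    (hqΛ : q ∈ Λ) (hτΛ : ∀ r, τ' r ∈ Λ) {x : Fin n → ℂ} (hx : LimRegular n q t τ a b α ζ x)
    (hxΛ : GenericPoint Λ x) : LimRegular n q t τ' a b α ζ x := by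
  have hne : ∀ y ∉ Λ, qPoch y q ≠ 0 := fun y hy h => by
    obtain ⟨k, hk⟩ := (qPoch_eq_zero_iff hq y).1 h
    refine hΛ.notMem_mul (hΛ.pow_mem hqΛ k) hy ?_
    rw [hk]
    exact hΛ.one_mem
  refine ⟨hx.ne_zero, hx.cross, hx.div, fun j r => ?_, fun j r => ?_⟩
  · by_cases h : poleExp a b α ζ r = 0
    · rw [h, powLim_zero]
      exact hne _ (hΛ.notMem_mul (hτΛ r) (hxΛ.notMem j))
    · rw [qPoch_powLim_of_ne h]; exact one_ne_zero
  · by_cases h : α r - ζ = 0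
    · rw [h, powLim_zero]
      exact hne _ (hΛ.notMem_div (hτΛ r) (hxΛ.notMem j))
    · rw [qPoch_powLim_of_ne h]; exact one_ne_zero

/-- For generic points, the limit of the broken density is the density of the limiting form. -/
theorem brokenLim_eq_limitDensity {Λ : Set ℂ} (hq : ‖q‖ < 1) (hΛ : IsMulGroup Λ) (hqΛ : q ∈ Λ)
    (hR : ExpRange a b α ζ) (hw : w = q / (t ^ (n - 1) * v * τ a * τ b)) {x : Fin n → ℂ}
    (hx : GenericPoint Λ x) :
    brokenLim n q t τ a b α ζ v w x = limitDensity n q t τ a b α ζ v x := by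
  have hne : ∀ y ∉ Λ, qPoch y q ≠ 0 := fun y hy h => by
    obtain ⟨k, hk⟩ := (qPoch_eq_zero_iff hq y).1 h
    refine hΛ.notMem_mul (hΛ.pow_mem hqΛ k) hy ?_
    rw [hk]
    exact hΛ.one_mem
  have h3 := hR.neg
  have hg1 : ∀ y, gammaLim q (1 + 2 * ζ) y = (if ζ = -1 / 2 then qPoch y q else 1)⁻¹ := by
    intro y
    rw [gammaLim, qPoch_powLim_of_ne (by linarith), one_div]
    split_ifs with h
    · rw [ExpRange.one_add_two_mul_eq_zero_iff.2 h, powLim_zero]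
    · rw [qPoch_powLim_of_ne fun h' => h (ExpRange.one_add_two_mul_eq_zero_iff.1 h')]
  have hg0 : ∀ y, gammaLim q 0 y = (qPoch y q)⁻¹ := by
    intro y
    rw [gammaLim, qPoch_powLim_of_ne (by norm_num), powLim_zero, one_div]
  have hθ : ∀ y ∉ Λ, thetaLim (-2 * ζ) y⁻¹ =
      (if ζ = -1 / 2 then qPoch y q / qPoch (q * y) q else 1) := by
    intro y hy
    rw [thetaLim, powLim_of_ne (by linarith), sub_zero, one_mul, inv_inv]
    split_ifs with h
    · rw [h, show (1 : ℝ) - -2 * (-1 / 2) = 0 by norm_num, powLim_zero, qPoch_rec hq y,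
        mul_div_cancel_right₀ _ (hne _ (hΛ.notMem_mul hqΛ hy))]
    · rw [powLim_of_ne (fun h' => h (by linarith)), sub_zero]
  rw [brokenLim, limitDensity]
  congr 1
  · refine Finset.prod_congr rfl fun j _ => Finset.prod_congr rfl fun k hk => ?_
    have hjk : j < k := (Finset.mem_filter.1 hk).2
    have hg2 : gammaLim q (-2 * ζ) (t / (x j * x k)) =
        if ζ = -1 / 2 then qPoch (q * x j * x k / t) q else 1 := by
      rw [gammaLim, qPoch_powLim_of_ne (by linarith : -2 * ζ ≠ 0), div_one]
      split_ifs with h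
      · rw [h, show (1 : ℝ) - -2 * (-1 / 2) = 0 by norm_num, powLim_zero, div_div_eq_mul_div,
          mul_assoc]
      · rw [qPoch_powLim_of_ne (fun h' => h (by linarith))]
    have hθ0 : thetaLim 0 (x j / x k) * theta (x k / x j) q =
        qPoch (x j / x k) q * qPoch (x k / x j) q := by
      rw [thetaLim, powLim_zero, powLim_of_ne (by norm_num), sub_zero, mul_one, theta,
        qPoch_rec hq (x j / x k), div_div_eq_mul_div, mul_div_assoc]
      ring
    rw [hg1, hg2, hg0, hg0, hθ0, hθ _ (hx.mul j k hjk.ne)]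
    split_ifs with h
    · rw [mul_assoc q]
      ring
    · ring
  · refine Finset.prod_congr rfl fun j _ => ?_
    have hr : ∀ r, gammaLim q (poleExp a b α ζ r) (τ r * x j) * gammaLim q (α r - ζ) (τ r / x j) =
        (if α r = 1 + ζ then qPoch (q * x j / τ r) q else 1) *
          (if α r = -ζ then qPoch (τ r * x j) q else 1)⁻¹ *
          (if r = a ∨ r = b then
            (qPoch (τ r / x j) q)⁻¹ * (if ζ = -1 / 2 then qPoch (τ r * x j) q else 1)⁻¹ else 1) := by
      intro r
      by_cases hr : r = a ∨ r = b
      · rw [if_pos hr, poleExp, if_pos hr, hg1, hR.eq_of_or hr, sub_self, hg0,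
          if_neg (show ¬ζ = 1 + ζ by intro h; linarith),
          if_neg (show ¬ζ = -ζ by intro h; linarith)]
        ring
      · rw [if_neg hr, poleExp, if_neg hr, mul_one]
        push Not at hr
        have h1 := hR.ge_neg r hr.1 hr.2
        have h2 := hR.le r hr.1 hr.2
        have e1 : gammaLim q (α r + ζ) (τ r * x j) =
            (if α r = -ζ then qPoch (τ r * x j) q else 1)⁻¹ := by
          rw [gammaLim, qPoch_powLim_of_ne (by linarith : 1 - (α r + ζ) ≠ 0), one_div]
          split_ifs with h
          · rw [h, neg_add_cancel, powLim_zero]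
          · rw [qPoch_powLim_of_ne (fun h' => h (by linarith))]
        have e2 : gammaLim q (α r - ζ) (τ r / x j) =
            if α r = 1 + ζ then qPoch (q * x j / τ r) q else 1 := by
          rw [gammaLim, qPoch_powLim_of_ne (by linarith : α r - ζ ≠ 0), div_one]
          split_ifs with h
          · rw [h, show 1 - (1 + ζ - ζ) = 0 by ring, powLim_zero, div_div_eq_mul_div]
          · rw [qPoch_powLim_of_ne (fun h' => h (by linarith))]
        rw [e1, e2, mul_comm]
    rw [Finset.prod_congr rfl fun r _ => hr r,
      Finset.prod_mul_distrib (g := fun r => if r = a ∨ r = b then _ else _), prod_ite_eq_or hR.ne,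
      Finset.prod_mul_distrib, Finset.prod_inv_distrib, hθ _ (hx.sq j), Finset.prod_filter,
      Finset.prod_filter, hw, div_mul_eq_mul_div]
    split_ifs with h
    · ring
    · ring

/-- The limit of the full integrand at generic points. -/
theorem normDenLim_mul_brokenLim {Λ : Set ℂ} (hq0 : q ≠ 0) (hq : ‖q‖ < 1) (ht0 : t ≠ 0)
    (hτ : ∀ r, τ r ≠ 0) (hv0 : v ≠ 0) (hw0 : w ≠ 0) (hΛ : IsMulGroup Λ) (hqΛ : q ∈ Λ)
    (hτΛ : ∀ r, τ r ∈ Λ) (hR : ExpRange a b α ζ) {x : Fin n → ℂ} (hx : GenericPoint Λ x)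
    (hreg : LimRegular n q t (tildeParam q mf mg τ) a b α ζ x) (hτ' : ∀ r, tildeParam q mf mg τ r ≠ 0) :
    normDenLim n q mf (α 4 - ζ) (poleExp a b α ζ 4) x (τ 4) *
        normDenLim n q mg (α 5 - ζ) (poleExp a b α ζ 5) x (τ 5) *
        brokenLim n q t (tildeParam q mf mg τ) a b α ζ v w x =
      brokenLim n q t τ a b α ζ v w x := by
  have hne : ∀ m r s₁ s₂, normDenLim n q m s₁ s₂ x (τ r) ≠ 0 := fun m r s₁ s₂ =>
    normDenLim_ne_zero fun i k => ⟨fun h => hx.notMem i ?_, fun h => hx.notMem i ?_⟩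
  rotate_left
  · have h1 := hΛ.div_mem (hΛ.pow_mem hqΛ (k + 1)) (hτΛ r)
    rw [show q ^ (k + 1) * x i / τ r = q ^ (k + 1) / τ r * x i by ring] at h
    rw [eq_inv_of_mul_eq_one_right h]
    exact hΛ.inv_mem _ h1
  · rw [div_eq_one_iff_eq (mul_ne_zero (hx.ne_zero i) (hτ r))] at h
    rw [← mul_div_cancel_right₀ (x i) (hτ r), ← h]
    exact hΛ.div_mem (hΛ.pow_mem hqΛ (k + 1)) (hτΛ r)
  have hid : Tendsto (fun p : ℂ => p) (𝓝[≠] 0) (𝓝[≠] 0) := tendsto_id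
  have hN : ∀ m r, Tendsto (fun p => normDen n q m (α r - ζ) (poleExp a b α ζ r) p x (τ r)) (𝓝[≠] 0)
      (𝓝 (normDenLim n q m (α r - ζ) (poleExp a b α ζ r) x (τ r))) := fun m r =>
    tendsto_normDen hq0 hid (tendsto_const_nhds (x := x)) (tendsto_const_nhds (x := τ r)) hx.ne_zero
      (hτ r) (hR.inner_mem r) (hR.poleExp_mem r)
  have h1 := ((hN mf 4).mul (hN mg 5)).mul (tendsto_brokenDensity hq ht0 hτ' hv0 hw0 hR hid
    (tendsto_const_nhds (x := x)) hreg)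
  have h2 := tendsto_brokenDensity hq ht0 hτ hv0 hw0 hR hid (tendsto_const_nhds (x := x))
    (hreg.of_genericPoint hq hΛ hqΛ hτΛ hx)
  refine tendsto_nhds_unique (h1.congr' ?_) h2
  filter_upwards [(hN mf 4).eventually_ne (hne _ _ _ _), (hN mg 5).eventually_ne (hne _ _ _ _),
    eventually_mem_nhdsWithin, eventually_norm_lt_of_tendsto_zero
      (tendsto_id.mono_right nhdsWithin_le_nhds) one_pos] with p h4 h5 hp0 hp
  exact (brokenDensity_eq_tildeParam hp0 hp hq0 hq hτ hx.ne_zero h4 h5).symm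

end limit

/-! ### The prefactor -/

lemma prod_lt_mul_swap {M : Type*} [CommMonoid M] (A : Fin 6 → Fin 6 → M) :
    ∏ r, ∏ s ∈ Finset.univ.filter (fun s => r < s), A r s * A s r =
      ∏ r, ∏ s ∈ Finset.univ.filter (fun s => s ≠ r), A r s := by
  have h := Finset.prod_prod_Ioi_mul_eq_prod_prod_off_diag (fun r s => A s r)
  have e1 : ∀ r : Fin 6, Finset.univ.filter (fun s => r < s) = Finset.Ioi r := fun r => by ext; simp
  have e2 : ∀ r : Fin 6, Finset.univ.filter (fun s => s ≠ r) = {r}ᶜ := fun r => by ext; simp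
  simp only [e1, e2]
  exact h

lemma prod_lt_ite_pair {M : Type*} [CommMonoid M] {a b : Fin 6} (hab : a ≠ b) (X : M) :
    ∏ r, ∏ s ∈ Finset.univ.filter (fun s => r < s),
      (if (r = a ∧ s = b) ∨ (r = b ∧ s = a) then X else 1) = X := by
  have h := prod_lt_mul_swap fun r s : Fin 6 => if r = a ∧ s = b then X else 1
  have e : ∀ r s : Fin 6, (if (r = a ∧ s = b) ∨ (r = b ∧ s = a) then X else 1) =
      (if r = a ∧ s = b then X else 1) * (if s = a ∧ r = b then X else 1) := by
    intro r s
    by_cases h1 : r = a ∧ s = b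
    · rw [if_pos (Or.inl h1), if_pos h1, if_neg fun h2 => hab (h1.1.symm.trans h2.2), mul_one]
    · by_cases h2 : s = a ∧ r = b
      · rw [if_pos (Or.inr h2.symm), if_neg h1, if_pos h2, one_mul]
      · rw [if_neg (by tauto), if_neg h1, if_neg h2, one_mul]
  simp only [e]
  rw [h, Finset.prod_eq_single a, Finset.prod_eq_single b]
  · simp
  · intro s _ hs
    simp [hs]
  · intro hb
    simp [hab.symm] at hb
  · intro r _ hr
    exact Finset.prod_eq_one fun s _ => by simp [hr]
  · simp

/-- The exponents of `p` in the gamma factors `Γ(t^i t_r t_s)`, where the factor for the pair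
`{a, b}` is multiplied by a theta function. -/
noncomputable def pairExp (a b : Fin 6) (α : Fin 6 → ℝ) (ζ : ℝ) (r s : Fin 6) : ℝ :=
  if (r = a ∧ s = b) ∨ (r = b ∧ s = a) then 1 + 2 * ζ else α r + α s

section prefactor

variable {n : ℕ} {q t : ℂ} {τ : Fin 6 → ℂ} {a b : Fin 6} {α : Fin 6 → ℝ} {ζ : ℝ} {v w : ℂ}

/-- The numbers `α_r + ζ` for `r ≠ a, b` are nonnegative and have the sum `1 + 2ζ`, so any two of them
have a sum of at most `1 + 2ζ`. -/
lemma ExpRange.add_le_one (hR : ExpRange a b α ζ) (hsum : ∑ r, α r = 1) {r s : Fin 6} (hrs : r ≠ s)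
    (hr : ¬(r = a ∨ r = b)) (hs : ¬(s = a ∨ s = b)) : α r + α s ≤ 1 := by
  let β : Fin 6 → ℝ := fun x => α x + ζ - if x = a ∨ x = b then 2 * ζ else 0
  have hβ0 : ∀ x, 0 ≤ β x := by
    intro x
    by_cases hx : x = a ∨ x = b
    · simp only [β, if_pos hx, hR.eq_of_or hx]; linarith
    · simp only [β, if_neg hx]
      push Not at hx
      linarith [hR.ge_neg x hx.1 hx.2]
  have hβ : ∑ x, β x = 1 + 2 * ζ := by
    have h1 : ∑ x : Fin 6, (if x = a ∨ x = b then 2 * ζ else 0) = 4 * ζ := by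
      rw [← Finset.sum_filter]
      have : Finset.univ.filter (fun x => x = a ∨ x = b) = ({a, b} : Finset (Fin 6)) := by
        ext; simp
      rw [this, Finset.sum_pair hR.ne]; ring
    simp only [β, Finset.sum_sub_distrib, Finset.sum_add_distrib, hsum, h1]
    simp
    ring
  have h2 := Finset.sum_le_sum_of_subset_of_nonneg (Finset.subset_univ {r, s})
    (fun x _ _ => hβ0 x)
  rw [Finset.sum_pair hrs, hβ] at h2
  simp only [β, if_neg hr, if_neg hs] at h2
  linarith

lemma ExpRange.pairExp_mem (hR : ExpRange a b α ζ) (hsum : ∑ r, α r = 1) {r s : Fin 6}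
    (hrs : r ≠ s) : 0 ≤ pairExp a b α ζ r s ∧ pairExp a b α ζ r s ≤ 1 := by
  have h3 := hR.neg
  have h4 := hR.ge
  unfold pairExp
  split_ifs with h
  · constructor <;> linarith
  · by_cases hr : r = a ∨ r = b
    · have hs : ¬(s = a ∨ s = b) := by
        rintro (hs | hs) <;> rcases hr with hr | hr <;> simp_all
      rw [hR.eq_of_or hr]
      push Not at hs
      have h1 := hR.ge_neg s hs.1 hs.2
      have h2 := hR.le s hs.1 hs.2
      constructor <;> linarith
    · by_cases hs : s = a ∨ s = b
      · rw [hR.eq_of_or hs]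
        push Not at hr
        have h1 := hR.ge_neg r hr.1 hr.2
        have h2 := hR.le r hr.1 hr.2
        constructor <;> linarith
      · refine ⟨?_, hR.add_le_one hsum hrs hr hs⟩
        push Not at hr hs
        have h1 := hR.ge_neg s hs.1 hs.2
        have h2 := hR.ge_neg r hr.1 hr.2
        linarith

lemma qPoch_powLim_one_sub_pairExp (hR : ExpRange a b α ζ) (r s : Fin 6) (y : ℂ) :
    qPoch (powLim (1 - pairExp a b α ζ r s) y) q = if α r + α s = 1 then qPoch y q else 1 := by
  have h3 := hR.neg
  unfold pairExp
  split_ifs with h h' h'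
  · exfalso
    have : α r = ζ ∧ α s = ζ := by
      rcases h with h | h
      · exact ⟨hR.eq_of_or (Or.inl h.1), hR.eq_of_or (Or.inr h.2)⟩
      · exact ⟨hR.eq_of_or (Or.inr h.1), hR.eq_of_or (Or.inl h.2)⟩
    linarith [this.1, this.2]
  · exact qPoch_powLim_of_ne (by linarith) _ _
  · rw [h', sub_self, powLim_zero]
  · exact qPoch_powLim_of_ne (fun h'' => h' (by linarith)) _ _

/-- The numerators of the limits of the inverse gamma factors. -/
lemma prod_qPoch_powLim_pairExp (hR : ExpRange a b α ζ) (T : ℂ) :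
    ∏ r, ∏ s ∈ Finset.univ.filter (fun s => r < s),
      qPoch (powLim (pairExp a b α ζ r s) (T * τ r * τ s)) q =
    (if ζ = -1 / 2 then qPoch (T * τ a * τ b) q else 1) *
      ∏ r ∈ Finset.univ.filter (fun r => α r = -ζ),
        (qPoch (T * τ r * τ a) q * qPoch (T * τ r * τ b) q) := by
  have h3 := hR.neg
  let H : Fin 6 → Fin 6 → ℂ := fun r s =>
    if (s = a ∨ s = b) ∧ α r = -ζ then qPoch (T * τ r * τ s) q else 1
  have hnot : ∀ {r}, (r = a ∨ r = b) → ¬(α r = -ζ) := fun hr h => by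
    rw [hR.eq_of_or hr] at h; linarith
  have hH : ∀ r s, r ≠ s → qPoch (powLim (pairExp a b α ζ r s) (T * τ r * τ s)) q =
      (if (r = a ∧ s = b) ∨ (r = b ∧ s = a) then
        (if ζ = -1 / 2 then qPoch (T * τ a * τ b) q else 1) else 1) * (H r s * H s r) := by
    intro r s hrs
    simp only [H, pairExp]
    by_cases h : (r = a ∧ s = b) ∨ (r = b ∧ s = a)
    · have hr : r = a ∨ r = b := by tauto
      have hs : s = a ∨ s = b := by tauto
      have hT : T * τ r * τ s = T * τ a * τ b := by
        rcases h with ⟨rfl, rfl⟩ | ⟨rfl, rfl⟩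
        · rfl
        · ring
      have hH1 : ¬((s = a ∨ s = b) ∧ α r = -ζ) := fun h' => hnot hr h'.2
      have hH2 : ¬((r = a ∨ r = b) ∧ α s = -ζ) := fun h' => hnot hs h'.2
      rw [if_pos h, if_pos h, if_neg hH1, if_neg hH2, mul_one, mul_one, hT]
      split_ifs with h'
      · rw [ExpRange.one_add_two_mul_eq_zero_iff.2 h', powLim_zero]
      · rw [qPoch_powLim_of_ne fun h'' => h' (ExpRange.one_add_two_mul_eq_zero_iff.1 h'')]
    · rw [if_neg h, if_neg h, one_mul]
      by_cases hr : r = a ∨ r = b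
      · have hs : ¬(s = a ∨ s = b) := by
          rintro (hs | hs) <;> rcases hr with hr | hr <;> simp_all
        rw [if_neg fun h' => hs h'.1, one_mul, hR.eq_of_or hr]
        by_cases h' : α s = -ζ
        · rw [if_pos ⟨hr, h'⟩, h', add_neg_cancel, powLim_zero, mul_right_comm]
        · rw [if_neg fun h'' => h' h''.2, qPoch_powLim_of_ne fun h'' => h' (by linarith)]
      · have hH2 : ¬((r = a ∨ r = b) ∧ α s = -ζ) := fun h' => hr h'.1
        rw [if_neg hH2, mul_one]
        by_cases hs : s = a ∨ s = b
        · rw [hR.eq_of_or hs]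
          by_cases h' : α r = -ζ
          · rw [if_pos ⟨hs, h'⟩, h', neg_add_cancel, powLim_zero]
          · rw [if_neg fun h'' => h' h''.2, qPoch_powLim_of_ne fun h'' => h' (by linarith)]
        · rw [if_neg fun h' => hs h'.1, qPoch_powLim_of_ne]
          push Not at hr hs
          have h1 := hR.ge_neg s hs.1 hs.2
          have h2 := hR.ge_neg r hr.1 hr.2
          linarith
  have e1 : ∏ r, ∏ s ∈ Finset.univ.filter (fun s => r < s),
      qPoch (powLim (pairExp a b α ζ r s) (T * τ r * τ s)) q =
      ∏ r, ∏ s ∈ Finset.univ.filter (fun s => r < s),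
        ((if (r = a ∧ s = b) ∨ (r = b ∧ s = a) then
          (if ζ = -1 / 2 then qPoch (T * τ a * τ b) q else 1) else 1) * (H r s * H s r)) :=
    Finset.prod_congr rfl fun r _ => Finset.prod_congr rfl fun s hs =>
      hH r s (Finset.mem_filter.1 hs).2.ne
  rw [e1]
  simp only [Finset.prod_mul_distrib (s := Finset.filter _ _) (g := fun s => H _ s * H s _)]
  rw [Finset.prod_mul_distrib, prod_lt_ite_pair hR.ne, prod_lt_mul_swap, Finset.prod_filter]
  congr 1
  refine Finset.prod_congr rfl fun r _ => ?_
  split_ifs with hr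
  · have e2 : ∏ s ∈ Finset.univ.filter (fun s => s ≠ r), H r s =
        ∏ s, if s = a ∨ s = b then qPoch (T * τ r * τ s) q else 1 := by
      rw [Finset.prod_filter]
      refine Finset.prod_congr rfl fun s _ => ?_
      simp only [H, hr, and_true]
      by_cases hs : s = r
      · rw [if_neg (not_not.2 hs), if_neg fun h => hnot (hs ▸ h) hr]
      · rw [if_pos hs]
    rw [e2, prod_ite_eq_or hR.ne]
  · exact Finset.prod_eq_one fun s _ => if_neg fun h => hr h.2

/-- The prefactor of the elliptic form, divided by the right-hand side of the symmetrization
identity and multiplied by `2^n`. -/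
noncomputable def brokenPrefactor (n : ℕ) (p q t : ℂ) (τ : Fin 6 → ℂ) (a b : Fin 6) (α : Fin 6 → ℝ)
    (ζ : ℝ) (v : ℂ) : ℂ :=
  qPoch q q ^ n * qPoch p p ^ n * ellGamma p q t ^ n * (n.factorial : ℂ)⁻¹ *
    ∏ i ∈ Finset.range n, ((ellGamma p q (t ^ (i + 1)))⁻¹ *
      (∏ r, ∏ s ∈ Finset.univ.filter (fun s => r < s),
        (ellGamma p q (p ^ (pairExp a b α ζ r s : ℂ) * (t ^ i * τ r * τ s)))⁻¹) *
      (theta (t ^ i * τ a * v) q * theta (t ^ i * τ b * v) q)⁻¹)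

/-- The factor `1 / Γ(t^i t_a t_b)`, with the exponent `2ζ` of `p`, is the only one that does not converge;
the theta function `θ(t^i t_a t_b; q)` from the symmetrization identity turns the exponent into
`1 + 2ζ`. -/
theorem tendsto_brokenPrefactor (hq : ‖q‖ < 1) (ht0 : t ≠ 0) (ht : ‖t‖ < 1)
    (hτ : ∀ r, τ r ≠ 0) (hR : ExpRange a b α ζ) (hsum : ∑ r, α r = 1)
    (hpair : ∀ r s, r < s → α r + α s = 1 → ∀ i < n, qPoch (q / (t ^ i * τ r * τ s)) q ≠ 0) :
    Tendsto (fun p => brokenPrefactor n p q t τ a b α ζ v) (𝓝[≠] 0)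
      (𝓝 (limitPrefactor n q t τ a b α ζ v)) := by
  have hid : Tendsto (fun p : ℂ => p) (𝓝[≠] 0) (𝓝[≠] 0) := tendsto_id
  have hid' : Tendsto (fun p : ℂ => p) (𝓝[≠] 0) (𝓝 0) := hid.mono_right nhdsWithin_le_nhds
  have hpp : Tendsto (fun p => qPoch p p) (𝓝[≠] 0) (𝓝 1) := by
    simpa using tendsto_qPoch_small hid' hid'
  have hne : ∀ y : ℂ, ‖y‖ < 1 → qPoch y q ≠ 0 := by
    intro y hy h
    obtain ⟨k, hk⟩ := (qPoch_eq_zero_iff hq y).1 h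
    have h1 : ‖q ^ k * y‖ < 1 := by
      rw [norm_mul, norm_pow]
      exact mul_lt_one_of_nonneg_of_lt_one_right (pow_le_one₀ (norm_nonneg q) hq.le)
        (norm_nonneg y) hy
    rw [hk, norm_one] at h1
    exact lt_irrefl _ h1
  have hti : ∀ i : ℕ, ‖t ^ (i + 1)‖ < 1 := fun i => by
    rw [norm_pow]
    exact pow_lt_one₀ (norm_nonneg t) ht (Nat.succ_ne_zero i)
  have hg0 : ∀ y, gammaLim q 0 y = (qPoch y q)⁻¹ := by
    intro y
    rw [gammaLim, qPoch_powLim_of_ne (by norm_num), powLim_zero, one_div]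
  have hΓ : Tendsto (fun p => ellGamma p q t) (𝓝[≠] 0) (𝓝 (qPoch t q)⁻¹) := by
    have := tendsto_ellGamma (e := 0) hq hid (tendsto_const_nhds (x := t)) ht0 le_rfl zero_le_one
      (by rw [powLim_zero]; exact hne t ht)
    rw [hg0] at this
    simpa using this
  have hΓi : ∀ i : ℕ, Tendsto (fun p => (ellGamma p q (t ^ (i + 1)))⁻¹) (𝓝[≠] 0)
      (𝓝 (qPoch (t ^ (i + 1)) q)) := by
    intro i
    have := tendsto_ellGamma_inv (e := 0) hq hid (tendsto_const_nhds (x := t ^ (i + 1)))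
      (pow_ne_zero _ ht0) le_rfl zero_le_one
      (by rw [qPoch_powLim_of_ne (by norm_num)]; exact one_ne_zero)
    rw [hg0, inv_inv] at this
    simpa using this
  have hB : ∀ i < n, ∀ r s : Fin 6, r < s → Tendsto
      (fun p => (ellGamma p q (p ^ (pairExp a b α ζ r s : ℂ) * (t ^ i * τ r * τ s)))⁻¹) (𝓝[≠] 0)
      (𝓝 (gammaLim q (pairExp a b α ζ r s) (t ^ i * τ r * τ s))⁻¹) := by
    intro i hi r s hrs
    obtain ⟨h1, h2⟩ := hR.pairExp_mem hsum hrs.ne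
    refine tendsto_ellGamma_inv hq hid tendsto_const_nhds
      (mul_ne_zero (mul_ne_zero (pow_ne_zero _ ht0) (hτ r)) (hτ s)) h1 h2 ?_
    rw [qPoch_powLim_one_sub_pairExp hR]
    split_ifs with h
    · exact hpair r s hrs h i hi
    · exact one_ne_zero
  have hlim : Tendsto (fun p => brokenPrefactor n p q t τ a b α ζ v) (𝓝[≠] 0)
      (𝓝 (qPoch q q ^ n * 1 ^ n * (qPoch t q)⁻¹ ^ n * (n.factorial : ℂ)⁻¹ *
        ∏ i ∈ Finset.range n, (qPoch (t ^ (i + 1)) q *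
          (∏ r, ∏ s ∈ Finset.univ.filter (fun s => r < s),
            (gammaLim q (pairExp a b α ζ r s) (t ^ i * τ r * τ s))⁻¹) *
          (theta (t ^ i * τ a * v) q * theta (t ^ i * τ b * v) q)⁻¹))) := by
    refine Tendsto.mul (((tendsto_const_nhds.mul (hpp.pow n)).mul (hΓ.pow n)).mul
      tendsto_const_nhds) (tendsto_finsetProd _ fun i hi => ?_)
    refine ((hΓi i).mul (tendsto_finsetProd _ fun r _ => tendsto_finsetProd _ fun s hs => ?_)).mul
      tendsto_const_nhds
    exact hB i (Finset.mem_range.1 hi) r s (Finset.mem_filter.1 hs).2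
  convert hlim using 2
  rw [limitPrefactor, one_pow, mul_one, inv_pow]
  congr 1
  · rw [div_eq_mul_inv, mul_inv]; ring
  · refine Finset.prod_congr rfl fun i _ => ?_
    have e1 : ∏ r, ∏ s ∈ Finset.univ.filter (fun s => r < s),
        (gammaLim q (pairExp a b α ζ r s) (t ^ i * τ r * τ s))⁻¹ =
        (∏ r, ∏ s ∈ Finset.univ.filter (fun s => r < s),
          qPoch (powLim (pairExp a b α ζ r s) (t ^ i * τ r * τ s)) q) *
        (∏ r : Fin 6, ∏ s ∈ Finset.univ.filter (fun s => r < s ∧ α r + α s = 1),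
          qPoch (q / (t ^ i * τ r * τ s)) q)⁻¹ := by
      rw [← Finset.prod_inv_distrib, ← Finset.prod_mul_distrib]
      refine Finset.prod_congr rfl fun r _ => ?_
      rw [← Finset.filter_filter, Finset.prod_filter (fun s => α r + α s = 1),
        ← Finset.prod_inv_distrib, ← Finset.prod_mul_distrib]
      refine Finset.prod_congr rfl fun s _ => ?_
      rw [gammaLim, inv_div, qPoch_powLim_one_sub_pairExp hR, div_eq_mul_inv]
    rw [e1, prod_qPoch_powLim_pairExp hR, div_eq_mul_inv, mul_inv, mul_inv, mul_inv]
    ring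

/-- The prefactor of the elliptic form in terms of `brokenPrefactor`. -/
theorem prefactor_eq_brokenPrefactor {p : ℂ} (hn : 1 ≤ n) (hp0 : p ≠ 0) (hp : ‖p‖ < 1) (hq0 : q ≠ 0)
    (hq : ‖q‖ < 1) (ht0 : t ≠ 0) (hτ : ∀ r, τ r ≠ 0) (hv0 : v ≠ 0) (hR : ExpRange a b α ζ)
    (hw : w = q / (t ^ (n - 1) * v * τ a * τ b))
    (hv : ∀ i < n, theta (t ^ i * τ a * v) q ≠ 0 ∧ theta (t ^ i * τ b * v) q ≠ 0)
    (hab : ∀ i < n, theta (t ^ i * (p ^ (ζ : ℂ) * τ a) * (p ^ (ζ : ℂ) * τ b)) q ≠ 0) {I J : ℂ}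
    (hIJ : (∏ i ∈ Finset.range n, (theta (t ^ i * (p ^ (ζ : ℂ) * τ a) * (p ^ (ζ : ℂ) * τ b)) q *
        theta (t ^ i * τ a * v) q * theta (t ^ i * τ a * w) q)) * J = 2 ^ n * I) :
    qPoch q q ^ n * qPoch p p ^ n * ellGamma p q t ^ n /
      (2 ^ n * (n.factorial : ℂ) * ∏ j ∈ Finset.range n, (ellGamma p q (t ^ (j + 1)) *
        ∏ r : Fin 6, ∏ s ∈ Finset.univ.filter (fun s => r < s),
          ellGamma p q (t ^ j * (p ^ (α r : ℂ) * τ r) * (p ^ (α s : ℂ) * τ s)))) * J =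
      brokenPrefactor n p q t τ a b α ζ v * I := by
  have hrefl : ∏ i ∈ Finset.range n, theta (t ^ i * τ a * w) q =
      ∏ i ∈ Finset.range n, theta (t ^ i * τ b * v) q := by
    rw [← Finset.prod_range_reflect]
    refine Finset.prod_congr rfl fun i hi => ?_
    have hi' := Finset.mem_range.1 hi
    rw [← theta_div_self hq0 (t ^ i * τ b * v), hw]
    congr 1
    have h1 : t ^ (n - 1) = t ^ (n - 1 - i) * t ^ i := by rw [← pow_add]; congr 1; omega
    have := hτ a
    have := hτ b
    rw [h1]
    field_simp
  have hB : ∀ i < n, ∏ r, ∏ s ∈ Finset.univ.filter (fun s => r < s),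
      (ellGamma p q (p ^ (pairExp a b α ζ r s : ℂ) * (t ^ i * τ r * τ s)))⁻¹ =
      (∏ r : Fin 6, ∏ s ∈ Finset.univ.filter (fun s => r < s),
        ellGamma p q (t ^ i * (p ^ (α r : ℂ) * τ r) * (p ^ (α s : ℂ) * τ s)))⁻¹ *
      (theta (t ^ i * (p ^ (ζ : ℂ) * τ a) * (p ^ (ζ : ℂ) * τ b)) q)⁻¹ := by
    intro i hi
    rw [← prod_lt_ite_pair hR.ne (theta (t ^ i * (p ^ (ζ : ℂ) * τ a) * (p ^ (ζ : ℂ) * τ b)) q)⁻¹,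
      ← Finset.prod_inv_distrib, ← Finset.prod_mul_distrib]
    refine Finset.prod_congr rfl fun r _ => ?_
    rw [← Finset.prod_inv_distrib, ← Finset.prod_mul_distrib]
    refine Finset.prod_congr rfl fun s _ => ?_
    unfold pairExp
    split_ifs with h
    · have e : ∀ T : ℂ, p ^ ((1 + 2 * ζ : ℝ) : ℂ) * T = p * (p ^ (ζ : ℂ) * p ^ (ζ : ℂ) * T) := by
        intro T
        rw [show 1 + 2 * ζ = 1 + (ζ + ζ) by ring, cpow_ofReal_add hp0, cpow_ofReal_add hp0]
        simp only [Complex.ofReal_one, Complex.cpow_one]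
        ring
      have e' : p ^ (ζ : ℂ) * p ^ (ζ : ℂ) * (t ^ i * τ r * τ s) =
          t ^ i * (p ^ (ζ : ℂ) * τ a) * (p ^ (ζ : ℂ) * τ b) := by
        rcases h with ⟨rfl, rfl⟩ | ⟨rfl, rfl⟩ <;> ring
      have e'' : t ^ i * (p ^ (α r : ℂ) * τ r) * (p ^ (α s : ℂ) * τ s) =
          t ^ i * (p ^ (ζ : ℂ) * τ a) * (p ^ (ζ : ℂ) * τ b) := by
        rcases h with ⟨rfl, rfl⟩ | ⟨rfl, rfl⟩ <;> rw [hR.eq_a, hR.eq_b]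
        ring
      rw [e, e', e'', ellGamma_p_mul hp0 hp hq (hab i hi), mul_inv, mul_comm]
    · rw [mul_one, cpow_ofReal_add hp0]
      congr 2
      ring
  have hS : ∏ i ∈ Finset.range n, (theta (t ^ i * (p ^ (ζ : ℂ) * τ a) * (p ^ (ζ : ℂ) * τ b)) q *
        theta (t ^ i * τ a * v) q * theta (t ^ i * τ a * w) q) =
      (∏ i ∈ Finset.range n, theta (t ^ i * (p ^ (ζ : ℂ) * τ a) * (p ^ (ζ : ℂ) * τ b)) q) *
      ∏ i ∈ Finset.range n, (theta (t ^ i * τ a * v) q * theta (t ^ i * τ b * v) q) := by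
    rw [Finset.prod_mul_distrib, Finset.prod_mul_distrib, hrefl,
      Finset.prod_mul_distrib (g := fun i => theta (t ^ i * τ b * v) q), mul_assoc]
  have hS1 : ∏ i ∈ Finset.range n,
      theta (t ^ i * (p ^ (ζ : ℂ) * τ a) * (p ^ (ζ : ℂ) * τ b)) q ≠ 0 :=
    Finset.prod_ne_zero_iff.2 fun i hi => hab i (Finset.mem_range.1 hi)
  have hS2 : ∏ i ∈ Finset.range n, (theta (t ^ i * τ a * v) q * theta (t ^ i * τ b * v) q) ≠ 0 :=
    Finset.prod_ne_zero_iff.2 fun i hi =>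
      mul_ne_zero (hv i (Finset.mem_range.1 hi)).1 (hv i (Finset.mem_range.1 hi)).2
  rw [hS] at hIJ
  have hT : ∏ i ∈ Finset.range n, ((ellGamma p q (t ^ (i + 1)))⁻¹ *
      (∏ r, ∏ s ∈ Finset.univ.filter (fun s => r < s),
        (ellGamma p q (p ^ (pairExp a b α ζ r s : ℂ) * (t ^ i * τ r * τ s)))⁻¹) *
      (theta (t ^ i * τ a * v) q * theta (t ^ i * τ b * v) q)⁻¹) =
      (∏ i ∈ Finset.range n, ellGamma p q (t ^ (i + 1)))⁻¹ *
      ((∏ i ∈ Finset.range n, ∏ r : Fin 6, ∏ s ∈ Finset.univ.filter (fun s => r < s),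
          ellGamma p q (t ^ i * (p ^ (α r : ℂ) * τ r) * (p ^ (α s : ℂ) * τ s)))⁻¹ *
        (∏ i ∈ Finset.range n,
          theta (t ^ i * (p ^ (ζ : ℂ) * τ a) * (p ^ (ζ : ℂ) * τ b)) q)⁻¹) *
      (∏ i ∈ Finset.range n, (theta (t ^ i * τ a * v) q * theta (t ^ i * τ b * v) q))⁻¹ := by
    simp only [← Finset.prod_inv_distrib (s := Finset.range n)]
    rw [← Finset.prod_mul_distrib, ← Finset.prod_mul_distrib, ← Finset.prod_mul_distrib]
    exact Finset.prod_congr rfl fun i hi => by rw [hB i (Finset.mem_range.1 hi)]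
  rw [brokenPrefactor, hT, Finset.prod_mul_distrib (s := Finset.range n)
    (f := fun j => ellGamma p q (t ^ (j + 1)))]
  have hJ : J = 2 ^ n * I * ((∏ i ∈ Finset.range n,
      theta (t ^ i * (p ^ (ζ : ℂ) * τ a) * (p ^ (ζ : ℂ) * τ b)) q)⁻¹ *
      (∏ i ∈ Finset.range n, (theta (t ^ i * τ a * v) q * theta (t ^ i * τ b * v) q))⁻¹) := by
    rw [← mul_inv, eq_mul_inv_iff_mul_eq₀ (mul_ne_zero hS1 hS2), ← hIJ, mul_comm]
  have h2 : (2 : ℂ) ^ n * (2 ^ n)⁻¹ = 1 := mul_inv_cancel₀ (pow_ne_zero n two_ne_zero)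
  rw [hJ, div_eq_mul_inv, mul_inv, mul_inv, mul_inv]
  generalize (∏ i ∈ Finset.range n,
    theta (t ^ i * (p ^ (ζ : ℂ) * τ a) * (p ^ (ζ : ℂ) * τ b)) q)⁻¹ = A1
  generalize (∏ i ∈ Finset.range n, (theta (t ^ i * τ a * v) q * theta (t ^ i * τ b * v) q))⁻¹ = A2
  generalize (∏ i ∈ Finset.range n, ellGamma p q (t ^ (i + 1)))⁻¹ = A3
  generalize (∏ i ∈ Finset.range n, ∏ r : Fin 6, ∏ s ∈ Finset.univ.filter (fun s => r < s),
    ellGamma p q (t ^ i * (p ^ (α r : ℂ) * τ r) * (p ^ (α s : ℂ) * τ s)))⁻¹ = A4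
  linear_combination (qPoch q q ^ n * qPoch p p ^ n * ellGamma p q t ^ n * (n.factorial : ℂ)⁻¹ *
    A1 * A2 * A3 * A4 * I) * h2

end prefactor

/-- A contour of the elliptic form separates `t^i q^k τ'_a` from the reciprocals of the
`q^k τ'_b`; this excludes zeros of theta functions of `t^i τ'_a τ'_b`. -/
lemma IsFormContour.theta_ne_zero {p q t : ℂ} {τ τ' : Fin 6 → ℂ} {D : ClosedChain}
    (hD : IsFormContour p q t τ' D) (hq0 : q ≠ 0) (hq : ‖q‖ < 1) (ht0 : t ≠ 0)
    (hτ : ∀ r, τ r ≠ 0) (hτ' : ∀ r, ∃ k : ℕ, τ r = q ^ k * τ' r) {a b : Fin 6} {i : ℕ}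
    (h1 : 1 < ‖t ^ i * τ a * τ b‖) : theta (t ^ i * τ a * τ b) q ≠ 0 := by
  have hne : t ^ i * τ a * τ b ≠ 0 := mul_ne_zero (mul_ne_zero (pow_ne_zero _ ht0) (hτ a)) (hτ b)
  rw [Ne, theta_eq_zero_iff hq0 hq hne]
  rintro ⟨m, hm⟩
  have hm0 : m < 0 := by
    by_contra! h
    obtain ⟨k, rfl⟩ := Int.eq_ofNat_of_zero_le h
    rw [hm, zpow_natCast, norm_pow] at h1
    exact absurd (pow_le_one₀ (norm_nonneg q) hq.le) (not_le.2 h1)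
  obtain ⟨k, rfl⟩ : ∃ k : ℕ, m = -(k : ℤ) := ⟨m.natAbs, by omega⟩
  obtain ⟨ka, hka⟩ := hτ' a
  obtain ⟨kb, hkb⟩ := hτ' b
  have hin : ∀ i : ℕ, t ^ i * (q ^ (k + ka) * τ' a) ∈ D.inside := by
    intro i
    induction i with
    | zero => simpa using hD.contains a 0 (k + ka)
    | succ i ih =>
      have himg : ∀ c ∈ D.support, t * c ∈ D.inside := fun c hc => by
        simpa using hD.contains_image 0 0 c hc
      rw [pow_succ', mul_assoc]
      refine ClosedChain.mul_mem_inside hD.isContour ht0 himg (fun c hc => ?_) (Or.inl ih)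
      have h2 := hD.inside_inv _ (himg _ (hD.support_inv c hc))
        (mul_ne_zero ht0 (inv_ne_zero (D.ne_zero_of_mem_support hc)))
      rwa [mul_inv, inv_inv] at h2
  refine ClosedChain.disjoint_inside_outside (hin i) ?_
  have hout := hD.excludes b 0 kb
  rw [pow_zero, one_mul, ← hkb] at hout
  convert hout using 1
  rw [zpow_neg, zpow_natCast] at hm
  refine eq_inv_of_mul_eq_one_left ?_
  have hqk : q ^ k * (q ^ k)⁻¹ = 1 := mul_inv_cancel₀ (pow_ne_zero k hq0)
  rw [← hqk, ← hm, hka]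
  ring

/-! ### The denominator of a leading coefficient -/

/-- A reduced denominator of a function `num / den = G / D` with nonzero `D` does not vanish on a
hyperplane `u₀ = u`: otherwise the numerator would vanish there as well. -/
theorem exists_polynomial_den {n : ℕ} (c : FractionRing (MvPolynomial (Option (Fin n)) ℂ))
    {G D : (Option (Fin n) → ℂ) → ℂ} {u : ℂ} (hu : u ≠ 0)
    (h : ∀ y ∈ cstar (Option (Fin n)),
      MvPolynomial.eval y (IsFractionRing.den (MvPolynomial (Option (Fin n)) ℂ) c :
          MvPolynomial (Option (Fin n)) ℂ) * G y =
        MvPolynomial.eval y (IsFractionRing.num (MvPolynomial (Option (Fin n)) ℂ) c) * D y)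
    {H : MvPolynomial (Fin n) ℂ} (hH : H ≠ 0)
    (hD : ∀ x ∈ cstar (Fin n), MvPolynomial.eval x H ≠ 0 → D (fun o => o.elim u x) ≠ 0) :
    ∃ P : MvPolynomial (Fin n) ℂ, P ≠ 0 ∧ ∀ x, MvPolynomial.eval x P =
      MvPolynomial.eval (fun o => o.elim u x)
        (IsFractionRing.den (MvPolynomial (Option (Fin n)) ℂ) c :
          MvPolynomial (Option (Fin n)) ℂ) := by
  let S : MvPolynomial (Option (Fin n)) ℂ →+* MvPolynomial (Fin n) ℂ :=
    (Polynomial.evalRingHom (MvPolynomial.C u)).comp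
      (MvPolynomial.optionEquivLeft ℂ (Fin n)).toRingEquiv.toRingHom
  have hS : ∀ Q x, MvPolynomial.eval x (S Q) = MvPolynomial.eval (fun o => o.elim u x) Q := by
    intro Q x
    have : (MvPolynomial.eval x).comp S = MvPolynomial.eval (fun o => o.elim u x) := by
      refine MvPolynomial.ringHom_ext (fun c => ?_) fun o => ?_
      · simp [S]
      · cases o <;> simp [S]
    exact congrArg (fun φ => φ Q) this
  have hdvd : ∀ Q, S Q = 0 → (MvPolynomial.X none - MvPolynomial.C u) ∣ Q := by
    intro Q hQ
    have h1 : (Polynomial.X - Polynomial.C (MvPolynomial.C u)) ∣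
        MvPolynomial.optionEquivLeft ℂ (Fin n) Q := Polynomial.dvd_iff_isRoot.2 hQ
    have h2 := map_dvd (MvPolynomial.optionEquivLeft ℂ (Fin n)).symm h1
    rw [AlgEquiv.symm_apply_apply] at h2
    convert h2 using 1
    rw [AlgEquiv.eq_symm_apply]
    simp
  refine ⟨S (IsFractionRing.den (MvPolynomial (Option (Fin n)) ℂ) c :
    MvPolynomial (Option (Fin n)) ℂ), fun h0 => ?_, fun x => hS _ x⟩
  have hnum : S (IsFractionRing.num (MvPolynomial (Option (Fin n)) ℂ) c) = 0 := by
    have hX : (∏ i : Fin n, MvPolynomial.X (R := ℂ) i) ≠ 0 :=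
      Finset.prod_ne_zero_iff.2 fun i _ => MvPolynomial.X_ne_zero i
    have hz : S (IsFractionRing.num (MvPolynomial (Option (Fin n)) ℂ) c) *
        (H * ∏ i : Fin n, MvPolynomial.X i) = 0 := by
      refine MvPolynomial.funext fun x => ?_
      rw [map_mul, map_mul, map_zero, map_prod]
      by_cases hx : x ∈ cstar (Fin n)
      · by_cases hxH : MvPolynomial.eval x H = 0
        · rw [hxH, zero_mul, mul_zero]
        · have hy : (fun o : Option (Fin n) => o.elim u x) ∈ cstar (Option (Fin n)) := by
            rintro (_ | i)
            exacts [hu, hx i]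
          have h1 := h _ hy
          rw [← hS, h0, map_zero, zero_mul] at h1
          rw [hS, (mul_eq_zero.1 h1.symm).resolve_right (hD x hx hxH), zero_mul]
      · have : ∃ i, x i = 0 := by
          by_contra! hne
          exact hx hne
        obtain ⟨i, hi⟩ := this
        rw [Finset.prod_eq_zero (Finset.mem_univ i) (by simp [hi]), mul_zero, mul_zero]
    exact (mul_eq_zero.1 hz).resolve_right (mul_ne_zero hH hX)
  have hunit := IsFractionRing.num_den_reduced (MvPolynomial (Option (Fin n)) ℂ) c
    (hdvd _ hnum) (hdvd _ h0)
  have h1 := hunit.map (MvPolynomial.eval fun o : Option (Fin n) => o.elim u fun _ => 1)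
  simp at h1

/-! ### The integrand of the limiting form -/

section normalized

variable {n m : ℕ} {q u : ℂ} {s₁ s₂ : ℝ}

/-- Outside the zero set of a polynomial, the limit of the normalized function is the leading
coefficient times the limit of the polar factor. -/
theorem exists_polynomial_ratEval (hq0 : q ≠ 0) (hu : u ≠ 0)
    (c : FractionRing (MvPolynomial (Option (Fin n)) ℂ)) {G : (Option (Fin n) → ℂ) → ℂ}
    (h : ∀ y ∈ cstar (Option (Fin n)),
      MvPolynomial.eval y (IsFractionRing.den (MvPolynomial (Option (Fin n)) ℂ) c :
          MvPolynomial (Option (Fin n)) ℂ) * G y =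
        MvPolynomial.eval y (IsFractionRing.num (MvPolynomial (Option (Fin n)) ℂ) c) *
          normDenLim n q m s₁ s₂ (fun i => y (some i)) (y none)) :
    ∃ P : MvPolynomial (Fin n) ℂ, P ≠ 0 ∧ ∀ x ∈ cstar (Fin n), MvPolynomial.eval x P ≠ 0 →
      G (fun o => o.elim u x) =
        ratEval c (fun o => o.elim u x) * normDenLim n q m s₁ s₂ x u := by
  have hne : ∀ (Q : MvPolynomial (Fin n) ℂ), MvPolynomial.eval 0 Q ≠ 0 → Q ≠ 0 := fun Q hQ h0 =>
    hQ (by rw [h0, map_zero])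
  obtain ⟨P, hP0, hP⟩ := exists_polynomial_den c hu h
    (H := ∏ i : Fin n, ∏ k ∈ Finset.range m,
      (MvPolynomial.C (q ^ (k + 1)) * MvPolynomial.X i - MvPolynomial.C u) *
        (MvPolynomial.X i * MvPolynomial.C u - MvPolynomial.C (q ^ (k + 1))))
    (Finset.prod_ne_zero_iff.2 fun i _ => Finset.prod_ne_zero_iff.2 fun k _ =>
      mul_ne_zero (hne _ (by simpa using hu)) (hne _ (by simpa using hq0)))
    (fun x hx hxH => by
      refine Finset.prod_ne_zero_iff.2 fun i hi => Finset.prod_ne_zero_iff.2 fun k hk => ?_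
      simp only [map_prod] at hxH
      have h1 := Finset.prod_ne_zero_iff.1 (Finset.prod_ne_zero_iff.1 hxH i hi) k hk
      simp only [map_mul, map_sub, MvPolynomial.eval_C, MvPolynomial.eval_X] at h1
      obtain ⟨h2, h3⟩ := mul_ne_zero_iff.1 h1
      refine mul_ne_zero (thetaLim_ne_zero fun h4 => h2 ?_) (thetaLim_ne_zero fun h4 => h3 ?_)
      · exact sub_eq_zero.2 ((div_eq_one_iff_eq hu).1 h4)
      · exact sub_eq_zero.2 ((div_eq_one_iff_eq (mul_ne_zero (hx i) hu)).1 h4).symm)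
  refine ⟨P, hP0, fun x hx hxP => ?_⟩
  rw [hP] at hxP
  have h1 := h (fun o => o.elim u x) (by rintro (_ | i); exacts [hu, hx i])
  rw [ratEval, div_mul_eq_mul_div, eq_div_iff hxP, mul_comm]
  exact h1

end normalized

section main

variable {n : ℕ} {q t : ℂ} {τ : Fin 6 → ℂ} {a b : Fin 6} {α : Fin 6 → ℝ} {ζ : ℝ} {v w : ℂ}
  {mf mg : ℕ}

lemma tildeParam_ne_zero (hq0 : q ≠ 0) (hτ : ∀ r, τ r ≠ 0) (r : Fin 6) :
    tildeParam q mf mg τ r ≠ 0 := div_ne_zero (hτ r) (pow_ne_zero _ hq0)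

lemma tildeParam_mul (c : Fin 6 → ℂ) :
    tildeParam q mf mg (fun r => c r * τ r) = fun r => c r * tildeParam q mf mg τ r :=
  funext fun _ => mul_div_assoc _ _ _

/-- Whenever an elliptic contour exists and `p` is small, the theta functions that appear in the
symmetrization identity do not vanish. -/
lemma eventually_theta_ne_zero (hq0 : q ≠ 0) (hq : ‖q‖ < 1) (ht0 : t ≠ 0) (hτ : ∀ r, τ r ≠ 0)
    (hR : ExpRange a b α ζ) :
    ∀ᶠ p : ℂ in 𝓝[≠] 0, ∀ D,
      IsFormContour p q t (tildeParam q mf mg fun r => p ^ (α r : ℂ) * τ r) D →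
      ∀ i < n, theta (t ^ i * (p ^ (ζ : ℂ) * τ a) * (p ^ (ζ : ℂ) * τ b)) q ≠ 0 := by
  have h3 := hR.neg
  have hsmall : ∀ᶠ p : ℂ in 𝓝[≠] 0, ∀ i ∈ Finset.range n,
      ‖p ^ ((-2 * ζ : ℝ) : ℂ)‖ < ‖t ^ i * τ a * τ b‖ :=
    (Finset.eventually_all _).2 fun i _ => eventually_norm_cpow_lt (by linarith)
      (norm_pos_iff.2 (mul_ne_zero (mul_ne_zero (pow_ne_zero _ ht0) (hτ a)) (hτ b)))
  filter_upwards [hsmall, eventually_mem_nhdsWithin] with p hp (hp0 : p ≠ 0) D hD i hi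
  have h := hp i (Finset.mem_range.2 hi)
  have hP : ∀ e : ℝ, p ^ (e : ℂ) ≠ 0 := fun e => by simp [Complex.cpow_eq_zero_iff, hp0]
  have hone : p ^ ((-2 * ζ : ℝ) : ℂ) * (p ^ (ζ : ℂ) * p ^ (ζ : ℂ)) = 1 := by
    rw [← cpow_ofReal_add hp0, ← cpow_ofReal_add hp0,
      show -2 * ζ + (ζ + ζ) = 0 by ring]
    simp
  have key := hD.theta_ne_zero (τ := fun r => p ^ (α r : ℂ) * τ r) hq0 hq ht0
    (fun r => mul_ne_zero (hP _) (hτ r))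
    (fun r => ⟨_, (mul_div_cancel₀ _ (pow_ne_zero _ hq0)).symm⟩) (a := a) (b := b) (i := i) ?_
  · simpa only [hR.eq_a, hR.eq_b] using key
  · simp only [hR.eq_a, hR.eq_b]
    have e : p ^ ((-2 * ζ : ℝ) : ℂ) * (t ^ i * (p ^ (ζ : ℂ) * τ a) * (p ^ (ζ : ℂ) * τ b)) =
        t ^ i * τ a * τ b := by
      linear_combination (t ^ i * τ a * τ b) * hone
    rw [← e, norm_mul] at h
    exact lt_of_mul_lt_mul_left (by rwa [mul_one]) (norm_nonneg (p ^ ((-2 * ζ : ℝ) : ℂ)))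

lemma differentiableOn_comp_elim {Φ : (Option (Fin n) → ℂ) → ℂ} {u : ℂ} (hu : u ≠ 0)
    (hΦ : DifferentiableOn ℂ Φ (cstar _)) :
    DifferentiableOn ℂ (fun x : Fin n → ℂ => Φ fun o => o.elim u x) (cstar (Fin n)) := by
  refine hΦ.comp (fun x _ => (differentiableAt_pi.2 ?_).differentiableWithinAt) fun x hx => ?_
  · rintro (_ | i)
    · exact differentiableAt_const _
    · exact differentiableAt_apply i x
  · rintro (_ | i)
    exacts [hu, hx i]

/-- The normalized functions of `exists_normalized`, at `u₀ = u`. -/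
lemma MemATilde.exists_isNormalization (hq0 : q ≠ 0) {m : ℕ} {f : (Fin n → ℂ) → ℂ → ℂ → ℂ}
    (hf : MemATilde n q m f) {γ v : ℝ} {c : FractionRing (MvPolynomial (Option (Fin n)) ℂ)}
    (hc : HasLeadingTerm (rescale f (fun _ => ζ) γ) v c) {s₁ s₂ : ℝ} (h₁ : s₁ = γ - ζ)
    (h₂ : s₂ = γ + ζ ∨ s₂ = γ + ζ + 1) (h₁' : 0 ≤ s₁ ∧ s₁ ≤ 1) (h₂' : 0 ≤ s₂ ∧ s₂ ≤ 1) {u : ℂ}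
    (hu : u ≠ 0) :
    ∃ (Φ : ℂ → (Fin n → ℂ) → ℂ) (G : (Fin n → ℂ) → ℂ) (P : MvPolynomial (Fin n) ℂ),
      (∀ᶠ p in 𝓝[≠] (0 : ℂ), DifferentiableOn ℂ (Φ p) (cstar _) ∧
        IsNormalization n q m s₁ s₂ ζ v p u (fun z => f z (p ^ (γ : ℂ) * u) p) (Φ p)) ∧
      (∀ y ∈ cstar (Fin n),
        Tendsto (fun x : ℂ × (Fin n → ℂ) => Φ x.1 x.2) (𝓝[≠] 0 ×ˢ 𝓝 y) (𝓝 (G y))) ∧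
      P ≠ 0 ∧ ∀ x ∈ cstar (Fin n), MvPolynomial.eval x P ≠ 0 →
        G x = ratEval c (fun o => o.elim u x) * normDenLim n q m s₁ s₂ x u := by
  obtain ⟨Φ, G, hΦ, hlim, hG⟩ := exists_normalized hq0 hf hc h₁ h₂ h₁' h₂'
  obtain ⟨P, hP0, hP⟩ := exists_polynomial_ratEval hq0 hu c hG
  have hcs : ∀ x ∈ cstar (Fin n), (fun o : Option (Fin n) => o.elim u x) ∈ cstar _ := fun x hx => by
    rintro (_ | i)
    exacts [hu, hx i]
  refine ⟨fun p x => Φ p fun o => o.elim u x, fun x => G fun o => o.elim u x, P, ?_, ?_, hP0, hP⟩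
  · filter_upwards [hΦ, eventually_mem_nhdsWithin, eventually_norm_lt_of_tendsto_zero
      (tendsto_id.mono_right nhdsWithin_le_nhds) one_pos] with p h (hp0 : p ≠ 0) hp
    have hP : ∀ e : ℝ, p ^ (e : ℂ) ≠ 0 := fun e => by simp [Complex.cpow_eq_zero_iff, hp0]
    refine ⟨differentiableOn_comp_elim hu h.1, fun x hx hxn i => ?_, fun x hx hxn => ?_⟩
    · exact (hf.memA p (norm_pos_iff.2 hp0) hp (p ^ (γ : ℂ) * u) (mul_ne_zero (hP γ) hu)).inversion i
        (fun j => p ^ (ζ : ℂ) * x j) (fun j => mul_ne_zero (hP ζ) (hx j))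
        (h.2 _ (hcs x hx) hxn).1
    · exact (h.2 _ (hcs x hx) hxn).2
  · intro y hy
    refine (hlim _ (hcs y hy)).comp (tendsto_fst.prodMk ?_)
    refine tendsto_pi_nhds.2 ?_
    rintro (_ | i)
    · exact tendsto_const_nhds
    · exact (tendsto_pi_nhds.1 tendsto_id i).comp tendsto_snd

/-- The integrand of the limiting form, up to a set that is negligible on every torus. -/
lemma exists_polynomials_limitDensity (hq0 : q ≠ 0) (hq : ‖q‖ < 1) (ht0 : t ≠ 0)
    (hτ : ∀ r, τ r ≠ 0) (hv0 : v ≠ 0) (hR : ExpRange a b α ζ)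
    (hw : w = q / (t ^ (n - 1) * v * τ a * τ b)) {C : ClosedChain}
    (hC : IsLimitContour n q t (tildeParam q mf mg τ) a b α ζ C) :
    ∃ (ι : Type) (_ : Countable ι) (P : ι → MvPolynomial (Fin n) ℂ), (∀ i, P i ≠ 0) ∧
      ∀ x : Fin n → ℂ, (∀ j, x j ∈ C.support) → (∀ i, MvPolynomial.eval x (P i) ≠ 0) →
        normDenLim n q mf (α 4 - ζ) (poleExp a b α ζ 4) x (τ 4) *
          normDenLim n q mg (α 5 - ζ) (poleExp a b α ζ 5) x (τ 5) *
          brokenLim n q t (tildeParam q mf mg τ) a b α ζ v w x =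
        limitDensity n q t τ a b α ζ v x := by
  have hw0 : w ≠ 0 := by
    rw [hw]
    exact div_ne_zero hq0 (mul_ne_zero (mul_ne_zero (mul_ne_zero (pow_ne_zero _ ht0) hv0) (hτ a))
      (hτ b))
  obtain ⟨Λ, hΛc, hΛ, hAΛ⟩ := IsMulGroup.exists_countable
    (A := insert q (Set.range τ)) ((Set.countable_range τ).insert q) (by
      rintro x (rfl | ⟨r, rfl⟩)
      exacts [hq0, hτ r])
  have hqΛ : q ∈ Λ := hAΛ (Set.mem_insert _ _)
  have hτΛ : ∀ r, τ r ∈ Λ := fun r => hAΛ (Set.mem_insert_of_mem _ ⟨r, rfl⟩)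
  obtain ⟨ι, hι, P, hP0, hP⟩ := exists_polynomials_genericPoint (n := n) hΛc hΛ
  refine ⟨ι, hι, P, hP0, fun x hx hxP => ?_⟩
  have hgen := hP x (fun j => C.ne_zero_of_mem_support (hx j)) hxP
  rw [normDenLim_mul_brokenLim hq0 hq ht0 hτ hv0 hw0 hΛ hqΛ hτΛ hR hgen (hC.limRegular hq hR hx)
    (tildeParam_ne_zero hq0 hτ), brokenLim_eq_limitDensity hq hΛ hqΛ hR hw hgen]

end main

end SelbergLimit

open SelbergLimit
theorem mainTheorem5 (n : ℕ) (hn : 1 ≤ n)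
    (q t : ℂ) (hq0 : q ≠ 0) (hq1 : ‖q‖ < 1) (ht0 : t ≠ 0) (ht1 : ‖t‖ < 1)
    (τ : Fin 6 → ℂ) (hτ : ∀ r, τ r ≠ 0) (hbal : t ^ (2 * (n - 1)) * ∏ r, τ r = q)
    (a b : Fin 6) (hab : a ≠ b) (α : Fin 6 → ℝ) (ζ : ℝ)
    (hζ : -1 / 2 ≤ ζ) (hζ0 : ζ < 0) (hsum : ∑ r, α r = 1)
    (ha : α a = ζ) (hb : α b = ζ)
    (hα : ∀ r, r ≠ a → r ≠ b → -ζ ≤ α r ∧ α r ≤ 1 + ζ)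
    (hpair : ∀ r s, r < s → α r + α s = 1 → ∀ i < n, qPoch (q / (t ^ i * τ r * τ s)) q ≠ 0)
    (mf mg : ℕ) (f g : (Fin n → ℂ) → ℂ → ℂ → ℂ)
    (hf : MemATilde n q mf f) (hg : MemATilde n q mg g)
    (vf vg : ℝ) (cf cg : FractionRing (MvPolynomial (Option (Fin n)) ℂ))
    (hcf : HasLeadingTerm (rescale f (fun _ => ζ) (α 4)) vf cf)
    (hcg : HasLeadingTerm (rescale g (fun _ => ζ) (α 5)) vg cg)
    (v : ℂ) (hv0 : v ≠ 0)
    (hv : ∀ i < n, theta (t ^ i * τ a * v) q ≠ 0 ∧ theta (t ^ i * τ b * v) q ≠ 0)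
    (C : ClosedChain) (hC : IsLimitContour n q t (tildeParam q mf mg τ) a b α ζ C) :
    Tendsto
      (fun x : ℂ × ClosedChain =>
        x.1 ^ (-(vf + vg : ℝ) : ℂ) *
          bilinForm n x.1 q t (fun r => x.1 ^ (α r : ℂ) * τ r) x.2
            (fun z => f z (x.1 ^ (α 4 : ℂ) * τ 4) x.1)
            (fun z => g z (x.1 ^ (α 5 : ℂ) * τ 5) x.1))
      (comap Prod.fst (𝓝[≠] (0 : ℂ)) ⊓
        𝓟 {x : ℂ × ClosedChain |
          IsFormContour x.1 q t (tildeParam q mf mg (fun r => x.1 ^ (α r : ℂ) * τ r)) x.2})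
      (𝓝 (limitPrefactor n q t τ a b α ζ v *
        C.torusIntegral n (fun z =>
          ratEval cf (fun o => o.elim (τ 4) z) * ratEval cg (fun o => o.elim (τ 5) z) *
            limitDensity n q t τ a b α ζ v z))) := by
  have hR : ExpRange a b α ζ :=
    ⟨hab, hζ0, hζ, ha, hb, fun r h1 h2 => (hα r h1 h2).1, fun r h1 h2 => (hα r h1 h2).2⟩
  obtain ⟨w, hw⟩ : ∃ w, w = q / (t ^ (n - 1) * v * τ a * τ b) := ⟨_, rfl⟩
  have hw0 : w ≠ 0 := by
    rw [hw]
    exact div_ne_zero hq0 (mul_ne_zero (mul_ne_zero (mul_ne_zero (pow_ne_zero _ ht0) hv0) (hτ a))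
      (hτ b))
  have hτ' := tildeParam_ne_zero (mf := mf) (mg := mg) hq0 hτ
  obtain ⟨Φ, Gf, Pf, hΦ, hΦlim, hPf, hGf⟩ := hf.exists_isNormalization hq0 hcf rfl
    (hR.poleExp_eq 4) (hR.inner_mem 4) (hR.poleExp_mem 4) (hτ 4)
  obtain ⟨Ψ, Gg, Pg, hΨ, hΨlim, hPg, hGg⟩ := hg.exists_isNormalization hq0 hcg rfl
    (hR.poleExp_eq 5) (hR.inner_mem 5) (hR.poleExp_mem 5) (hτ 5)
  have hdef := hC.eventually_torusIntegral_eq hq0 hq1 ht0 ht1 hζ hζ0 ha hb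
    (fun r h1 h2 => (hα r h1 h2).1)
  have hsmall : ∀ᶠ p : ℂ in 𝓝[≠] 0, p ≠ 0 ∧ ‖p‖ < 1 := eventually_mem_nhdsWithin.and
    (eventually_norm_lt_of_tendsto_zero (tendsto_id.mono_right nhdsWithin_le_nhds) one_pos)
  have hD : ∀ᶠ p in 𝓝[≠] (0 : ℂ), IsDeformable n q t (tildeParam q mf mg τ) a b α ζ p fun x =>
      Φ p x * Ψ p x * brokenDensity n p q t (tildeParam q mf mg τ) a b α ζ v w x := by
    filter_upwards [hΦ, hΨ, hsmall] with p h1 h2 h3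
    exact isDeformable_mul_brokenDensity h3.1 h3.2 hq1 ht0 hτ' hv0 hw0 (h1.1.mul h2.1)
  -- the limit of the integrals of the broken density over the fixed contour
  have hlim : Tendsto (fun p => C.torusIntegral n fun x =>
      Φ p x * Ψ p x * brokenDensity n p q t (tildeParam q mf mg τ) a b α ζ v w x) (𝓝[≠] 0)
      (𝓝 (C.torusIntegral n fun z =>
        ratEval cf (fun o => o.elim (τ 4) z) * ratEval cg (fun o => o.elim (τ 5) z) *
          limitDensity n q t τ a b α ζ v z)) := by
    obtain ⟨ι, hι, P, hP0, hP⟩ := exists_polynomials_limitDensity (n := n) hq0 hq1 ht0 hτ hv0 hR hw hC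
    have hcongr : C.torusIntegral n (fun x =>
        Gf x * Gg x * brokenLim n q t (tildeParam q mf mg τ) a b α ζ v w x) =
        C.torusIntegral n fun z =>
        ratEval cf (fun o => o.elim (τ 4) z) * ratEval cg (fun o => o.elim (τ 5) z) *
          limitDensity n q t τ a b α ζ v z := by
      refine C.torusIntegral_congr_of_polynomials
        (fun i : Option (Option ι) => i.elim Pf fun i => i.elim Pg P) ?_ fun x hx hxP => ?_
      · rintro (_ | _ | i)
        exacts [hPf, hPg, hP0 i]
      · have hx0 : x ∈ cstar (Fin n) := fun j => C.ne_zero_of_mem_support (hx j)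
        rw [hGf x hx0 (hxP none), hGg x hx0 (hxP (some none)),
          ← hP x hx fun i => hxP (some (some i))]
        ring
    rw [← hcongr]
    refine C.tendsto_torusIntegral (fun x hx => ?_) ?_
    · have hx0 : x ∈ cstar (Fin n) := fun j => C.ne_zero_of_mem_support (hx j)
      exact ((hΦlim x hx0).mul (hΨlim x hx0)).mul (tendsto_brokenDensity hq1 ht0 hτ' hv0 hw0 hR
        tendsto_fst tendsto_snd (hC.limRegular hq1 hR hx))
    · filter_upwards [hdef, hD] with p h1 h2 using (h1 _ h2).1
  -- for small `p`, and for every contour on the left, the form is the product of `brokenPrefactor`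
  -- and the integral over `C`, in which the contour on the left does not appear
  refine Tendsto.congr' ?_ ((((tendsto_brokenPrefactor hq1 ht0 ht1 hτ hR hsum hpair).mul hlim).comp
    tendsto_comap).mono_left inf_le_left)
  have hev := hdef.and (hD.and (hΦ.and (hΨ.and (hsmall.and
    (eventually_theta_ne_zero (n := n) (mf := mf) (mg := mg) hq0 hq1 ht0 hτ hR)))))
  filter_upwards [(tendsto_comap.eventually hev).filter_mono inf_le_left,
    mem_inf_of_right (mem_principal_self _)] with x hx hxC
  obtain ⟨p, D⟩ := x
  obtain ⟨h1, h2, h3, h4, ⟨hp0, hp⟩, h5⟩ := hx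
  have hxC' : IsFormContour p q t (tildeParam q mf mg fun r => p ^ (α r : ℂ) * τ r) D := hxC
  have hθ := h5 D hxC'
  rw [tildeParam_mul] at hxC'
  have hI := prod_theta_mul_torusIntegral hn hp0 hp hq0 hq1 ht0 hτ hab ha hb hv0 hw
    (fun i hi => (hv i hi).2) h3.2 h4.2 ((h1 _ h2).2 D hxC')
  have hpre := prefactor_eq_brokenPrefactor hn hp0 hp hq0 hq1 ht0 hτ hv0 hR hw hv hθ hI
  have hpow : p ^ (-(vf + vg : ℝ) : ℂ) * p ^ ((vf + vg : ℝ) : ℂ) = 1 := by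
    rw [← Complex.cpow_add _ _ hp0, neg_add_cancel, Complex.cpow_zero]
  simp only [Function.comp_apply, bilinForm]
  rw [hpre]
  linear_combination (-brokenPrefactor n p q t τ a b α ζ v * C.torusIntegral n fun x =>
    Φ p x * Ψ p x * brokenDensity n p q t (tildeParam q mf mg τ) a b α ζ v w x) * hpow
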